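/- **Theorem 5 (Single-mode Gaussian conversion).** Consider bosonic modes with annihilation operators $a_i=(x_i+\mathrm i p_i)/\sqrt2$, so that the vacuum has quadrature variances $1/2$, and write $D(\alpha)=\exp\sum_i(\alpha_i a_i^\dagger-\alpha_i^*a_i)$ for displacements. A *classical* state is a mixture $\int P(d\gamma)\,|\gamma\rangle\langle\gamma|$ of coherent states with a probability measure $P$. A *passive linear unitary* is one that preserves the photon number and maps $a_j^\dagger\mapsto\sum_i u_{ij}a_i^\dagger$ with $u$ unitary. A *Gaussian* state with mean $d$ and covariance matrix $V$ is a density operator $\rho$ with $\operatorname{tr}[\rho\, e^{\mathrm i\xi\cdot q}]=\exp(\mathrm i\,\xi\cdot d-\tfrac12\xi^{\mathsf T}V\xi)$ for all real $\xi$, where $q=(x_1,p_1,\dots,x_n,p_n)$. *Operations.* $\rho\mapsto\sigma$ under $\mathcal P_0$ means that $\sigma$ is obtained from $\rho$ without measurement: add finitely many ancilla modes in a classical state, apply a passive linear unitary to system and ancilla, trace out the ancilla modes, and displace; the ancilla state, the unitary and the displacement may depend on a classical random variable, which is forgotten at the end. A *protocol in* $\mathcal{GP}_{\mathbb N}$ is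 a finite composition of the following steps: adding a classical Gaussian ancilla; a passive linear unitary; a displacement by a constant plus a linear function of the measurement outcomes recorded so far; discarding modes; a destructive Gaussian measurement of some modes, either with POVM density $\pi^{-m}D(\alpha)\Lambda D(\alpha)^\dagger\,d^{2m}\alpha$ for a Gaussian state $\Lambda$ of these $m$ modes, or a homodyne measurement of their $x$ quadratures. We say $\rho\mapsto\sigma$ under $\mathcal{GP}_{\mathbb N}$ with nonzero probability if for some such protocol and some measurable set $B$ of outcome records, $\int_B\rho_y\,dy=p\,\sigma$ with $p>0$, where $\rho_y$ is the unnormalised output (density) for the record $y$. *Measures.* For a single-mode Gaussian state whose covariance matrix has eigenvalues $v_+\ge v_-$, put $$\mathcal N_1=\max\{1-2v_-,0\},\qquad \mathcal N_2=\frac{\mathcal N_1}{2v_+-1},\qquad \mathcal N_3=v_+\,\mathcal N_2,$$ with $\mathcal N_2=\mathcal N_3=0$ if $v_+=1/2$ (which forces $v_-=1/2$). Let $\rho$ and $\sigma$ be single-mode Gaussian states. Then (a) $\rho\mapsto\sigma$ under $\mathcal P_0$ if and only if $\mathcal N_1(\sigma)\le\mathcal N_1(\rho)$ and $\mathcal N_2(\sigma)\le\mathcal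 N_2(\rho)$; (b) $\rho\mapsto\sigma$ under $\mathcal{GP}_{\mathbb N}$ with nonzero probability if and only if $\mathcal N_1(\sigma)\le\mathcal N_1(\rho)$ and $\mathcal N_3(\sigma)\le\mathcal N_3(\rho)$. -/

import Mathlib

/-! Bosonic modes in the number (Fock) basis.  The Hilbert space of `n` modes has the orthonormal
basis `|k⟩`, `k : Fin n → ℕ` the occupation numbers; operators are written as infinite matrices in
this basis.  `a_i = (x_i + i p_i) / √2`, so the vacuum has quadrature variances `1/2`. -/

noncomputable section

/-- Operators on the Hilbert space of `n` bosonic modes, as matrices in the number basis. -/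
abbrev FockMatrix (n : ℕ) : Type := Matrix (Fin n → ℕ) (Fin n → ℕ) ℂ

namespace FockMatrix

open MeasureTheory

/-! ### States -/

open scoped ComplexOrder in
/-- Density operators: positive semidefinite, of trace one. -/
structure IsState {n : ℕ} (ρ : FockMatrix n) : Prop where
  posSemidef : ρ.PosSemidef
  trace_eq_one : HasSum (fun k => ρ k k) 1

/-- `A ρ A†`. -/
def conjBy {n : ℕ} (A ρ : FockMatrix n) : FockMatrix n :=
  fun k l => ∑' p : (Fin n → ℕ) × (Fin n → ℕ), A k p.1 * ρ p.1 p.2 * star (A l p.2)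

/-- The number-basis components of the coherent state `|γ⟩ = |γ₁⟩ … |γₙ⟩`. -/
def coherent {n : ℕ} (γ : Fin n → ℂ) (k : Fin n → ℕ) : ℂ :=
  ∏ i, ((Real.exp (-‖γ i‖ ^ 2 / 2) : ℝ) : ℂ) * γ i ^ k i / ((Real.sqrt ((k i).factorial) : ℝ) : ℂ)

/-- Classical states: mixtures `∫ P(dγ) |γ⟩⟨γ|` of coherent states. -/
def IsClassical {n : ℕ} (τ : FockMatrix n) : Prop :=
  ∃ P : Measure (Fin n → ℂ), IsProbabilityMeasure P ∧
    ∀ k l, τ k l = ∫ γ, coherent γ k * star (coherent γ l) ∂P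

/-! ### Free unitaries -/

/-- Single-mode matrix elements `⟨j| D(α) |k⟩` of
`D(α) = exp(α a† - α* a) = exp(-|α|²/2) exp(α a†) exp(-α* a)`. -/
def dispElem (α : ℂ) (j k : ℕ) : ℂ :=
  ((Real.exp (-‖α‖ ^ 2 / 2) * Real.sqrt (j.factorial * k.factorial) : ℝ) : ℂ) *
    ∑ s ∈ Finset.range (min j k + 1),
      α ^ (j - s) * (-star α) ^ (k - s) /
        ((s.factorial : ℂ) * ((j - s).factorial : ℂ) * ((k - s).factorial : ℂ))

/-- The displacement operator `D(α) = ∏ i, exp(α i a_i† - (α i)* a_i)`. -/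
def displacement {n : ℕ} (α : Fin n → ℂ) : FockMatrix n :=
  fun k l => ∏ i, dispElem (α i) (k i) (l i)

/-- The passive linear unitary `U` of the unitary matrix `u`: `U|0⟩ = |0⟩` and
`U a_j† U† = ∑ i, u i j a_i†`.  Hence `U|l⟩ = ∏ j, (∑ i, u i j a_i†) ^ l j / √(l j !) |0⟩`, and the
coefficient of `|k⟩` is read off from the polynomial `∏ j, (∑ i, u i j X_i) ^ l j`. -/
def passive {n : ℕ} (u : Matrix (Fin n) (Fin n) ℂ) : FockMatrix n :=
  fun k l =>
    MvPolynomial.coeff (Finsupp.equivFunOnFinite.symm k)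
        (∏ j, (∑ i, MvPolynomial.C (u i j) * MvPolynomial.X i) ^ l j : MvPolynomial (Fin n) ℂ) *
      ((Real.sqrt (∏ i, ((k i).factorial : ℝ)) / Real.sqrt (∏ i, ((l i).factorial : ℝ)) : ℝ) : ℂ)

/-! ### Composite systems -/

/-- `ρ ⊗ τ`; the modes of `ρ` come first. -/
def tensor {n m : ℕ} (ρ : FockMatrix n) (τ : FockMatrix m) : FockMatrix (n + m) :=
  fun k l =>
    ρ (fun i => k (Fin.castAdd m i)) (fun i => l (Fin.castAdd m i)) *
      τ (fun i => k (Fin.natAdd n i)) (fun i => l (Fin.natAdd n i))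

/-- Partial trace over the last `m` modes. -/
def partialTrace {n m : ℕ} (ρ : FockMatrix (n + m)) : FockMatrix n :=
  fun k l => ∑' j : Fin m → ℕ, ρ (Fin.append k j) (Fin.append l j)

/-- `tr_{A'} [(I ⊗ E) ρ]`, where `A'` consists of the last `m` modes: the unnormalised state of the
remaining modes after a destructive measurement of `A'` with the outcome of effect `E`. -/
def measured {n m : ℕ} (E : FockMatrix m) (ρ : FockMatrix (n + m)) : FockMatrix n :=
  fun k l => ∑' p : (Fin m → ℕ) × (Fin m → ℕ),
    E p.1 p.2 * ρ (Fin.append k p.2) (Fin.append l p.1)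

/-! ### Gaussian states -/

/-- `exp(i ξ·q) = D(α)` with `α_i = i (ξ_{x_i} + i ξ_{p_i}) / √2`; the coordinate `(i, 0)` belongs
to `x_i` and `(i, 1)` to `p_i`. -/
def weylAmplitude {n : ℕ} (ξ : Fin n × Fin 2 → ℝ) : Fin n → ℂ :=
  fun i => Complex.I * ((ξ (i, 0) : ℂ) + Complex.I * (ξ (i, 1) : ℂ)) / ((Real.sqrt 2 : ℝ) : ℂ)

/-- The characteristic function `ξ ↦ tr [ρ exp(i ξ·q)]`. -/
def charFn {n : ℕ} (ρ : FockMatrix n) (ξ : Fin n × Fin 2 → ℝ) : ℂ :=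
  ∑' k, ∑' l, ρ k l * displacement (weylAmplitude ξ) l k

/-- `ρ` is the Gaussian state with mean vector `d` and covariance matrix `V`,
`V_st = ½ ⟨{q_s - d_s, q_t - d_t}⟩`. -/
structure IsGaussian {n : ℕ} (ρ : FockMatrix n) (d : Fin n × Fin 2 → ℝ)
    (V : Matrix (Fin n × Fin 2) (Fin n × Fin 2) ℝ) : Prop where
  isState : ρ.IsState
  symm : V.IsSymm
  charFn_eq : ∀ ξ, charFn ρ ξ =
    Complex.exp (Complex.I * ((ξ ⬝ᵥ d : ℝ) : ℂ) - ((ξ ⬝ᵥ (V.mulVec ξ) : ℝ) : ℂ) / 2)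

/-- Gaussian states. -/
def IsGaussianState {n : ℕ} (ρ : FockMatrix n) : Prop := ∃ d V, IsGaussian ρ d V

/-! ### Free operations without measurement -/

/-- `ρ ↦ σ` under a measurement-free operation: with `ω` the value of a classical random
number generator, add a classical ancilla `τ ω`, apply the passive linear unitary of `u ω` to
system and ancilla, trace out the ancilla modes, displace by `δ ω`, and forget `ω`.  -/
def TransformsP0 {n : ℕ} (ρ σ : FockMatrix n) : Prop :=
  ∃ (Ω : Type) (_ : MeasurableSpace Ω) (μ : Measure Ω) (m : ℕ) (τ : Ω → FockMatrix m)
    (u : Ω → Matrix (Fin (n + m)) (Fin (n + m)) ℂ) (δ : Ω → Fin n → ℂ),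
    IsProbabilityMeasure μ ∧
    (∀ k l, Measurable fun ω => τ ω k l) ∧ (∀ i j, Measurable fun ω => u ω i j) ∧
    (∀ i, Measurable fun ω => δ ω i) ∧
    (∀ ω, IsClassical (τ ω)) ∧ (∀ ω, u ω ∈ Matrix.unitaryGroup (Fin (n + m)) ℂ) ∧
    ∀ k l, σ k l = ∫ ω, conjBy (displacement (δ ω))
      (partialTrace (conjBy (passive (u ω)) (tensor ρ (τ ω)))) k l ∂μ

/-! ### Gaussian free operations with measurements and feed-forward -/

/-- The POVM density `E(α) = π⁻ᵐ D(α) Λ D(α)†` with respect to `d^{2m} α`. -/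
def generalDyne {m : ℕ} (Λ : FockMatrix m) (α : Fin m → ℂ) : FockMatrix m :=
  fun k l => (((Real.pi ^ m)⁻¹ : ℝ) : ℂ) * conjBy (displacement α) Λ k l

/-- The Hermite function `⟨x|k⟩`, the position wave function of the `k`-th number state. -/
def hermiteFn (k : ℕ) (x : ℝ) : ℝ :=
  Real.exp (-x ^ 2 / 2) * Polynomial.aeval (Real.sqrt 2 * x) (Polynomial.hermite k) /
    Real.sqrt (Real.sqrt Real.pi * k.factorial)

/-- The POVM density `|x⟩⟨x|` (with respect to `d^m x`) of the homodyne measurement of the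
quadratures `x_1, …, x_m`. -/
def homodyne {m : ℕ} (x : Fin m → ℝ) : FockMatrix m :=
  fun k l => ∏ i, ((hermiteFn (k i) (x i) * hermiteFn (l i) (x i) : ℝ) : ℂ)

/-- Gaussian protocols on `n₀` input modes: finite compositions of elementary steps.
`GaussianProtocol n₀ r n` are those with `r` recorded real measurement outcomes so far and `n`
current modes.  The only operations that may depend on the record are displacements, and they do so
with linear gain. -/
inductive GaussianProtocol (n₀ : ℕ) : ℕ → ℕ → Type
  /-- Do nothing. -/
  | start : GaussianProtocol n₀ 0 n₀
  /-- Add an uncorrelated classical Gaussian ancilla. -/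
  | ancilla {r n : ℕ} (P : GaussianProtocol n₀ r n) (m : ℕ) (τ : FockMatrix m)
      (hG : IsGaussianState τ) (hC : IsClassical τ) : GaussianProtocol n₀ r (n + m)
  /-- Apply a passive linear unitary. -/
  | passive {r n : ℕ} (P : GaussianProtocol n₀ r n) (u : Matrix (Fin n) (Fin n) ℂ)
      (hu : u ∈ Matrix.unitaryGroup (Fin n) ℂ) : GaussianProtocol n₀ r n
  /-- Displace by a constant plus a linear function of the record. -/
  | displace {r n : ℕ} (P : GaussianProtocol n₀ r n) (δ : Fin n → ℂ)
      (G : (Fin r → ℝ) →ₗ[ℝ] (Fin n → ℂ)) : GaussianProtocol n₀ r n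
  /-- Discard the last `m` modes. -/
  | discard {r n m : ℕ} (P : GaussianProtocol n₀ r (n + m)) : GaussianProtocol n₀ r n
  /-- Measure the last `m` modes destructively with `E(α) = π⁻ᵐ D(α) Λ D(α)†`. -/
  | generalDyne {r n m : ℕ} (P : GaussianProtocol n₀ r (n + m)) (Λ : FockMatrix m)
      (hΛ : IsGaussianState Λ) : GaussianProtocol n₀ (r + (m + m)) n
  /-- Measure the `x` quadratures of the last `m` modes destructively. -/
  | homodyne {r n m : ℕ} (P : GaussianProtocol n₀ r (n + m)) : GaussianProtocol n₀ (r + m) n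

/-- The operation performed by a protocol: `P.run ρ y` is the unnormalised output state for the
record `y` of outcomes, as a density with respect to Lebesgue measure `dy`. -/
def GaussianProtocol.run {n₀ : ℕ} (ρ : FockMatrix n₀) :
    {r n : ℕ} → GaussianProtocol n₀ r n → (Fin r → ℝ) → FockMatrix n
  | _, _, .start, _ => ρ
  | _, _, .ancilla P _ τ _ _, y => tensor (P.run ρ y) τ
  | _, _, .passive P u _, y => conjBy (FockMatrix.passive u) (P.run ρ y)
  | _, _, .displace P δ G, y => conjBy (displacement (δ + G y)) (P.run ρ y)
  | _, _, .discard P, y => partialTrace (P.run ρ y)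
  | _, _, .generalDyne (r := r) (m := m) P Λ _, y =>
      measured
        (FockMatrix.generalDyne Λ fun j =>
          (y (Fin.natAdd r (Fin.castAdd m j)) : ℂ) +
            Complex.I * (y (Fin.natAdd r (Fin.natAdd m j)) : ℂ))
        (P.run ρ fun i => y (Fin.castAdd (m + m) i))
  | _, _, .homodyne (r := r) (m := m) P, y =>
      measured (FockMatrix.homodyne fun j => y (Fin.natAdd r j))
        (P.run ρ fun i => y (Fin.castAdd m i))

/-- `ρ ↦ σ` with nonzero probability under Gaussian protocols: for some protocol, the records in
some set `B` occur with total probability `p > 0`, and the output after coarse-graining over `B` is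
`σ`. -/
def TransformsGP {n : ℕ} (ρ σ : FockMatrix n) : Prop :=
  ∃ (r : ℕ) (P : GaussianProtocol n r n) (B : Set (Fin r → ℝ)) (p : ℝ),
    MeasurableSet B ∧ 0 < p ∧ ∀ k l, (p : ℂ) * σ k l = ∫ y in B, P.run ρ y k l

/-! ### Nonclassicality measures of a single-mode Gaussian state, from its covariance matrix -/

/-- The larger eigenvalue `v₊`. -/
def vPlus (V : Matrix (Fin 1 × Fin 2) (Fin 1 × Fin 2) ℝ) : ℝ := sSup (spectrum ℝ V)

/-- The smaller eigenvalue `v₋`. -/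
def vMinus (V : Matrix (Fin 1 × Fin 2) (Fin 1 × Fin 2) ℝ) : ℝ := sInf (spectrum ℝ V)

/-- `𝒩₁ = max {1 - 2 v₋, 0}`. -/
def N₁ (V : Matrix (Fin 1 × Fin 2) (Fin 1 × Fin 2) ℝ) : ℝ := max (1 - 2 * vMinus V) 0

/-- `𝒩₂ = 𝒩₁ / (2 v₊ - 1)`.  The denominator vanishes only for `V = I/2`, where `𝒩₁ = 0` and the
value is `0`. -/
def N₂ (V : Matrix (Fin 1 × Fin 2) (Fin 1 × Fin 2) ℝ) : ℝ := N₁ V / (2 * vPlus V - 1)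

/-- `𝒩₃ = v₊ 𝒩₂`. -/
def N₃ (V : Matrix (Fin 1 × Fin 2) (Fin 1 × Fin 2) ℝ) : ℝ := vPlus V * N₂ V

end FockMatrix

end

noncomputable section

namespace FockMatrix

open MeasureTheory

/-! ### Sums over occupation numbers -/

/-! On phase space the problem becomes one about quadratic forms. A passive unitary acts on
characteristic functions by an orthogonal symplectic substitution, a displacement by a phase, an
uncorrelated ancilla by a factor, discarding by restriction, and a Gaussian measurement by a
Gaussian integral over the measured variables. With these rules established for number-basis
matrices, both equivalences reduce to principal axes in the plane.

Necessity for protocols. All outputs of a protocol share one quadratic form `B`, whatever the record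
(`GaussianProtocol.exists_isGaussianFamily`). Two inequalities survive every step (`IsBounded`): `B
≥ m`, and `B x x + κ B u u ≥ κ sympl u x + (1 - κ)/2 |x|²` for all `x`, `u`. The second interpolates
between the classical bound (`κ = 0`) and the uncertainty relation (`κ = 1`); optimised over `u` it
says `B ≥ (1 - κ)/2 + (κ/4) Jᵀ B⁻¹ J`, where `J` is the symplectic matrix. On the minor axis of a
squeezed state this is an equality for `κ = 2 𝒩₃`, and `κ ≤ 1` is then `4 v₊ v₋ ≥ 1`.
Coarse-graining over records can only enlarge the form (`IsGaussianFamily.le_covForm`), so the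
target inherits both inequalities and `HasAxes.of_isBounded` reads off `𝒩₁` and `𝒩₃`.

Sufficiency for protocols. Mix the input with vacuum on a beam splitter, homodyne the other output
along the major axis and feed the outcome forward. The transmissivity is fixed by `v₋`; the gain
solves a quadratic equation that has a real root by the condition on `𝒩₃`
(`HasAxes.exists_feedforward`). Fourier inversion evaluates the average over all outcomes
(`transformsGP_of_split`).

Without measurements. The modulus of a characteristic function does not see coherent amplitudes, so
any classical ancilla is as good as vacuum up to mixing. Comparing moduli near the origin shows that
the average of `outForm` over the random variable is at most the target's covariance. The
single-mode block of a unitary is multiplication by a complex number; this links the values of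
`outForm` on orthogonal axes by a linear inequality, which after averaging is the monotonicity of
`𝒩₂`. Conversely, loss followed by Gaussian random displacements suffices.

Analysis. A matrix is determined by its kernel on exponential vectors (`eq_of_kern_eq`), which makes
the Weyl relations identities between exponents. Gaussian states have geometrically decaying entries
(`IsGaussian.isGeo`) and protocol steps preserve this, which justifies all interchanges of sums and
integrals. Weyl–Fourier inversion gives uniqueness (`IsTame.eq_of_charFn_eq`), and positivity gives
the uncertainty relation (`IsGaussian.sympl_le`). -/

theorem hasSum_mul_of_summable_norm {𝕜 ι κ : Type*} [NormedField 𝕜] [CompleteSpace 𝕜]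
    {f : ι → 𝕜} {g : κ → 𝕜} {a b : 𝕜} (hf : HasSum f a) (hg : HasSum g b)
    (hf' : Summable fun k => ‖f k‖) (hg' : Summable fun k => ‖g k‖) :
    HasSum (fun p : ι × κ => f p.1 * g p.2) (a * b) :=
  hf.mul hg (summable_mul_of_summable_norm hf' hg')

theorem summable_mul_norm_of_summable_norm {𝕜 ι κ : Type*} [NormedField 𝕜]
    {f : ι → 𝕜} {g : κ → 𝕜} (hf : Summable fun k => ‖f k‖) (hg : Summable fun k => ‖g k‖) :
    Summable (fun p : ι × κ => ‖f p.1 * g p.2‖) :=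
  Summable.mul_norm hf hg

theorem hasSum_pi_prod_of_summable_norm {𝕜 : Type*} [NormedField 𝕜] [CompleteSpace 𝕜] {n : ℕ}
    {f : Fin n → ℕ → 𝕜} {a : Fin n → 𝕜} (h : ∀ i, HasSum (f i) (a i))
    (hn : ∀ i, Summable fun k => ‖f i k‖) :
    HasSum (fun k : Fin n → ℕ => ∏ i, f i (k i)) (∏ i, a i) ∧
      Summable fun k : Fin n → ℕ => ‖∏ i, f i (k i)‖ := by
  induction n with
  | zero => exact ⟨by simp [hasSum_unique], (hasSum_fintype _).summable⟩
  | succ n ih =>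
    obtain ⟨h1, h2⟩ := ih (fun i => h i.succ) fun i => hn i.succ
    have e : ∀ p : ℕ × (Fin n → ℕ),
        ∏ i, f i (Fin.consEquiv (fun _ : Fin (n + 1) => ℕ) p i) =
          f 0 p.1 * ∏ i, f i.succ (p.2 i) := fun p => by
      simp [Fin.consEquiv, Fin.prod_univ_succ]
    constructor
    · rw [Fin.prod_univ_succ, ← (Fin.consEquiv fun _ : Fin (n + 1) => ℕ).hasSum_iff]
      have h3 := hasSum_mul_of_summable_norm (h 0) h1 (hn 0) h2
      have e' : (fun k : Fin (n + 1) → ℕ => ∏ i, f i (k i)) ∘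
          (Fin.consEquiv fun _ : Fin (n + 1) => ℕ) =
          fun p : ℕ × (Fin n → ℕ) => f 0 p.1 * ∏ i, f i.succ (p.2 i) := funext e
      rw [e']
      exact h3
    · rw [← (Fin.consEquiv fun _ : Fin (n + 1) => ℕ).summable_iff]
      have h3 := summable_mul_norm_of_summable_norm (hn 0) h2
      have e' : (fun k : Fin (n + 1) → ℕ => ‖∏ i, f i (k i)‖) ∘
          (Fin.consEquiv fun _ : Fin (n + 1) => ℕ) =
          fun p : ℕ × (Fin n → ℕ) => ‖f 0 p.1 * ∏ i, f i.succ (p.2 i)‖ :=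
        funext fun p => congrArg _ (e p)
      rw [e']
      exact h3

theorem hasSum_pi_prod {n : ℕ} {f : Fin n → ℕ → ℂ} {a : Fin n → ℂ} (h : ∀ i, HasSum (f i) (a i)) :
    HasSum (fun k : Fin n → ℕ => ∏ i, f i (k i)) (∏ i, a i) :=
  (hasSum_pi_prod_of_summable_norm (f := f) h fun i => (h i).summable.norm).1

theorem hasSum_pi_prod_real {n : ℕ} {f : Fin n → ℕ → ℝ} {a : Fin n → ℝ}
    (h : ∀ i, HasSum (f i) (a i)) : HasSum (fun k : Fin n → ℕ => ∏ i, f i (k i)) (∏ i, a i) :=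
  (hasSum_pi_prod_of_summable_norm (f := f) h fun i => (h i).summable.norm).1

theorem summable_pi_prod {n : ℕ} {f : Fin n → ℕ → ℝ} (h : ∀ i, Summable (f i)) :
    Summable fun k : Fin n → ℕ => ∏ i, f i (k i) :=
  (hasSum_pi_prod_real fun i => (h i).hasSum).summable

/-- The total occupation number. -/
def deg {n : ℕ} (k : Fin n → ℕ) : ℕ := ∑ i, k i

theorem summable_pow_deg {n : ℕ} {R : ℝ} (h0 : 0 ≤ R) (h1 : R < 1) :
    Summable fun k : Fin n → ℕ => R ^ deg k := by
  simp_rw [deg, ← Finset.prod_pow_eq_pow_sum]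
  exact summable_pi_prod fun _ => summable_geometric_of_lt_one h0 h1

/-! ### Averages over the torus -/

/-- The uniform probability measure on `(0, 2π]`. -/
def angleMeasure : Measure ℝ :=
  (ENNReal.ofReal (2 * Real.pi))⁻¹ • volume.restrict (Set.Ioc 0 (2 * Real.pi))

instance : IsProbabilityMeasure angleMeasure := by
  constructor
  have : ENNReal.ofReal (2 * Real.pi) ≠ 0 := by simp [Real.pi_pos]
  rw [angleMeasure, Measure.smul_apply, Measure.restrict_apply_univ, Real.volume_Ioc, sub_zero,
    smul_eq_mul, ENNReal.inv_mul_cancel this ENNReal.ofReal_ne_top]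

theorem integral_angleMeasure (a : ℤ) :
    ∫ θ, Complex.exp (Complex.I * a * θ) ∂angleMeasure = if a = 0 then 1 else 0 := by
  rw [angleMeasure, integral_smul_measure, ← intervalIntegral.integral_of_le (by positivity)]
  split_ifs with h
  · subst h
    have : (Real.pi : ℂ) ≠ 0 := by simp [Real.pi_ne_zero]
    simp [ENNReal.toReal_ofReal Real.pi_pos.le]
    field_simp
  · rw [integral_exp_mul_complex (by simp [h])]
    have : Complex.exp (Complex.I * a * (2 * Real.pi : ℝ)) = 1 := by
      rw [Complex.exp_eq_one_iff]; exact ⟨a, by push_cast; ring⟩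
    rw [this]; simp

/-- The uniform probability measure on the torus of angles. -/
def torusMeasure (n : ℕ) : Measure (Fin n → ℝ) := Measure.pi fun _ => angleMeasure

instance (n : ℕ) : IsProbabilityMeasure (torusMeasure n) := by
  unfold torusMeasure; infer_instance

theorem integral_torusMeasure {n : ℕ} (a : Fin n → ℤ) :
    ∫ θ, ∏ i, Complex.exp (Complex.I * a i * θ i) ∂torusMeasure n = if a = 0 then 1 else 0 := by
  rw [torusMeasure, integral_fintype_prod_eq_prod (f := fun i (θ : ℝ) =>
    Complex.exp (Complex.I * a i * θ))]
  simp_rw [integral_angleMeasure]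
  split_ifs with h
  · simp [h]
  · obtain ⟨i, hi⟩ := Function.ne_iff.1 h
    exact Finset.prod_eq_zero (Finset.mem_univ i) (by simpa using hi)

/-- Averaging over phases keeps exactly the terms of zero frequency; this isolates single
coefficients and, later, diagonal matrix elements. -/
theorem hasSum_torusMeasure {n : ℕ} {ι : Type*} [Countable ι] (c : ι → ℂ) (a : ι → Fin n → ℤ)
    (hc : Summable c) :
    HasSum (fun j => if a j = 0 then c j else 0)
      (∫ θ, ∑' j, c j * ∏ i, Complex.exp (Complex.I * a j i * θ i) ∂torusMeasure n) := by
  have hn : ∀ (j : ι) (θ : Fin n → ℝ), ‖c j * ∏ i, Complex.exp (Complex.I * a j i * θ i)‖ = ‖c j‖ := by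
    intro j θ
    have (i : Fin n) : ‖Complex.exp (Complex.I * a j i * θ i)‖ = 1 := by
      rw [Complex.norm_exp]; simp
    simp [this]
  have key := hasSum_integral_of_dominated_convergence (μ := torusMeasure n)
    (F := fun j θ => c j * ∏ i, Complex.exp (Complex.I * a j i * θ i))
    (f := fun θ => ∑' j, c j * ∏ i, Complex.exp (Complex.I * a j i * θ i))
    (bound := fun j _ => ‖c j‖) (fun j => Continuous.aestronglyMeasurable (by fun_prop))
    (fun j => ae_of_all _ fun θ => (hn j θ).le) (ae_of_all _ fun _ => hc.norm)
    (integrable_const _)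
    (ae_of_all _ fun θ => (Summable.of_norm (by simpa only [hn] using hc.norm)).hasSum)
  convert! key using 2 with j
  rw [integral_const_mul, integral_torusMeasure]
  split_ifs <;> simp

theorem eq_zero_of_sum_monomial_eq_zero {n : ℕ} (c : (Fin n → ℕ) → ℂ) (hc : Summable c)
    (h : ∀ v : Fin n → ℂ, (∀ i, ‖v i‖ = 1) → ∑' k, c k * ∏ i, v i ^ k i = 0) (m) : c m = 0 := by
  have key := hasSum_torusMeasure c (fun k i => (k i : ℤ) - m i) hc
  have hz : ∀ θ : Fin n → ℝ,
      ∑' k, c k * ∏ i, Complex.exp (Complex.I * ((k i : ℤ) - m i : ℤ) * θ i) = 0 := by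
    intro θ
    have := h (fun i => Complex.exp (Complex.I * θ i)) fun i => by
      rw [Complex.norm_exp]; simp
    -- The extra factor is the conjugate of the `m`-th monomial; it shifts the frequency of the
    -- `m`-th term to zero.
    have e : ∀ k : Fin n → ℕ, c k * ∏ i, Complex.exp (Complex.I * ((k i : ℤ) - m i : ℤ) * θ i) =
        (c k * ∏ i, Complex.exp (Complex.I * θ i) ^ k i) *
          ∏ i, Complex.exp (-Complex.I * m i * θ i) := by
      intro k
      rw [mul_assoc, ← Finset.prod_mul_distrib]
      congr 1
      refine Finset.prod_congr rfl fun i _ => ?_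
      rw [← Complex.exp_nat_mul, ← Complex.exp_add]
      congr 1; push_cast; ring
    simp_rw [e, tsum_mul_right, this, zero_mul]
  simp_rw [hz, integral_zero] at key
  have h1 : HasSum (fun k : Fin n → ℕ => if (fun i => (k i : ℤ) - m i) = 0 then c k else 0) (c m) := by
    convert! hasSum_ite_eq m (c m) using 2 with k
    have : ((fun i => (k i : ℤ) - m i) = 0) ↔ k = m := by
      simp [funext_iff, sub_eq_zero]
    simp only [this]
    split_ifs with h <;> simp [h]
  exact h1.unique key

/-! ### Exponential vectors and kernels -/

/-- The exponential vector `∑ k, z ^ k / √(k!) |k⟩`, an unnormalised coherent state. -/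
def expVec {n : ℕ} (z : Fin n → ℂ) (k : Fin n → ℕ) : ℂ :=
  ∏ i, z i ^ k i / ((Real.sqrt ((k i).factorial) : ℝ) : ℂ)

/-- Real exponential vectors. -/
def expVecR {n : ℕ} (r : Fin n → ℝ) (k : Fin n → ℕ) : ℝ :=
  ∏ i, r i ^ k i / Real.sqrt ((k i).factorial)

theorem norm_expVec {n : ℕ} (z : Fin n → ℂ) (k : Fin n → ℕ) :
    ‖expVec z k‖ = expVecR (fun i => ‖z i‖) k := by
  simp [expVec, expVecR, abs_of_nonneg]

theorem expVecR_nonneg {n : ℕ} {r : Fin n → ℝ} (hr : ∀ i, 0 ≤ r i) (k : Fin n → ℕ) :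
    0 ≤ expVecR r k :=
  Finset.prod_nonneg fun i _ => div_nonneg (pow_nonneg (hr i) _) (Real.sqrt_nonneg _)

/-- The modulus of each term is the product of `(2|r|)^k / √k!` and `2⁻ᵏ`; it is bounded by the sum
of their squares, and both squares are summable. -/
theorem summable_pow_div_sqrt_factorial (r : ℝ) :
    Summable fun k : ℕ => r ^ k / Real.sqrt k.factorial := by
  refine Summable.of_norm_bounded (g := fun k : ℕ => (4 * r ^ 2) ^ k / k.factorial + (1 / 4) ^ k)
    ((Real.summable_pow_div_factorial _).add
      (summable_geometric_of_lt_one (by norm_num) (by norm_num))) fun k => ?_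
  have hf : (0 : ℝ) < k.factorial := by positivity
  have h1 : ‖r ^ k / Real.sqrt k.factorial‖ =
      ((2 * |r|) ^ k / Real.sqrt k.factorial) * (1 / 2) ^ k := by
    rw [Real.norm_eq_abs, abs_div, abs_pow, abs_of_nonneg (Real.sqrt_nonneg _)]
    rw [div_mul_eq_mul_div, mul_comm 2 |r|, mul_pow, mul_assoc, ← mul_pow]; norm_num
  have h2 : (4 * r ^ 2) ^ k / k.factorial = ((2 * |r|) ^ k / Real.sqrt k.factorial) ^ 2 := by
    rw [div_pow, Real.sq_sqrt hf.le, ← pow_mul, mul_comm k 2, pow_mul, mul_pow 2 |r|, sq_abs]; norm_num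
  have h3 : ((1 : ℝ) / 4) ^ k = ((1 / 2) ^ k) ^ 2 := by
    rw [← pow_mul, mul_comm k 2, pow_mul]; norm_num
  rw [h1, h2, h3]
  nlinarith [sq_nonneg ((2 * |r|) ^ k / Real.sqrt k.factorial - (1 / 2) ^ k),
    sq_nonneg ((2 * |r|) ^ k / Real.sqrt k.factorial + (1 / 2) ^ k)]

theorem summable_expVecR {n : ℕ} (r : Fin n → ℝ) : Summable (expVecR r) := by
  have := summable_pi_prod (f := fun i k => r i ^ k / Real.sqrt k.factorial)
    fun i => summable_pow_div_sqrt_factorial (r i)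
  exact this

theorem summable_expVec {n : ℕ} (z : Fin n → ℂ) : Summable (expVec z) :=
  Summable.of_norm (by simpa only [norm_expVec] using summable_expVecR _)

theorem hasSum_expVec_mul_expVec {n : ℕ} (z w : Fin n → ℂ) :
    HasSum (fun k => expVec z k * expVec w k) (Complex.exp (∑ i, z i * w i)) := by
  rw [Complex.exp_sum]
  have := hasSum_pi_prod (f := fun (i : Fin n) (k : ℕ) => (z i * w i) ^ k / (k.factorial : ℂ))
    (a := fun i => Complex.exp (z i * w i)) fun i => by
      rw [Complex.exp_eq_exp_ℂ]; exact NormedSpace.expSeries_div_hasSum_exp _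
  refine this.congr_fun fun k => ?_
  rw [expVec, expVec, ← Finset.prod_mul_distrib]
  refine Finset.prod_congr rfl fun i _ => ?_
  rw [div_mul_div_comm, ← Complex.ofReal_mul, Real.mul_self_sqrt (by positivity), mul_pow]
  simp

theorem expVec_smul {n : ℕ} (v z : Fin n → ℂ) (k : Fin n → ℕ) :
    expVec (fun i => v i * z i) k = expVec z k * ∏ i, v i ^ k i := by
  simp only [expVec, ← Finset.prod_mul_distrib]
  exact Finset.prod_congr rfl fun i _ => by rw [mul_pow]; ring

theorem expVec_one_ne_zero {n : ℕ} (k : Fin n → ℕ) : expVec (fun _ => 1) k ≠ 0 := by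
  refine Finset.prod_ne_zero_iff.2 fun i _ => ?_
  have : Real.sqrt ((k i).factorial) ≠ 0 := by positivity
  simp [this]

theorem eq_zero_of_sum_mul_expVec_eq_zero {n : ℕ} {c : (Fin n → ℕ) → ℂ}
    (hc : ∀ z, Summable fun k => c k * expVec z k) (h : ∀ z, ∑' k, c k * expVec z k = 0) :
    c = 0 := by
  funext m
  have := eq_zero_of_sum_monomial_eq_zero (fun k => c k * expVec (fun _ => 1) k) (hc _)
    (fun v _ => by
      rw [← h fun i => v i]
      refine tsum_congr fun k => ?_
      rw [mul_assoc, ← expVec_smul]; simp) m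
  simpa [expVec_one_ne_zero] using this

/-- The kernel `∑ k l, (z ^ k / √(k!)) A k l (w ^ l / √(l!))`. -/
def kern {n : ℕ} (A : FockMatrix n) (z w : Fin n → ℂ) : ℂ :=
  ∑' p : (Fin n → ℕ) × (Fin n → ℕ), expVec z p.1 * A p.1 p.2 * expVec w p.2

/-- The kernel of `A` converges absolutely everywhere. -/
def HasKern {n : ℕ} (A : FockMatrix n) : Prop :=
  ∀ z w : Fin n → ℂ, Summable fun p : (Fin n → ℕ) × (Fin n → ℕ) =>
    expVec z p.1 * A p.1 p.2 * expVec w p.2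

theorem hasKern_of_bounded {n : ℕ} {A : FockMatrix n} {C : ℝ} (h : ∀ k l, ‖A k l‖ ≤ C) :
    HasKern A := fun z w => by
  have := (summable_mul_of_summable_norm (summable_expVec z).norm (summable_expVec w).norm).norm
  refine Summable.of_norm_bounded (this.mul_left C) fun p => ?_
  rw [norm_mul, norm_mul, norm_mul, mul_right_comm, mul_comm C]
  exact mul_le_mul_of_nonneg_left (h _ _) (by positivity)

/-- The kernel is an absolutely convergent power series in both arguments, so its coefficients are
determined, first in `z` for fixed `w` and then row by row in `w`. Operator identities thereby
reduce to identities of kernels, which are exponentials for displacements and passive unitaries. -/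
theorem eq_of_kern_eq {n : ℕ} {A B : FockMatrix n} (hA : HasKern A) (hB : HasKern B)
    (h : ∀ z w, kern A z w = kern B z w) : A = B := by
  have hd : ∀ z w : Fin n → ℂ, Summable fun p : (Fin n → ℕ) × (Fin n → ℕ) =>
      expVec z p.1 * (A - B) p.1 p.2 * expVec w p.2 := fun z w => by
    refine ((hA z w).sub (hB z w)).congr fun p => ?_
    simp [mul_sub, sub_mul]
  have hz : ∀ z w : Fin n → ℂ, ∑' p : (Fin n → ℕ) × (Fin n → ℕ),
      expVec z p.1 * (A - B) p.1 p.2 * expVec w p.2 = 0 := fun z w => by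
    rw [← sub_eq_zero.2 (h z w), kern, kern, ← (hA z w).tsum_sub (hB z w)]
    refine tsum_congr fun p => ?_
    simp [mul_sub, sub_mul]
  have hrow : ∀ k w, Summable fun l => (A - B) k l * expVec w l := fun k w => by
    have := (hd (fun _ => 1) w).prod_factor k
    simp_rw [mul_assoc] at this
    exact (summable_mul_left_iff (expVec_one_ne_zero k)).1 this
  have h1 : ∀ w, (fun k => ∑' l, (A - B) k l * expVec w l) = 0 := fun w => by
    refine eq_zero_of_sum_mul_expVec_eq_zero (fun z => ?_) fun z => ?_
    · refine (hd z w).prod.congr fun k => ?_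
      rw [← tsum_mul_right]; exact tsum_congr fun l => by ring
    · rw [← hz z w, (hd z w).tsum_prod]
      refine tsum_congr fun k => ?_
      rw [← tsum_mul_right]; exact tsum_congr fun l => by ring
  rw [← sub_eq_zero]
  funext k
  exact eq_zero_of_sum_mul_expVec_eq_zero (hrow k) fun w => congrFun (h1 w) k

/-! ### Displacement operators -/

/-- The matrix elements of `exp(x a†) exp(y a)`. -/
def dispPoly (x y : ℂ) (j k : ℕ) : ℂ :=
  ((Real.sqrt (j.factorial * k.factorial) : ℝ) : ℂ) *
    ∑ s ∈ Finset.range (min j k + 1),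
      x ^ (j - s) * y ^ (k - s) / ((s.factorial : ℂ) * ((j - s).factorial : ℂ) * ((k - s).factorial : ℂ))

/-- The real version of `dispPoly`. -/
def dispPolyR (x y : ℝ) (j k : ℕ) : ℝ :=
  Real.sqrt (j.factorial * k.factorial) *
    ∑ s ∈ Finset.range (min j k + 1),
      x ^ (j - s) * y ^ (k - s) / (s.factorial * (j - s).factorial * (k - s).factorial)

theorem dispPolyR_ofReal (x y : ℝ) (j k : ℕ) : (dispPolyR x y j k : ℂ) = dispPoly x y j k := by
  simp [dispPolyR, dispPoly]

theorem dispElem_eq (α : ℂ) (j k : ℕ) :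
    dispElem α j k = ((Real.exp (-‖α‖ ^ 2 / 2) : ℝ) : ℂ) * dispPoly α (-star α) j k := by
  rw [dispElem, dispPoly, Complex.ofReal_mul, mul_assoc]

theorem norm_dispPoly_le (x y : ℂ) (j k : ℕ) : ‖dispPoly x y j k‖ ≤ dispPolyR ‖x‖ ‖y‖ j k := by
  rw [dispPoly, dispPolyR, norm_mul, Complex.norm_real, Real.norm_of_nonneg (Real.sqrt_nonneg _)]
  refine mul_le_mul_of_nonneg_left ((norm_sum_le _ _).trans_eq ?_) (Real.sqrt_nonneg _)
  simp

theorem dispPolyR_nonneg {x y : ℝ} (hx : 0 ≤ x) (hy : 0 ≤ y) (j k : ℕ) : 0 ≤ dispPolyR x y j k := by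
  unfold dispPolyR
  positivity

theorem hasSum_shift {E : Type*} [AddCommMonoid E] [TopologicalSpace E] {f : ℕ → E} {a : E}
    (h : HasSum f a) (s : ℕ) : HasSum (fun k => if s ≤ k then f (k - s) else 0) a := by
  have hi : Function.Injective fun k : ℕ => k + s := add_left_injective s
  rw [← hi.hasSum_iff] 
  · simpa [Function.comp_def] using h
  · intro k hk
    rw [if_neg]
    intro hs
    exact hk ⟨k - s, Nat.sub_add_cancel hs⟩

theorem sum_range_min {E : Type*} [AddCommMonoid E] (f : ℕ → E) (j k : ℕ) :
    ∑ s ∈ Finset.range (min j k + 1), f s =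
      ∑ s ∈ Finset.range (j + 1), if s ≤ k then f s else 0 := by
  rw [← Finset.sum_filter]
  refine Finset.sum_congr ?_ fun _ _ => rfl
  ext s
  simp only [Finset.mem_range, Finset.mem_filter]
  omega

/-- `exp(y a)` multiplies the exponential vector of `w` by `exp(y w)`, and `exp(x a†)` moves it to
`w + x`. In coordinates: shifted exponential series, then the binomial theorem. -/
theorem hasSum_dispPoly (x y w : ℂ) (j : ℕ) :
    HasSum (fun k => dispPoly x y j k * (w ^ k / ((Real.sqrt k.factorial : ℝ) : ℂ)))
      (Complex.exp (y * w) * ((w + x) ^ j / ((Real.sqrt j.factorial : ℝ) : ℂ))) := by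
  have h1 : ∀ s, HasSum (fun k => if s ≤ k then w ^ s * ((y * w) ^ (k - s) / ((k - s).factorial : ℂ)) else 0)
      (w ^ s * Complex.exp (y * w)) := fun s => by
    refine hasSum_shift (f := fun k => w ^ s * ((y * w) ^ k / (k.factorial : ℂ))) (HasSum.mul_left _ ?_) s
    rw [Complex.exp_eq_exp_ℂ]; exact NormedSpace.expSeries_div_hasSum_exp _
  have h2 := (hasSum_sum (s := Finset.range (j + 1)) fun s _ => (h1 s).mul_left
    (x ^ (j - s) / ((s.factorial : ℂ) * ((j - s).factorial : ℂ)))).mul_left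
    ((Real.sqrt j.factorial : ℝ) : ℂ)
  have hs : ∀ k : ℕ, ((Real.sqrt k.factorial : ℝ) : ℂ) ≠ 0 := fun k => by
    have : Real.sqrt (k.factorial) ≠ 0 := by positivity
    exact_mod_cast this
  convert! h2 using 1
  · funext k
    rw [dispPoly, sum_range_min, Real.sqrt_mul (by positivity), Complex.ofReal_mul,
      Finset.mul_sum, Finset.mul_sum, Finset.sum_mul]
    refine Finset.sum_congr rfl fun s _ => ?_
    split_ifs with h
    · obtain ⟨m, rfl⟩ := Nat.exists_eq_add_of_le h
      rw [Nat.add_sub_cancel_left, mul_pow, pow_add]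
      have := hs (s + m)
      field_simp
    · simp
  · rw [add_pow, Finset.sum_div, Finset.mul_sum, Finset.mul_sum]
    refine Finset.sum_congr rfl fun s hs' => ?_
    rw [Nat.cast_choose ℂ (Nat.lt_succ_iff.1 (Finset.mem_range.1 hs'))]
    have h3 : (j.factorial : ℂ) = ((Real.sqrt j.factorial : ℝ) : ℂ) * ((Real.sqrt j.factorial : ℝ) : ℂ) := by
      rw [← Complex.ofReal_mul, Real.mul_self_sqrt (by positivity)]; simp
    have := hs j
    rw [h3]
    field_simp

theorem hasSum_dispPolyR (x y w : ℝ) (j : ℕ) :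
    HasSum (fun k => dispPolyR x y j k * (w ^ k / Real.sqrt k.factorial))
      (Real.exp (y * w) * ((w + x) ^ j / Real.sqrt j.factorial)) := by
  have := hasSum_dispPoly x y w j
  rw [← Complex.hasSum_ofReal]
  convert! this using 1
  · funext k; rw [← dispPolyR_ofReal]; push_cast; rfl
  · push_cast; rfl

theorem choose_mul_pow_mul_pow_le {u v : ℝ} (hu : 0 ≤ u) (hv : 0 ≤ v) (k s : ℕ) (h : s ≤ k) :
    (k.choose s : ℝ) * (u ^ s * v ^ (k - s)) ≤ (u + v) ^ k := by
  rw [add_pow, mul_comm]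
  exact Finset.single_le_sum (f := fun m => u ^ m * v ^ (k - m) * (k.choose m : ℝ))
    (fun m _ => by positivity) (Finset.mem_range.2 (Nat.lt_succ_iff.2 h))

/-- A single term of the binomial expansion of `(1/θ + (θ - 1)/θ)^k = 1`. -/
theorem sqrt_choose_le {θ : ℝ} (hθ : 1 < θ) (k s : ℕ) (h : s ≤ k) :
    Real.sqrt (k.choose s) ≤ Real.sqrt θ ^ s * Real.sqrt (θ / (θ - 1)) ^ (k - s) := by
  have h0 : 0 < θ - 1 := by linarith
  have hp : 0 < θ := by linarith
  have := choose_mul_pow_mul_pow_le (u := 1 / θ) (v := (θ - 1) / θ) (by positivity) (by positivity) k s h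
  rw [show 1 / θ + (θ - 1) / θ = 1 by field_simp; ring, one_pow] at this
  refine Real.sqrt_le_iff.2 ⟨by positivity, ?_⟩
  rw [mul_pow, ← pow_mul, ← pow_mul, mul_comm s, mul_comm (k - s), pow_mul, pow_mul,
    Real.sq_sqrt hp.le, Real.sq_sqrt (by positivity)]
  have e : (1 / θ) ^ s * ((θ - 1) / θ) ^ (k - s) * (θ ^ s * (θ / (θ - 1)) ^ (k - s)) = 1 := by
    rw [mul_mul_mul_comm, ← mul_pow, ← mul_pow]
    have : (θ - 1) / θ * (θ / (θ - 1)) = 1 := by field_simp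
    rw [this]; field_simp; simp
  calc (k.choose s : ℝ) = (k.choose s : ℝ) * ((1 / θ) ^ s * ((θ - 1) / θ) ^ (k - s)) *
        (θ ^ s * (θ / (θ - 1)) ^ (k - s)) := by rw [mul_assoc, e, mul_one]
    _ ≤ 1 * (θ ^ s * (θ / (θ - 1)) ^ (k - s)) := by
        exact mul_le_mul_of_nonneg_right this (by positivity)
    _ = _ := one_mul _

/-- Rows of a displacement operator are summable against geometric weights, with geometric
bounds. -/
theorem dispPolyR_geometric {a R R' : ℝ} (ha : 0 ≤ a) (hR : 0 < R) (hRR : R < R') :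
    ∃ C, 0 ≤ C ∧ ∀ j, Summable (fun k => dispPolyR a a j k * R ^ k) ∧
      ∑' k, dispPolyR a a j k * R ^ k ≤ C * R' ^ j := by
  -- With this `θ` the factor `√θ^s * √θ^s` produced by the two binomial bounds turns `R^s` into
  -- `R'^s`.
  obtain ⟨θ, hθ⟩ : ∃ θ, θ = R' / R := ⟨_, rfl⟩
  have hθ1 : 1 < θ := by rw [hθ, one_lt_div hR]; exact hRR
  have hR' : 0 < R' := hR.trans hRR
  have hθR : θ * R = R' := by rw [hθ]; field_simp
  have hθ0 : 0 < θ := by linarith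
  set B := Real.sqrt (θ / (θ - 1)) with hB
  have hB0 : 0 ≤ B := Real.sqrt_nonneg _
  set g : ℕ → ℝ := fun i => (B * a) ^ i / Real.sqrt i.factorial
  set h : ℕ → ℝ := fun i => (B * a * R) ^ i / Real.sqrt i.factorial
  have hg0 : ∀ i, 0 ≤ g i := fun i => by positivity
  have hsum : Summable h := summable_pow_div_sqrt_factorial _
  set q : ℕ → ℝ := fun i => (B * a / R') ^ i / Real.sqrt i.factorial
  have hq : Summable q := summable_pow_div_sqrt_factorial _
  have hq0 : ∀ i, 0 ≤ q i := fun i => by positivity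
  -- Writing `j!` and `k!` through binomial coefficients leaves two square roots of binomials over
  -- `√(j-s)! √(k-s)!`. After the binomial bounds the dependence on `k - s` and on `j - s`
  -- separates.
  have bound : ∀ j k, dispPolyR a a j k * R ^ k ≤
      ∑ s ∈ Finset.range (j + 1), if s ≤ k then (R' ^ s * g (j - s)) * h (k - s) else 0 := by
    intro j k
    rw [dispPolyR, sum_range_min, Finset.mul_sum, Finset.sum_mul]
    refine Finset.sum_le_sum fun s hs => ?_
    split_ifs with hk
    · have hj : s ≤ j := Nat.lt_succ_iff.1 (Finset.mem_range.1 hs)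
      have e1 : ∀ m, s ≤ m → Real.sqrt m.factorial = Real.sqrt (m.choose s) *
          (Real.sqrt s.factorial * Real.sqrt (m - s).factorial) := fun m hm => by
        rw [← Real.sqrt_mul (by positivity), ← Real.sqrt_mul (by positivity)]
        congr 1
        rw [← mul_assoc]
        exact_mod_cast (Nat.choose_mul_factorial_mul_factorial hm).symm
      have e2 : ∀ m : ℕ, (m.factorial : ℝ) = Real.sqrt m.factorial * Real.sqrt m.factorial := fun m =>
        (Real.mul_self_sqrt (by positivity)).symm
      have e3 : Real.sqrt (j.factorial * k.factorial) *
          (a ^ (j - s) * a ^ (k - s) / (s.factorial * (j - s).factorial * (k - s).factorial)) * R ^ k =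
          (Real.sqrt (j.choose s) * Real.sqrt (k.choose s)) *
            (a ^ (j - s) / Real.sqrt (j - s).factorial * (a ^ (k - s) / Real.sqrt (k - s).factorial) * R ^ k) := by
        rw [Real.sqrt_mul (by positivity), e1 j hj, e1 k hk]
        have p1 : Real.sqrt s.factorial ≠ 0 := by positivity
        have p2 : Real.sqrt (j - s).factorial ≠ 0 := by positivity
        have p3 : Real.sqrt (k - s).factorial ≠ 0 := by positivity
        have q1 := e2 s
        have q2 := e2 (j - s)
        have q3 := e2 (k - s)
        generalize Real.sqrt s.factorial = S1 at *
        generalize Real.sqrt (j - s).factorial = S2 at *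
        generalize Real.sqrt (k - s).factorial = S3 at *
        rw [q1, q2, q3]
        field_simp
      rw [e3]
      calc _ ≤ (Real.sqrt θ ^ s * B ^ (j - s)) * (Real.sqrt θ ^ s * B ^ (k - s)) *
            (a ^ (j - s) / Real.sqrt (j - s).factorial * (a ^ (k - s) / Real.sqrt (k - s).factorial) * R ^ k) := by
            refine mul_le_mul_of_nonneg_right ?_ (by positivity)
            exact mul_le_mul (sqrt_choose_le hθ1 j s hj) (sqrt_choose_le hθ1 k s hk)
              (Real.sqrt_nonneg _) (by positivity)
        _ = (R' ^ s * g (j - s)) * h (k - s) := by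
            have : R ^ k = R ^ s * R ^ (k - s) := by rw [← pow_add, Nat.add_sub_cancel' hk]
            rw [this, ← hθR]
            simp only [g, h, mul_pow]
            have : Real.sqrt θ ^ s * Real.sqrt θ ^ s = θ ^ s := by
              rw [← mul_pow, Real.mul_self_sqrt hθ0.le]
            rw [← this]; ring
    · simp
  have hs1 : ∀ j, HasSum (fun k => ∑ s ∈ Finset.range (j + 1),
      if s ≤ k then (R' ^ s * g (j - s)) * h (k - s) else 0)
      (∑ s ∈ Finset.range (j + 1), (R' ^ s * g (j - s)) * ∑' i, h i) := fun j =>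
    hasSum_sum fun s _ => hasSum_shift (hsum.hasSum.mul_left _) s
  have hh0 : 0 ≤ ∑' i, h i := tsum_nonneg fun i => by positivity
  refine ⟨(∑' i, q i) * ∑' i, h i, mul_nonneg (tsum_nonneg hq0) hh0, fun j => ?_⟩
  have hsm : Summable (fun k => dispPolyR a a j k * R ^ k) :=
    Summable.of_nonneg_of_le (fun k => mul_nonneg (dispPolyR_nonneg ha ha _ _) (by positivity))
      (bound j) (hs1 j).summable
  refine ⟨hsm, (hsm.tsum_le_tsum (bound j) (hs1 j).summable).trans ?_⟩
  rw [(hs1 j).tsum_eq, ← Finset.sum_mul, mul_right_comm]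
  refine mul_le_mul_of_nonneg_right ?_ hh0
  have e : ∀ s ∈ Finset.range (j + 1), R' ^ s * g (j - s) = R' ^ j * q (j - s) := fun s hs => by
    have hj : s ≤ j := Nat.lt_succ_iff.1 (Finset.mem_range.1 hs)
    have : R' ^ j = R' ^ s * R' ^ (j - s) := by rw [← pow_add, Nat.add_sub_cancel' hj]
    simp only [g, q]; rw [this, div_pow]; field_simp
  rw [Finset.sum_congr rfl e, ← Finset.mul_sum, mul_comm]
  refine mul_le_mul_of_nonneg_right ?_ (by positivity)
  have := Finset.sum_range_reflect q (j + 1)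
  simp only [Nat.add_sub_cancel] at this
  rw [this]
  exact hq.sum_le_tsum _ fun i _ => hq0 i

/-! ### Operators that map exponential vectors to exponential vectors -/

/-- `A` maps the exponential vector of `w` to `φ w` times the exponential vector of `S w`, with
absolutely convergent sums. -/
structure IsExpOp {n : ℕ} (A : FockMatrix n) (φ : (Fin n → ℂ) → ℂ)
    (S : (Fin n → ℂ) → (Fin n → ℂ)) : Prop where
  hasSum : ∀ w k, HasSum (fun l => A k l * expVec w l) (φ w * expVec (S w) k)
  bound : ∀ r : Fin n → ℝ, (∀ i, 0 ≤ r i) → ∃ (C : ℝ) (r' : Fin n → ℝ), 0 ≤ C ∧ (∀ i, 0 ≤ r' i) ∧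
    ∀ k, Summable (fun l => ‖A k l‖ * expVecR r l) ∧
      ∑' l, ‖A k l‖ * expVecR r l ≤ C * expVecR r' k

/-- The rows of `A` are summable against geometric weights, with geometric bounds. -/
def IsGeoOp {n : ℕ} (A : FockMatrix n) : Prop :=
  ∀ R : ℝ, 0 < R → R < 1 → ∃ C R' : ℝ, 0 ≤ C ∧ 0 < R' ∧ R' < 1 ∧
    ∀ k, Summable (fun l => ‖A k l‖ * R ^ deg l) ∧ ∑' l, ‖A k l‖ * R ^ deg l ≤ C * R' ^ deg k

/-- `A† M B`. -/
def sandwich {n : ℕ} (A M B : FockMatrix n) : FockMatrix n :=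
  fun q p => ∑' x : (Fin n → ℕ) × (Fin n → ℕ), star (A x.1 q) * M x.1 x.2 * B x.2 p

theorem star_expVec {n : ℕ} (z : Fin n → ℂ) (k : Fin n → ℕ) :
    star (expVec z k) = expVec (star z) k := by
  simp [expVec]

theorem summable_mul_pair {ι κ : Type*} {f : ι → ℝ} {g : κ → ℝ} (hf : Summable f) (hg : Summable g) :
    Summable fun p : ι × κ => f p.1 * g p.2 :=
  summable_mul_of_summable_norm (summable_norm_iff.2 hf) (summable_norm_iff.2 hg)

theorem summable_mul_rows {ι ι' κ κ' : Type*} {a : ι → κ → ℝ} {b : ι' → κ' → ℝ} {f : ι → ℝ}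
    {g : ι' → ℝ} (ha : ∀ i k, 0 ≤ a i k) (hb : ∀ i k, 0 ≤ b i k) (hf : Summable f) (hg : Summable g)
    (h1 : ∀ i, Summable (a i) ∧ ∑' k, a i k ≤ f i) (h2 : ∀ i, Summable (b i) ∧ ∑' k, b i k ≤ g i) :
    Summable fun x : (ι × ι') × (κ × κ') => a x.1.1 x.2.1 * b x.1.2 x.2.2 := by
  have hs : ∀ i j, HasSum (fun p : κ × κ' => a i p.1 * b j p.2) ((∑' k, a i k) * ∑' k, b j k) :=
    fun i j => hasSum_mul_of_summable_norm (h1 i).1.hasSum (h2 j).1.hasSum (h1 i).1.norm (h2 j).1.norm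
  rw [summable_prod_of_nonneg fun x => mul_nonneg (ha _ _) (hb _ _)]
  refine ⟨fun x => (hs x.1 x.2).summable, ?_⟩
  have hfg : Summable fun p : ι × ι' => f p.1 * g p.2 := summable_mul_pair hf hg
  refine Summable.of_nonneg_of_le (fun x => tsum_nonneg fun y => mul_nonneg (ha _ _) (hb _ _))
    (fun x => ?_) hfg
  rw [(hs x.1 x.2).tsum_eq]
  exact mul_le_mul (h1 x.1).2 (h2 x.2).2 (tsum_nonneg (hb _)) ((tsum_nonneg (ha _)).trans (h1 x.1).2)

/-- The weighted rows of `A` and `B` are bounded by multiples of exponential vectors, which are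
summable, and `M` is bounded; so the fourfold family converges absolutely. -/
theorem summable_sandwich_aux {n : ℕ} {A B M : FockMatrix n} {φ ψ S T} (hA : IsExpOp A φ S)
    (hB : IsExpOp B ψ T) {C : ℝ} (hM : ∀ k l, ‖M k l‖ ≤ C) (z w : Fin n → ℂ) :
    Summable fun x : ((Fin n → ℕ) × (Fin n → ℕ)) × ((Fin n → ℕ) × (Fin n → ℕ)) =>
      expVec z x.2.1 * (star (A x.1.1 x.2.1) * M x.1.1 x.1.2 * B x.1.2 x.2.2) * expVec w x.2.2 := by
  obtain ⟨C1, r1, hC1, hr1, h1⟩ := hA.bound (fun i => ‖z i‖) fun i => norm_nonneg _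
  obtain ⟨C2, r2, hC2, hr2, h2⟩ := hB.bound (fun i => ‖w i‖) fun i => norm_nonneg _
  have key := summable_mul_rows (a := fun l q => ‖A l q‖ * expVecR (fun i => ‖z i‖) q)
    (b := fun l q => ‖B l q‖ * expVecR (fun i => ‖w i‖) q)
    (f := fun k => C1 * expVecR r1 k) (g := fun k => C2 * expVecR r2 k)
    (fun l q => mul_nonneg (norm_nonneg _) (expVecR_nonneg (fun i => norm_nonneg _) _))
    (fun l q => mul_nonneg (norm_nonneg _) (expVecR_nonneg (fun i => norm_nonneg _) _))
    ((summable_expVecR r1).mul_left C1) ((summable_expVecR r2).mul_left C2) h1 h2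
  refine Summable.of_norm_bounded (key.mul_left C) fun x => ?_
  rw [norm_mul, norm_mul, norm_mul, norm_mul, norm_star, norm_expVec, norm_expVec]
  have := hM x.1.1 x.1.2
  have e1 := expVecR_nonneg (fun i => norm_nonneg (z i)) x.2.1
  have e2 := expVecR_nonneg (fun i => norm_nonneg (w i)) x.2.2
  calc _ = ‖M x.1.1 x.1.2‖ * ((‖A x.1.1 x.2.1‖ * expVecR (fun i => ‖z i‖) x.2.1) *
    (‖B x.1.2 x.2.2‖ * expVecR (fun i => ‖w i‖) x.2.2)) := by ring
    _ ≤ _ := mul_le_mul_of_nonneg_right this (by positivity)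

theorem hasKern_sandwich {n : ℕ} {A B M : FockMatrix n} {φ ψ S T} (hA : IsExpOp A φ S)
    (hB : IsExpOp B ψ T) {C : ℝ} (hM : ∀ k l, ‖M k l‖ ≤ C) : HasKern (sandwich A M B) := fun z w => by
  have hs := (summable_sandwich_aux hA hB hM z w).prod_symm.prod
  refine hs.congr fun p => ?_
  simp only [sandwich, Prod.swap, tsum_mul_left, tsum_mul_right]

/-- The inner sums are the images of exponential vectors under `A` and `B`. The stars appear because
`kern` is bilinear, whereas `A†` acts on the conjugate side. -/
theorem kern_sandwich {n : ℕ} {A B M : FockMatrix n} {φ ψ S T} (hA : IsExpOp A φ S)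
    (hB : IsExpOp B ψ T) {C : ℝ} (hM : ∀ k l, ‖M k l‖ ≤ C) (z w : Fin n → ℂ) :
    kern (sandwich A M B) z w =
      star (φ (star z)) * ψ w * kern M (star (S (star z))) (T w) := by
  have hs := summable_sandwich_aux hA hB hM z w
  have e1 : kern (sandwich A M B) z w = ∑' (p : (Fin n → ℕ) × (Fin n → ℕ)) (x : (Fin n → ℕ) × (Fin n → ℕ)),
      expVec z p.1 * (star (A x.1 p.1) * M x.1 x.2 * B x.2 p.2) * expVec w p.2 := by
    simp only [kern, sandwich, tsum_mul_left, tsum_mul_right]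
  have e2 := Summable.tsum_comm (f := fun (x p : (Fin n → ℕ) × (Fin n → ℕ)) =>
    expVec z p.1 * (star (A x.1 p.1) * M x.1 x.2 * B x.2 p.2) * expVec w p.2) hs
  rw [e1, e2, kern, ← tsum_mul_left]
  refine tsum_congr fun x => ?_
  have ha : HasSum (fun q => expVec z q * star (A x.1 q))
      (star (φ (star z)) * expVec (star (S (star z))) x.1) := by
    have := (hA.hasSum (star z) x.1).star
    simp only [star_mul', star_expVec, star_star] at this
    simpa only [mul_comm] using this
  have hb := hB.hasSum w x.2
  have := (hasSum_mul_of_summable_norm (f := fun q => expVec z q * star (A x.1 q))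
    (g := fun q => B x.2 q * expVec w q) ha hb ha.summable.norm hb.summable.norm).mul_left (M x.1 x.2)
  rw [show star (φ (star z)) * ψ w * (expVec (star (S (star z))) x.1 * M x.1 x.2 * expVec (T w) x.2) =
    M x.1 x.2 * (star (φ (star z)) * expVec (star (S (star z))) x.1 * (ψ w * expVec (T w) x.2)) by ring,
    ← this.tsum_eq]
  exact tsum_congr fun p => by ring

theorem HasKern.const_mul {n : ℕ} {A : FockMatrix n} (hA : HasKern A) (c : ℂ) :
    HasKern (fun k l => c * A k l) := fun z w => by
  refine ((hA z w).mul_left c).congr fun p => ?_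
  ring

theorem kern_const_mul {n : ℕ} (A : FockMatrix n) (c : ℂ) (z w : Fin n → ℂ) :
    kern (fun k l => c * A k l) z w = c * kern A z w := by
  simp only [kern, ← tsum_mul_left]
  exact tsum_congr fun p => by ring

theorem IsExpOp.kern_eq {n : ℕ} {A : FockMatrix n} {φ S} (hA : IsExpOp A φ S) (hK : HasKern A)
    (z w : Fin n → ℂ) : kern A z w = φ w * Complex.exp (∑ i, z i * S w i) := by
  rw [kern, (hK z w).tsum_prod, ← (hasSum_expVec_mul_expVec z (S w)).tsum_eq, ← tsum_mul_left]
  refine tsum_congr fun k => ?_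
  simp_rw [mul_assoc]
  rw [tsum_mul_left, (hA.hasSum w k).tsum_eq]
  ring

theorem IsExpOp.hasKern {n : ℕ} {A : FockMatrix n} {φ S} (hA : IsExpOp A φ S) : HasKern A := fun z w => by
  obtain ⟨C, r, hC, hr, h⟩ := hA.bound (fun i => ‖w i‖) fun i => norm_nonneg _
  refine Summable.of_norm ?_
  rw [summable_prod_of_nonneg fun _ => norm_nonneg _]
  simp only [norm_mul, norm_expVec, mul_assoc]
  have hn : ∀ l q, 0 ≤ ‖A l q‖ * expVecR (fun i => ‖w i‖) q := fun l q =>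
    mul_nonneg (norm_nonneg _) (expVecR_nonneg (fun i => norm_nonneg _) _)
  refine ⟨fun k => ((h k).1.mul_left _), ?_⟩
  simp_rw [tsum_mul_left]
  refine Summable.of_nonneg_of_le (fun k => mul_nonneg (expVecR_nonneg (fun i => norm_nonneg _) _)
      (tsum_nonneg (hn k)))
    (fun k => mul_le_mul_of_nonneg_left (h k).2 (expVecR_nonneg (fun i => norm_nonneg _) _)) ?_
  -- The first summand of the bound is zero. The second is a product of two exponential vectors,
  -- hence an exponential series.
  refine Summable.of_norm_bounded (g := fun k => C * (expVecR (fun i => ‖z i‖ * r i) (fun _ => 0) * 0 + expVecR (fun i => ‖z i‖) k * expVecR r k)) ?_ fun k => ?_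
  · refine Summable.mul_left _ (Summable.add (by simp) ?_)
    have := (hasSum_expVec_mul_expVec (fun i => (‖z i‖ : ℂ)) (fun i => (r i : ℂ))).summable.norm
    refine this.congr fun k => ?_
    rw [norm_mul, norm_expVec, norm_expVec]
    simp [abs_of_nonneg, hr]
  · rw [Real.norm_of_nonneg (mul_nonneg (expVecR_nonneg (fun i => norm_nonneg _) _)
      (mul_nonneg hC (expVecR_nonneg hr _)))]
    simp; linarith

theorem isExpOp_one {n : ℕ} : IsExpOp (1 : FockMatrix n) (fun _ => 1) id where
  hasSum w k := by
    convert! hasSum_ite_eq k (expVec w k) using 2 with l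
    · by_cases h : l = k
      · subst h; simp
      · simp [h, Matrix.one_apply_ne' h]
    · simp
  bound r hr := ⟨1, r, zero_le_one, hr, fun k => by
    have : HasSum (fun l => ‖(1 : FockMatrix n) k l‖ * expVecR r l) (expVecR r k) := by
      convert! hasSum_ite_eq k (expVecR r k) using 2 with l
      by_cases h : l = k
      · subst h; simp
      · simp [h, Matrix.one_apply_ne' h]
    exact ⟨this.summable, by rw [this.tsum_eq, one_mul]⟩⟩

theorem kern_one {n : ℕ} (z w : Fin n → ℂ) :
    kern (1 : FockMatrix n) z w = Complex.exp (∑ i, z i * w i) := by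
  rw [isExpOp_one.kern_eq isExpOp_one.hasKern, one_mul]; rfl

theorem norm_one_le {n : ℕ} (k l : Fin n → ℕ) : ‖(1 : FockMatrix n) k l‖ ≤ 1 := by
  by_cases h : k = l
  · subst h; simp
  · simp [Matrix.one_apply_ne h]

theorem sandwich_one {n : ℕ} (A B : FockMatrix n) (q p : Fin n → ℕ) :
    sandwich A 1 B q p = ∑' k, star (A k q) * B k p := by
  have hi : Function.Injective fun k : Fin n → ℕ => (k, k) := fun a b h => (Prod.ext_iff.1 h).1
  rw [sandwich, ← hi.tsum_eq (f := fun x => star (A x.1 q) * (1 : FockMatrix n) x.1 x.2 * B x.2 p)]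
  · simp
  · intro x hx
    by_contra hne
    refine hx ?_
    have : x.1 ≠ x.2 := fun h => hne ⟨x.1, by ext1 <;> simp [h]⟩
    simp [Matrix.one_apply_ne this]

/-- If `A† A = 1` then the entries of `A` have modulus at most one. -/
theorem norm_le_one_of_sandwich_one {n : ℕ} {A : FockMatrix n} (h : sandwich A 1 A = 1)
    (k l : Fin n → ℕ) : ‖A k l‖ ≤ 1 ∧ Summable (fun k => ‖A k l‖ ^ 2) ∧ ∑' k, ‖A k l‖ ^ 2 = 1 := by
  have h1 : ∑' k, star (A k l) * A k l = 1 := by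
    rw [← sandwich_one, h]; simp
  have e : ∀ k, star (A k l) * A k l = ((‖A k l‖ ^ 2 : ℝ) : ℂ) := fun k => by
    rw [Complex.star_def, ← Complex.normSq_eq_conj_mul_self, Complex.normSq_eq_norm_sq]
  simp_rw [e] at h1
  rw [← Complex.ofReal_tsum] at h1
  have h2 : ∑' k, ‖A k l‖ ^ 2 = 1 := by exact_mod_cast h1
  have hs : Summable (fun k => ‖A k l‖ ^ 2) := by
    -- A family that is not summable has `tsum` equal to `0`, contrary to the value `1`.
    by_contra hn
    rw [tsum_eq_zero_of_not_summable hn] at h2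
    exact zero_ne_one h2
  refine ⟨?_, hs, h2⟩
  have := hs.le_tsum k fun _ _ => sq_nonneg _
  rw [h2] at this
  nlinarith [norm_nonneg (A k l)]

/-! ### Displacements of several modes -/

theorem hasSum_displacement {n : ℕ} (α w : Fin n → ℂ) (k : Fin n → ℕ) :
    HasSum (fun l => displacement α k l * expVec w l)
      (Complex.exp (∑ i, (-(‖α i‖ ^ 2 / 2 : ℝ) - star (α i) * w i)) * expVec (w + α) k) := by
  have h := hasSum_pi_prod (n := n) fun i =>
    (hasSum_dispPoly (α i) (-star (α i)) (w i) (k i)).mul_left ((Real.exp (-‖α i‖ ^ 2 / 2) : ℝ) : ℂ)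
  convert! h using 1
  · funext l
    simp only [displacement, expVec, dispElem_eq, ← Finset.prod_mul_distrib, mul_assoc]
  · rw [Complex.exp_sum, expVec, ← Finset.prod_mul_distrib]
    refine Finset.prod_congr rfl fun i _ => ?_
    rw [← mul_assoc, Complex.ofReal_exp, ← Complex.exp_add]
    congr 2
    push_cast; ring

theorem norm_dispElem_le (α : ℂ) (j k : ℕ) : ‖dispElem α j k‖ ≤ dispPolyR ‖α‖ ‖α‖ j k := by
  rw [dispElem_eq, norm_mul, Complex.norm_real, Real.norm_of_nonneg (Real.exp_pos _).le]
  have h := norm_dispPoly_le α (-star α) j k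
  rw [norm_neg, norm_star] at h
  have : Real.exp (-‖α‖ ^ 2 / 2) ≤ 1 := Real.exp_le_one_iff.2 (by nlinarith [sq_nonneg ‖α‖])
  calc _ ≤ 1 * ‖dispPoly α (-star α) j k‖ := mul_le_mul_of_nonneg_right this (norm_nonneg _)
    _ ≤ _ := by rwa [one_mul]

theorem isExpOp_displacement {n : ℕ} (α : Fin n → ℂ) : IsExpOp (displacement α)
    (fun w => Complex.exp (∑ i, (-(‖α i‖ ^ 2 / 2 : ℝ) - star (α i) * w i))) (fun w => w + α) where
  hasSum w k := hasSum_displacement α w k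
  bound r hr := by
    refine ⟨∏ i, Real.exp (‖α i‖ * r i), fun i => r i + ‖α i‖, by positivity,
      fun i => add_nonneg (hr i) (norm_nonneg _), fun k => ?_⟩
    have h := hasSum_pi_prod_real (n := n) fun i => hasSum_dispPolyR ‖α i‖ ‖α i‖ (r i) (k i)
    have hle : ∀ l, ‖displacement α k l‖ * expVecR r l ≤
        ∏ i, dispPolyR ‖α i‖ ‖α i‖ (k i) (l i) * (r i ^ l i / Real.sqrt (l i).factorial) := fun l => by
      rw [displacement, norm_prod, expVecR, ← Finset.prod_mul_distrib]
      have hp : ∀ i, 0 ≤ r i ^ l i / Real.sqrt (l i).factorial := fun i =>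
        div_nonneg (pow_nonneg (hr i) _) (Real.sqrt_nonneg _)
      exact Finset.prod_le_prod (fun i _ => mul_nonneg (norm_nonneg _) (hp i)) fun i _ =>
        mul_le_mul_of_nonneg_right (norm_dispElem_le _ _ _) (hp i)
    have hs := Summable.of_nonneg_of_le (fun l => mul_nonneg (norm_nonneg _) (expVecR_nonneg hr l)) hle
      h.summable
    refine ⟨hs, (hs.tsum_le_tsum hle h.summable).trans_eq ?_⟩
    rw [h.tsum_eq, expVecR, ← Finset.prod_mul_distrib]

theorem displacement_row {n : ℕ} (α : Fin n → ℂ) {R R' : ℝ} (h0 : 0 < R) (hRR : R < R') : ∃ C, 0 ≤ C ∧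
    ∀ k, Summable (fun l => ‖displacement α k l‖ * R ^ deg l) ∧
      ∑' l, ‖displacement α k l‖ * R ^ deg l ≤ C * R' ^ deg k := by
  choose C hC h using fun i => dispPolyR_geometric (norm_nonneg (α i)) h0 hRR
  refine ⟨∏ i, C i, Finset.prod_nonneg fun i _ => hC i, fun k => ?_⟩
  have hh := hasSum_pi_prod_real (n := n) fun i => (h i (k i)).1.hasSum
  have hle : ∀ l, ‖displacement α k l‖ * R ^ deg l ≤
      ∏ i, dispPolyR ‖α i‖ ‖α i‖ (k i) (l i) * R ^ l i := fun l => by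
    rw [displacement, norm_prod, deg, ← Finset.prod_pow_eq_pow_sum, ← Finset.prod_mul_distrib]
    exact Finset.prod_le_prod (fun i _ => by positivity) fun i _ =>
      mul_le_mul_of_nonneg_right (norm_dispElem_le _ _ _) (by positivity)
  have hs := Summable.of_nonneg_of_le (fun l => by positivity) hle hh.summable
  refine ⟨hs, (hs.tsum_le_tsum hle hh.summable).trans ?_⟩
  rw [hh.tsum_eq, deg, ← Finset.prod_pow_eq_pow_sum, ← Finset.prod_mul_distrib]
  exact Finset.prod_le_prod (fun i _ => tsum_nonneg fun l =>
    mul_nonneg (dispPolyR_nonneg (norm_nonneg _) (norm_nonneg _) _ _) (by positivity))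
    fun i _ => (h i (k i)).2

theorem isGeoOp_displacement {n : ℕ} (α : Fin n → ℂ) : IsGeoOp (displacement α) := by
  intro R h0 h1
  obtain ⟨R', hRR, hR1⟩ := exists_between h1
  obtain ⟨C, hC, h⟩ := displacement_row α h0 hRR
  exact ⟨C, R', hC, h0.trans hRR, hR1, h⟩

theorem kern_displacement {n : ℕ} (α z w : Fin n → ℂ) : kern (displacement α) z w =
    Complex.exp (∑ i, (-(‖α i‖ ^ 2 / 2 : ℝ) - star (α i) * w i + z i * (w i + α i))) := by
  rw [(isExpOp_displacement α).kern_eq (isExpOp_displacement α).hasKern, ← Complex.exp_add,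
    ← Finset.sum_add_distrib]
  rfl

theorem normSq_cast (z : ℂ) : ((‖z‖ ^ 2 : ℝ) : ℂ) = star z * z := by
  rw [Complex.star_def, ← Complex.normSq_eq_conj_mul_self, Complex.normSq_eq_norm_sq]

/-- `D(α)† D(β)` is a multiple of `D(β - α)`. -/
theorem sandwich_displacement_one {n : ℕ} (α β : Fin n → ℂ) :
    sandwich (displacement α) 1 (displacement β) = fun k l =>
      Complex.exp (∑ i, (star (α i) * β i - α i * star (β i)) / 2) * displacement (β - α) k l := by
  have hA := isExpOp_displacement α
  have hB := isExpOp_displacement β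
  have hD := (isExpOp_displacement (β - α)).hasKern
  refine eq_of_kern_eq (hasKern_sandwich hA hB norm_one_le) (hD.const_mul _) fun z w => ?_
  · rw [kern_sandwich hA hB norm_one_le, kern_one]
    rw [kern_const_mul, kern_displacement, Complex.star_def, ← Complex.exp_conj, ← Complex.exp_add,
      ← Complex.exp_add, ← Complex.exp_add, map_sum, ← Finset.sum_add_distrib,
      ← Finset.sum_add_distrib, ← Finset.sum_add_distrib]
    congr 1
    refine Finset.sum_congr rfl fun i _ => ?_
    simp only [Pi.star_apply, Pi.add_apply, Pi.sub_apply, Complex.ofReal_div, normSq_cast, map_sub, map_neg, map_mul,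
      Complex.star_def, map_add, Complex.conj_conj, Complex.conj_ofReal, map_div₀]
    push_cast
    ring

theorem displacement_zero {n : ℕ} : displacement (0 : Fin n → ℂ) = 1 := by
  refine eq_of_kern_eq (isExpOp_displacement _).hasKern isExpOp_one.hasKern fun z w => ?_
  rw [kern_displacement, kern_one]
  simp

theorem norm_displacement_le {n : ℕ} (α : Fin n → ℂ) (k l) : ‖displacement α k l‖ ≤ 1 := by
  refine (norm_le_one_of_sandwich_one ?_ k l).1
  rw [sandwich_displacement_one, sub_self, displacement_zero]
  funext k l
  simp [mul_comm]

/-- `D(α)† D(β) D(α)` is a multiple of `D(β)`. -/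
theorem sandwich_displacement {n : ℕ} (α β : Fin n → ℂ) :
    sandwich (displacement α) (displacement β) (displacement α) = fun k l =>
      Complex.exp (∑ i, (star (α i) * β i - α i * star (β i))) * displacement β k l := by
  have hA := isExpOp_displacement α
  have hD := (isExpOp_displacement β).hasKern
  refine eq_of_kern_eq (hasKern_sandwich hA hA (norm_displacement_le β)) (hD.const_mul _) fun z w => ?_
  · rw [kern_sandwich hA hA (norm_displacement_le β)]
    rw [kern_const_mul, kern_displacement, kern_displacement, Complex.star_def, ← Complex.exp_conj,
      ← Complex.exp_add, ← Complex.exp_add, ← Complex.exp_add, map_sum, ← Finset.sum_add_distrib,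
      ← Finset.sum_add_distrib, ← Finset.sum_add_distrib]
    congr 1
    refine Finset.sum_congr rfl fun i _ => ?_
    simp only [Pi.star_apply, Pi.add_apply, Complex.ofReal_div, normSq_cast, map_sub, map_neg, map_mul,
      Complex.star_def, map_add, Complex.conj_conj, Complex.conj_ofReal, map_div₀]
    push_cast
    ring

theorem star_dispElem (α : ℂ) (j k : ℕ) : star (dispElem α j k) = dispElem (-α) k j := by
  simp only [dispElem, star_mul', star_sum, Complex.star_def, Complex.conj_ofReal, norm_neg, min_comm,
    mul_comm (j.factorial : ℝ)]
  congr 1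
  refine Finset.sum_congr rfl fun s _ => ?_
  simp only [map_div₀, map_mul, map_pow, map_neg, Complex.conj_conj, map_natCast, neg_neg]
  ring

theorem star_displacement {n : ℕ} (α : Fin n → ℂ) (k l) :
    star (displacement α k l) = displacement (-α) l k := by
  simp [displacement, star_prod, star_dispElem]

/-! ### Passive linear unitaries -/

/-- The polynomial `∏ j, (∑ i, u i j X_i) ^ l j`. -/
def passivePoly {𝕜 : Type*} [CommRing 𝕜] {n : ℕ} (u : Matrix (Fin n) (Fin n) 𝕜) (l : Fin n → ℕ) :
    MvPolynomial (Fin n) 𝕜 :=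
  ∏ j, (∑ i, MvPolynomial.C (u i j) * MvPolynomial.X i) ^ l j

/-- The coefficients of `passivePoly`. -/
def passiveCoeff {𝕜 : Type*} [CommRing 𝕜] {n : ℕ} (u : Matrix (Fin n) (Fin n) 𝕜)
    (k l : Fin n → ℕ) : 𝕜 :=
  MvPolynomial.coeff (Finsupp.equivFunOnFinite.symm k) (passivePoly u l)

/-- Conservation of the photon number: `passivePoly u l` is homogeneous of degree `deg l`. -/
theorem passiveCoeff_eq_zero {𝕜 : Type*} [CommRing 𝕜] {n : ℕ} (u : Matrix (Fin n) (Fin n) 𝕜)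
    {k l : Fin n → ℕ} (h : deg k ≠ deg l) : passiveCoeff u k l = 0 := by
  have hh : (passivePoly u l).IsHomogeneous (∑ j, 1 * l j) := by
    refine MvPolynomial.IsHomogeneous.prod _ _ _ fun j _ => MvPolynomial.IsHomogeneous.pow ?_ _
    exact MvPolynomial.IsHomogeneous.sum _ _ _ fun i _ => by
      simpa using (MvPolynomial.isHomogeneous_C (Fin n) (u i j)).mul (MvPolynomial.isHomogeneous_X 𝕜 i)
  refine hh.coeff_eq_zero fun he => h ?_
  rw [deg, deg]
  simpa [Finsupp.degree_eq_sum] using he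

theorem sum_pow_eq_sum_div_factorial {R : Type*} [CommRing R] [Algebra ℚ R] {n : ℕ} (f : Fin n → R)
    (N : ℕ) : algebraMap ℚ R (1 / N.factorial) * (∑ i, f i) ^ N =
      ∑ k ∈ Finset.univ.piAntidiag N, algebraMap ℚ R (∏ i, (1 / (k i).factorial : ℚ)) * ∏ i, f i ^ k i := by
  rw [Finset.sum_pow_eq_sum_piAntidiag, Finset.mul_sum]
  refine Finset.sum_congr rfl fun k hk => ?_
  rw [Finset.mem_piAntidiag] at hk
  have := Nat.multinomial_spec Finset.univ k
  rw [hk.1] at this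
  have h2 : (1 / (N.factorial : ℚ)) * (Nat.multinomial Finset.univ k : ℚ) =
      ∏ i, (1 / (k i).factorial : ℚ) := by
    rw [← this, Finset.prod_div_distrib, Finset.prod_const_one]
    push_cast
    have h3 : (∏ i, ((k i).factorial : ℚ)) ≠ 0 := Finset.prod_ne_zero_iff.2 fun i _ => by positivity
    have h4 : (Nat.multinomial Finset.univ k : ℚ) ≠ 0 := by
      have := Nat.multinomial_pos Finset.univ k; positivity
    field_simp
  rw [← h2, map_mul, map_natCast, mul_assoc]

/-- Compare the coefficients of the monomial `X^k` in two multinomial expansions of `(∑ i j, u i j w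
j X i)^N / N!` with `N = deg k`, the inner sum being grouped once by `j` and once by `i`. -/
theorem sum_passiveCoeff {𝕜 : Type*} [Field 𝕜] [CharZero 𝕜] {n : ℕ} (u : Matrix (Fin n) (Fin n) 𝕜)
    (w : Fin n → 𝕜) (k : Fin n → ℕ) :
    ∑ l ∈ Finset.univ.piAntidiag (deg k), passiveCoeff u k l * ∏ j, (w j ^ l j / (l j).factorial) =
      ∏ i, ((∑ j, u i j * w j) ^ k i / (k i).factorial) := by
  have h1 := sum_pow_eq_sum_div_factorial (R := MvPolynomial (Fin n) 𝕜)
    (fun j => MvPolynomial.C (w j) * ∑ i, MvPolynomial.C (u i j) * MvPolynomial.X i) (deg k)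
  have h2 := sum_pow_eq_sum_div_factorial (R := MvPolynomial (Fin n) 𝕜)
    (fun i => MvPolynomial.C (∑ j, u i j * w j) * MvPolynomial.X i) (deg k)
  have e : ∑ j, (MvPolynomial.C (w j) * ∑ i, MvPolynomial.C (u i j) * MvPolynomial.X i) =
      ∑ i : Fin n, (MvPolynomial.C (∑ j, u i j * w j) * MvPolynomial.X i : MvPolynomial (Fin n) 𝕜) := by
    simp_rw [Finset.mul_sum, map_sum, Finset.sum_mul]
    rw [Finset.sum_comm]
    refine Finset.sum_congr rfl fun i _ => Finset.sum_congr rfl fun j _ => ?_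
    rw [map_mul]; ring
  rw [e, h2] at h1
  have h3 := congrArg (MvPolynomial.coeff (Finsupp.equivFunOnFinite.symm k)) h1
  simp only [MvPolynomial.coeff_sum, MvPolynomial.algebraMap_eq, IsScalarTower.algebraMap_apply ℚ 𝕜
    (MvPolynomial (Fin n) 𝕜), MvPolynomial.coeff_C_mul, mul_pow, Finset.prod_mul_distrib, ← map_pow,
    ← map_prod] at h3
  have hX : ∀ x : Fin n → ℕ, (∏ i, MvPolynomial.X (R := 𝕜) i ^ x i) =
      MvPolynomial.monomial (Finsupp.equivFunOnFinite.symm x) 1 := fun x => by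
    rw [MvPolynomial.monomial_eq, Finsupp.prod_fintype _ _ fun i => pow_zero _]; simp
  have hL : ∀ x ∈ Finset.univ.piAntidiag (deg k),
      algebraMap ℚ 𝕜 (∏ i, (1 / (x i).factorial : ℚ)) * ((∏ i, (∑ j, u i j * w j) ^ x i) *
        MvPolynomial.coeff (Finsupp.equivFunOnFinite.symm k) (∏ i, MvPolynomial.X (R := 𝕜) i ^ x i)) =
      if x = k then ∏ i, ((∑ j, u i j * w j) ^ k i / (k i).factorial) else 0 := fun x _ => by
    rw [hX, MvPolynomial.coeff_monomial]
    by_cases h : x = k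
    · subst h
      simp [div_eq_mul_inv, Finset.prod_mul_distrib, mul_comm]
    · simp [h]
  rw [Finset.sum_congr rfl hL, Finset.sum_ite_eq' , if_pos (by simp [deg])] at h3
  rw [h3]
  refine Finset.sum_congr rfl fun l _ => ?_
  rw [passiveCoeff, passivePoly, Finset.prod_div_distrib]
  simp [div_eq_mul_inv]
  ring

theorem passive_eq {n : ℕ} (u : Matrix (Fin n) (Fin n) ℂ) (k l : Fin n → ℕ) :
    passive u k l = passiveCoeff u k l *
      ((∏ i, Real.sqrt ((k i).factorial) / Real.sqrt ((l i).factorial) : ℝ) : ℂ) := by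
  rw [passive, passiveCoeff, passivePoly, Finset.prod_div_distrib,
    Real.sqrt_eq_rpow, Real.sqrt_eq_rpow, ← Real.finsetProd_rpow _ _ fun i _ => by positivity,
    ← Real.finsetProd_rpow _ _ fun i _ => by positivity]
  simp only [← Real.sqrt_eq_rpow]

theorem passive_eq_zero {n : ℕ} (u : Matrix (Fin n) (Fin n) ℂ) {k l : Fin n → ℕ}
    (h : deg k ≠ deg l) : passive u k l = 0 := by
  rw [passive_eq, passiveCoeff_eq_zero u h, zero_mul]

/-! ### Nonnegative majorants of polynomials -/

/-- The coefficients of `p` are dominated by those of `q`. -/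
def Dominates {n : ℕ} (q : MvPolynomial (Fin n) ℝ) (p : MvPolynomial (Fin n) ℂ) : Prop :=
  ∀ m, ‖MvPolynomial.coeff m p‖ ≤ MvPolynomial.coeff m q

theorem Dominates.nonneg {n : ℕ} {q : MvPolynomial (Fin n) ℝ} {p : MvPolynomial (Fin n) ℂ}
    (h : Dominates q p) (m) : 0 ≤ MvPolynomial.coeff m q := (norm_nonneg _).trans (h m)

theorem Dominates.mul {n : ℕ} {q q' : MvPolynomial (Fin n) ℝ} {p p' : MvPolynomial (Fin n) ℂ}
    (h : Dominates q p) (h' : Dominates q' p') : Dominates (q * q') (p * p') := fun m => by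
  classical
  rw [MvPolynomial.coeff_mul, MvPolynomial.coeff_mul]
  refine (norm_sum_le _ _).trans (Finset.sum_le_sum fun x _ => ?_)
  rw [norm_mul]
  exact mul_le_mul (h _) (h' _) (norm_nonneg _) (h.nonneg _)

theorem Dominates.sum {n : ℕ} {ι : Type*} {s : Finset ι} {q : ι → MvPolynomial (Fin n) ℝ}
    {p : ι → MvPolynomial (Fin n) ℂ} (h : ∀ i, Dominates (q i) (p i)) :
    Dominates (∑ i ∈ s, q i) (∑ i ∈ s, p i) := fun m => by
  rw [MvPolynomial.coeff_sum, MvPolynomial.coeff_sum]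
  exact (norm_sum_le _ _).trans (Finset.sum_le_sum fun x _ => h x m)

theorem dominates_one {n : ℕ} : Dominates (1 : MvPolynomial (Fin n) ℝ) 1 := fun m => by
  classical
  rw [MvPolynomial.coeff_one, MvPolynomial.coeff_one]
  split_ifs <;> simp

theorem Dominates.pow {n : ℕ} {q : MvPolynomial (Fin n) ℝ} {p : MvPolynomial (Fin n) ℂ}
    (h : Dominates q p) (N : ℕ) : Dominates (q ^ N) (p ^ N) := by
  induction N with
  | zero => simpa using dominates_one
  | succ N ih => rw [pow_succ, pow_succ]; exact ih.mul h

theorem Dominates.prod {n : ℕ} {ι : Type*} {s : Finset ι} {q : ι → MvPolynomial (Fin n) ℝ}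
    {p : ι → MvPolynomial (Fin n) ℂ} (h : ∀ i, Dominates (q i) (p i)) :
    Dominates (∏ i ∈ s, q i) (∏ i ∈ s, p i) := by
  classical
  induction s using Finset.induction_on with
  | empty => simpa using dominates_one
  | insert a s ha ih => rw [Finset.prod_insert ha, Finset.prod_insert ha]; exact (h a).mul ih

/-- The majorant built from the moduli `‖u i j‖` obeys the same generating identity, so it supplies
the absolute convergence required by `IsExpOp`. -/
theorem norm_passiveCoeff_le {n : ℕ} (u : Matrix (Fin n) (Fin n) ℂ) (k l : Fin n → ℕ) :
    ‖passiveCoeff u k l‖ ≤ passiveCoeff (u.map fun x => ‖x‖) k l := by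
  refine Dominates.prod (fun j => Dominates.pow (Dominates.sum fun i m => ?_) _) _
  classical
  rw [MvPolynomial.coeff_C_mul, MvPolynomial.coeff_C_mul, MvPolynomial.coeff_X, MvPolynomial.coeff_X]
  split_ifs <;> simp

theorem mem_piAntidiag_deg {n : ℕ} {N : ℕ} {l : Fin n → ℕ} :
    l ∈ (Finset.univ : Finset (Fin n)).piAntidiag N ↔ deg l = N := by
  simp [Finset.mem_piAntidiag, deg]

theorem hasSum_passiveCoeff {𝕜 : Type*} [RCLike 𝕜] {n : ℕ} (u : Matrix (Fin n) (Fin n) 𝕜)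
    (w : Fin n → 𝕜) (k : Fin n → ℕ) :
    HasSum (fun l => passiveCoeff u k l *
        ((∏ i, Real.sqrt ((k i).factorial) / Real.sqrt ((l i).factorial) : ℝ) : 𝕜) *
        ∏ i, (w i ^ l i / ((Real.sqrt ((l i).factorial) : ℝ) : 𝕜)))
      (∏ i, ((∑ j, u i j * w j) ^ k i / ((Real.sqrt ((k i).factorial) : ℝ) : 𝕜))) := by
  have hs : ∀ m : ℕ, ((Real.sqrt m.factorial : ℝ) : 𝕜) * ((Real.sqrt m.factorial : ℝ) : 𝕜) =
      (m.factorial : 𝕜) := fun m => by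
    rw [← RCLike.ofReal_mul, Real.mul_self_sqrt (by positivity)]; simp
  have hs0 : ∀ m : ℕ, ((Real.sqrt m.factorial : ℝ) : 𝕜) ≠ 0 := fun m => by
    have : Real.sqrt m.factorial ≠ 0 := by positivity
    exact_mod_cast this
  have key := congrArg (fun x : 𝕜 => (∏ i, ((Real.sqrt ((k i).factorial) : ℝ) : 𝕜)) * x)
    (sum_passiveCoeff u w k)
  simp only [Finset.mul_sum] at key
  have e : ∏ i, ((∑ j, u i j * w j) ^ k i / ((Real.sqrt ((k i).factorial) : ℝ) : 𝕜)) =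
      (∏ i, ((Real.sqrt ((k i).factorial) : ℝ) : 𝕜)) *
        ∏ i, ((∑ j, u i j * w j) ^ k i / ((k i).factorial : 𝕜)) := by
    rw [← Finset.prod_mul_distrib]
    refine Finset.prod_congr rfl fun i _ => ?_
    rw [← hs]
    have := hs0 (k i)
    field_simp
  rw [e, ← key]
  have e2 : ∀ l, passiveCoeff u k l *
        ((∏ i, Real.sqrt ((k i).factorial) / Real.sqrt ((l i).factorial) : ℝ) : 𝕜) *
        ∏ i, (w i ^ l i / ((Real.sqrt ((l i).factorial) : ℝ) : 𝕜)) =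
      (∏ i, ((Real.sqrt ((k i).factorial) : ℝ) : 𝕜)) * (passiveCoeff u k l * ∏ j, (w j ^ l j / (l j).factorial)) := by
    intro l
    rw [mul_assoc, mul_left_comm (∏ i, ((Real.sqrt ((k i).factorial) : ℝ) : 𝕜))]
    congr 1
    push_cast
    rw [← Finset.prod_mul_distrib, ← Finset.prod_mul_distrib]
    refine Finset.prod_congr rfl fun i _ => ?_
    rw [← hs]
    have := hs0 (l i)
    field_simp
  simp only [e2]
  refine hasSum_sum_of_ne_finset_zero fun l hl => ?_
  rw [mem_piAntidiag_deg] at hl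
  rw [passiveCoeff_eq_zero u (Ne.symm hl)]; simp

theorem isExpOp_passive {n : ℕ} (u : Matrix (Fin n) (Fin n) ℂ) :
    IsExpOp (passive u) (fun _ => 1) u.mulVec where
  hasSum w k := by
    simpa [passive_eq, expVec, Matrix.mulVec, dotProduct] using hasSum_passiveCoeff u w k
  bound r hr := by
    refine ⟨1, (u.map fun x => ‖x‖).mulVec r, zero_le_one, fun i => by
      simp only [Matrix.mulVec, dotProduct, Matrix.map_apply]
      exact Finset.sum_nonneg fun j _ => mul_nonneg (norm_nonneg _) (hr j), fun k => ?_⟩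
    have h : HasSum (fun l => passiveCoeff (u.map fun x => ‖x‖) k l *
        (∏ i, Real.sqrt ((k i).factorial) / Real.sqrt ((l i).factorial)) * expVecR r l)
        (expVecR ((u.map fun x => ‖x‖).mulVec r) k) :=
      hasSum_passiveCoeff (𝕜 := ℝ) (u.map fun x => ‖x‖) r k
    have hle : ∀ l, ‖passive u k l‖ * expVecR r l ≤ passiveCoeff (u.map fun x => ‖x‖) k l *
        (∏ i, Real.sqrt ((k i).factorial) / Real.sqrt ((l i).factorial)) * expVecR r l := fun l => by
      refine mul_le_mul_of_nonneg_right ?_ (expVecR_nonneg hr l)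
      have hp : 0 ≤ ∏ i, Real.sqrt ((k i).factorial) / Real.sqrt ((l i).factorial) := by positivity
      rw [passive_eq, norm_mul, Complex.norm_real, Real.norm_of_nonneg hp]
      exact mul_le_mul_of_nonneg_right (norm_passiveCoeff_le u k l) hp
    have hs := Summable.of_nonneg_of_le (fun l => mul_nonneg (norm_nonneg _) (expVecR_nonneg hr l)) hle
      h.summable
    refine ⟨hs, (hs.tsum_le_tsum hle h.summable).trans_eq ?_⟩
    rw [h.tsum_eq, one_mul]

theorem star_mulVec_star_dotProduct {n : ℕ} (u : Matrix (Fin n) (Fin n) ℂ) (z v : Fin n → ℂ) :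
    star (u.mulVec (star z)) ⬝ᵥ v = z ⬝ᵥ u.conjTranspose.mulVec v := by
  rw [Matrix.star_mulVec, star_star, Matrix.dotProduct_mulVec]

theorem conjTranspose_mulVec_mulVec {n : ℕ} {u : Matrix (Fin n) (Fin n) ℂ}
    (hu : u ∈ Matrix.unitaryGroup (Fin n) ℂ) (w : Fin n → ℂ) :
    u.conjTranspose.mulVec (u.mulVec w) = w := by
  rw [Matrix.mulVec_mulVec, ← Matrix.star_eq_conjTranspose, Matrix.mem_unitaryGroup_iff'.1 hu,
    Matrix.one_mulVec]

theorem sandwich_passive_one {n : ℕ} {u : Matrix (Fin n) (Fin n) ℂ}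
    (hu : u ∈ Matrix.unitaryGroup (Fin n) ℂ) : sandwich (passive u) 1 (passive u) = 1 := by
  have hA := isExpOp_passive u
  refine eq_of_kern_eq (hasKern_sandwich hA hA norm_one_le) isExpOp_one.hasKern fun z w => ?_
  rw [kern_sandwich hA hA norm_one_le, kern_one, kern_one]
  have := star_mulVec_star_dotProduct u z (u.mulVec w)
  rw [conjTranspose_mulVec_mulVec hu] at this
  simp only [star_one, one_mul]
  exact congrArg _ this

theorem norm_passive_le {n : ℕ} {u : Matrix (Fin n) (Fin n) ℂ}
    (hu : u ∈ Matrix.unitaryGroup (Fin n) ℂ) (k l) : ‖passive u k l‖ ≤ 1 :=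
  (norm_le_one_of_sandwich_one (sandwich_passive_one hu) k l).1

/-- Entries have modulus at most one and vanish unless the degrees agree. Any `R' > R` absorbs the
number of occupation vectors of a given degree. -/
theorem isGeoOp_passive {n : ℕ} {u : Matrix (Fin n) (Fin n) ℂ}
    (hu : u ∈ Matrix.unitaryGroup (Fin n) ℂ) : IsGeoOp (passive u) := by
  intro R h0 h1
  obtain ⟨R', hRR, hR1⟩ := exists_between h1
  have hR' : 0 < R' := h0.trans hRR
  have hs : Summable fun l : Fin n → ℕ => (R / R') ^ deg l :=
    summable_pow_deg (by positivity) ((div_lt_one hR').2 hRR)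
  refine ⟨∑' l : Fin n → ℕ, (R / R') ^ deg l, R', tsum_nonneg fun l => by positivity, hR', hR1,
    fun k => ?_⟩
  have hle : ∀ l, ‖passive u k l‖ * R ^ deg l ≤ (R / R') ^ deg l * R' ^ deg k := fun l => by
    by_cases h : deg k = deg l
    · rw [h, ← mul_pow, div_mul_cancel₀ _ hR'.ne']
      exact mul_le_of_le_one_left (by positivity) (norm_passive_le hu k l)
    · rw [passive_eq_zero u h, norm_zero, zero_mul]; positivity
  have hs' := Summable.of_nonneg_of_le (fun l => by positivity) hle (hs.mul_right _)
  refine ⟨hs', (hs'.tsum_le_tsum hle (hs.mul_right _)).trans_eq ?_⟩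
  rw [tsum_mul_right]

/-- `U† D(β) U = D(u† β)`. -/
theorem sandwich_passive {n : ℕ} {u : Matrix (Fin n) (Fin n) ℂ}
    (hu : u ∈ Matrix.unitaryGroup (Fin n) ℂ) (β : Fin n → ℂ) :
    sandwich (passive u) (displacement β) (passive u) = displacement (u.conjTranspose.mulVec β) := by
  have hA := isExpOp_passive u
  refine eq_of_kern_eq (hasKern_sandwich hA hA (norm_displacement_le β))
    (isExpOp_displacement _).hasKern fun z w => ?_
  rw [kern_sandwich hA hA (norm_displacement_le β), kern_displacement, kern_displacement]
  simp only [star_one, one_mul]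
  congr 1
  have e : ∀ (α z w : Fin n → ℂ), ∑ i, (-((‖α i‖ ^ 2 / 2 : ℝ) : ℂ) - star (α i) * w i + z i * (w i + α i)) =
      -(star α ⬝ᵥ α) / 2 - star α ⬝ᵥ w + z ⬝ᵥ (w + α) := by
    intro α z w
    simp only [dotProduct, Complex.ofReal_div, normSq_cast, Pi.star_apply, Pi.add_apply]
    rw [Finset.sum_add_distrib, Finset.sum_sub_distrib, neg_div, Finset.sum_div, ← Finset.sum_neg_distrib]
    simp
  have hu' : u * u.conjTranspose = 1 := Matrix.mem_unitaryGroup_iff.1 hu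
  have h1 : star (u.conjTranspose.mulVec β) ⬝ᵥ u.conjTranspose.mulVec β = star β ⬝ᵥ β := by
    rw [Matrix.star_mulVec, Matrix.conjTranspose_conjTranspose, ← Matrix.dotProduct_mulVec,
      Matrix.mulVec_mulVec, hu', Matrix.one_mulVec]
  have h2 : star (u.conjTranspose.mulVec β) ⬝ᵥ w = star β ⬝ᵥ u.mulVec w := by
    rw [Matrix.star_mulVec, Matrix.conjTranspose_conjTranspose, ← Matrix.dotProduct_mulVec]
  rw [e, e, h1, h2, star_mulVec_star_dotProduct, Matrix.mulVec_add, conjTranspose_mulVec_mulVec hu]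

/-! ### Matrices with geometrically decaying entries -/

/-- The entries of `ρ` decay geometrically. -/
def IsGeo {n : ℕ} (ρ : FockMatrix n) : Prop :=
  ∃ C R : ℝ, 0 ≤ C ∧ 0 < R ∧ R < 1 ∧ ∀ k l, ‖ρ k l‖ ≤ C * (R ^ deg k * R ^ deg l)

theorem summable_pow_deg_pair {n m : ℕ} {R S : ℝ} (h0 : 0 ≤ R) (h1 : R < 1) (hS : 0 ≤ S) (hS1 : S < 1) :
    Summable fun p : (Fin n → ℕ) × (Fin m → ℕ) => R ^ deg p.1 * S ^ deg p.2 :=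
  summable_mul_pair (f := fun k : Fin n → ℕ => R ^ deg k) (g := fun k : Fin m → ℕ => S ^ deg k)
    (summable_pow_deg h0 h1) (summable_pow_deg hS hS1)

theorem IsGeo.summable_norm {n : ℕ} {ρ : FockMatrix n} (h : IsGeo ρ) :
    Summable fun p : (Fin n → ℕ) × (Fin n → ℕ) => ‖ρ p.1 p.2‖ := by
  obtain ⟨C, R, hC, h0, h1, h⟩ := h
  exact Summable.of_nonneg_of_le (fun _ => norm_nonneg _) (fun p => h p.1 p.2)
    ((summable_pow_deg_pair h0.le h1 h0.le h1).mul_left C)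

/-- `tr (ρ M)`. -/
def trMul {n : ℕ} (ρ M : FockMatrix n) : ℂ :=
  ∑' p : (Fin n → ℕ) × (Fin n → ℕ), ρ p.1 p.2 * M p.2 p.1

/-- `exp(i ξ·q)`. -/
def weyl {n : ℕ} (ξ : Fin n × Fin 2 → ℝ) : FockMatrix n := displacement (weylAmplitude ξ)

theorem norm_weyl_le {n : ℕ} (ξ : Fin n × Fin 2 → ℝ) (k l) : ‖weyl ξ k l‖ ≤ 1 :=
  norm_displacement_le _ k l

theorem IsGeo.summable_mul {n : ℕ} {ρ : FockMatrix n} (h : IsGeo ρ) {M : FockMatrix n} {C : ℝ}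
    (hM : ∀ k l, ‖M k l‖ ≤ C) :
    Summable fun p : (Fin n → ℕ) × (Fin n → ℕ) => ρ p.1 p.2 * M p.2 p.1 := by
  refine Summable.of_norm_bounded (h.summable_norm.mul_right C) fun p => ?_
  rw [norm_mul]
  exact mul_le_mul_of_nonneg_left (hM _ _) (norm_nonneg _)

theorem IsGeo.charFn_eq {n : ℕ} {ρ : FockMatrix n} (h : IsGeo ρ) (ξ : Fin n × Fin 2 → ℝ) :
    charFn ρ ξ = trMul ρ (weyl ξ) :=
  ((h.summable_mul (norm_weyl_le ξ)).tsum_prod).symm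

theorem IsGeo.summable_conj_aux {n : ℕ} {A ρ M : FockMatrix n} (hA : IsGeoOp A) (h : IsGeo ρ) {C : ℝ}
    (hM : ∀ k l, ‖M k l‖ ≤ C) :
    Summable fun x : ((Fin n → ℕ) × (Fin n → ℕ)) × ((Fin n → ℕ) × (Fin n → ℕ)) =>
      A x.1.1 x.2.1 * ρ x.2.1 x.2.2 * star (A x.1.2 x.2.2) * M x.1.2 x.1.1 := by
  obtain ⟨C1, R, hC1, h0, h1, h⟩ := h
  obtain ⟨C2, S, hC2, hS0, hS1, h2⟩ := hA R h0 h1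
  have hs : Summable fun k : Fin n → ℕ => C2 * S ^ deg k := (summable_pow_deg hS0.le hS1).mul_left C2
  have key := summable_mul_rows (a := fun k p => ‖A k p‖ * R ^ deg p) (b := fun k p => ‖A k p‖ * R ^ deg p)
    (f := fun k => C2 * S ^ deg k) (g := fun k => C2 * S ^ deg k)
    (fun _ _ => by positivity) (fun _ _ => by positivity) hs hs h2 h2
  have hC : 0 ≤ C := (norm_nonneg _).trans (hM 0 0)
  refine Summable.of_norm_bounded (key.mul_left (C1 * C)) fun x => ?_
  rw [norm_mul, norm_mul, norm_mul, norm_star]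
  calc _ ≤ ‖A x.1.1 x.2.1‖ * (C1 * (R ^ deg x.2.1 * R ^ deg x.2.2)) * ‖A x.1.2 x.2.2‖ * C := by
        gcongr
        · exact h _ _
        · exact hM _ _
    _ = _ := by ring

theorem IsGeo.conjBy {n : ℕ} {A ρ : FockMatrix n} (hA : IsGeoOp A) (h : IsGeo ρ) :
    IsGeo (conjBy A ρ) := by
  obtain ⟨C1, R, hC1, h0, h1, h⟩ := h
  obtain ⟨C2, S, hC2, hS0, hS1, h2⟩ := hA R h0 h1
  refine ⟨C1 * (C2 * C2), S, by positivity, hS0, hS1, fun k l => ?_⟩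
  have hs : HasSum (fun p : (Fin n → ℕ) × (Fin n → ℕ) =>
      C1 * ((‖A k p.1‖ * R ^ deg p.1) * (‖A l p.2‖ * R ^ deg p.2))) (C1 * ((∑' p, ‖A k p‖ * R ^ deg p) *
        (∑' p, ‖A l p‖ * R ^ deg p))) := by
    refine HasSum.mul_left _ (hasSum_mul_of_summable_norm (f := fun p => ‖A k p‖ * R ^ deg p)
      (g := fun p => ‖A l p‖ * R ^ deg p) (h2 k).1.hasSum (h2 l).1.hasSum (h2 k).1.norm (h2 l).1.norm)
  have hb := tsum_of_norm_bounded (f := fun p : (Fin n → ℕ) × (Fin n → ℕ) =>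
    A k p.1 * ρ p.1 p.2 * star (A l p.2)) hs fun p => by
      rw [norm_mul, norm_mul, norm_star]
      calc _ ≤ ‖A k p.1‖ * (C1 * (R ^ deg p.1 * R ^ deg p.2)) * ‖A l p.2‖ := by
            gcongr
            exact h _ _
        _ = _ := by ring
  refine hb.trans ?_
  have : (∑' p, ‖A k p‖ * R ^ deg p) * (∑' p, ‖A l p‖ * R ^ deg p) ≤
      (C2 * S ^ deg k) * (C2 * S ^ deg l) :=
    mul_le_mul (h2 k).2 (h2 l).2 (tsum_nonneg fun _ => by positivity) (by positivity)
  calc _ ≤ C1 * ((C2 * S ^ deg k) * (C2 * S ^ deg l)) := mul_le_mul_of_nonneg_left this hC1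
    _ = _ := by ring

/-- Cyclicity of the trace. The geometric row bounds of `A` make the fourfold sum absolutely
convergent, so it can be summed in either order. -/
theorem trMul_conjBy {n : ℕ} {A ρ M : FockMatrix n} (hA : IsGeoOp A) (h : IsGeo ρ) {C : ℝ}
    (hM : ∀ k l, ‖M k l‖ ≤ C) : trMul (FockMatrix.conjBy A ρ) M = trMul ρ (sandwich A M A) := by
  have hs := IsGeo.summable_conj_aux hA h hM
  have e1 := Summable.tsum_comm (f := fun (x y : (Fin n → ℕ) × (Fin n → ℕ)) =>
    A x.1 y.1 * ρ y.1 y.2 * star (A x.2 y.2) * M x.2 x.1) hs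
  have e2 : trMul (FockMatrix.conjBy A ρ) M = ∑' (x : (Fin n → ℕ) × (Fin n → ℕ)) (y : (Fin n → ℕ) × (Fin n → ℕ)),
      A x.1 y.1 * ρ y.1 y.2 * star (A x.2 y.2) * M x.2 x.1 := by
    simp only [trMul, FockMatrix.conjBy, tsum_mul_right]
  rw [e2, ← e1, trMul]
  refine tsum_congr fun y => ?_
  rw [sandwich, ← tsum_mul_left, ← (Equiv.prodComm (Fin n → ℕ) (Fin n → ℕ)).tsum_eq]
  exact tsum_congr fun x => by simp only [Equiv.prodComm_apply, Prod.fst_swap, Prod.snd_swap]; ring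

theorem trMul_const_mul {n : ℕ} (ρ M : FockMatrix n) (c : ℂ) :
    trMul ρ (fun k l => c * M k l) = c * trMul ρ M := by
  simp only [trMul, ← tsum_mul_left]
  exact tsum_congr fun p => by ring

/-! ### Phase space -/

/-- The phase space vector `ξ` as a complex vector `ξ_x + i ξ_p`. -/
def toComplex {n : ℕ} (ξ : Fin n × Fin 2 → ℝ) : Fin n → ℂ :=
  fun i => (ξ (i, 0) : ℂ) + Complex.I * (ξ (i, 1) : ℂ)

/-- The inverse of `toComplex`. -/
def ofComplex {n : ℕ} (z : Fin n → ℂ) : Fin n × Fin 2 → ℝ :=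
  fun i => if i.2 = 0 then (z i.1).re else (z i.1).im

theorem toComplex_ofComplex {n : ℕ} (z : Fin n → ℂ) : toComplex (ofComplex z) = z := by
  funext i
  simp [toComplex, ofComplex, mul_comm Complex.I]

theorem ofComplex_toComplex {n : ℕ} (ξ : Fin n × Fin 2 → ℝ) : ofComplex (toComplex ξ) = ξ := by
  funext ⟨i, j⟩
  fin_cases j <;> simp [toComplex, ofComplex]

/-- `toComplex` as a real-linear equivalence. -/
def phaseEquiv (n : ℕ) : (Fin n × Fin 2 → ℝ) ≃ₗ[ℝ] (Fin n → ℂ) where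
  toFun := toComplex
  invFun := ofComplex
  left_inv := ofComplex_toComplex
  right_inv := toComplex_ofComplex
  map_add' ξ η := by funext i; simp [toComplex]; ring
  map_smul' c ξ := by funext i; simp [toComplex]; ring

theorem weylAmplitude_eq {n : ℕ} (ξ : Fin n × Fin 2 → ℝ) :
    weylAmplitude ξ = (Complex.I / ((Real.sqrt 2 : ℝ) : ℂ)) • toComplex ξ := by
  funext i
  simp only [weylAmplitude, toComplex, Pi.smul_apply, smul_eq_mul]
  ring

/-- The action of the adjoint of `u` on phase space. -/
def pullback {n : ℕ} (u : Matrix (Fin n) (Fin n) ℂ) : (Fin n × Fin 2 → ℝ) →ₗ[ℝ] (Fin n × Fin 2 → ℝ) :=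
  (phaseEquiv n).symm.toLinearMap ∘ₗ (u.conjTranspose.mulVecLin.restrictScalars ℝ) ∘ₗ
    (phaseEquiv n).toLinearMap

theorem toComplex_pullback {n : ℕ} (u : Matrix (Fin n) (Fin n) ℂ) (ξ : Fin n × Fin 2 → ℝ) :
    toComplex (pullback u ξ) = u.conjTranspose.mulVec (toComplex ξ) :=
  toComplex_ofComplex _

theorem weylAmplitude_pullback {n : ℕ} (u : Matrix (Fin n) (Fin n) ℂ) (ξ : Fin n × Fin 2 → ℝ) :
    weylAmplitude (pullback u ξ) = u.conjTranspose.mulVec (weylAmplitude ξ) := by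
  rw [weylAmplitude_eq, weylAmplitude_eq, toComplex_pullback, Matrix.mulVec_smul]

theorem IsGeo.charFn_passive {n : ℕ} {ρ : FockMatrix n} (h : IsGeo ρ)
    {u : Matrix (Fin n) (Fin n) ℂ} (hu : u ∈ Matrix.unitaryGroup (Fin n) ℂ) (ξ : Fin n × Fin 2 → ℝ) :
    charFn (FockMatrix.conjBy (passive u) ρ) ξ = charFn ρ (pullback u ξ) := by
  rw [(h.conjBy (isGeoOp_passive hu)).charFn_eq, h.charFn_eq,
    trMul_conjBy (isGeoOp_passive hu) h (norm_weyl_le ξ), weyl, sandwich_passive hu, weyl,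
    weylAmplitude_pullback]

/-- The shift of the mean vector under `D(α)`. -/
def meanShift {n : ℕ} (α : Fin n → ℂ) : Fin n × Fin 2 → ℝ := ofComplex ((Real.sqrt 2 : ℂ) • α)

theorem weyl_phase {n : ℕ} (α : Fin n → ℂ) (ξ : Fin n × Fin 2 → ℝ) :
    ∑ i, (star (α i) * weylAmplitude ξ i - α i * star (weylAmplitude ξ i)) =
      Complex.I * ((ξ ⬝ᵥ meanShift α : ℝ) : ℂ) := by
  rw [dotProduct, Fintype.sum_prod_type]
  push_cast
  rw [Finset.mul_sum]
  refine Finset.sum_congr rfl fun i _ => ?_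
  have h2 : ((Real.sqrt 2 : ℝ) : ℂ) * ((Real.sqrt 2 : ℝ) : ℂ) = 2 := by
    rw [← Complex.ofReal_mul, Real.mul_self_sqrt (by norm_num)]; norm_num
  have h0 : ((Real.sqrt 2 : ℝ) : ℂ) ≠ 0 := fun h => by rw [h] at h2; norm_num at h2
  rw [Fin.sum_univ_two]
  have hα : α i = (α i).re + (α i).im * Complex.I := (Complex.re_add_im _).symm
  simp only [weylAmplitude, meanShift, ofComplex, if_true, Pi.smul_apply, smul_eq_mul, Complex.star_def,
    map_div₀, map_mul, map_add, Complex.conj_I, Complex.conj_ofReal, Complex.re_ofReal_mul,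
    Complex.im_ofReal_mul, one_ne_zero, if_false]
  generalize (α i).re = a at hα
  generalize (α i).im = b at hα
  rw [hα]
  simp only [map_add, map_mul, Complex.conj_ofReal, Complex.conj_I]
  push_cast
  field_simp
  linear_combination (-((ξ (i, 0) : ℂ) * a + ξ (i, 1) * b)) * h2 + (-2 * (b : ℂ) * ξ (i, 1)) * Complex.I_sq

theorem IsGeo.charFn_displacement {n : ℕ} {ρ : FockMatrix n} (h : IsGeo ρ) (α : Fin n → ℂ)
    (ξ : Fin n × Fin 2 → ℝ) : charFn (FockMatrix.conjBy (displacement α) ρ) ξ =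
      Complex.exp (Complex.I * ((ξ ⬝ᵥ meanShift α : ℝ) : ℂ)) * charFn ρ ξ := by
  rw [(h.conjBy (isGeoOp_displacement α)).charFn_eq, h.charFn_eq,
    trMul_conjBy (isGeoOp_displacement α) h (norm_weyl_le ξ), weyl, sandwich_displacement, weyl_phase,
    trMul_const_mul]

/-! ### Composite systems -/

/-- The phase space vector of a composite system. -/
def joinPhase {n m : ℕ} (ξ : Fin n × Fin 2 → ℝ) (η : Fin m × Fin 2 → ℝ) : Fin (n + m) × Fin 2 → ℝ :=
  fun i => Fin.append (fun a => ξ (a, i.2)) (fun b => η (b, i.2)) i.1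

/-- The first component of a phase space vector. -/
def fstPhase {n m : ℕ} (ζ : Fin (n + m) × Fin 2 → ℝ) : Fin n × Fin 2 → ℝ :=
  fun i => ζ (Fin.castAdd m i.1, i.2)

/-- The second component of a phase space vector. -/
def sndPhase {n m : ℕ} (ζ : Fin (n + m) × Fin 2 → ℝ) : Fin m × Fin 2 → ℝ :=
  fun i => ζ (Fin.natAdd n i.1, i.2)

@[simp] theorem fstPhase_joinPhase {n m : ℕ} (ξ : Fin n × Fin 2 → ℝ) (η : Fin m × Fin 2 → ℝ) :
    fstPhase (joinPhase ξ η) = ξ := by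
  funext i; simp [fstPhase, joinPhase]

@[simp] theorem sndPhase_joinPhase {n m : ℕ} (ξ : Fin n × Fin 2 → ℝ) (η : Fin m × Fin 2 → ℝ) :
    sndPhase (joinPhase ξ η) = η := by
  funext i; simp [sndPhase, joinPhase]

theorem weyl_append {n m : ℕ} (ζ : Fin (n + m) × Fin 2 → ℝ) (k l : Fin n → ℕ) (p q : Fin m → ℕ) :
    weyl ζ (Fin.append k p) (Fin.append l q) = weyl (fstPhase ζ) k l * weyl (sndPhase ζ) p q := by
  simp [weyl, displacement, Fin.prod_univ_add, weylAmplitude, fstPhase, sndPhase]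

theorem deg_append {n m : ℕ} (k : Fin n → ℕ) (p : Fin m → ℕ) : deg (Fin.append k p) = deg k + deg p := by
  simp [deg, Fin.sum_univ_add]

/-- Pairs of occupation numbers of a composite system. -/
def pairEquiv (n m : ℕ) : (((Fin n → ℕ) × (Fin n → ℕ)) × ((Fin m → ℕ) × (Fin m → ℕ))) ≃
    (Fin (n + m) → ℕ) × (Fin (n + m) → ℕ) where
  -- The pair for the last modes is stored in exchanged order, as the indices occur in `measured`.
  toFun x := (Fin.append x.1.1 x.2.2, Fin.append x.1.2 x.2.1)
  invFun y := ((fun i => y.1 (Fin.castAdd m i), fun i => y.2 (Fin.castAdd m i)),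
    (fun i => y.2 (Fin.natAdd n i), fun i => y.1 (Fin.natAdd n i)))
  left_inv x := by simp
  right_inv y := by
    have h : ∀ f : Fin (n + m) → ℕ, Fin.append (fun i => f (Fin.castAdd m i)) (fun i => f (Fin.natAdd n i)) = f :=
      fun f => Fin.append_castAdd_natAdd
    simp only [h]

theorem IsGeo.charFn_composite {n m : ℕ} {ρ : FockMatrix (n + m)} (h : IsGeo ρ)
    (ζ : Fin (n + m) × Fin 2 → ℝ) :
    charFn ρ ζ = ∑' x : ((Fin n → ℕ) × (Fin n → ℕ)) × ((Fin m → ℕ) × (Fin m → ℕ)),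
      ρ (Fin.append x.1.1 x.2.2) (Fin.append x.1.2 x.2.1) *
        (weyl (fstPhase ζ) x.1.2 x.1.1 * weyl (sndPhase ζ) x.2.1 x.2.2) := by
  rw [h.charFn_eq, trMul, ← (pairEquiv n m).tsum_eq]
  exact tsum_congr fun x => by rw [← weyl_append]; rfl

theorem IsGeo.max {n m : ℕ} {ρ : FockMatrix n} {τ : FockMatrix m} (h : IsGeo ρ) (h' : IsGeo τ) :
    ∃ C R : ℝ, 0 ≤ C ∧ 0 < R ∧ R < 1 ∧ (∀ k l, ‖ρ k l‖ ≤ C * (R ^ deg k * R ^ deg l)) ∧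
      ∀ k l, ‖τ k l‖ ≤ C * (R ^ deg k * R ^ deg l) := by
  obtain ⟨C, R, hC, h0, h1, h⟩ := h
  obtain ⟨C', R', hC', h0', h1', h'⟩ := h'
  refine ⟨Max.max C C', Max.max R R', le_max_of_le_left hC, lt_max_of_lt_left h0, max_lt h1 h1',
    fun k l => (h k l).trans ?_, fun k l => (h' k l).trans ?_⟩ <;> gcongr <;>
    first | exact le_max_left _ _ | exact le_max_right _ _

theorem IsGeo.tensor {n m : ℕ} {ρ : FockMatrix n} {τ : FockMatrix m} (h : IsGeo ρ) (h' : IsGeo τ) :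
    IsGeo (tensor ρ τ) := by
  obtain ⟨C, R, hC, h0, h1, h, h'⟩ := h.max h'
  refine ⟨C * C, R, by positivity, h0, h1, fun k l => ?_⟩
  have e : ∀ k : Fin (n + m) → ℕ, deg k = deg (fun i => k (Fin.castAdd m i)) + deg fun i => k (Fin.natAdd n i) :=
    fun k => by simp [deg, Fin.sum_univ_add]
  rw [FockMatrix.tensor, norm_mul, e k, e l, pow_add, pow_add]
  calc _ ≤ _ := mul_le_mul (h _ _) (h' _ _) (norm_nonneg _) (by positivity)
    _ = _ := by ring

theorem IsGeo.charFn_tensor {n m : ℕ} {ρ : FockMatrix n} {τ : FockMatrix m} (h : IsGeo ρ) (h' : IsGeo τ)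
    (ζ : Fin (n + m) × Fin 2 → ℝ) :
    charFn (FockMatrix.tensor ρ τ) ζ = charFn ρ (fstPhase ζ) * charFn τ (sndPhase ζ) := by
  have hs1 := h.summable_mul (norm_weyl_le (fstPhase ζ))
  have hs2 := (h'.summable_mul (norm_weyl_le (sndPhase ζ))).prod_symm
  have e : trMul τ (weyl (sndPhase ζ)) = ∑' p : (Fin m → ℕ) × (Fin m → ℕ),
      τ p.swap.1 p.swap.2 * weyl (sndPhase ζ) p.swap.2 p.swap.1 :=
    ((Equiv.prodComm (Fin m → ℕ) (Fin m → ℕ)).tsum_eq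
      fun p => τ p.1 p.2 * weyl (sndPhase ζ) p.2 p.1).symm
  have key := hasSum_mul_of_summable_norm (f := fun p : (Fin n → ℕ) × (Fin n → ℕ) =>
    ρ p.1 p.2 * weyl (fstPhase ζ) p.2 p.1) (g := fun p : (Fin m → ℕ) × (Fin m → ℕ) =>
    τ p.swap.1 p.swap.2 * weyl (sndPhase ζ) p.swap.2 p.swap.1) hs1.hasSum hs2.hasSum hs1.norm hs2.norm
  rw [(h.tensor h').charFn_composite, h.charFn_eq, h'.charFn_eq, e, trMul, ← key.tsum_eq]
  refine tsum_congr fun x => ?_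
  simp only [FockMatrix.tensor, Fin.append_left, Fin.append_right, Prod.fst_swap, Prod.snd_swap]
  ring

/-! ### Measurements -/

/-- `E = ∫ g(t) exp(i ι(t)·q) dt`, with integrals that grow subexponentially. -/
structure IsWeylIntegral {m : ℕ} {T : Type*} [MeasurableSpace T] (μ : Measure T) (E : FockMatrix m)
    (g : T → ℂ) (ι : T → Fin m × Fin 2 → ℝ) : Prop where
  integrable : ∀ p q, Integrable (fun t => g t * weyl (ι t) p q) μ
  bound : ∀ S : ℝ, 1 < S → ∃ C, ∀ p q, ∫ t, ‖g t * weyl (ι t) p q‖ ∂μ ≤ C * (S ^ deg p * S ^ deg q)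
  eq_integral : ∀ p q, E p q = ∫ t, g t * weyl (ι t) p q ∂μ

/-- `S` is the room between the decay rate `R` and `1`: an effect whose entries grow at most like
`S^deg` is still summable against the state. Homodyne effects need this, since the available bounds
on their Weyl integrals grow with the occupation numbers. -/
theorem IsGeo.append_bound {n m : ℕ} {ρ : FockMatrix (n + m)} (h : IsGeo ρ) :
    ∃ C R S : ℝ, 0 ≤ C ∧ 0 < R ∧ R < 1 ∧ 1 < S ∧ S * R < 1 ∧ ∀ k l p q,
      ‖ρ (Fin.append k q) (Fin.append l p)‖ ≤ C * ((R ^ deg k * R ^ deg l) * (R ^ deg p * R ^ deg q)) := by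
  obtain ⟨C, R, hC, h0, h1, h⟩ := h
  obtain ⟨S, hS1, hS⟩ := exists_between ((one_lt_div h0).2 h1)
  refine ⟨C, R, S, hC, h0, h1, hS1, (lt_div_iff₀ h0).1 hS, fun k l p q => (h _ _).trans_eq ?_⟩
  rw [deg_append, deg_append, pow_add, pow_add]; ring

theorem IsWeylIntegral.norm_le {m : ℕ} {T : Type*} [MeasurableSpace T] {μ : Measure T} {E : FockMatrix m}
    {g : T → ℂ} {ι : T → Fin m × Fin 2 → ℝ} (hE : IsWeylIntegral μ E g ι) (p q) :
    ‖E p q‖ ≤ ∫ t, ‖g t * weyl (ι t) p q‖ ∂μ := by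
  rw [hE.eq_integral]; exact norm_integral_le_integral_norm _

theorem IsGeo.summable_measured {n m : ℕ} {ρ : FockMatrix (n + m)} (h : IsGeo ρ) {T : Type*}
    [MeasurableSpace T] {μ : Measure T} {E : FockMatrix m} {g : T → ℂ} {ι : T → Fin m × Fin 2 → ℝ}
    (hE : IsWeylIntegral μ E g ι) : ∃ C R : ℝ, 0 ≤ C ∧ 0 < R ∧ R < 1 ∧ ∃ b : (Fin m → ℕ) × (Fin m → ℕ) → ℝ,
      Summable b ∧ (∀ p, 0 ≤ b p) ∧ ∀ k l p, (∫ t, ‖g t * weyl (ι t) p.1 p.2‖ ∂μ) *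
        ‖ρ (Fin.append k p.2) (Fin.append l p.1)‖ ≤ C * (R ^ deg k * R ^ deg l) * b p := by
  obtain ⟨C, R, S, hC, h0, h1, hS1, hSR, h⟩ := h.append_bound
  obtain ⟨C', hb⟩ := hE.bound S hS1
  have hC' : 0 ≤ C' := by
    have h1 := hb 0 0
    have h2 : 0 ≤ ∫ t, ‖g t * weyl (ι t) 0 0‖ ∂μ := integral_nonneg fun _ => norm_nonneg _
    simp only [deg, Pi.zero_apply, Finset.sum_const_zero, pow_zero, mul_one] at h1
    exact h2.trans h1
  have hSR0 : 0 < S * R := by positivity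
  refine ⟨C, R, hC, h0, h1, fun p => C' * ((S * R) ^ deg p.1 * (S * R) ^ deg p.2),
    (summable_pow_deg_pair hSR0.le hSR hSR0.le hSR).mul_left C', fun p => by positivity, fun k l p => ?_⟩
  calc _ ≤ (C' * (S ^ deg p.1 * S ^ deg p.2)) *
        (C * ((R ^ deg k * R ^ deg l) * (R ^ deg p.1 * R ^ deg p.2))) :=
        mul_le_mul (hb _ _) (h _ _ _ _) (norm_nonneg _) (by positivity)
    _ = _ := by simp only [mul_pow]; ring

theorem IsGeo.measured {n m : ℕ} {ρ : FockMatrix (n + m)} (h : IsGeo ρ) {T : Type*}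
    [MeasurableSpace T] {μ : Measure T} {E : FockMatrix m} {g : T → ℂ} {ι : T → Fin m × Fin 2 → ℝ}
    (hE : IsWeylIntegral μ E g ι) : IsGeo (measured E ρ) := by
  obtain ⟨C, R, hC, h0, h1, b, hb, hb0, h⟩ := h.summable_measured hE
  refine ⟨C * ∑' p, b p, R, mul_nonneg hC (tsum_nonneg hb0), h0, h1, fun k l => ?_⟩
  have := tsum_of_norm_bounded (f := fun p : (Fin m → ℕ) × (Fin m → ℕ) =>
    E p.1 p.2 * ρ (Fin.append k p.2) (Fin.append l p.1)) (hb.hasSum.mul_left (C * (R ^ deg k * R ^ deg l)))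
    fun p => by
      rw [norm_mul]
      exact (mul_le_mul_of_nonneg_right (hE.norm_le _ _) (norm_nonneg _)).trans (h k l p)
  exact this.trans_eq (by ring)

/-- Insert the Weyl expansion of the effect into the trace and exchange sum and integral. All
measurements, and discarding, enter the phase space calculus through this formula. -/
theorem IsGeo.charFn_measured {n m : ℕ} {ρ : FockMatrix (n + m)} (h : IsGeo ρ) {T : Type*}
    [MeasurableSpace T] {μ : Measure T} {E : FockMatrix m} {g : T → ℂ} {ι : T → Fin m × Fin 2 → ℝ}
    (hE : IsWeylIntegral μ E g ι) (ξ : Fin n × Fin 2 → ℝ) :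
    charFn (FockMatrix.measured E ρ) ξ = ∫ t, g t * charFn ρ (joinPhase ξ (ι t)) ∂μ := by
  obtain ⟨C, R, hC, h0, h1, b, hb, hb0, hbound⟩ := h.summable_measured hE
  have hpair : Summable fun x : ((Fin n → ℕ) × (Fin n → ℕ)) × ((Fin m → ℕ) × (Fin m → ℕ)) =>
      C * (R ^ deg x.1.1 * R ^ deg x.1.2) * b x.2 :=
    summable_mul_pair (f := fun p : (Fin n → ℕ) × (Fin n → ℕ) => C * (R ^ deg p.1 * R ^ deg p.2)) (g := b)
      ((summable_pow_deg_pair h0.le h1 h0.le h1).mul_left C) hb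
  have hle : ∀ (x : ((Fin n → ℕ) × (Fin n → ℕ)) × ((Fin m → ℕ) × (Fin m → ℕ))),
      (∫ t, ‖g t * weyl (ι t) x.2.1 x.2.2‖ ∂μ) *
        ‖ρ (Fin.append x.1.1 x.2.2) (Fin.append x.1.2 x.2.1) * weyl ξ x.1.2 x.1.1‖ ≤
      C * (R ^ deg x.1.1 * R ^ deg x.1.2) * b x.2 := fun x => by
    refine le_trans ?_ (hbound x.1.1 x.1.2 x.2)
    refine mul_le_mul_of_nonneg_left ?_ (integral_nonneg fun _ => norm_nonneg _)
    rw [norm_mul]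
    exact mul_le_of_le_one_right (norm_nonneg _) (norm_weyl_le ξ _ _)
  set F : ((Fin n → ℕ) × (Fin n → ℕ)) × ((Fin m → ℕ) × (Fin m → ℕ)) → T → ℂ := fun x t =>
    (g t * weyl (ι t) x.2.1 x.2.2) *
      (ρ (Fin.append x.1.1 x.2.2) (Fin.append x.1.2 x.2.1) * weyl ξ x.1.2 x.1.1) with hF
  have hFi : ∀ x, Integrable (F x) μ := fun x => (hE.integrable _ _).mul_const _
  have hFs : Summable fun x => ∫ t, ‖F x t‖ ∂μ := by
    refine Summable.of_nonneg_of_le (fun x => integral_nonneg fun _ => norm_nonneg _) (fun x => ?_) hpair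
    simp only [hF, norm_mul _ (ρ _ _ * _)]
    rw [integral_mul_const]
    exact hle x
  have key := hasSum_integral_of_summable_integral_norm hFi hFs
  have e1 : ∀ x, ∫ t, F x t ∂μ = E x.2.1 x.2.2 *
      (ρ (Fin.append x.1.1 x.2.2) (Fin.append x.1.2 x.2.1) * weyl ξ x.1.2 x.1.1) := fun x => by
    rw [hE.eq_integral, integral_mul_const]
  simp only [e1] at key
  have e2 : (∫ t, g t * charFn ρ (joinPhase ξ (ι t)) ∂μ) = ∫ t, ∑' x, F x t ∂μ := by
    refine integral_congr_ae (ae_of_all _ fun t => ?_)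
    simp only [hF]
    rw [h.charFn_composite, ← tsum_mul_left]
    refine tsum_congr fun x => ?_
    rw [fstPhase_joinPhase, sndPhase_joinPhase]; ring
  rw [e2, ← key.tsum_eq, (h.measured hE).charFn_eq, trMul, key.summable.tsum_prod]
  refine tsum_congr fun p => ?_
  rw [FockMatrix.measured, ← tsum_mul_right]
  exact tsum_congr fun q => by ring

theorem weyl_zero {n : ℕ} : weyl (0 : Fin n × Fin 2 → ℝ) = 1 := by
  rw [weyl, show weylAmplitude (0 : Fin n × Fin 2 → ℝ) = 0 from funext fun i => by simp [weylAmplitude],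
    displacement_zero]

/-- The identity is the Weyl operator at the origin, so a partial trace is a measurement whose Weyl
integral is over a point mass. -/
theorem isWeylIntegral_one {m : ℕ} : IsWeylIntegral (Measure.dirac ()) (1 : FockMatrix m) (fun _ => 1)
    fun _ => 0 where
  integrable p q := by simp
  bound S hS := ⟨1, fun p q => by
    have h1 : 1 ≤ S ^ deg p := one_le_pow₀ hS.le
    have h2 : 1 ≤ S ^ deg q := one_le_pow₀ hS.le
    simp only [integral_dirac, one_mul, weyl_zero]
    exact (norm_one_le p q).trans (one_le_mul_of_one_le_of_one_le h1 h2)⟩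
  eq_integral p q := by simp [weyl_zero]

theorem partialTrace_eq_measured {n m : ℕ} (ρ : FockMatrix (n + m)) : partialTrace ρ = measured 1 ρ := by
  funext k l
  have hi : Function.Injective fun k : Fin m → ℕ => (k, k) := fun a b h => (Prod.ext_iff.1 h).1
  rw [partialTrace, measured, ← hi.tsum_eq (f := fun p : (Fin m → ℕ) × (Fin m → ℕ) =>
    (1 : FockMatrix m) p.1 p.2 * ρ (Fin.append k p.2) (Fin.append l p.1))]
  · simp
  · intro x hx
    by_contra hne
    refine hx ?_
    have : x.1 ≠ x.2 := fun h => hne ⟨x.1, by ext1 <;> simp [h]⟩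
    simp [Matrix.one_apply_ne this]

theorem IsGeo.partialTrace {n m : ℕ} {ρ : FockMatrix (n + m)} (h : IsGeo ρ) : IsGeo (partialTrace ρ) := by
  rw [partialTrace_eq_measured]; exact h.measured isWeylIntegral_one

theorem IsGeo.charFn_partialTrace {n m : ℕ} {ρ : FockMatrix (n + m)} (h : IsGeo ρ)
    (ξ : Fin n × Fin 2 → ℝ) :
    charFn (FockMatrix.partialTrace ρ) ξ = charFn ρ (joinPhase ξ 0) := by
  rw [partialTrace_eq_measured, h.charFn_measured isWeylIntegral_one]
  simp

/-! ### Fourier inversion on `ι → ℝ` -/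

/-- Fourier inversion on the Euclidean space, transported to `ι → ℝ`. Rescaling the frequency by
`2π` produces the constant. -/
theorem integral_exp_mul_fourier {ι : Type*} [Fintype ι] {f : (ι → ℝ) → ℂ} (hf : Continuous f)
    (hi : Integrable f)
    (hF : Integrable fun y : ι → ℝ => ∫ s, Complex.exp (-(Complex.I * ((s ⬝ᵥ y : ℝ) : ℂ))) * f s)
    (a : ι → ℝ) :
    ∫ y : ι → ℝ, Complex.exp (Complex.I * ((y ⬝ᵥ a : ℝ) : ℂ)) *
      ∫ s, Complex.exp (-(Complex.I * ((s ⬝ᵥ y : ℝ) : ℂ))) * f s =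
      ((2 * Real.pi) ^ Fintype.card ι : ℝ) * f a := by
  set G : (ι → ℝ) → ℂ := fun y => ∫ s, Complex.exp (-(Complex.I * ((s ⬝ᵥ y : ℝ) : ℂ))) * f s with hG
  have hmp := EuclideanSpace.volume_preserving_symm_measurableEquiv_toLp ι
  set e : EuclideanSpace ℝ ι ≃ᵐ (ι → ℝ) := (MeasurableEquiv.toLp 2 (ι → ℝ)).symm with he
  have he' : ∀ x, e x = x.ofLp := fun x => rfl
  have hinner : ∀ v w : EuclideanSpace ℝ ι, inner ℝ v w = e v ⬝ᵥ e w := fun v w => by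
    simp [PiLp.inner_apply, dotProduct, he', mul_comm]
  have h2π : (2 * Real.pi) ≠ 0 := by positivity
  have hfc : Continuous (f ∘ e) := by
    exact hf.comp (PiLp.continuous_ofLp 2 _)
  have hfi : Integrable (f ∘ e) := (hmp.integrable_comp_emb e.measurableEmbedding).2 hi
  have hFT : ∀ w, FourierTransform.fourier (f ∘ e) w = G ((2 * Real.pi) • e w) := fun w => by
    rw [Real.fourier_eq, hG]
    simp only
    rw [← hmp.integral_comp e.measurableEmbedding]
    refine integral_congr_ae (ae_of_all _ fun v => ?_)
    simp only [Function.comp_apply, Circle.smul_def, Real.fourierChar_apply, smul_eq_mul, hinner]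
    congr 2
    rw [dotProduct_smul]; push_cast; simp only [smul_eq_mul]; push_cast; ring
  have hGi : Integrable fun w : ι → ℝ => G ((2 * Real.pi) • w) :=
    (integrable_comp_smul_iff volume G h2π).2 hF
  have hFTi : Integrable (FourierTransform.fourier (f ∘ e)) := by
    have := (hmp.integrable_comp_emb e.measurableEmbedding).2 hGi
    exact this.congr (ae_of_all _ fun w => (hFT w).symm)
  have key := congrFun (hfc.fourierInv_fourier_eq hfi hFTi) (e.symm a)
  rw [Real.fourierInv_eq] at key
  simp only [hFT, Function.comp_apply, MeasurableEquiv.apply_symm_apply, hinner, Circle.smul_def,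
    Real.fourierChar_apply, smul_eq_mul] at key
  rw [← key, hmp.integral_comp e.measurableEmbedding (fun w =>
    Complex.exp (((2 * Real.pi * (w ⬝ᵥ a) : ℝ) : ℂ) * Complex.I) * G ((2 * Real.pi) • w))]
  have hsc := Measure.integral_comp_smul (volume : Measure (ι → ℝ)) (fun y =>
    Complex.exp (Complex.I * ((y ⬝ᵥ a : ℝ) : ℂ)) * G y) (2 * Real.pi)
  have e1 : ∀ w : ι → ℝ, Complex.exp (((2 * Real.pi * (w ⬝ᵥ a) : ℝ) : ℂ) * Complex.I) * G ((2 * Real.pi) • w) =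
      Complex.exp (Complex.I * ((((2 * Real.pi) • w) ⬝ᵥ a : ℝ) : ℂ)) * G ((2 * Real.pi) • w) := fun w => by
    rw [smul_dotProduct, smul_eq_mul, mul_comm Complex.I]
  simp only [e1]
  rw [hsc, Module.finrank_fintype_fun_eq_card, Complex.real_smul, ← mul_assoc, ← Complex.ofReal_mul,
    abs_of_nonneg (by positivity), mul_inv_cancel₀ (by positivity), Complex.ofReal_one, one_mul]

theorem eq_zero_of_fourier_eq_zero {ι : Type*} [Fintype ι] {f : (ι → ℝ) → ℂ} (hf : Continuous f)
    (hi : Integrable f) (h : ∀ y : ι → ℝ, ∫ s, Complex.exp (-(Complex.I * ((s ⬝ᵥ y : ℝ) : ℂ))) * f s = 0) :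
    f = 0 := by
  funext a
  have := integral_exp_mul_fourier hf hi (by simp only [h]; exact integrable_zero _ _ _) a
  simp only [h, mul_zero, integral_zero] at this
  have h2 : (((2 * Real.pi) ^ Fintype.card ι : ℝ) : ℂ) ≠ 0 := by
    have : (2 * Real.pi) ^ Fintype.card ι ≠ 0 := by positivity
    exact_mod_cast this
  exact (mul_eq_zero.1 this.symm).resolve_left h2

/-! ### Expansions in Weyl operators -/

theorem continuous_dispElem (j k : ℕ) : Continuous fun α : ℂ => dispElem α j k := by
  unfold dispElem
  fun_prop

theorem continuous_weylAmplitude {n : ℕ} : Continuous (weylAmplitude (n := n)) := by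
  unfold weylAmplitude
  fun_prop

theorem continuous_weyl {n : ℕ} (k l : Fin n → ℕ) : Continuous fun ξ => weyl ξ k l := by
  unfold weyl displacement
  refine continuous_finsetProd _ fun i _ => (continuous_dispElem _ _).comp ?_
  exact (continuous_apply i).comp continuous_weylAmplitude

/-- The linear coefficients in the exponent of the kernel of a Weyl operator. -/
def kernCoeff {n : ℕ} (z w : Fin n → ℂ) : Fin n × Fin 2 → ℂ :=
  fun s => if s.2 = 0 then Complex.I / ((Real.sqrt 2 : ℝ) : ℂ) * (z s.1 + w s.1)
    else -(1 / ((Real.sqrt 2 : ℝ) : ℂ)) * (z s.1 - w s.1)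

theorem sqrt_two_mul_self : ((Real.sqrt 2 : ℝ) : ℂ) * ((Real.sqrt 2 : ℝ) : ℂ) = 2 := by
  rw [← Complex.ofReal_mul, Real.mul_self_sqrt (by norm_num)]; norm_num

theorem sqrt_two_ne_zero : ((Real.sqrt 2 : ℝ) : ℂ) ≠ 0 := fun h => by
  have := sqrt_two_mul_self
  rw [h] at this; norm_num at this

theorem kern_weyl {n : ℕ} (ξ : Fin n × Fin 2 → ℝ) (z w : Fin n → ℂ) : kern (weyl ξ) z w =
    Complex.exp (z ⬝ᵥ w) *
      Complex.exp (-(1 / 4 : ℂ) * ∑ s, (ξ s : ℂ) ^ 2 + ∑ s, kernCoeff z w s * (ξ s : ℂ)) := by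
  rw [weyl, kern_displacement, ← Complex.exp_add, Fintype.sum_prod_type, Fintype.sum_prod_type,
    Finset.mul_sum, dotProduct, ← Finset.sum_add_distrib, ← Finset.sum_add_distrib]
  congr 1
  refine Finset.sum_congr rfl fun i _ => ?_
  have h2 := sqrt_two_mul_self
  have h0 := sqrt_two_ne_zero
  rw [Fin.sum_univ_two, Fin.sum_univ_two, Complex.ofReal_div, normSq_cast]
  simp only [weylAmplitude, kernCoeff, if_true, one_ne_zero, if_false, Complex.star_def,
    map_div₀, map_mul, map_add, Complex.conj_I, Complex.conj_ofReal]
  push_cast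
  generalize ((Real.sqrt 2 : ℝ) : ℂ) = r at *
  have h3 : r⁻¹ * r⁻¹ = 1 / 2 := by rw [← mul_inv, h2]; norm_num
  simp only [div_eq_mul_inv]
  linear_combination ((ξ (i, 0) : ℂ) ^ 2 + (ξ (i, 1) : ℂ) ^ 2) * (-1 / 2 : ℂ) * h3 +
    (r⁻¹ * r⁻¹ * ((ξ (i, 0) : ℂ) ^ 2 / 2 - (ξ (i, 1) : ℂ) ^ 2 / 2 * Complex.I ^ 2 + (ξ (i, 1) : ℂ) ^ 2 / 2) + r⁻¹ * (ξ (i, 1) : ℂ) * (z i - w i)) * Complex.I_sq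

theorem integrable_gaussian_linear {ι : Type*} [Fintype ι] {b : ℂ} (hb : 0 < b.re) (c : ι → ℂ) :
    Integrable fun v : ι → ℝ => Complex.exp (-b * ∑ i, (v i : ℂ) ^ 2 + ∑ i, c i * v i) :=
  GaussianFourier.integrable_cexp_neg_mul_sum_add hb c

theorem integrable_kern_weyl {n : ℕ} (z w : Fin n → ℂ) :
    Integrable fun ξ : Fin n × Fin 2 → ℝ => kern (weyl ξ) z w := by
  simp only [kern_weyl]
  exact (integrable_gaussian_linear (by norm_num) _).const_mul _

theorem integrable_mul_weyl {n : ℕ} {T : Type*} [MeasurableSpace T] {μ : Measure T} {g : T → ℂ}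
    (hg : Integrable g μ) {ι : T → Fin n × Fin 2 → ℝ} (hι : Measurable ι) (k l : Fin n → ℕ) :
    Integrable (fun t => g t * weyl (ι t) k l) μ := by
  refine (hg.bdd_mul (c := 1) ((continuous_weyl k l).measurable.comp hι).aestronglyMeasurable
    (ae_of_all _ fun t => norm_weyl_le _ _ _)).congr (ae_of_all _ fun t => mul_comm _ _)

theorem hasKern_integral_weyl {n : ℕ} {T : Type*} [MeasurableSpace T] {μ : Measure T} {g : T → ℂ}
    (hg : Integrable g μ) (ι : T → Fin n × Fin 2 → ℝ) :
    HasKern (fun k l => ∫ t, g t * weyl (ι t) k l ∂μ) :=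
  hasKern_of_bounded (C := ∫ t, ‖g t‖ ∂μ) fun k l => by
    refine norm_integral_le_of_norm_le hg.norm (ae_of_all _ fun t => ?_)
    rw [norm_mul]
    exact mul_le_of_le_one_right (norm_nonneg _) (norm_weyl_le _ _ _)

theorem kern_integral_weyl {n : ℕ} {T : Type*} [MeasurableSpace T] {μ : Measure T} {g : T → ℂ}
    (hg : Integrable g μ) {ι : T → Fin n × Fin 2 → ℝ} (hι : Measurable ι) (z w : Fin n → ℂ) :
    kern (fun k l => ∫ t, g t * weyl (ι t) k l ∂μ) z w = ∫ t, g t * kern (weyl (ι t)) z w ∂μ := by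
  have hs := (summable_mul_of_summable_norm (summable_expVec z).norm (summable_expVec w).norm).norm
  set F : (Fin n → ℕ) × (Fin n → ℕ) → T → ℂ := fun p t =>
    expVec z p.1 * (g t * weyl (ι t) p.1 p.2) * expVec w p.2 with hF
  have key := hasSum_integral_of_summable_integral_norm (F := F) (μ := μ)
    (fun p => ((integrable_mul_weyl hg hι p.1 p.2).const_mul _).mul_const _) (by
      refine Summable.of_nonneg_of_le (fun p => integral_nonneg fun _ => norm_nonneg _) (fun p => ?_)
        (hs.mul_right (∫ t, ‖g t‖ ∂μ))
      rw [← integral_const_mul]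
      refine integral_mono_of_nonneg (ae_of_all _ fun _ => norm_nonneg _) (hg.norm.const_mul _)
        (ae_of_all _ fun t => ?_)
      simp only [hF, norm_mul]
      have := norm_weyl_le (ι t) p.1 p.2
      calc _ = ‖expVec z p.1‖ * ‖expVec w p.2‖ * ‖g t‖ * ‖weyl (ι t) p.1 p.2‖ := by ring
        _ ≤ _ := mul_le_of_le_one_right (by positivity) this)
  unfold kern
  have e : ∀ p, ∫ t, F p t ∂μ = expVec z p.1 * (∫ t, g t * weyl (ι t) p.1 p.2 ∂μ) * expVec w p.2 :=
    fun p => by simp only [hF]; rw [integral_mul_const, integral_const_mul]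
  simp only [e] at key
  rw [key.tsum_eq]
  refine integral_congr_ae (ae_of_all _ fun t => ?_)
  simp only [hF]
  rw [← tsum_mul_left]
  exact tsum_congr fun p => by ring

theorem hasKern_expVec {n : ℕ} (z w : Fin n → ℂ) :
    HasKern (fun l k => expVec w l * expVec z k) := fun z' w' => by
  have := summable_mul_of_summable_norm (hasSum_expVec_mul_expVec z' w).summable.norm
    (hasSum_expVec_mul_expVec z w').summable.norm
  exact this.congr fun p => by ring

theorem kern_expVec {n : ℕ} (z w z' w' : Fin n → ℂ) :
    kern (fun l k => expVec w l * expVec z k) z' w' = Complex.exp (z' ⬝ᵥ w + z ⬝ᵥ w') := by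
  have h1 := hasSum_expVec_mul_expVec z' w
  have h2 := hasSum_expVec_mul_expVec z w'
  have h := hasSum_mul_of_summable_norm (f := fun k => expVec z' k * expVec w k)
    (g := fun k => expVec z k * expVec w' k) h1 h2 h1.summable.norm h2.summable.norm
  rw [Complex.exp_add, dotProduct, dotProduct, ← h.tsum_eq]
  unfold kern
  exact tsum_congr fun p => by ring

/-- The rank one operator of two exponential vectors as a superposition of Weyl operators. -/
theorem integral_kern_weyl_mul_weyl {n : ℕ} (z w : Fin n → ℂ) (l k : Fin n → ℕ) :
    ∫ ξ : Fin n × Fin 2 → ℝ, kern (weyl (-ξ)) z w * weyl ξ l k =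
      ((2 * Real.pi) ^ n : ℝ) * (expVec w l * expVec z k) := by
  have hg : Integrable fun ξ : Fin n × Fin 2 → ℝ => kern (weyl (-ξ)) z w :=
    (integrable_kern_weyl z w).comp_neg
  refine congrFun (congrFun (eq_of_kern_eq (hasKern_integral_weyl hg fun ξ => ξ)
    ((hasKern_expVec z w).const_mul _) fun z' w' => ?_) l) k
  rw [kern_integral_weyl (ι := fun ξ => ξ) hg measurable_id, kern_const_mul (A := fun l k => expVec w l * expVec z k), kern_expVec]
  simp only [kern_weyl]
  have e : ∀ ξ : Fin n × Fin 2 → ℝ, Complex.exp (z ⬝ᵥ w) * Complex.exp (-(1 / 4 : ℂ) *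
      ∑ s, ((-ξ) s : ℂ) ^ 2 + ∑ s, kernCoeff z w s * ((-ξ) s : ℂ)) *
      (Complex.exp (z' ⬝ᵥ w') * Complex.exp (-(1 / 4 : ℂ) * ∑ s, (ξ s : ℂ) ^ 2 +
        ∑ s, kernCoeff z' w' s * (ξ s : ℂ))) = (Complex.exp (z ⬝ᵥ w) * Complex.exp (z' ⬝ᵥ w')) *
      Complex.exp (-(1 / 2 : ℂ) * ∑ s, (ξ s : ℂ) ^ 2 +
        ∑ s, (kernCoeff z' w' s - kernCoeff z w s) * (ξ s : ℂ)) := fun ξ => by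
    rw [mul_mul_mul_comm, ← Complex.exp_add (-(1 / 4 : ℂ) * ∑ s, ((-ξ) s : ℂ) ^ 2 + _)]
    congr 2
    simp only [Pi.neg_apply, Complex.ofReal_neg, neg_sq, sub_mul, Finset.sum_sub_distrib, mul_neg,
      Finset.sum_neg_distrib]
    ring
  simp only [e]
  rw [integral_const_mul, GaussianFourier.integral_cexp_neg_mul_sum_add (by norm_num), ← Complex.exp_add,
    mul_left_comm, ← Complex.exp_add]
  congr 1
  · rw [Fintype.card_prod, Fintype.card_fin, Fintype.card_fin]
    push_cast
    rw [mul_div_assoc, div_self two_ne_zero, mul_one, Complex.cpow_natCast]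
    congr 1; field_simp
  · congr 1
    rw [Fintype.sum_prod_type, dotProduct, dotProduct, dotProduct, dotProduct, ← Finset.sum_add_distrib,
      ← Finset.sum_add_distrib, Finset.sum_div, ← Finset.sum_add_distrib]
    refine Finset.sum_congr rfl fun i _ => ?_
    rw [Fin.sum_univ_two]
    have h2 := sqrt_two_mul_self
    simp only [kernCoeff, if_true, one_ne_zero, if_false]
    generalize ((Real.sqrt 2 : ℝ) : ℂ) = r at *
    have h3 : r⁻¹ * r⁻¹ = 1 / 2 := by rw [← mul_inv, h2]; norm_num
    simp only [div_eq_mul_inv]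
    linear_combination (-2 * (z' i - z i) * (w' i - w i)) * h3 + (r⁻¹ * r⁻¹ / 2 * (z' i + w' i - z i - w i) ^ 2) * Complex.I_sq

/-! ### Operators with a well-behaved characteristic function -/

theorem measurable_tsum_complex {κ T : Type*} [Countable κ] [MeasurableSpace T] {f : κ → T → ℂ}
    (hf : ∀ i, Measurable (f i)) (hs : ∀ t, Summable fun i => f i t) :
    Measurable fun t => ∑' i, f i t :=
  measurable_of_tendsto_metrizable' (Filter.atTop : Filter (Finset κ))
    (f := fun s t => ∑ i ∈ s, f i t) (fun _ => Finset.measurable_sum _ fun i _ => hf i)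
    (tendsto_pi_nhds.2 fun t => (hs t).hasSum)

/-- Matrices for which the sums in the characteristic function converge boundedly. -/
structure IsTame {n : ℕ} (ρ : FockMatrix n) : Prop where
  bounded : ∃ C, ∀ k l, ‖ρ k l‖ ≤ C
  row : ∃ C : (Fin n → ℕ) → ℝ, ∀ k ξ, Summable (fun l => ‖ρ k l * weyl ξ l k‖) ∧
    ∀ F : Finset (Fin n → ℕ), ∑ l ∈ F, ‖ρ k l * weyl ξ l k‖ ≤ C k
  sum : ∃ C : ℝ, ∀ ξ (F : Finset (Fin n → ℕ)), ∑ k ∈ F, ‖∑' l, ρ k l * weyl ξ l k‖ ≤ C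

theorem IsGeo.isTame {n : ℕ} {ρ : FockMatrix n} (h : IsGeo ρ) : IsTame ρ where
  bounded := by
    obtain ⟨C, R, hC, h0, h1, h⟩ := h
    refine ⟨C * (1 * 1), fun k l => (h k l).trans ?_⟩
    gcongr <;> exact pow_le_one₀ h0.le h1.le
  row := by
    refine ⟨fun k => ∑' l, ‖ρ k l‖, fun k ξ => ?_⟩
    have hs : Summable fun l => ‖ρ k l‖ := h.summable_norm.prod_factor k
    have hle : ∀ l, ‖ρ k l * weyl ξ l k‖ ≤ ‖ρ k l‖ := fun l => by
      rw [norm_mul]; exact mul_le_of_le_one_right (norm_nonneg _) (norm_weyl_le _ _ _)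
    exact ⟨Summable.of_nonneg_of_le (fun _ => norm_nonneg _) hle hs, fun F =>
      (Finset.sum_le_sum fun l _ => hle l).trans (hs.sum_le_tsum _ fun _ _ => norm_nonneg _)⟩
  sum := by
    refine ⟨∑' k, ∑' l, ‖ρ k l‖, fun ξ F => ?_⟩
    have hs : ∀ k, Summable fun l => ‖ρ k l‖ := fun k => h.summable_norm.prod_factor k
    have hle : ∀ k l, ‖ρ k l * weyl ξ l k‖ ≤ ‖ρ k l‖ := fun k l => by
      rw [norm_mul]; exact mul_le_of_le_one_right (norm_nonneg _) (norm_weyl_le _ _ _)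
    refine (Finset.sum_le_sum fun k _ => tsum_of_norm_bounded (hs k).hasSum (hle k)).trans ?_
    exact h.summable_norm.prod.sum_le_tsum _ fun k _ => tsum_nonneg fun _ => norm_nonneg _

theorem IsTame.measurable_row {n : ℕ} {ρ : FockMatrix n} (h : IsTame ρ) (k : Fin n → ℕ) :
    Measurable fun ξ => ∑' l, ρ k l * weyl ξ l k := by
  obtain ⟨C, hC⟩ := h.row
  exact measurable_tsum_complex (fun l => ((continuous_weyl l k).measurable).const_mul _)
    fun ξ => (hC k ξ).1.of_norm

theorem IsTame.summable_charFn {n : ℕ} {ρ : FockMatrix n} (h : IsTame ρ) (ξ : Fin n × Fin 2 → ℝ) :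
    Summable fun k => ‖∑' l, ρ k l * weyl ξ l k‖ := by
  obtain ⟨C, hC⟩ := h.sum
  exact summable_of_sum_le (fun _ => norm_nonneg _) (hC ξ)

theorem IsTame.measurable_charFn {n : ℕ} {ρ : FockMatrix n} (h : IsTame ρ) :
    Measurable (charFn ρ) :=
  measurable_tsum_complex (fun k => h.measurable_row k) fun ξ => (h.summable_charFn ξ).of_norm

theorem IsTame.norm_charFn_le {n : ℕ} {ρ : FockMatrix n} (h : IsTame ρ) {C : ℝ} {ξ : Fin n × Fin 2 → ℝ}
    (hC : ∀ F : Finset (Fin n → ℕ), ∑ k ∈ F, ‖∑' l, ρ k l * weyl ξ l k‖ ≤ C) : ‖charFn ρ ξ‖ ≤ C :=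
  (norm_tsum_le_tsum_norm (h.summable_charFn ξ)).trans ((h.summable_charFn ξ).tsum_le_of_sum_le hC)

/-- The bounds on finite partial sums are uniform in `ξ`, so sum and integral can be exchanged
within each row and then for the sum over rows. Absolute convergence of the double sum is not
needed, which matters for states not known to decay. -/
theorem IsTame.hasSum_integral_mul_charFn {n : ℕ} {ρ : FockMatrix n} (h : IsTame ρ)
    {g : (Fin n × Fin 2 → ℝ) → ℂ} (hg : Integrable g) :
    HasSum (fun k => ∑' l, ρ k l * ∫ ξ, g ξ * weyl ξ l k) (∫ ξ, g ξ * charFn ρ ξ) := by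
  obtain ⟨C, hC⟩ := h.sum
  obtain ⟨D, hD⟩ := h.row
  have hrow : ∀ k, HasSum (fun l => ∫ ξ, g ξ * (ρ k l * weyl ξ l k)) (∫ ξ, g ξ * ∑' l, ρ k l * weyl ξ l k) := by
    intro k
    have hi : ∀ l, Integrable fun ξ => g ξ * (ρ k l * weyl ξ l k) := fun l =>
      ((integrable_mul_weyl hg measurable_id l k).const_mul (ρ k l)).congr
        (ae_of_all _ fun ξ => by simp only [id]; ring)
    have := hasSum_integral_of_summable_integral_norm (F := fun l ξ => g ξ * (ρ k l * weyl ξ l k)) hi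
      (summable_of_sum_le (c := (∫ ξ, ‖g ξ‖) * D k) (fun _ => integral_nonneg fun _ => norm_nonneg _) fun F => by
        rw [← integral_finsetSum _ fun l _ => (hi l).norm, ← integral_mul_const]
        refine integral_mono (integrable_finsetSum _ fun l _ => (hi l).norm) (hg.norm.mul_const _) fun ξ => ?_
        simp only [norm_mul (g ξ), ← Finset.mul_sum]
        exact mul_le_mul_of_nonneg_left ((hD k ξ).2 F) (norm_nonneg _))
    simpa only [tsum_mul_left] using this
  have hb : ∀ k ξ, ‖∑' l, ρ k l * weyl ξ l k‖ ≤ C := fun k ξ => by simpa using hC ξ {k}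
  have hi : ∀ k, Integrable fun ξ => g ξ * ∑' l, ρ k l * weyl ξ l k := fun k =>
    hg.mul_bdd (c := C) (h.measurable_row k).aestronglyMeasurable (ae_of_all _ (hb k))
  have := hasSum_integral_of_summable_integral_norm (F := fun k ξ => g ξ * ∑' l, ρ k l * weyl ξ l k) hi
    (summable_of_sum_le (c := (∫ ξ, ‖g ξ‖) * C) (fun _ => integral_nonneg fun _ => norm_nonneg _) fun F => by
      rw [← integral_finsetSum _ fun l _ => (hi l).norm, ← integral_mul_const]
      refine integral_mono (integrable_finsetSum _ fun l _ => (hi l).norm) (hg.norm.mul_const _) fun ξ => ?_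
      simp only [norm_mul (g ξ), ← Finset.mul_sum]
      exact mul_le_mul_of_nonneg_left (hC ξ F) (norm_nonneg _))
  simp only [tsum_mul_left] at this
  refine this.congr_fun fun k => ?_
  rw [← (hrow k).tsum_eq]
  refine tsum_congr fun l => ?_
  rw [← integral_const_mul]
  exact integral_congr_ae (ae_of_all _ fun ξ => by ring)

theorem IsTame.hasKern {n : ℕ} {ρ : FockMatrix n} (h : IsTame ρ) : HasKern ρ := by
  obtain ⟨C, hC⟩ := h.bounded
  exact hasKern_of_bounded hC

/-- Integrated against the kernel of `weyl (-ξ)`, the Weyl operators in the characteristic function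
combine to a rank one operator of exponential vectors, whose trace with `ρ` is a kernel value. This
is Weyl–Fourier inversion on the level of kernels. -/
theorem IsTame.integral_kern_mul_charFn {n : ℕ} {ρ : FockMatrix n} (h : IsTame ρ) (z w : Fin n → ℂ) :
    ∫ ξ, kern (weyl (-ξ)) z w * charFn ρ ξ = ((2 * Real.pi) ^ n : ℝ) * kern ρ z w := by
  have hg : Integrable fun ξ : Fin n × Fin 2 → ℝ => kern (weyl (-ξ)) z w :=
    (integrable_kern_weyl z w).comp_neg
  rw [← (h.hasSum_integral_mul_charFn hg).tsum_eq, kern, (h.hasKern z w).tsum_prod, ← tsum_mul_left]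
  refine tsum_congr fun k => ?_
  rw [← tsum_mul_left]
  refine tsum_congr fun l => ?_
  rw [integral_kern_weyl_mul_weyl]
  ring

/-! ### Density operators -/

open scoped ComplexOrder in
-- Gram factorisations of finite blocks let Cauchy–Schwarz arguments run without square roots of
-- infinite matrices.
theorem exists_gram {κ : Type*} {ρ : Matrix κ κ ℂ} (h : ρ.PosSemidef) (S : Finset κ) :
    ∃ (m : ℕ) (B : Fin m → κ → ℂ), ∀ k ∈ S, ∀ l ∈ S, ρ k l = ∑ b, star (B b k) * B b l := by
  classical
  have h1 := h.submatrix (Subtype.val : S → κ)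
  obtain ⟨m, v, hv⟩ := Matrix.posSemidef_iff_eq_sum_vecMulVec.1 h1
  refine ⟨m, fun b k => if hk : k ∈ S then star (v b ⟨k, hk⟩) else 0, fun k hk l hl => ?_⟩
  have := congrFun (congrFun hv ⟨k, hk⟩) ⟨l, hl⟩
  simp only [Matrix.submatrix_apply, Matrix.sum_apply, Matrix.vecMulVec_apply, Pi.star_apply] at this
  simp only [dif_pos hk, dif_pos hl, star_star]
  exact this

/-- Unitarity in the order `W W†`, obtained from `W† W = 1` at `-ξ` because the adjoint of a Weyl
operator is the Weyl operator at the opposite point. -/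
theorem hasSum_weyl_row {n : ℕ} (ξ : Fin n × Fin 2 → ℝ) (q p : Fin n → ℕ) :
    HasSum (fun k => weyl ξ q k * star (weyl ξ p k)) (if q = p then 1 else 0) := by
  have h0 : sandwich (weyl (-ξ)) 1 (weyl (-ξ)) = (1 : FockMatrix n) := by
    rw [weyl, sandwich_displacement_one]
    funext k l
    simp [displacement_zero, mul_comm]
  have e : ∀ q k, star (weyl (-ξ) k q) = weyl ξ q k := fun q k => by
    have e1 : weylAmplitude (-ξ) = -weylAmplitude ξ := by
      funext i
      simp only [weylAmplitude, Pi.neg_apply]; push_cast; ring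
    rw [weyl, star_displacement, e1, neg_neg, weyl]
  have h1 := congrFun (congrFun h0 q) p
  rw [sandwich_one] at h1
  have e' : ∀ k, weyl (-ξ) k p = star (weyl ξ p k) := fun k => by rw [← e, star_star]
  simp only [e, e'] at h1
  have hs : ∀ q, Summable fun k => ‖weyl ξ q k‖ ^ 2 := fun q => by
    have := (norm_le_one_of_sandwich_one h0 0 q).2.1
    refine this.congr fun k => ?_
    rw [← e, norm_star]
  rw [Matrix.one_apply] at h1
  rw [← h1]
  refine Summable.hasSum (Summable.of_norm_bounded ((hs q).add (hs p)) fun k => ?_)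
  rw [norm_mul, norm_star]
  nlinarith [sq_nonneg (‖weyl ξ q k‖ - ‖weyl ξ p k‖), sq_nonneg ‖weyl ξ q k‖, sq_nonneg ‖weyl ξ p k‖]

theorem hasSum_norm_weyl_row {n : ℕ} (ξ : Fin n × Fin 2 → ℝ) (S : Finset (Fin n → ℕ)) (b : (Fin n → ℕ) → ℂ) :
    HasSum (fun k => ‖∑ l ∈ S, b l * weyl ξ l k‖ ^ 2) (∑ l ∈ S, ‖b l‖ ^ 2) := by
  have h := hasSum_sum (s := S) fun q _ => hasSum_sum (s := S) fun p _ =>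
    (hasSum_weyl_row ξ q p).mul_left (b q * star (b p))
  rw [← Complex.hasSum_ofReal]
  have e2 : ∑ q ∈ S, ∑ p ∈ S, b q * star (b p) * (if q = p then (1 : ℂ) else 0) =
      ((∑ l ∈ S, ‖b l‖ ^ 2 : ℝ) : ℂ) := by
    simp only [mul_ite, mul_one, mul_zero, Finset.sum_ite_eq]
    push_cast
    refine Finset.sum_congr rfl fun q hq => ?_
    rw [if_pos hq, Complex.star_def, Complex.mul_conj']
  rw [e2] at h
  refine h.congr_fun fun k => ?_
  · rw [Complex.ofReal_pow, ← Complex.mul_conj', ← Complex.star_def, star_sum, Finset.sum_mul_sum]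
    refine Finset.sum_congr rfl fun q _ => Finset.sum_congr rfl fun p _ => ?_
    rw [star_mul']; ring

open scoped ComplexOrder in
theorem IsState.diag_re {n : ℕ} {ρ : FockMatrix n} (h : IsState ρ) (k : Fin n → ℕ) :
    0 ≤ (ρ k k).re ∧ ρ k k = ((ρ k k).re : ℂ) := by
  have := h.posSemidef.diag_nonneg (i := k)
  rw [Complex.le_def] at this
  exact ⟨this.1, Complex.ext rfl this.2.symm⟩

theorem IsState.hasSum_re {n : ℕ} {ρ : FockMatrix n} (h : IsState ρ) : HasSum (fun k => (ρ k k).re) 1 :=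
  (Complex.hasSum_re h.trace_eq_one)

theorem IsState.sum_diag_le {n : ℕ} {ρ : FockMatrix n} (h : IsState ρ) (F : Finset (Fin n → ℕ)) :
    ∑ k ∈ F, (ρ k k).re ≤ 1 := sum_le_hasSum _ (fun k _ => (h.diag_re k).1) h.hasSum_re

open scoped ComplexOrder in
theorem IsState.normSq_le {n : ℕ} {ρ : FockMatrix n} (h : IsState ρ) (k l : Fin n → ℕ) :
    ‖ρ k l‖ ^ 2 ≤ (ρ k k).re * (ρ l l).re := by
  have h1 := (h.posSemidef.submatrix ![k, l]).det_nonneg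
  have h2 : ρ l k = star (ρ k l) := (h.posSemidef.isHermitian.apply l k).symm
  rw [Matrix.det_fin_two] at h1
  simp only [Matrix.submatrix_apply, Matrix.cons_val_zero, Matrix.cons_val_one] at h1
  rw [h2, Complex.star_def, Complex.mul_conj', (h.diag_re k).2, (h.diag_re l).2] at h1
  have : ((0 : ℝ) : ℂ) ≤ (((ρ k k).re * (ρ l l).re - ‖ρ k l‖ ^ 2 : ℝ) : ℂ) := by push_cast; exact h1
  have := Complex.real_le_real.1 this
  linarith

/-- A finite form of the trace norm bound for `ρ W`. With `ρ = B† B` on the block, every term is at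
most the mean of the squared entries of `B` and of `B W`; both have total at most one, since the
rows of `W` are orthonormal. -/
theorem IsState.sum_norm_le {n : ℕ} {ρ : FockMatrix n} (h : IsState ρ) (ξ : Fin n × Fin 2 → ℝ)
    (F S : Finset (Fin n → ℕ)) : ∑ k ∈ F, ‖∑ l ∈ S, ρ k l * weyl ξ l k‖ ≤ 1 := by
  classical
  obtain ⟨m, B, hB⟩ := exists_gram h.posSemidef (F ∪ S)
  set c : Fin m → (Fin n → ℕ) → ℂ := fun b k => ∑ l ∈ S, B b l * weyl ξ l k with hc
  have hdiag : ∀ k ∈ F ∪ S, (ρ k k).re = ∑ b, ‖B b k‖ ^ 2 := fun k hk => by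
    rw [hB k hk k hk, Complex.re_sum]
    refine Finset.sum_congr rfl fun b _ => ?_
    rw [Complex.star_def, Complex.conj_mul', ← Complex.ofReal_pow, Complex.ofReal_re]
  have h1 : ∀ k ∈ F, ‖∑ l ∈ S, ρ k l * weyl ξ l k‖ ≤ ∑ b, (‖B b k‖ ^ 2 + ‖c b k‖ ^ 2) / 2 := fun k hk => by
    have : ∑ l ∈ S, ρ k l * weyl ξ l k = ∑ b, star (B b k) * c b k := by
      simp only [hc, Finset.mul_sum]
      rw [Finset.sum_comm]
      refine Finset.sum_congr rfl fun l hl => ?_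
      rw [hB k (Finset.mem_union_left _ hk) l (Finset.mem_union_right _ hl), Finset.sum_mul]
      exact Finset.sum_congr rfl fun b _ => mul_assoc _ _ _
    rw [this]
    refine (norm_sum_le _ _).trans (Finset.sum_le_sum fun b _ => ?_)
    rw [norm_mul, norm_star]
    nlinarith [sq_nonneg (‖B b k‖ - ‖c b k‖)]
  refine (Finset.sum_le_sum h1).trans ?_
  have h2 : ∑ k ∈ F, ∑ b, ‖B b k‖ ^ 2 ≤ 1 := by
    refine le_trans (le_of_eq ?_) (h.sum_diag_le F)
    exact Finset.sum_congr rfl fun k hk => (hdiag k (Finset.mem_union_left _ hk)).symm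
  have h3 : ∑ k ∈ F, ∑ b, ‖c b k‖ ^ 2 ≤ 1 := by
    rw [Finset.sum_comm]
    calc ∑ b, ∑ k ∈ F, ‖c b k‖ ^ 2 ≤ ∑ b, ∑ l ∈ S, ‖B b l‖ ^ 2 := Finset.sum_le_sum fun b _ =>
          sum_le_hasSum _ (fun _ _ => by positivity) (hasSum_norm_weyl_row ξ S (B b))
      _ = ∑ l ∈ S, (ρ l l).re := by
          rw [Finset.sum_comm]
          exact Finset.sum_congr rfl fun k hk => (hdiag k (Finset.mem_union_right _ hk)).symm
      _ ≤ 1 := h.sum_diag_le S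
  have h4 : ∑ k ∈ F, ∑ b, (‖B b k‖ ^ 2 + ‖c b k‖ ^ 2) / 2 =
      (∑ k ∈ F, ∑ b, ‖B b k‖ ^ 2 + ∑ k ∈ F, ∑ b, ‖c b k‖ ^ 2) / 2 := by
    simp only [← Finset.sum_div, Finset.sum_add_distrib]
  rw [h4]; linarith

theorem IsState.row_aux {n : ℕ} {ρ : FockMatrix n} (h : IsState ρ) (k : Fin n → ℕ) (ξ : Fin n × Fin 2 → ℝ) :
    Summable (fun l => ‖ρ k l * weyl ξ l k‖) ∧
      ∀ F : Finset (Fin n → ℕ), ∑ l ∈ F, ‖ρ k l * weyl ξ l k‖ ≤ 1 := by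
  have hle : ∀ F : Finset (Fin n → ℕ), ∑ l ∈ F, ‖ρ k l * weyl ξ l k‖ ≤ 1 := fun F => by
    have h1 : ∑ l ∈ F, ‖ρ k l‖ ^ 2 ≤ 1 := by
      refine (Finset.sum_le_sum fun l _ => h.normSq_le k l).trans ?_
      rw [← Finset.mul_sum]
      have := h.sum_diag_le {k}
      rw [Finset.sum_singleton] at this
      have h0 := Finset.sum_nonneg fun l (_ : l ∈ F) => (h.diag_re l).1
      have := h.sum_diag_le F
      nlinarith [(h.diag_re k).1]
    have h2 : ∑ l ∈ F, ‖weyl ξ l k‖ ^ 2 ≤ 1 := by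
      have e : ∀ l, ‖weyl ξ l k‖ = ‖weyl (-ξ) k l‖ := fun l => by
        have e1 : weylAmplitude (-ξ) = -weylAmplitude ξ := by
          funext i
          simp only [weylAmplitude, Pi.neg_apply]; push_cast; ring
        rw [weyl, weyl, e1, ← star_displacement, norm_star]
      have := sum_le_hasSum F (fun _ _ => by positivity) (hasSum_norm_weyl_row (-ξ) {k} fun _ => 1)
      simpa [e] using this
    calc ∑ l ∈ F, ‖ρ k l * weyl ξ l k‖ ≤ ∑ l ∈ F, (‖ρ k l‖ ^ 2 + ‖weyl ξ l k‖ ^ 2) / 2 :=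
          Finset.sum_le_sum fun l _ => by
            rw [norm_mul]; nlinarith [sq_nonneg (‖ρ k l‖ - ‖weyl ξ l k‖)]
      _ ≤ 1 := by rw [← Finset.sum_div, Finset.sum_add_distrib]; linarith
  exact ⟨summable_of_sum_le (fun _ => norm_nonneg _) hle, hle⟩

theorem IsState.sum_tsum_le {n : ℕ} {ρ : FockMatrix n} (h : IsState ρ) (ξ : Fin n × Fin 2 → ℝ)
    (F : Finset (Fin n → ℕ)) : ∑ k ∈ F, ‖∑' l, ρ k l * weyl ξ l k‖ ≤ 1 :=
  le_of_tendsto (tendsto_finsetSum F fun k _ => ((h.row_aux k ξ).1.of_norm.hasSum).norm)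
    (Filter.Eventually.of_forall fun S => h.sum_norm_le ξ F S)

theorem IsState.isTame {n : ℕ} {ρ : FockMatrix n} (h : IsState ρ) : IsTame ρ where
  bounded := ⟨1, fun k l => by
    have h1 := h.normSq_le k l
    have h2 := h.sum_diag_le {k}
    have h3 := h.sum_diag_le {l}
    rw [Finset.sum_singleton] at h2 h3
    have := (h.diag_re k).1
    have := (h.diag_re l).1
    nlinarith [norm_nonneg (ρ k l)]⟩
  row := ⟨fun _ => 1, fun k ξ => h.row_aux k ξ⟩
  sum := ⟨1, h.sum_tsum_le⟩

theorem IsState.norm_charFn_le {n : ℕ} {ρ : FockMatrix n} (h : IsState ρ) (ξ : Fin n × Fin 2 → ℝ) :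
    ‖charFn ρ ξ‖ ≤ 1 := h.isTame.norm_charFn_le (h.sum_tsum_le ξ)

/-! ### Inversion and uniqueness -/

theorem IsTame.eq_of_charFn_eq {n : ℕ} {ρ σ : FockMatrix n} (hρ : IsTame ρ) (hσ : IsTame σ)
    (h : ∀ ξ, charFn ρ ξ = charFn σ ξ) : ρ = σ := by
  refine eq_of_kern_eq hρ.hasKern hσ.hasKern fun z w => ?_
  have h1 := hρ.integral_kern_mul_charFn z w
  simp only [h] at h1
  rw [hσ.integral_kern_mul_charFn z w] at h1
  have h2 : (((2 * Real.pi) ^ n : ℝ) : ℂ) ≠ 0 := by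
    have : (2 * Real.pi) ^ n ≠ 0 := by positivity
    exact_mod_cast this
  exact (mul_left_cancel₀ h2 h1).symm

theorem IsTame.eq_integral {n : ℕ} {ρ : FockMatrix n} (h : IsTame ρ) (hi : Integrable (charFn ρ))
    (k l : Fin n → ℕ) :
    ρ k l = ((((2 * Real.pi) ^ n)⁻¹ : ℝ) : ℂ) * ∫ ξ, charFn ρ ξ * weyl (-ξ) k l := by
  have h2 : (((2 * Real.pi) ^ n : ℝ) : ℂ) ≠ 0 := by
    have : (2 * Real.pi) ^ n ≠ 0 := by positivity
    exact_mod_cast this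
  have key := eq_of_kern_eq (A := fun k l => (((2 * Real.pi) ^ n : ℝ) : ℂ) * ρ k l)
    (h.hasKern.const_mul _) (hasKern_integral_weyl hi fun ξ => -ξ) fun z w => by
      rw [kern_const_mul, kern_integral_weyl hi measurable_neg, ← h.integral_kern_mul_charFn]
      simp only [mul_comm]
  have : (((2 * Real.pi) ^ n : ℝ) : ℂ) * ρ k l = ∫ ξ, charFn ρ ξ * weyl (-ξ) k l :=
    congrFun (congrFun key k) l
  rw [← this, ← mul_assoc, Complex.ofReal_inv, inv_mul_cancel₀ h2, one_mul]

/-- On the antidiagonal `z = star w` the linear part of the exponent is purely imaginary, so these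
kernels are Fourier characters times a fixed Gaussian. -/
theorem kern_weyl_star {n : ℕ} (ξ : Fin n × Fin 2 → ℝ) (v : Fin n → ℂ) : kern (weyl (-ξ)) (star v) v =
    Complex.exp ((∑ i, ‖v i‖ ^ 2 : ℝ)) * (Complex.exp (-(1 / 4 : ℂ) * ∑ s, (ξ s : ℂ) ^ 2) *
      Complex.exp (-(Complex.I * ((ξ ⬝ᵥ meanShift v : ℝ) : ℂ)))) := by
  rw [kern_weyl]
  have h2 := sqrt_two_mul_self
  congr 1
  · congr 1
    rw [dotProduct]; push_cast
    refine Finset.sum_congr rfl fun i _ => ?_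
    rw [Pi.star_apply, Complex.star_def, Complex.conj_mul']
  · rw [← Complex.exp_add]
    congr 1
    simp only [Pi.neg_apply, Complex.ofReal_neg, neg_sq]
    congr 1
    rw [dotProduct]
    push_cast
    rw [Finset.mul_sum, ← Finset.sum_neg_distrib, Fintype.sum_prod_type, Fintype.sum_prod_type]
    refine Finset.sum_congr rfl fun i _ => ?_
    rw [Fin.sum_univ_two, Fin.sum_univ_two]
    simp only [kernCoeff, if_true, one_ne_zero, if_false, meanShift, ofComplex, Pi.smul_apply,
      smul_eq_mul, Complex.mul_re, Complex.mul_im, Complex.ofReal_re, Complex.ofReal_im, zero_mul,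
      sub_zero, add_zero, Pi.star_apply, Complex.star_def]
    have e1 := Complex.re_add_im (v i)
    have e2 : (starRingEnd ℂ) (v i) = (v i).re - (v i).im * Complex.I := by
      apply Complex.ext <;> simp
    rw [e2]
    have e3 : v i = (v i).re + (v i).im * Complex.I := e1.symm
    generalize (v i).re = a at *
    generalize (v i).im = b at *
    rw [e3]
    push_cast
    generalize ((Real.sqrt 2 : ℝ) : ℂ) = r at *
    have h0 : r ≠ 0 := fun h => by rw [h] at h2; norm_num at h2
    field_simp
    linear_combination ((ξ (i,0) : ℂ) * a * Complex.I + (ξ (i,1) : ℂ) * b * Complex.I) * h2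

theorem exists_meanShift {n : ℕ} (y : Fin n × Fin 2 → ℝ) : ∃ v : Fin n → ℂ, meanShift v = y := by
  refine ⟨((Real.sqrt 2 : ℂ)⁻¹) • toComplex y, ?_⟩
  rw [meanShift, smul_smul, mul_inv_cancel₀ sqrt_two_ne_zero, one_smul, ofComplex_toComplex]

theorem meanShift_dotProduct_self {n : ℕ} (v : Fin n → ℂ) :
    meanShift v ⬝ᵥ meanShift v = 2 * ∑ i, ‖v i‖ ^ 2 := by
  have h2 : Real.sqrt 2 * Real.sqrt 2 = 2 := Real.mul_self_sqrt (by norm_num)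
  rw [dotProduct, Fintype.sum_prod_type, Finset.mul_sum]
  refine Finset.sum_congr rfl fun i _ => ?_
  rw [Fin.sum_univ_two, ← Complex.normSq_eq_norm_sq, Complex.normSq_apply]
  simp only [meanShift, ofComplex, if_true, one_ne_zero, if_false, Pi.smul_apply, smul_eq_mul,
    Complex.mul_re, Complex.mul_im, Complex.ofReal_re, Complex.ofReal_im, zero_mul, sub_zero, add_zero]
  linear_combination ((v i).re ^ 2 + (v i).im ^ 2) * h2

/-- The vanishing entries annihilate the kernels at `(star v, v)`, which up to nonzero factors are
the Fourier transform of `F ξ * exp(-|ξ|²/4)`. It identifies characteristic functions when one side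
is only an integral over records. -/
theorem eq_zero_of_integral_weyl_eq_zero {n : ℕ} {F : (Fin n × Fin 2 → ℝ) → ℂ} (hF : Continuous F)
    (hi : Integrable F) (h : ∀ k l, ∫ ξ, F ξ * weyl (-ξ) k l = 0) : F = 0 := by
  have hk : ∀ z w, ∫ ξ, F ξ * kern (weyl (-ξ)) z w = 0 := fun z w => by
    rw [← kern_integral_weyl hi measurable_neg]
    have : (fun k l => ∫ ξ, F ξ * weyl (-ξ) k l) = (fun _ _ => 0 : FockMatrix n) := by
      funext k l; exact h k l
    rw [this]
    simp [kern]
  set G : (Fin n × Fin 2 → ℝ) → ℂ := fun ξ => Complex.exp (-(1 / 4 : ℂ) * ∑ s, (ξ s : ℂ) ^ 2) * F ξ with hG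
  have hGi : Integrable G := by
    refine hi.bdd_mul (c := 1) (Continuous.aestronglyMeasurable (by fun_prop)) (ae_of_all _ fun ξ => ?_)
    rw [Complex.norm_exp]
    refine Real.exp_le_one_iff.2 ?_
    have : -(1 / 4 : ℂ) * ∑ s, (ξ s : ℂ) ^ 2 = ((-(1 / 4) * ∑ s, ξ s ^ 2 : ℝ) : ℂ) := by push_cast; ring
    rw [this, Complex.ofReal_re]
    have : 0 ≤ ∑ s, ξ s ^ 2 := Finset.sum_nonneg fun _ _ => sq_nonneg _
    linarith
  have hG0 : G = 0 := eq_zero_of_fourier_eq_zero (by fun_prop) hGi fun y => by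
    obtain ⟨v, rfl⟩ := exists_meanShift y
    have := hk (star v) v
    simp only [kern_weyl_star] at this
    have h3 : ∀ ξ : Fin n × Fin 2 → ℝ, F ξ * (Complex.exp ((∑ i, ‖v i‖ ^ 2 : ℝ)) *
        (Complex.exp (-(1 / 4 : ℂ) * ∑ s, (ξ s : ℂ) ^ 2) *
        Complex.exp (-(Complex.I * ((ξ ⬝ᵥ meanShift v : ℝ) : ℂ))))) = Complex.exp ((∑ i, ‖v i‖ ^ 2 : ℝ)) *
        (Complex.exp (-(Complex.I * ((ξ ⬝ᵥ meanShift v : ℝ) : ℂ))) * G ξ) := fun ξ => by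
      simp only [hG]; ring
    simp only [h3] at this
    rw [integral_const_mul] at this
    exact (mul_eq_zero.1 this).resolve_left (Complex.exp_ne_zero _)
  funext ξ
  exact (mul_eq_zero.1 (congrFun hG0 ξ)).resolve_left (Complex.exp_ne_zero _)

/-! ### Gaussian integrals -/

/-- A symmetric positive definite bilinear form. -/
structure IsPosForm {E : Type*} [AddCommGroup E] [Module ℝ E] (B : LinearMap.BilinForm ℝ E) : Prop where
  symm : ∀ x y, B x y = B y x
  pos : ∀ x, x ≠ 0 → 0 < B x x

theorem IsPosForm.nonneg {E : Type*} [AddCommGroup E] [Module ℝ E] {B : LinearMap.BilinForm ℝ E}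
    (h : IsPosForm B) (x : E) : 0 ≤ B x x := by
  by_cases hx : x = 0
  · simp [hx]
  · exact (h.pos x hx).le

open scoped MatrixOrder in
theorem IsPosForm.exists_root {ι : Type*} [Fintype ι] [DecidableEq ι] {B : LinearMap.BilinForm ℝ (ι → ℝ)}
    (h : IsPosForm B) : ∃ A : Matrix ι ι ℝ, A.det ≠ 0 ∧ ∀ x, B x x = A.mulVec x ⬝ᵥ A.mulVec x := by
  set M : Matrix ι ι ℝ := LinearMap.toMatrix₂' ℝ B with hM
  have hB : ∀ x y, B x y = x ⬝ᵥ M.mulVec y := fun x y => by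
    rw [← Matrix.toLinearMap₂'_apply', hM, Matrix.toLinearMap₂'_toMatrix']
  have hsymm : M.IsHermitian := by
    ext i j
    rw [Matrix.conjTranspose_apply, star_trivial, hM, LinearMap.toMatrix₂'_apply,
      LinearMap.toMatrix₂'_apply, h.symm]
  have hpd : M.PosDef := Matrix.PosDef.of_dotProduct_mulVec_pos hsymm fun {x} hx => by
    rw [star_trivial, ← hB]; exact h.pos x hx
  obtain ⟨A, hA⟩ := CStarAlgebra.nonneg_iff_eq_star_mul_self.mp hpd.posSemidef.nonneg
  refine ⟨A, fun h0 => ?_, fun x => ?_⟩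
  · have := hpd.det_pos
    rw [hA, Matrix.det_mul, h0, mul_zero] at this
    exact lt_irrefl _ this
  · rw [hB, hA, ← Matrix.mulVec_mulVec, Matrix.dotProduct_mulVec, Matrix.star_eq_conjTranspose,
      Matrix.vecMul_conjTranspose, star_trivial, star_trivial]

theorem integrable_comp_mulVec {ι : Type*} [Fintype ι] [DecidableEq ι] {A : Matrix ι ι ℝ} (hA : A.det ≠ 0)
    {f : (ι → ℝ) → ℂ} (hf : Continuous f) (hi : Integrable f) :
    Integrable (fun x => f (A.mulVec x)) ∧
      ∫ x, f (A.mulVec x) = ((|A.det|⁻¹ : ℝ) : ℂ) * ∫ x, f x := by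
  have hmap := Real.map_matrix_volume_pi_eq_smul_volume_pi hA
  have hm : Measurable (Matrix.toLin' A) := (LinearMap.continuous_of_finiteDimensional _).measurable
  have hi' : Integrable f (Measure.map (Matrix.toLin' A) volume) := by
    rw [hmap]; exact hi.smul_measure ENNReal.ofReal_ne_top
  constructor
  · exact (integrable_map_measure hf.aestronglyMeasurable hm.aemeasurable).1 hi'
  · have := integral_map (μ := volume) hm.aemeasurable (f := f) hf.aestronglyMeasurable
    rw [hmap, integral_smul_measure, ENNReal.toReal_ofReal (abs_nonneg _), abs_inv,
      Complex.real_smul] at this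
    exact this.symm

/-- A root of `B` reduces the integral to the standard Gaussian; the matrix in the conclusion is the
inverse transpose of that root. -/
theorem IsPosForm.integral_exp {ι : Type*} [Fintype ι] [DecidableEq ι] {B : LinearMap.BilinForm ℝ (ι → ℝ)}
    (h : IsPosForm B) : Integrable (fun η => Complex.exp (-((B η η : ℝ) : ℂ) / 2)) ∧
      ∃ (C : ℝ) (A : Matrix ι ι ℝ), 0 < C ∧ A.det ≠ 0 ∧ ∀ x : ι → ℝ,
        ∫ η, Complex.exp (Complex.I * ((η ⬝ᵥ x : ℝ) : ℂ) - ((B η η : ℝ) : ℂ) / 2) =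
          ((C * Real.exp (-(A.mulVec x ⬝ᵥ A.mulVec x) / 2) : ℝ) : ℂ) := by
  obtain ⟨A, hA, hB⟩ := h.exists_root
  set f : (ι → ℝ) → (ι → ℝ) → ℂ := fun y s =>
    Complex.exp (-(1 / 2 : ℂ) * ∑ i, (s i : ℂ) ^ 2 + ∑ i, Complex.I * y i * s i) with hf
  have hfc : ∀ y, Continuous (f y) := fun y => by fun_prop
  have hfi : ∀ y, Integrable (f y) := fun y => integrable_gaussian_linear (by norm_num) _
  have hfv : ∀ y, ∫ s, f y s = ((2 * Real.pi) ^ ((Fintype.card ι : ℝ) / 2) * Real.exp (-(y ⬝ᵥ y) / 2) : ℝ) := fun y => by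
    simp only [hf]
    rw [GaussianFourier.integral_cexp_neg_mul_sum_add (by norm_num)]
    push_cast
    congr 1
    · rw [Complex.ofReal_cpow (by positivity)]
      push_cast
      congr 1; field_simp
    · congr 1
      simp only [mul_pow, Complex.I_sq, dotProduct]
      push_cast
      simp only [neg_mul, one_mul, Finset.sum_neg_distrib, sq]
      ring
  have e : ∀ y η : ι → ℝ, f y (A.mulVec η) =
      Complex.exp (Complex.I * ((η ⬝ᵥ A.transpose.mulVec y : ℝ) : ℂ) - ((B η η : ℝ) : ℂ) / 2) := fun y η => by
    simp only [hf]
    congr 1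
    have e1 : η ⬝ᵥ A.transpose.mulVec y = A.mulVec η ⬝ᵥ y := by
      rw [Matrix.dotProduct_mulVec, Matrix.vecMul_transpose]
    rw [e1, hB, dotProduct, dotProduct]
    push_cast
    rw [Finset.mul_sum, Finset.mul_sum, Finset.sum_div, ← Finset.sum_sub_distrib,
      ← Finset.sum_add_distrib]
    exact Finset.sum_congr rfl fun i _ => by ring
  constructor
  · have := (integrable_comp_mulVec hA (hfc 0) (hfi 0)).1
    simp only [e] at this
    refine this.congr (ae_of_all _ fun η => ?_)
    simp [neg_div]
  · have hAt : IsUnit A.transpose.det := by rw [Matrix.det_transpose]; exact hA.isUnit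
    refine ⟨|A.det|⁻¹ * (2 * Real.pi) ^ ((Fintype.card ι : ℝ) / 2), A.transpose⁻¹, by positivity, ?_, fun x => ?_⟩
    · rw [Matrix.det_nonsing_inv]
      exact (hAt.ringInverse).ne_zero
    · have := (integrable_comp_mulVec hA (hfc (A.transpose⁻¹.mulVec x)) (hfi _)).2
      simp only [e, Matrix.mulVec_mulVec, Matrix.mul_nonsing_inv _ hAt, Matrix.one_mulVec] at this
      rw [this, hfv, mul_assoc]; push_cast; ring

theorem exists_le_mulVec {ι : Type*} [Fintype ι] [DecidableEq ι] {A : Matrix ι ι ℝ} (hA : A.det ≠ 0) :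
    ∃ ε : ℝ, 0 < ε ∧ ∀ x, ε * (x ⬝ᵥ x) ≤ A.mulVec x ⬝ᵥ A.mulVec x := by
  set K := ∑ i, ∑ j, (A⁻¹ i j) ^ 2 with hK
  have hK0 : 0 ≤ K := Finset.sum_nonneg fun _ _ => Finset.sum_nonneg fun _ _ => sq_nonneg _
  have hb : ∀ y : ι → ℝ, A⁻¹.mulVec y ⬝ᵥ A⁻¹.mulVec y ≤ K * (y ⬝ᵥ y) := fun y => by
    simp only [dotProduct, hK, Matrix.mulVec, ← sq]
    rw [Finset.sum_mul]
    exact Finset.sum_le_sum fun i _ => Finset.sum_mul_sq_le_sq_mul_sq _ _ _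
  refine ⟨(K + 1)⁻¹, by positivity, fun x => ?_⟩
  have := hb (A.mulVec x)
  rw [Matrix.mulVec_mulVec, Matrix.nonsing_inv_mul _ hA.isUnit, Matrix.one_mulVec] at this
  rw [inv_mul_le_iff₀ (by positivity)]
  have h0 : 0 ≤ A.mulVec x ⬝ᵥ A.mulVec x := Finset.sum_nonneg fun _ _ => mul_self_nonneg _
  nlinarith

/-! ### Gaussian states have geometrically decaying matrix elements -/

/-- The quotient `exp(a t) / t^k` is smallest at `t = k / a`. Stirling's formula then leaves `a^k`
times a factor of order `√k`, which is absorbed by passing from `a` to `b`. -/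
theorem exists_factorial_mul_exp_le {a b : ℝ} (ha : 0 < a) (hab : a < b) :
    ∃ C : ℝ, 0 < C ∧ ∀ k : ℕ, ∃ t : ℝ, 0 < t ∧ k.factorial * Real.exp (a * t) ≤ C * b ^ k * t ^ k := by
  have hr : 0 < b / a - 1 := by rw [sub_pos, one_lt_div ha]; exact hab
  set s := Stirling.stirlingSeq 1
  have hs : 0 < s := Stirling.stirlingSeq'_pos 0
  refine ⟨s * 2 / (b / a - 1) + Real.exp a, by positivity, fun k => ?_⟩
  cases k with
  | zero => exact ⟨1, one_pos, by simp; positivity⟩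
  | succ k =>
    refine ⟨(k + 1 : ℕ) / a, by positivity, ?_⟩
    have h1 : Stirling.stirlingSeq (k + 1) ≤ s := Stirling.stirlingSeq'_antitone (Nat.zero_le k)
    have hk : (0 : ℝ) < (k + 1 : ℕ) := by positivity
    rw [Stirling.stirlingSeq, div_le_iff₀ (by positivity), div_pow, ← Real.exp_nat_mul, mul_one] at h1
    have h2 : Real.sqrt (2 * (k + 1 : ℕ)) ≤ 2 * (k + 1 : ℕ) := by
      rw [Real.sqrt_le_left (by positivity)]
      have : (1 : ℝ) ≤ (k + 1 : ℕ) := by exact_mod_cast Nat.succ_le_succ (Nat.zero_le k)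
      nlinarith
    have h3 : ((k + 1 : ℕ) : ℝ) * (b / a - 1) ≤ (b / a) ^ (k + 1) := by
      have := one_add_mul_le_pow (a := b / a - 1) (by linarith) (k + 1)
      rw [add_sub_cancel] at this
      linarith
    have h4 : ((k + 1 : ℕ) : ℝ) ≤ (b / a) ^ (k + 1) / (b / a - 1) := by rwa [le_div_iff₀ hr]
    have he : a * (((k + 1 : ℕ) : ℝ) / a) = (k + 1 : ℕ) := by field_simp
    rw [he]
    generalize ((k + 1 : ℕ) : ℝ) = N at *
    have hb : 0 < b := ha.trans hab
    calc ((k + 1).factorial : ℝ) * Real.exp N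
        ≤ s * (Real.sqrt (2 * N) * (N ^ (k + 1) / Real.exp N)) * Real.exp N := by gcongr
      _ = s * Real.sqrt (2 * N) * N ^ (k + 1) := by field_simp
      _ ≤ s * (2 * ((b / a) ^ (k + 1) / (b / a - 1))) * N ^ (k + 1) := by
          gcongr; exact h2.trans (by linarith)
      _ = s * 2 / (b / a - 1) * b ^ (k + 1) * (N / a) ^ (k + 1) := by
          rw [div_pow, div_pow]; ring
      _ ≤ _ := by gcongr; linarith [Real.exp_pos a]

/-- Cauchy's estimate: averaging `kern ρ (star v) v` over the phases of `v` leaves the series of the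
diagonal entries, whose terms are nonnegative, and one of them is kept. -/
theorem IsState.diag_mul_le {n : ℕ} {ρ : FockMatrix n} (h : IsState ρ) {r : Fin n → ℝ} (hr : ∀ i, 0 ≤ r i)
    {C : ℝ} (hC : ∀ v : Fin n → ℂ, (∀ i, ‖v i‖ = r i) → ‖kern ρ (star v) v‖ ≤ C) (k : Fin n → ℕ) :
    (ρ k k).re * (expVecR r k * expVecR r k) ≤ C := by
  set c : (Fin n → ℕ) × (Fin n → ℕ) → ℂ := fun p => expVecR r p.1 * ρ p.1 p.2 * expVecR r p.2 with hc
  have hcs : Summable c := by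
    have := h.isTame.hasKern (fun i => (r i : ℂ)) (fun i => (r i : ℂ))
    refine this.congr fun p => ?_
    simp only [hc, expVec, expVecR]
    push_cast
    rfl
  have hT := hasSum_torusMeasure c (fun p i => (p.2 i : ℤ) - p.1 i) hcs
  set v : (Fin n → ℝ) → Fin n → ℂ := fun θ i => r i * Complex.exp (Complex.I * θ i) with hv
  have hve : ∀ θ k, expVec (v θ) k = expVecR r k * ∏ i, Complex.exp (Complex.I * (k i : ℤ) * θ i) := fun θ k => by
    simp only [expVec, expVecR, hv]
    push_cast
    rw [← Finset.prod_mul_distrib]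
    refine Finset.prod_congr rfl fun i _ => ?_
    rw [mul_pow, ← Complex.exp_nat_mul, show (k i : ℂ) * (Complex.I * θ i) = Complex.I * k i * θ i by ring]
    ring
  have hve' : ∀ θ k, expVec (star (v θ)) k =
      expVecR r k * ∏ i, Complex.exp (-(Complex.I * (k i : ℤ) * θ i)) := fun θ k => by
    rw [← star_expVec, hve, star_mul', star_prod, Complex.star_def, Complex.conj_ofReal]
    congr 1
    refine Finset.prod_congr rfl fun i _ => ?_
    rw [← Complex.exp_conj]
    simp
  have hk : ∀ θ, ∑' j, c j * ∏ i, Complex.exp (Complex.I * ((j.2 i : ℤ) - j.1 i : ℤ) * θ i) =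
      kern ρ (star (v θ)) (v θ) := fun θ => by
    rw [kern]
    refine tsum_congr fun p => ?_
    rw [hve, hve']
    have : ∀ i, Complex.exp (Complex.I * ((p.2 i : ℤ) - p.1 i : ℤ) * θ i) =
        Complex.exp (-(Complex.I * (p.1 i : ℤ) * θ i)) * Complex.exp (Complex.I * (p.2 i : ℤ) * θ i) := fun i => by
      rw [← Complex.exp_add]; congr 1; push_cast; ring
    simp only [this, Finset.prod_mul_distrib, hc]
    ring
  simp only [hk] at hT
  have hnorm : ‖∫ θ, kern ρ (star (v θ)) (v θ) ∂torusMeasure n‖ ≤ C := by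
    have := norm_integral_le_of_norm_le_const (μ := torusMeasure n) (C := C)
      (f := fun θ => kern ρ (star (v θ)) (v θ)) (ae_of_all _ fun θ => hC _ fun i => by
        simp only [hv, norm_mul, Complex.norm_exp]
        simp [abs_of_nonneg (hr i)])
    simpa using this
  have hre := Complex.hasSum_re hT
  have hpos : ∀ p : (Fin n → ℕ) × (Fin n → ℕ),
      0 ≤ (if (fun i => (p.2 i : ℤ) - p.1 i) = 0 then c p else 0).re := fun p => by
    split_ifs with hp
    · have : p.1 = p.2 := by
        funext i
        have := congrFun hp i
        simp only [Pi.zero_apply] at this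
        omega
      simp only [hc, this, Complex.re_mul_ofReal, Complex.re_ofReal_mul]
      have := (h.diag_re p.2).1
      have := expVecR_nonneg hr p.2
      positivity
    · simp
  have hle := le_hasSum hre (k, k) fun p _ => hpos p
  have hle2 := hle.trans ((Complex.re_le_norm _).trans hnorm)
  have : (fun i => ((k, k).2 i : ℤ) - (k, k).1 i) = (0 : Fin n → ℤ) := by funext i; simp
  rw [if_pos this] at hle2
  simp only [hc, Complex.re_mul_ofReal, Complex.re_ofReal_mul] at hle2
  linarith

/-- Growth rate `a < 1` in the exponent means decay. Radii chosen separately for each `k` by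
`exists_factorial_mul_exp_le` give diagonal entries of order `b^deg k`; positivity bounds the other
entries by geometric means, hence the rate `√b`. -/
theorem IsState.isGeo_of_kern_le {n : ℕ} {ρ : FockMatrix n} (h : IsState ρ) {C a : ℝ} (ha : 0 < a) (ha1 : a < 1)
    (hC : ∀ v : Fin n → ℂ, ‖kern ρ (star v) v‖ ≤ C * Real.exp (a * ∑ i, ‖v i‖ ^ 2)) : IsGeo ρ := by
  obtain ⟨b, hab, hb1⟩ := exists_between ha1
  have hb : 0 < b := ha.trans hab
  obtain ⟨K, hK, hKt⟩ := exists_factorial_mul_exp_le ha hab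
  choose t ht0 ht using hKt
  have hC0 : 0 ≤ C := by
    have := (norm_nonneg _).trans (hC 0)
    simpa using this
  have hdiag : ∀ k, (ρ k k).re ≤ C * K ^ n * b ^ deg k := fun k => by
    have h1 := h.diag_mul_le (r := fun i => Real.sqrt (t (k i))) (fun i => Real.sqrt_nonneg _)
      (C := C * Real.exp (a * ∑ i, t (k i))) (fun v hv => (hC v).trans (le_of_eq (by
        simp only [hv, Real.sq_sqrt (ht0 _).le]))) k
    have e1 : expVecR (fun i => Real.sqrt (t (k i))) k * expVecR (fun i => Real.sqrt (t (k i))) k =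
        ∏ i, t (k i) ^ k i / (k i).factorial := by
      rw [expVecR, ← Finset.prod_mul_distrib]
      refine Finset.prod_congr rfl fun i _ => ?_
      rw [div_mul_div_comm, ← mul_pow, Real.mul_self_sqrt (ht0 _).le, Real.mul_self_sqrt (by positivity)]
    have e2 : Real.exp (a * ∑ i, t (k i)) = ∏ i, Real.exp (a * t (k i)) := by
      rw [Finset.mul_sum, Real.exp_sum]
    have h2 : ∏ i, Real.exp (a * t (k i)) ≤ ∏ i, (K * b ^ k i) * (t (k i) ^ k i / (k i).factorial) :=
      Finset.prod_le_prod (fun i _ => (Real.exp_pos _).le) fun i _ => by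
        rw [← mul_div_assoc, le_div_iff₀ (by positivity), mul_comm]
        exact ht (k i)
    rw [Finset.prod_mul_distrib, Finset.prod_mul_distrib, Finset.prod_const, Finset.card_univ,
      Fintype.card_fin, Finset.prod_pow_eq_pow_sum] at h2
    rw [e1, e2] at h1
    have hpos : 0 < ∏ i, t (k i) ^ k i / ((k i).factorial : ℝ) :=
      Finset.prod_pos fun i _ => div_pos (pow_pos (ht0 _) _) (by positivity)
    have h3 := h1.trans (mul_le_mul_of_nonneg_left h2 hC0)
    have h4 : (ρ k k).re * ∏ i, t (k i) ^ k i / ((k i).factorial : ℝ) ≤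
        (C * K ^ n * b ^ deg k) * ∏ i, t (k i) ^ k i / ((k i).factorial : ℝ) := by
      rw [deg]; linarith
    exact le_of_mul_le_mul_right h4 hpos
  refine ⟨C * K ^ n, Real.sqrt b, by positivity, Real.sqrt_pos.2 hb,
    by rw [Real.sqrt_lt' one_pos]; simpa using hb1, fun k l => ?_⟩
  refine le_of_sq_le_sq ?_ (by positivity)
  refine (h.normSq_le k l).trans ?_
  calc (ρ k k).re * (ρ l l).re ≤ (C * K ^ n * b ^ deg k) * (C * K ^ n * b ^ deg l) :=
        mul_le_mul (hdiag k) (hdiag l) (h.diag_re l).1 (by positivity)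
    _ = _ := by
        have e : ∀ j : ℕ, Real.sqrt b ^ j * Real.sqrt b ^ j = b ^ j := fun j => by
          rw [← mul_pow, Real.mul_self_sqrt hb.le]
        rw [← e, ← e]
        ring

/-! ### Covariance forms -/

/-- The bilinear form of a matrix. -/
abbrev covForm {ι : Type*} [Fintype ι] [DecidableEq ι] (V : Matrix ι ι ℝ) : LinearMap.BilinForm ℝ (ι → ℝ) :=
  Matrix.toLinearMap₂' ℝ V

theorem covForm_apply {ι : Type*} [Fintype ι] [DecidableEq ι] (V : Matrix ι ι ℝ) (x y : ι → ℝ) :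
    covForm V x y = x ⬝ᵥ V.mulVec y := Matrix.toLinearMap₂'_apply' _ _ _

theorem covForm_symm {ι : Type*} [Fintype ι] [DecidableEq ι] {V : Matrix ι ι ℝ} (h : V.IsSymm) (x y : ι → ℝ) :
    covForm V x y = covForm V y x := by
  rw [covForm_apply, covForm_apply, Matrix.dotProduct_mulVec, dotProduct_comm, ← Matrix.mulVec_transpose, h.eq]

theorem dotProduct_self_nonneg' {ι : Type*} [Fintype ι] (x : ι → ℝ) : 0 ≤ x ⬝ᵥ x :=
  Finset.sum_nonneg fun _ _ => mul_self_nonneg _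

theorem dotProduct_self_pos {ι : Type*} [Fintype ι] {x : ι → ℝ} (hx : x ≠ 0) : 0 < x ⬝ᵥ x :=
  lt_of_le_of_ne (dotProduct_self_nonneg' x) fun h => hx (dotProduct_self_eq_zero.1 h.symm)

theorem norm_exp_gaussian (a b : ℝ) : ‖Complex.exp (Complex.I * (a : ℂ) - (b : ℂ) / 2)‖ = Real.exp (-b / 2) := by
  rw [Complex.norm_exp]
  congr 1
  simp [neg_div]

/-- A characteristic function of a state has modulus at most one. Strict positivity has to wait for
the uncertainty relation, whose proof uses the geometric decay. -/
theorem IsGaussian.covForm_nonneg {n : ℕ} {ρ : FockMatrix n} {d V} (h : IsGaussian ρ d V)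
    (ξ : Fin n × Fin 2 → ℝ) : 0 ≤ covForm V ξ ξ := by
  have h1 := h.isState.norm_charFn_le ξ
  rw [h.charFn_eq, norm_exp_gaussian, Real.exp_le_one_iff] at h1
  rw [covForm_apply]
  linarith

theorem IsGaussian.isGeo {n : ℕ} {ρ : FockMatrix n} {d V} (h : IsGaussian ρ d V) : IsGeo ρ := by
  classical
  -- The kernel of the Weyl operator contributes the multiple `1/2` of the Euclidean form, which
  -- makes `Q` definite although `covForm V` is so far only known to be nonnegative.
  set Q : LinearMap.BilinForm ℝ (Fin n × Fin 2 → ℝ) := covForm V + (1 / 2 : ℝ) • covForm 1 with hQ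
  have hQa : ∀ x y, Q x y = covForm V x y + 1 / 2 * (x ⬝ᵥ y) := fun x y => by
    simp only [hQ, LinearMap.add_apply, LinearMap.smul_apply, covForm_apply 1, Matrix.one_mulVec, smul_eq_mul]
  have hQp : IsPosForm Q := ⟨fun x y => by rw [hQa, hQa, covForm_symm h.symm, dotProduct_comm], fun x hx => by
    have := h.covForm_nonneg x
    have := dotProduct_self_pos hx
    rw [hQa]; linarith⟩
  obtain ⟨-, C, A, hC, hA, hint⟩ := hQp.integral_exp
  obtain ⟨ε, hε, hεA⟩ := exists_le_mulVec hA
  have hkern : ∀ v : Fin n → ℂ, ‖kern ρ (star v) v‖ ≤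
      C * Real.exp (ε / 2 * (d ⬝ᵥ d)) * Real.exp ((1 - ε / 2) * ∑ i, ‖v i‖ ^ 2) := fun v => by
    have h1 := h.isState.isTame.integral_kern_mul_charFn (star v) v
    have e : ∀ ξ, kern (weyl (-ξ)) (star v) v * charFn ρ ξ = Complex.exp ((∑ i, ‖v i‖ ^ 2 : ℝ)) *
        Complex.exp (Complex.I * ((ξ ⬝ᵥ (d - meanShift v) : ℝ) : ℂ) - ((Q ξ ξ : ℝ) : ℂ) / 2) := fun ξ => by
      rw [kern_weyl_star, h.charFn_eq, mul_assoc, ← Complex.exp_add, ← Complex.exp_add, hQa, covForm_apply,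
        dotProduct_sub]
      congr 2
      have : ξ ⬝ᵥ ξ = ∑ s, ξ s ^ 2 := by simp only [dotProduct, sq]
      rw [this]
      push_cast
      ring
    simp only [e] at h1
    rw [integral_const_mul, hint] at h1
    have h2 : (1 : ℝ) ≤ (2 * Real.pi) ^ n := one_le_pow₀ (by linarith [Real.pi_gt_three])
    have h3 := congrArg norm h1
    rw [norm_mul, norm_mul, Complex.norm_real, Complex.norm_real, Complex.norm_exp, Complex.ofReal_re,
      Real.norm_of_nonneg (by positivity), Real.norm_of_nonneg (by positivity)] at h3
    have h4 : ‖kern ρ (star v) v‖ ≤ (2 * Real.pi) ^ n * ‖kern ρ (star v) v‖ :=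
      le_mul_of_one_le_left (norm_nonneg _) h2
    rw [← h3] at h4
    refine h4.trans ?_
    rw [mul_left_comm, mul_assoc, ← Real.exp_add, ← Real.exp_add]
    refine mul_le_mul_of_nonneg_left (Real.exp_le_exp.2 ?_) hC.le
    have h5 := hεA (d - meanShift v)
    have h6 := meanShift_dotProduct_self v
    have h7 : meanShift v ⬝ᵥ meanShift v ≤ 2 * ((d - meanShift v) ⬝ᵥ (d - meanShift v)) + 2 * (d ⬝ᵥ d) := by
      have := dotProduct_self_nonneg' (d + (d - meanShift v))
      simp only [dotProduct_add, dotProduct_sub, add_dotProduct, sub_dotProduct] at this ⊢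
      have := dotProduct_comm d (meanShift v)
      linarith
    -- Definiteness of the dual form buys the fraction `ε / 2` of the exponent `∑ ‖v i‖²`, at the
    -- price of a constant depending on the mean `d`.
    have h8 : ε * (∑ i, ‖v i‖ ^ 2) ≤ ε * ((d - meanShift v) ⬝ᵥ (d - meanShift v) + d ⬝ᵥ d) :=
      mul_le_mul_of_nonneg_left (by linarith) hε.le
    linarith
  -- The maximum with `1/2` keeps the rate positive when `ε` is large.
  have ha1 : max (1 - ε / 2) (1 / 2) < 1 := max_lt (by linarith) (by norm_num)
  refine h.isState.isGeo_of_kern_le (C := C * Real.exp (ε / 2 * (d ⬝ᵥ d)))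
    (a := max (1 - ε / 2) (1 / 2)) (lt_max_of_lt_right (by norm_num)) ha1
    fun v => (hkern v).trans ?_
  refine mul_le_mul_of_nonneg_left (Real.exp_le_exp.2 ?_) (by positivity)
  exact mul_le_mul_of_nonneg_right (le_max_left _ _) (Finset.sum_nonneg fun _ _ => by positivity)

/-! ### Positivity -/

theorem IsGeoOp.const_mul {n : ℕ} {A : FockMatrix n} (hA : IsGeoOp A) (c : ℂ) :
    IsGeoOp (fun k l => c * A k l) := fun R h0 h1 => by
  obtain ⟨C, R', hC, hR0, hR1, h⟩ := hA R h0 h1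
  refine ⟨‖c‖ * C, R', by positivity, hR0, hR1, fun k => ?_⟩
  simp only [norm_mul, mul_assoc, tsum_mul_left]
  exact ⟨(h k).1.mul_left _, mul_le_mul_of_nonneg_left (h k).2 (norm_nonneg _)⟩

theorem IsGeoOp.add {n : ℕ} {A B : FockMatrix n} (hA : IsGeoOp A) (hB : IsGeoOp B) :
    IsGeoOp (fun k l => A k l + B k l) := fun R h0 h1 => by
  obtain ⟨C, S, hC, hS0, hS1, h⟩ := hA R h0 h1
  obtain ⟨D, T, hD, hT0, hT1, h'⟩ := hB R h0 h1
  refine ⟨C + D, max S T, by positivity, lt_max_of_lt_left hS0, max_lt hS1 hT1, fun k => ?_⟩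
  have hle : ∀ l, ‖A k l + B k l‖ * R ^ deg l ≤ ‖A k l‖ * R ^ deg l + ‖B k l‖ * R ^ deg l := fun l => by
    rw [← add_mul]; gcongr; exact norm_add_le _ _
  have hs := (h k).1.add (h' k).1
  have hs' : Summable fun l => ‖A k l + B k l‖ * R ^ deg l :=
    Summable.of_nonneg_of_le (fun _ => by positivity) hle hs
  refine ⟨hs', (hs'.tsum_le_tsum hle hs).trans ?_⟩
  rw [(h k).1.tsum_add (h' k).1, add_mul]
  refine add_le_add ((h k).2.trans ?_) ((h' k).2.trans ?_)
  · gcongr; exact le_max_left _ _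
  · gcongr; exact le_max_right _ _

theorem isGeoOp_zero {n : ℕ} : IsGeoOp (fun _ _ => 0 : FockMatrix n) := fun R h0 h1 =>
  ⟨0, R, le_rfl, h0, h1, fun k => by simp⟩

theorem IsGeoOp.sum {n : ℕ} {κ : Type*} (s : Finset κ) {A : κ → FockMatrix n} (hA : ∀ i, IsGeoOp (A i)) :
    IsGeoOp (fun k l => ∑ i ∈ s, A i k l) := by
  classical
  induction s using Finset.induction_on with
  | empty => simpa using isGeoOp_zero
  | insert i s hi ih =>
    simp only [Finset.sum_insert hi]
    exact (hA i).add ih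

open scoped ComplexOrder in
theorem posSemidef_of_gram {κ : Type*} {ρ : Matrix κ κ ℂ}
    (h : ∀ S : Finset κ, ∃ (m : ℕ) (B : Fin m → κ → ℂ), ∀ k ∈ S, ∀ l ∈ S, ρ k l = ∑ b, star (B b k) * B b l) :
    ρ.PosSemidef := by
  classical
  refine ⟨?_, fun x => ?_⟩
  · ext k l
    obtain ⟨m, B, hB⟩ := h {k, l}
    rw [Matrix.conjTranspose_apply, hB l (by simp) k (by simp), hB k (by simp) l (by simp), star_sum]
    exact Finset.sum_congr rfl fun b _ => by rw [star_mul', star_star, mul_comm]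
  · obtain ⟨m, B, hB⟩ := h x.support
    have : (x.sum fun i xi => x.sum fun j xj => star xi * ρ i j * xj) =
        ∑ b, star (∑ i ∈ x.support, B b i * x i) * ∑ i ∈ x.support, B b i * x i := by
      simp only [Finsupp.sum, star_sum, Finset.sum_mul_sum]
      conv_rhs => rw [Finset.sum_comm]
      refine Finset.sum_congr rfl fun i hi => ?_
      conv_rhs => rw [Finset.sum_comm]
      refine Finset.sum_congr rfl fun j hj => ?_
      rw [hB i hi j hj, Finset.mul_sum, Finset.sum_mul]
      refine Finset.sum_congr rfl fun b _ => ?_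
      rw [star_mul']; ring
    rw [this]
    exact Finset.sum_nonneg fun b _ => star_mul_self_nonneg _

open scoped ComplexOrder in
theorem posSemidef_of_tendsto {κ ι : Type*} {l : Filter ι} [l.NeBot] {M : ι → Matrix κ κ ℂ} {ρ : Matrix κ κ ℂ}
    (hM : ∀ i, (M i).PosSemidef) (h : ∀ a b, Filter.Tendsto (fun i => M i a b) l (nhds (ρ a b))) :
    ρ.PosSemidef := by
  refine ⟨?_, fun x => ?_⟩
  · ext a b
    refine tendsto_nhds_unique ((continuous_star.tendsto _).comp (h b a)) ((h a b).congr fun i => ?_)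
    exact ((hM i).1.apply a b).symm
  · refine ge_of_tendsto' (f := fun i => x.sum fun a xa => x.sum fun b xb => star xa * M i a b * xb)
      (x := l) ?_ fun i => (hM i).2 x
    exact tendsto_finsetSum _ fun a _ => tendsto_finsetSum _ fun b _ =>
      ((h a b).const_mul _).mul_const _

open scoped ComplexOrder in
theorem posSemidef_conjBy {n : ℕ} {A ρ : FockMatrix n} (hA : IsGeoOp A) (h : IsGeo ρ) (hρ : ρ.PosSemidef) :
    (conjBy A ρ).PosSemidef := by
  classical
  refine posSemidef_of_tendsto (l := (Filter.atTop : Filter (Finset (Fin n → ℕ))))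
    (M := fun S k l => ∑ p ∈ S ×ˢ S, A k p.1 * ρ p.1 p.2 * star (A l p.2)) (fun S => ?_) fun k l => ?_
  · refine posSemidef_of_gram fun T => ?_
    obtain ⟨m, B, hB⟩ := exists_gram hρ S
    refine ⟨m, fun b k => ∑ p ∈ S, B b p * star (A k p), fun k _ l _ => ?_⟩
    simp only [star_sum, Finset.sum_mul_sum]
    conv_rhs => rw [Finset.sum_comm]
    rw [Finset.sum_product]
    refine Finset.sum_congr rfl fun p hp => ?_
    conv_rhs => rw [Finset.sum_comm]
    refine Finset.sum_congr rfl fun q hq => ?_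
    rw [hB p hp q hq, Finset.mul_sum, Finset.sum_mul]
    refine Finset.sum_congr rfl fun b _ => ?_
    rw [star_mul', star_star]; ring
  · obtain ⟨C1, R, hC1, h0, h1, h⟩ := h
    obtain ⟨C2, S, hC2, hS0, hS1, h2⟩ := hA R h0 h1
    have hs : Summable fun p : (Fin n → ℕ) × (Fin n → ℕ) => A k p.1 * ρ p.1 p.2 * star (A l p.2) := by
      have : Summable fun p : (Fin n → ℕ) × (Fin n → ℕ) =>
          C1 * ((‖A k p.1‖ * R ^ deg p.1) * (‖A l p.2‖ * R ^ deg p.2)) :=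
        (hasSum_mul_of_summable_norm (f := fun p => ‖A k p‖ * R ^ deg p)
          (g := fun p => ‖A l p‖ * R ^ deg p) (h2 k).1.hasSum (h2 l).1.hasSum (h2 k).1.norm
          (h2 l).1.norm).summable.mul_left C1
      refine Summable.of_norm_bounded this fun p => ?_
      rw [norm_mul, norm_mul, norm_star]
      calc _ ≤ ‖A k p.1‖ * (C1 * (R ^ deg p.1 * R ^ deg p.2)) * ‖A l p.2‖ := by
            gcongr
            exact h _ _
        _ = _ := by ring
    have hS : Filter.Tendsto (fun S : Finset (Fin n → ℕ) => S ×ˢ S) Filter.atTop Filter.atTop :=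
      Filter.tendsto_atTop.2 fun T => by
        filter_upwards [Filter.eventually_ge_atTop (T.image Prod.fst ∪ T.image Prod.snd)] with S hS p hp
        exact Finset.mem_product.2 ⟨hS (Finset.mem_union_left _ (Finset.mem_image_of_mem _ hp)),
          hS (Finset.mem_union_right _ (Finset.mem_image_of_mem _ hp))⟩
    have ht := hs.hasSum
    rw [HasSum, SummationFilter.unconditional_filter] at ht
    exact ht.comp hS

theorem trMul_one {n : ℕ} (ρ : FockMatrix n) : trMul ρ 1 = ∑' k, ρ k k := by
  have hi : Function.Injective fun k : Fin n → ℕ => (k, k) := fun a b h => (Prod.ext_iff.1 h).1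
  rw [trMul, ← hi.tsum_eq (f := fun p => ρ p.1 p.2 * (1 : FockMatrix n) p.2 p.1)]
  · simp
  · rintro ⟨a, b⟩ hab
    simp only [Function.mem_support, Matrix.one_apply] at hab
    split_ifs at hab with h
    · exact ⟨a, by rw [h]⟩
    · simp at hab

theorem IsGeo.summable_diag {n : ℕ} {ρ : FockMatrix n} (h : IsGeo ρ) : Summable fun k => ρ k k :=
  h.summable_norm.of_norm.comp_injective (i := fun k => (k, k)) fun _ _ h => (Prod.ext_iff.1 h).1

theorem IsState.conjBy {n : ℕ} {A ρ : FockMatrix n} (hA : IsGeoOp A) (h1 : sandwich A 1 A = 1) (h : IsGeo ρ)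
    (hρ : IsState ρ) : IsState (conjBy A ρ) where
  posSemidef := posSemidef_conjBy hA h hρ.posSemidef
  trace_eq_one := by
    have := trMul_conjBy hA h norm_one_le
    rw [h1, trMul_one, trMul_one, hρ.trace_eq_one.tsum_eq] at this
    rw [← this]
    exact (h.conjBy hA).summable_diag.hasSum

/-! ### Weyl relations and the uncertainty principle -/

/-- The symplectic form. -/
def sympl {n : ℕ} (ξ η : Fin n × Fin 2 → ℝ) : ℝ := ∑ i, (ξ (i, 0) * η (i, 1) - ξ (i, 1) * η (i, 0))

theorem sandwich_weyl {n : ℕ} (ξ η : Fin n × Fin 2 → ℝ) (k l : Fin n → ℕ) :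
    sandwich (weyl ξ) 1 (weyl η) k l = Complex.exp (Complex.I * (sympl ξ η / 2 : ℝ)) * weyl (η - ξ) k l := by
  rw [weyl, weyl, sandwich_displacement_one]
  have e1 : weylAmplitude (η - ξ) = weylAmplitude η - weylAmplitude ξ := by
    funext i
    simp only [weylAmplitude, Pi.sub_apply]; push_cast; ring
  rw [weyl, e1]
  refine congrArg (· * displacement (weylAmplitude η - weylAmplitude ξ) k l) (congrArg Complex.exp ?_)
  rw [sympl]
  push_cast
  rw [Finset.sum_div, Finset.mul_sum]
  refine Finset.sum_congr rfl fun i _ => ?_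
  have h2 := sqrt_two_mul_self
  simp only [weylAmplitude, Complex.star_def,
    map_div₀, map_mul, map_add, Complex.conj_I, Complex.conj_ofReal]
  generalize ((Real.sqrt 2 : ℝ) : ℂ) = r at *
  have h3 : r⁻¹ * r⁻¹ = 1 / 2 := by rw [← mul_inv, h2]; norm_num
  simp only [div_eq_mul_inv]
  linear_combination ((ξ (i, 0) * η (i, 1) - ξ (i, 1) * η (i, 0)) * Complex.I) * h3 -
    (r⁻¹ * r⁻¹ * Complex.I * (ξ (i, 0) * η (i, 1) - ξ (i, 1) * η (i, 0))) * Complex.I_sq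

open scoped ComplexOrder in
-- Quantum Bochner positivity: the sum is the trace of `A ρ A†` for `A = ∑ i, c i * weyl (ξ i)`,
-- with `A† A` expanded by the Weyl relations.
theorem IsState.sum_charFn_nonneg {n : ℕ} {ρ : FockMatrix n} (hρ : IsState ρ) (h : IsGeo ρ) {κ : Type*} [Fintype κ]
    (c : κ → ℂ) (ξ : κ → Fin n × Fin 2 → ℝ) :
    0 ≤ (∑ i, ∑ j, star (c i) * c j * (Complex.exp (Complex.I * (sympl (ξ i) (ξ j) / 2 : ℝ)) *
      charFn ρ (ξ j - ξ i))).re := by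
  set A : FockMatrix n := fun k l => ∑ i, c i * weyl (ξ i) k l with hA
  have hAg : IsGeoOp A := IsGeoOp.sum _ fun i => (isGeoOp_displacement _).const_mul _
  have hsum : ∀ (i j : κ) (q p : Fin n → ℕ), Summable fun k => star (weyl (ξ i) k q) * weyl (ξ j) k p := by
    intro i j q p
    have hcol : ∀ i q, Summable fun k => ‖weyl (ξ i) k q‖ ^ 2 := fun i q => by
      refine (norm_le_one_of_sandwich_one (A := weyl (ξ i)) ?_ q q).2.1
      rw [weyl, sandwich_displacement_one]
      funext k l
      simp [displacement_zero, mul_comm]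
    refine Summable.of_norm_bounded ((hcol i q).add (hcol j p)) fun k => ?_
    rw [norm_mul, norm_star]
    nlinarith [sq_nonneg (‖weyl (ξ i) k q‖ - ‖weyl (ξ j) k p‖), sq_nonneg ‖weyl (ξ i) k q‖,
      sq_nonneg ‖weyl (ξ j) k p‖]
  have hsand : ∀ q p, sandwich A 1 A q p = ∑ i, ∑ j, star (c i) * c j *
      (Complex.exp (Complex.I * (sympl (ξ i) (ξ j) / 2 : ℝ)) * weyl (ξ j - ξ i) q p) := fun q p => by
    have h1 : HasSum (fun k => ∑ i, ∑ j, star (c i) * c j * (star (weyl (ξ i) k q) * weyl (ξ j) k p))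
        (∑ i, ∑ j, star (c i) * c j * ∑' k, star (weyl (ξ i) k q) * weyl (ξ j) k p) :=
      hasSum_sum fun i _ => hasSum_sum fun j _ => (hsum i j q p).hasSum.mul_left (star (c i) * c j)
    simp only [← sandwich_one, sandwich_weyl] at h1
    rw [← h1.tsum_eq, sandwich_one]
    refine tsum_congr fun k => ?_
    simp only [hA, star_sum, Finset.sum_mul_sum]
    refine Finset.sum_congr rfl fun i _ => Finset.sum_congr rfl fun j _ => ?_
    rw [star_mul']; ring
  have key := trMul_conjBy hAg h norm_one_le
  have h2 : HasSum (fun p : (Fin n → ℕ) × (Fin n → ℕ) => ∑ i, ∑ j, star (c i) * c j *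
        Complex.exp (Complex.I * (sympl (ξ i) (ξ j) / 2 : ℝ)) * (ρ p.1 p.2 * weyl (ξ j - ξ i) p.2 p.1))
      (∑ i, ∑ j, star (c i) * c j * Complex.exp (Complex.I * (sympl (ξ i) (ξ j) / 2 : ℝ)) *
        ∑' p : (Fin n → ℕ) × (Fin n → ℕ), ρ p.1 p.2 * weyl (ξ j - ξ i) p.2 p.1) :=
    hasSum_sum fun i _ => hasSum_sum fun j _ =>
      (h.summable_mul (norm_weyl_le (ξ j - ξ i))).hasSum.mul_left _
  have h3 : trMul ρ (sandwich A 1 A) = ∑ i, ∑ j, star (c i) * c j *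
      (Complex.exp (Complex.I * (sympl (ξ i) (ξ j) / 2 : ℝ)) * charFn ρ (ξ j - ξ i)) := by
    simp only [h.charFn_eq]
    rw [trMul]
    simp only [trMul, ← mul_assoc]
    rw [← h2.tsum_eq]
    refine tsum_congr fun p => ?_
    rw [hsand, Finset.mul_sum]
    refine Finset.sum_congr rfl fun i _ => ?_
    rw [Finset.mul_sum]
    exact Finset.sum_congr rfl fun j _ => by ring
  rw [← h3, ← key, trMul_one, Complex.re_tsum (h.conjBy hAg).summable_diag]
  refine tsum_nonneg fun k => ?_
  have := (posSemidef_conjBy hAg h hρ.posSemidef).diag_nonneg (i := k)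
  exact (Complex.le_def.1 this).1

/-- The mean vector contributes only phases, which are absorbed into the coefficients. -/
theorem IsGaussian.sum_exp_nonneg {n : ℕ} {ρ : FockMatrix n} {d V} (h : IsGaussian ρ d V) {κ : Type*} [Fintype κ]
    (c : κ → ℂ) (ξ : κ → Fin n × Fin 2 → ℝ) :
    0 ≤ (∑ i, ∑ j, star (c i) * c j * Complex.exp (Complex.I * (sympl (ξ i) (ξ j) / 2 : ℝ) -
      ((covForm V (ξ j - ξ i) (ξ j - ξ i) : ℝ) : ℂ) / 2)).re := by
  have := h.isState.sum_charFn_nonneg h.isGeo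
    (fun i => c i * Complex.exp (-(Complex.I * ((ξ i ⬝ᵥ d : ℝ) : ℂ)))) ξ
  refine this.trans_eq (congrArg Complex.re (Finset.sum_congr rfl fun i _ => Finset.sum_congr rfl fun j _ => ?_))
  rw [star_mul', Complex.star_def, ← Complex.exp_conj, h.charFn_eq, ← covForm_apply]
  set q : ℂ := ((covForm V (ξ j - ξ i) (ξ j - ξ i) : ℝ) : ℂ) / 2
  set θ : ℂ := Complex.I * ((sympl (ξ i) (ξ j) / 2 : ℝ) : ℂ)
  have e : θ - q = (starRingEnd ℂ) (-(Complex.I * ((ξ i ⬝ᵥ d : ℝ) : ℂ))) + -(Complex.I * ((ξ j ⬝ᵥ d : ℝ) : ℂ)) +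
      (θ + (Complex.I * (((ξ j - ξ i) ⬝ᵥ d : ℝ) : ℂ) - q)) := by
    simp only [map_neg, map_mul, Complex.conj_I, Complex.conj_ofReal, sub_dotProduct]
    push_cast
    ring
  rw [e, Complex.exp_add, Complex.exp_add, Complex.exp_add]
  ring

/-- The uncertainty relation, obtained by contracting three points to the origin in the Bochner
inequality and comparing terms of second order. -/
theorem IsGaussian.sympl_le {n : ℕ} {ρ : FockMatrix n} {d V} (h : IsGaussian ρ d V) (x u : Fin n × Fin 2 → ℝ) :
    sympl x u ≤ covForm V x x + covForm V u u := by
  set w := sympl x u with hw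
  set e := covForm V (u - x) (u - x) with he
  have key : ∀ s : ℝ, 2 * Real.sin (s ^ 2 * w / 2) * Real.exp (-(s ^ 2 * e) / 2) ≤
      s ^ 2 * (covForm V x x + covForm V u u) := fun s => by
    -- The coefficients sum to zero, so the constant terms cancel. The relative phase `I` between
    -- the first two points turns the symplectic phase into a sine.
    have h1 := h.sum_exp_nonneg (κ := Fin 3) ![1, Complex.I, -(1 + Complex.I)] ![s • x, s • u, 0]
    have z1 : ∀ a : Fin n × Fin 2 → ℝ, sympl a 0 = 0 := fun a => by simp [sympl]
    have z2 : ∀ a : Fin n × Fin 2 → ℝ, sympl 0 a = 0 := fun a => by simp [sympl]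
    have z3 : ∀ a : Fin n × Fin 2 → ℝ, sympl a a = 0 := fun a => by simp [sympl, mul_comm]
    have z4 : sympl (s • x) (s • u) = s ^ 2 * w := by
      simp only [hw, sympl, Pi.smul_apply, smul_eq_mul, Finset.mul_sum]
      exact Finset.sum_congr rfl fun i _ => by ring
    have z5 : sympl (s • u) (s • x) = -(s ^ 2 * w) := by
      simp only [hw, sympl, Pi.smul_apply, smul_eq_mul, Finset.mul_sum, ← Finset.sum_neg_distrib]
      exact Finset.sum_congr rfl fun i _ => by ring
    have z6 : covForm V (s • u - s • x) (s • u - s • x) = s ^ 2 * e := by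
      rw [← smul_sub]; simp only [map_smul, LinearMap.smul_apply, smul_eq_mul, he]; ring
    have z7 : covForm V (s • x - s • u) (s • x - s • u) = s ^ 2 * e := by
      rw [← smul_sub, ← neg_sub u x]
      simp only [map_smul, LinearMap.smul_apply, smul_eq_mul, he, map_neg, LinearMap.neg_apply]; ring
    have z8 : ∀ a, covForm V (s • a) (s • a) = s ^ 2 * covForm V a a := fun a => by
      simp only [map_smul, LinearMap.smul_apply, smul_eq_mul]; ring
    simp only [Fin.sum_univ_three, Matrix.cons_val_zero, Matrix.cons_val_one, Matrix.cons_val_two,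
      Matrix.head_cons, Matrix.tail_cons, z1, z2, z3, z4, z5, z6, z7, sub_self, sub_zero, zero_sub,
      map_neg, LinearMap.neg_apply, neg_neg, z8, map_zero] at h1
    obtain ⟨p, q, hp, hq, ex⟩ : ∃ p q : ℝ → ℝ → ℝ, (∀ a b, p a b = Real.exp (-b / 2) * Real.cos a) ∧
        (∀ a b, q a b = Real.exp (-b / 2) * Real.sin a) ∧
        ∀ a b : ℝ, Complex.exp (Complex.I * (a : ℂ) - (b : ℂ) / 2) = p a b + q a b * Complex.I := by
      refine ⟨_, _, fun _ _ => rfl, fun _ _ => rfl, fun a b => ?_⟩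
      rw [sub_eq_add_neg, add_comm, Complex.exp_add, mul_comm Complex.I, Complex.exp_mul_I]
      push_cast; rw [neg_div]; ring
    simp only [ex] at h1
    simp only [Complex.add_re, Complex.mul_re, Complex.add_im, Complex.mul_im, Complex.ofReal_re, Complex.ofReal_im,
      Complex.I_re, Complex.I_im, Complex.star_def, map_one, map_neg, map_add, Complex.conj_I, Complex.neg_re,
      Complex.neg_im, Complex.one_re, Complex.one_im, hp, hq] at h1
    simp only [neg_div, Real.sin_neg, Real.cos_neg, zero_div, Real.sin_zero, Real.cos_zero, neg_zero,
      Real.exp_zero] at h1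
    have h2 := Real.add_one_le_exp (-(s ^ 2 * covForm V x x / 2))
    have h3 := Real.add_one_le_exp (-(s ^ 2 * covForm V u u / 2))
    rw [neg_div]
    linarith
  -- In the variable `τ = s²` the left side of `key` vanishes at zero and has derivative `w` there.
  have hd : HasDerivAt (fun τ : ℝ => 2 * Real.sin (τ * w / 2) * Real.exp (-(τ * e) / 2)) w 0 := by
    have h1 : HasDerivAt (fun τ : ℝ => τ * w / 2) (w / 2) 0 := by
      simpa using ((hasDerivAt_id (0 : ℝ)).mul_const w).div_const 2
    have h2 : HasDerivAt (fun τ : ℝ => -(τ * e) / 2) (-e / 2) 0 := by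
      simpa using (((hasDerivAt_id (0 : ℝ)).mul_const e).neg).div_const 2
    have := (h1.sin.const_mul 2).mul h2.exp
    refine this.congr_deriv ?_
    simp only [zero_mul, zero_div, neg_zero, Real.cos_zero, Real.sin_zero, Real.exp_zero]
    ring
  have ht := hd.tendsto_slope_zero_right
  refine le_of_tendsto ht ?_
  filter_upwards [self_mem_nhdsWithin] with τ hτ
  have hτ' : 0 < τ := hτ
  have := key (Real.sqrt τ)
  rw [Real.sq_sqrt hτ'.le] at this
  simp only [zero_add, zero_mul, zero_div, Real.sin_zero, mul_zero, sub_zero, smul_eq_mul]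
  rw [inv_mul_le_iff₀ hτ']
  exact this

/-! ### Hermite functions and the homodyne measurement -/

theorem eq_zero_of_forall_hasSum {c : ℕ → ℂ}
    (h : ∀ w : ℂ, HasSum (fun k => c k * (w ^ k / ((Real.sqrt k.factorial : ℝ) : ℂ))) 0) : c = 0 := by
  have h' : ∀ z : Fin 1 → ℂ, HasSum (fun k : Fin 1 → ℕ => c (k 0) * expVec z k) 0 := fun z => by
    have := (Equiv.funUnique (Fin 1) ℕ).hasSum_iff.2 (h (z 0))
    refine this.congr_fun fun k => ?_
    simp [expVec, Equiv.funUnique]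
  have := eq_zero_of_sum_mul_expVec_eq_zero (c := fun k : Fin 1 → ℕ => c (k 0)) (fun z => (h' z).summable)
    fun z => (h' z).tsum_eq
  funext k
  exact congrFun this fun _ => k

/-- Matrix elements of the displacement operator without the normalising factorials. -/
def dispElem' (α : ℂ) (j k : ℕ) : ℂ :=
  ((Real.sqrt j.factorial * Real.sqrt k.factorial : ℝ) : ℂ) * dispElem α j k

theorem sqrt_factorial_ne_zero (k : ℕ) : ((Real.sqrt k.factorial : ℝ) : ℂ) ≠ 0 := by
  have : Real.sqrt k.factorial ≠ 0 := by positivity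
  exact_mod_cast this

theorem sqrt_factorial_mul_self (k : ℕ) :
    ((Real.sqrt k.factorial : ℝ) : ℂ) * ((Real.sqrt k.factorial : ℝ) : ℂ) = k.factorial := by
  rw [← Complex.ofReal_mul, Real.mul_self_sqrt (by positivity)]; norm_num

theorem hasSum_dispElem' (α w : ℂ) (j : ℕ) : HasSum (fun k => dispElem' α j k * (w ^ k / (k.factorial : ℂ)))
    (((Real.exp (-‖α‖ ^ 2 / 2) : ℝ) : ℂ) * Complex.exp (-star α * w) * (w + α) ^ j) := by
  have h := (hasSum_dispPoly α (-star α) w j).mul_left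
    (((Real.exp (-‖α‖ ^ 2 / 2) : ℝ) : ℂ) * ((Real.sqrt j.factorial : ℝ) : ℂ))
  have e : ((Real.exp (-‖α‖ ^ 2 / 2) : ℝ) : ℂ) * ((Real.sqrt j.factorial : ℝ) : ℂ) *
      (Complex.exp (-star α * w) * ((w + α) ^ j / ((Real.sqrt j.factorial : ℝ) : ℂ))) =
      ((Real.exp (-‖α‖ ^ 2 / 2) : ℝ) : ℂ) * Complex.exp (-star α * w) * (w + α) ^ j := by
    have := sqrt_factorial_ne_zero j
    field_simp
  rw [e] at h
  refine h.congr_fun fun k => ?_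
  rw [dispElem', dispElem_eq, ← sqrt_factorial_mul_self k]
  have := sqrt_factorial_ne_zero k
  push_cast
  field_simp

/-- In the generating function over `k`, raising `j` multiplies by `w + α`. At `k = 0` the truncated
`k - 1` is harmless, since its coefficient is zero. -/
theorem dispElem'_succ (α : ℂ) (j k : ℕ) :
    dispElem' α (j + 1) k = k * dispElem' α j (k - 1) + α * dispElem' α j k := by
  have hshift : ∀ w : ℂ, HasSum (fun k : ℕ => (k * dispElem' α j (k - 1)) * (w ^ k / (k.factorial : ℂ)))
      (w * (((Real.exp (-‖α‖ ^ 2 / 2) : ℝ) : ℂ) * Complex.exp (-star α * w) * (w + α) ^ j)) := fun w => by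
    rw [← hasSum_nat_add_iff' 1]
    simp only [Finset.range_one, Finset.sum_singleton, Nat.cast_zero, zero_mul, sub_zero]
    refine ((hasSum_dispElem' α w j).mul_left w).congr_fun fun k => ?_
    rw [Nat.add_sub_cancel, Nat.factorial_succ]
    have : ((k + 1 : ℕ) : ℂ) ≠ 0 := by exact_mod_cast Nat.succ_ne_zero k
    have : (k.factorial : ℂ) ≠ 0 := by exact_mod_cast k.factorial_ne_zero
    push_cast at *
    field_simp
    ring
  have hz := eq_zero_of_forall_hasSum (c := fun k => (dispElem' α (j + 1) k - k * dispElem' α j (k - 1) -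
    α * dispElem' α j k) / ((Real.sqrt k.factorial : ℝ) : ℂ)) fun w => by
      have h := ((hasSum_dispElem' α w (j + 1)).sub (hshift w)).sub ((hasSum_dispElem' α w j).mul_left α)
      have e : ((Real.exp (-‖α‖ ^ 2 / 2) : ℝ) : ℂ) * Complex.exp (-star α * w) * (w + α) ^ (j + 1) -
          w * (((Real.exp (-‖α‖ ^ 2 / 2) : ℝ) : ℂ) * Complex.exp (-star α * w) * (w + α) ^ j) -
          α * (((Real.exp (-‖α‖ ^ 2 / 2) : ℝ) : ℂ) * Complex.exp (-star α * w) * (w + α) ^ j) = 0 := by ring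
      rw [e] at h
      refine h.congr_fun fun k => ?_
      rw [← sqrt_factorial_mul_self k]
      have := sqrt_factorial_ne_zero k
      field_simp
  have := (div_eq_zero_iff.1 (congrFun hz k)).resolve_right (sqrt_factorial_ne_zero k)
  linear_combination this

theorem norm_dispElem_le_one (α : ℂ) (j k : ℕ) : ‖dispElem α j k‖ ≤ 1 := by
  have := norm_displacement_le (n := 1) (fun _ => α) (fun _ => j) (fun _ => k)
  simpa [displacement] using this

theorem mul_dispElem (α : ℂ) (j k : ℕ) : α * dispElem α j k =
    ((Real.sqrt (j + 1 : ℕ) : ℝ) : ℂ) * dispElem α (j + 1) k - ((Real.sqrt k : ℝ) : ℂ) * dispElem α j (k - 1) := by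
  have h := dispElem'_succ α j k
  simp only [dispElem'] at h
  have hj := sqrt_factorial_ne_zero j
  have hk := sqrt_factorial_ne_zero k
  have e1 : Real.sqrt ((j + 1).factorial) = Real.sqrt (j + 1 : ℕ) * Real.sqrt j.factorial := by
    rw [Nat.factorial_succ, Nat.cast_mul, Real.sqrt_mul (by positivity)]
  have e2 : (k : ℂ) * ((Real.sqrt (k - 1).factorial : ℝ) : ℂ) = ((Real.sqrt k : ℝ) : ℂ) * ((Real.sqrt k.factorial : ℝ) : ℂ) := by
    cases k with
    | zero => simp
    | succ k =>
      rw [Nat.add_sub_cancel, Nat.factorial_succ, Nat.cast_mul, Real.sqrt_mul (by positivity)]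
      have : ((Real.sqrt (k + 1 : ℕ) : ℝ) : ℂ) * ((Real.sqrt (k + 1 : ℕ) : ℝ) : ℂ) = (k + 1 : ℕ) := by
        rw [← Complex.ofReal_mul, Real.mul_self_sqrt (by positivity)]; norm_num
      rw [Complex.ofReal_mul, ← mul_assoc, this]
  rw [e1] at h
  push_cast at h e2 ⊢
  refine mul_left_cancel₀ (mul_ne_zero hj hk) ?_
  linear_combination -h - ((Real.sqrt j.factorial : ℝ) : ℂ) * dispElem α j (k - 1) * e2

/-- Multiplication by `α` shifts an index at the cost of a square root of an occupation number.
Doing it twice gives quadratic decay in `α`, enough for integrability along a line. -/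
theorem norm_mul_dispElem_le (α : ℂ) (j k : ℕ) : ‖α‖ ^ 2 * ‖dispElem α j k‖ ≤ ((j + k : ℕ) + 3) ^ 2 := by
  have hs : ∀ j : ℕ, Real.sqrt j ≤ j := fun j => by
    rw [Real.sqrt_le_left (by positivity)]
    exact_mod_cast Nat.le_self_pow two_ne_zero j
  have h1 : ∀ j k : ℕ, ‖α‖ * ‖dispElem α j k‖ ≤ (j + 1 : ℕ) + k := fun j k => by
    rw [← norm_mul, mul_dispElem]
    refine (norm_sub_le _ _).trans (add_le_add ?_ ?_) <;>
    · rw [norm_mul, Complex.norm_real, Real.norm_of_nonneg (Real.sqrt_nonneg _)]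
      exact (mul_le_of_le_one_right (Real.sqrt_nonneg _) (norm_dispElem_le_one _ _ _)).trans (hs _)
  have h2 : ‖α‖ * (‖α‖ * ‖dispElem α j k‖) ≤ (j + 1 : ℕ) * ((j + 1 + 1 : ℕ) + k) + k * ((j + 1 : ℕ) + (k - 1 : ℕ)) := by
    rw [← norm_mul, mul_dispElem]
    refine (mul_le_mul_of_nonneg_left (norm_sub_le _ _) (norm_nonneg _)).trans ?_
    rw [mul_add]
    refine add_le_add ?_ ?_ <;>
    · rw [norm_mul, Complex.norm_real, Real.norm_of_nonneg (Real.sqrt_nonneg _), mul_left_comm]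
      exact mul_le_mul (hs _) (h1 _ _) (by positivity) (by positivity)
  have h3 : ((k - 1 : ℕ) : ℝ) ≤ k := by exact_mod_cast Nat.sub_le k 1
  have h4 : (k : ℝ) * ((j + 1 : ℕ) + (k - 1 : ℕ)) ≤ k * ((j + 1 : ℕ) + k) := by gcongr
  push_cast at *
  nlinarith [(Nat.cast_nonneg j : (0 : ℝ) ≤ j), (Nat.cast_nonneg k : (0 : ℝ) ≤ k)]

theorem star_dispElem' (α : ℂ) (j k : ℕ) : star (dispElem α j k) = dispElem (star α) j k := by
  simp only [dispElem, star_mul', star_sum, Complex.star_def, Complex.conj_ofReal, RCLike.norm_conj]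
  congr 1
  refine Finset.sum_congr rfl fun s _ => ?_
  simp

/-- Matrix elements of `exp(i s x)`. -/
def quadElem (j k : ℕ) (s : ℝ) : ℂ := dispElem (Complex.I * s / ((Real.sqrt 2 : ℝ) : ℂ)) j k

theorem quadElem_comm (j k : ℕ) (s : ℝ) : quadElem j k s = quadElem k j s := by
  have h1 := star_dispElem (Complex.I * s / ((Real.sqrt 2 : ℝ) : ℂ)) k j
  rw [star_dispElem'] at h1
  have : star (Complex.I * s / ((Real.sqrt 2 : ℝ) : ℂ)) = -(Complex.I * s / ((Real.sqrt 2 : ℝ) : ℂ)) := by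
    simp; ring
  rw [this] at h1
  have h2 := star_dispElem' (Complex.I * s / ((Real.sqrt 2 : ℝ) : ℂ)) j k
  have h3 := star_dispElem (Complex.I * s / ((Real.sqrt 2 : ℝ) : ℂ)) j k
  rw [h2, this] at h3
  rw [this] at h2
  rw [quadElem, quadElem]
  have h4 := congrArg star h2
  rw [star_star, h3, star_dispElem', star_neg, this, neg_neg] at h4
  exact h4

theorem continuous_quadElem (j k : ℕ) : Continuous (quadElem j k) :=
  (continuous_dispElem j k).comp (by fun_prop)

theorem norm_quadElem_le (j k : ℕ) (s : ℝ) : ‖quadElem j k s‖ ≤ 2 * (((j + k : ℕ) + 3) ^ 2 + 1) * (1 + s ^ 2)⁻¹ := by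
  have h1 := norm_mul_dispElem_le (Complex.I * s / ((Real.sqrt 2 : ℝ) : ℂ)) j k
  have h2 := norm_dispElem_le_one (Complex.I * s / ((Real.sqrt 2 : ℝ) : ℂ)) j k
  have e : ‖Complex.I * s / ((Real.sqrt 2 : ℝ) : ℂ)‖ ^ 2 = s ^ 2 / 2 := by
    rw [norm_div, norm_mul, Complex.norm_I, one_mul, Complex.norm_real, Complex.norm_real, div_pow,
      Real.norm_eq_abs, Real.norm_eq_abs, sq_abs, sq_abs, Real.sq_sqrt (by norm_num)]
  rw [e] at h1
  rw [← div_eq_mul_inv, le_div_iff₀ (by positivity)]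
  unfold quadElem
  nlinarith

theorem integrable_quadElem (j k : ℕ) : Integrable (quadElem j k) :=
  (integrable_inv_one_add_sq.const_mul _).mono' (continuous_quadElem j k).aestronglyMeasurable
    (ae_of_all _ (norm_quadElem_le j k))

theorem integral_norm_quadElem_le (j k : ℕ) :
    ∫ s, ‖quadElem j k s‖ ≤ 2 * (((j + k : ℕ) + 3) ^ 2 + 1) * Real.pi := by
  refine (integral_mono (integrable_quadElem j k).norm (integrable_inv_one_add_sq.const_mul _)
    (norm_quadElem_le j k)).trans_eq ?_
  rw [integral_const_mul, integral_univ_inv_one_add_sq]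

/-! ### Products of Hermite functions as Fourier integrals -/

theorem derivative_hermite_succ (n : ℕ) : Polynomial.derivative (Polynomial.hermite (n + 1)) =
    ((n + 1 : ℕ) : Polynomial ℤ) * Polynomial.hermite n := by
  induction n with
  | zero => simp
  | succ n ih =>
    have h := Polynomial.hermite_succ (n + 1)
    rw [h, Polynomial.derivative_sub, Polynomial.derivative_mul, ih, Polynomial.derivative_X, Polynomial.derivative_mul,
      Polynomial.derivative_natCast, Polynomial.hermite_succ n]
    push_cast
    ring

/-- Hermite functions without the normalising constant. -/
def hermiteAux (k : ℕ) (x : ℝ) : ℝ :=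
  Real.exp (-x ^ 2 / 2) * Polynomial.aeval (Real.sqrt 2 * x) (Polynomial.hermite k)

theorem hermiteAux_recurrence (k : ℕ) (x : ℝ) :
    hermiteAux (k + 1) x + k * hermiteAux (k - 1) x = Real.sqrt 2 * x * hermiteAux k x := by
  cases k with
  | zero => simp [hermiteAux]; ring
  | succ k =>
    rw [hermiteAux, Polynomial.hermite_succ, derivative_hermite_succ, hermiteAux, hermiteAux]
    simp
    ring

theorem hasDerivAt_hermiteAux (k : ℕ) (x : ℝ) :
    HasDerivAt (hermiteAux k) (x * hermiteAux k x - Real.sqrt 2 * hermiteAux (k + 1) x) x := by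
  have h1 : HasDerivAt (fun x : ℝ => Real.exp (-x ^ 2 / 2)) (Real.exp (-x ^ 2 / 2) * (-(2 * x) / 2)) x := by
    have := (((hasDerivAt_pow 2 x).neg).div_const 2).exp
    simpa using this
  have h2 : HasDerivAt (fun x : ℝ => Polynomial.aeval (Real.sqrt 2 * x) (Polynomial.hermite k))
      (Polynomial.aeval (Real.sqrt 2 * x) (Polynomial.derivative (Polynomial.hermite k)) * Real.sqrt 2) x := by
    have := (Polynomial.hasDerivAt_aeval (Polynomial.hermite k) (Real.sqrt 2 * x)).comp x
      ((hasDerivAt_id x).const_mul (Real.sqrt 2))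
    rw [mul_one] at this
    exact this
  refine (h1.mul h2).congr_deriv ?_
  rw [hermiteAux, hermiteAux, Polynomial.hermite_succ]
  simp only [map_sub, map_mul, Polynomial.aeval_X]
  have h2 : Real.sqrt 2 * Real.sqrt 2 = 2 := Real.mul_self_sqrt (by norm_num)
  linear_combination ((Real.exp (-x ^ 2 / 2)) * x * Polynomial.aeval (Real.sqrt 2 * x) (Polynomial.hermite k)) * h2

/-- The Fourier integral of the matrix elements of `exp(i s x)`. -/
def quadInt (k l : ℕ) (x : ℝ) : ℂ :=
  ∫ s : ℝ, Complex.exp (-(Complex.I * s * x)) * dispElem' (Complex.I * s / ((Real.sqrt 2 : ℝ) : ℂ)) k l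

theorem continuous_dispElem'_quad (k l : ℕ) :
    Continuous fun s : ℝ => dispElem' (Complex.I * s / ((Real.sqrt 2 : ℝ) : ℂ)) k l :=
  continuous_const.mul (continuous_quadElem k l)

theorem integrable_dispElem'_quad (k l : ℕ) :
    Integrable fun s : ℝ => dispElem' (Complex.I * s / ((Real.sqrt 2 : ℝ) : ℂ)) k l :=
  (integrable_quadElem k l).const_mul _

theorem norm_exp_neg_I_mul (s x : ℝ) : ‖Complex.exp (-(Complex.I * s * x))‖ = 1 := by
  rw [Complex.norm_exp]; simp

theorem integrable_quadInt (k l : ℕ) (x : ℝ) : Integrable fun s : ℝ => Complex.exp (-(Complex.I * s * x)) *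
    dispElem' (Complex.I * s / ((Real.sqrt 2 : ℝ) : ℂ)) k l :=
  (integrable_dispElem'_quad k l).bdd_mul (c := 1) (Continuous.aestronglyMeasurable (by fun_prop))
    (ae_of_all _ fun s => (norm_exp_neg_I_mul s x).le)

/-- Differentiation under the integral brings down `-i s`, which `dispElem'_succ` converts into
neighbouring indices. -/
theorem hasDerivAt_quadInt (k l : ℕ) (x : ℝ) : HasDerivAt (quadInt k l)
    (-((Real.sqrt 2 : ℝ) : ℂ) * (quadInt (k + 1) l x - l * quadInt k (l - 1) x)) x := by
  have hrec : ∀ s : ℝ, -(Complex.I * s) * dispElem' (Complex.I * s / ((Real.sqrt 2 : ℝ) : ℂ)) k l =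
      -((Real.sqrt 2 : ℝ) : ℂ) * (dispElem' (Complex.I * s / ((Real.sqrt 2 : ℝ) : ℂ)) (k + 1) l -
        l * dispElem' (Complex.I * s / ((Real.sqrt 2 : ℝ) : ℂ)) k (l - 1)) := fun s => by
    rw [dispElem'_succ]
    have := sqrt_two_ne_zero
    field_simp
    ring
  have key := hasDerivAt_integral_of_dominated_loc_of_deriv_le (μ := volume) (x₀ := x) (s := Set.univ)
    (F := fun (x s : ℝ) => Complex.exp (-(Complex.I * s * x)) * dispElem' (Complex.I * s / ((Real.sqrt 2 : ℝ) : ℂ)) k l)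
    (F' := fun (x s : ℝ) => Complex.exp (-(Complex.I * s * x)) * (-((Real.sqrt 2 : ℝ) : ℂ) *
      (dispElem' (Complex.I * s / ((Real.sqrt 2 : ℝ) : ℂ)) (k + 1) l -
        l * dispElem' (Complex.I * s / ((Real.sqrt 2 : ℝ) : ℂ)) k (l - 1))))
    (bound := fun s : ℝ => ‖-((Real.sqrt 2 : ℝ) : ℂ) *
      (dispElem' (Complex.I * s / ((Real.sqrt 2 : ℝ) : ℂ)) (k + 1) l -
        l * dispElem' (Complex.I * s / ((Real.sqrt 2 : ℝ) : ℂ)) k (l - 1))‖)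
    Filter.univ_mem
    (Filter.Eventually.of_forall fun x => (integrable_quadInt k l x).aestronglyMeasurable)
    (integrable_quadInt k l x)
    (Continuous.aestronglyMeasurable (by
      have h1 := continuous_dispElem'_quad (k + 1) l
      have h2 := continuous_dispElem'_quad k (l - 1)
      fun_prop))
    (ae_of_all _ fun s y _ => by rw [norm_mul, norm_exp_neg_I_mul, one_mul])
    ((((integrable_dispElem'_quad (k + 1) l).sub ((integrable_dispElem'_quad k (l - 1)).const_mul _)).const_mul _).norm)
    (ae_of_all _ fun s y _ => by
      have h1 : HasDerivAt (fun y : ℝ => -(Complex.I * s * (y : ℂ))) (-(Complex.I * s)) y := by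
        have := ((hasDerivAt_id y).ofReal_comp.const_mul (Complex.I * s)).neg
        exact this.congr_deriv (by simp)
      refine (h1.cexp.mul_const _).congr_deriv ?_
      rw [mul_assoc, hrec])
  refine key.2.congr_deriv ?_
  rw [quadInt, quadInt, ← integral_const_mul, ← integral_sub (integrable_quadInt _ _ _)
    ((integrable_quadInt _ _ _).const_mul _), ← integral_const_mul]
  exact integral_congr_ae (ae_of_all _ fun s => by ring)

theorem quadInt_comm (k l : ℕ) (x : ℝ) : quadInt k l x = quadInt l k x := by
  refine integral_congr_ae (ae_of_all _ fun s => ?_)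
  have := quadElem_comm k l s
  simp only [quadElem] at this
  simp only [dispElem', this, mul_comm (Real.sqrt k.factorial)]

theorem quadInt_zero (x : ℝ) :
    quadInt 0 0 x = ((2 * Real.sqrt Real.pi * (hermiteAux 0 x * hermiteAux 0 x) : ℝ) : ℂ) := by
  have h := fourierIntegral_gaussian (b := 1 / 4) (by norm_num) (-(x : ℂ))
  have e : ∀ s : ℝ, Complex.exp (-(Complex.I * s * x)) * dispElem' (Complex.I * s / ((Real.sqrt 2 : ℝ) : ℂ)) 0 0 =
      Complex.exp (Complex.I * (-(x : ℂ)) * s) * Complex.exp (-(1 / 4) * (s : ℂ) ^ 2) := fun s => by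
    have e1 : ‖Complex.I * s / ((Real.sqrt 2 : ℝ) : ℂ)‖ ^ 2 = s ^ 2 / 2 := by
      rw [norm_div, norm_mul, Complex.norm_I, one_mul, Complex.norm_real, Complex.norm_real, div_pow,
        Real.norm_eq_abs, Real.norm_eq_abs, sq_abs, sq_abs, Real.sq_sqrt (by norm_num)]
    rw [dispElem', dispElem, neg_div, e1]
    congr 1
    · congr 1; ring
    · simp
      congr 1; ring
  simp only [quadInt, e, h]
  have h2 : ((Real.pi : ℂ) / (1 / 4)) ^ (1 / 2 : ℂ) = ((2 * Real.sqrt Real.pi : ℝ) : ℂ) := by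
    have : ((Real.pi : ℂ) / (1 / 4)) = ((4 * Real.pi : ℝ) : ℂ) := by push_cast; ring
    rw [this, show (1 / 2 : ℂ) = ((1 / 2 : ℝ) : ℂ) by norm_num, ← Complex.ofReal_cpow (by positivity),
      ← Real.sqrt_eq_rpow, Real.sqrt_mul (by norm_num), show (4 : ℝ) = 2 ^ 2 by norm_num, Real.sqrt_sq (by norm_num)]
  rw [h2]
  simp only [hermiteAux, Polynomial.hermite_zero]
  push_cast
  simp
  left
  rw [← Complex.exp_add]
  congr 1; ring

/-- Differentiating the identity for `(k, l)` and solving for the entry with `k + 1` reduces the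
claim to the Hermite recurrence. The second hypothesis is dropped at `l = 0`, where the term with `l
- 1` has coefficient zero. -/
theorem quadInt_succ_left {k l : ℕ} (h : ∀ x, quadInt k l x = ((2 * Real.sqrt Real.pi * (hermiteAux k x * hermiteAux l x) : ℝ) : ℂ))
    (h' : l ≠ 0 → ∀ x, quadInt k (l - 1) x =
      ((2 * Real.sqrt Real.pi * (hermiteAux k x * hermiteAux (l - 1) x) : ℝ) : ℂ)) (x : ℝ) :
    quadInt (k + 1) l x = ((2 * Real.sqrt Real.pi * (hermiteAux (k + 1) x * hermiteAux l x) : ℝ) : ℂ) := by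
  have h1 := hasDerivAt_quadInt k l x
  have h2 := (((hasDerivAt_hermiteAux k x).mul (hasDerivAt_hermiteAux l x)).const_mul
    (2 * Real.sqrt Real.pi)).ofReal_comp
  have h3 := h1.unique (h2.congr_of_eventuallyEq (Filter.Eventually.of_forall fun y => h y))
  have hl : (l : ℂ) * quadInt k (l - 1) x =
      ((2 * Real.sqrt Real.pi * (hermiteAux k x * (l * hermiteAux (l - 1) x)) : ℝ) : ℂ) := by
    by_cases hl : l = 0
    · simp [hl]
    · rw [h' hl]; push_cast; ring
  have h4 := hermiteAux_recurrence l x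
  have h5 : (l : ℝ) * hermiteAux (l - 1) x = Real.sqrt 2 * x * hermiteAux l x - hermiteAux (l + 1) x := by linarith
  rw [mul_sub, hl, h5] at h3
  have h6 := sqrt_two_mul_self
  refine mul_left_cancel₀ (neg_ne_zero.2 sqrt_two_ne_zero) ?_
  push_cast at h3 ⊢
  linear_combination h3 - ((Real.sqrt Real.pi : ℝ) : ℂ) * 2 * hermiteAux k x * x * hermiteAux l x * h6

theorem quadInt_eq (k l : ℕ) (x : ℝ) :
    quadInt k l x = ((2 * Real.sqrt Real.pi * (hermiteAux k x * hermiteAux l x) : ℝ) : ℂ) := by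
  have h0 : ∀ k x, quadInt k 0 x = ((2 * Real.sqrt Real.pi * (hermiteAux k x * hermiteAux 0 x) : ℝ) : ℂ) := fun k => by
    induction k with
    | zero => exact quadInt_zero
    | succ k ih => exact quadInt_succ_left ih fun h => absurd rfl h
  induction k generalizing l x with
  | zero => rw [quadInt_comm, h0, mul_comm (hermiteAux l x)]
  | succ k ih => exact quadInt_succ_left (ih l) (fun _ => ih (l - 1)) x

/-- Entrywise form of `|x⟩⟨x| = (2π)⁻¹ ∫ exp(-i s x) exp(i s X) ds`, where `X` is the position
operator. -/
theorem hermiteFn_mul (k l : ℕ) (x : ℝ) : ((hermiteFn k x * hermiteFn l x : ℝ) : ℂ) =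
    (((2 * Real.pi)⁻¹ : ℝ) : ℂ) * ∫ s : ℝ, Complex.exp (-(Complex.I * s * x)) * quadElem k l s := by
  have h := quadInt_eq k l x
  have e : quadInt k l x = ((Real.sqrt k.factorial * Real.sqrt l.factorial : ℝ) : ℂ) *
      ∫ s : ℝ, Complex.exp (-(Complex.I * s * x)) * quadElem k l s := by
    rw [← integral_const_mul]
    refine integral_congr_ae (ae_of_all _ fun s => ?_)
    simp only [dispElem', quadElem]; ring
  rw [e] at h
  have hk := sqrt_factorial_ne_zero k
  have hl := sqrt_factorial_ne_zero l
  refine mul_left_cancel₀ (mul_ne_zero hk hl) ?_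
  push_cast at h
  rw [mul_left_comm, h]
  have hs : Real.sqrt (Real.sqrt Real.pi) * Real.sqrt (Real.sqrt Real.pi) = Real.sqrt Real.pi :=
    Real.mul_self_sqrt (Real.sqrt_nonneg _)
  have hp : Real.sqrt Real.pi * Real.sqrt Real.pi = Real.pi := Real.mul_self_sqrt Real.pi_pos.le
  have hr : Real.sqrt k.factorial * Real.sqrt l.factorial * (hermiteFn k x * hermiteFn l x) =
      (2 * Real.pi)⁻¹ * (2 * Real.sqrt Real.pi * (hermiteAux k x * hermiteAux l x)) := by
    have e1 : ∀ k, hermiteFn k x = hermiteAux k x / (Real.sqrt (Real.sqrt Real.pi) * Real.sqrt k.factorial) := fun k => by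
      rw [hermiteFn, hermiteAux, Real.sqrt_mul (Real.sqrt_nonneg _)]
    have hk' : Real.sqrt k.factorial ≠ 0 := by positivity
    have hl' : Real.sqrt l.factorial ≠ 0 := by positivity
    have hs' : Real.sqrt (Real.sqrt Real.pi) ≠ 0 := by positivity
    have hp' : Real.sqrt Real.pi ≠ 0 := by positivity
    have e2 : Real.sqrt k.factorial * Real.sqrt l.factorial * (hermiteFn k x * hermiteFn l x) =
        hermiteAux k x * hermiteAux l x / (Real.sqrt (Real.sqrt Real.pi) * Real.sqrt (Real.sqrt Real.pi)) := by
      rw [e1, e1]; field_simp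
    rw [e2, hs, div_eq_iff hp', inv_mul_eq_div, div_mul_eq_mul_div, eq_div_iff (by positivity)]
    linear_combination (-2 * hermiteAux k x * hermiteAux l x) * hp
  have := congrArg Complex.ofReal hr
  push_cast at this ⊢
  exact this

/-! ### Gaussian measurements as superpositions of Weyl operators -/

theorem exists_sq_le_geometric {S : ℝ} (hS : 1 < S) :
    ∃ C : ℝ, 0 ≤ C ∧ ∀ j : ℕ, 2 * (((j : ℝ) + 3) ^ 2 + 1) * Real.pi ≤ C * S ^ j := by
  have h0 : 0 < S := by linarith
  have h := tendsto_pow_const_mul_const_pow_of_abs_lt_one 2 (r := S⁻¹)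
    (by rw [abs_of_pos (by positivity)]; exact inv_lt_one_of_one_lt₀ hS)
  obtain ⟨K, hK⟩ := h.bddAbove_range
  have hK' : ∀ j : ℕ, (j : ℝ) ^ 2 ≤ K * S ^ j := fun j => by
    have : (j : ℝ) ^ 2 * S⁻¹ ^ j ≤ K := hK ⟨j, rfl⟩
    rwa [inv_pow, ← div_eq_mul_inv, div_le_iff₀ (by positivity)] at this
  have hK0 : 0 ≤ K := by have := hK' 0; simpa using this
  refine ⟨2 * (2 * K + 19) * Real.pi, by positivity, fun j => ?_⟩
  have h1 : (1 : ℝ) ≤ S ^ j := one_le_pow₀ hS.le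
  have h2 := hK' j
  have h3 : ((j : ℝ) + 3) ^ 2 + 1 ≤ (2 * K + 19) * S ^ j := by nlinarith [sq_nonneg ((j : ℝ) - 3)]
  nlinarith [Real.pi_pos]

/-- The phase space vector with the given `x` components. -/
def quadPhase {m : ℕ} : (Fin m → ℝ) →ₗ[ℝ] (Fin m × Fin 2 → ℝ) where
  toFun s := fun i => if i.2 = 0 then s i.1 else 0
  map_add' s t := by funext i; simp only [Pi.add_apply]; split_ifs <;> simp
  map_smul' c s := by funext i; simp only [Pi.smul_apply, smul_eq_mul, RingHom.id_apply]; split_ifs <;> simp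

theorem weyl_quadPhase {m : ℕ} (s : Fin m → ℝ) (p q : Fin m → ℕ) :
    weyl (quadPhase s) p q = ∏ i, quadElem (p i) (q i) (s i) := by
  simp [weyl, displacement, weylAmplitude, quadPhase, quadElem]

theorem isWeylIntegral_homodyne {m : ℕ} (x : Fin m → ℝ) :
    IsWeylIntegral volume (homodyne x) (fun s : Fin m → ℝ => ((((2 * Real.pi) ^ m)⁻¹ : ℝ) : ℂ) *
      Complex.exp (-(Complex.I * ((s ⬝ᵥ x : ℝ) : ℂ)))) quadPhase := by
  have e : ∀ (p q : Fin m → ℕ) (s : Fin m → ℝ), ((((2 * Real.pi) ^ m)⁻¹ : ℝ) : ℂ) *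
      Complex.exp (-(Complex.I * ((s ⬝ᵥ x : ℝ) : ℂ))) * weyl (quadPhase s) p q =
      ∏ i, ((((2 * Real.pi)⁻¹ : ℝ) : ℂ) * (Complex.exp (-(Complex.I * s i * x i)) * quadElem (p i) (q i) (s i))) :=
    fun p q s => by
      rw [weyl_quadPhase, Finset.prod_mul_distrib, Finset.prod_mul_distrib, Finset.prod_const, Finset.card_univ,
        Fintype.card_fin, ← mul_assoc, ← Complex.exp_sum, dotProduct]
      congr 2
      · push_cast; rw [inv_pow]
      · congr 1
        push_cast
        rw [Finset.mul_sum, ← Finset.sum_neg_distrib]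
        exact Finset.sum_congr rfl fun i _ => by ring
  have hint : ∀ (p q : Fin m → ℕ) i, Integrable fun s : ℝ =>
      (((2 * Real.pi)⁻¹ : ℝ) : ℂ) * (Complex.exp (-(Complex.I * s * x i)) * quadElem (p i) (q i) s) := fun p q i =>
    ((integrable_quadElem (p i) (q i)).bdd_mul (c := 1) (Continuous.aestronglyMeasurable (by fun_prop))
      (ae_of_all _ fun s => (norm_exp_neg_I_mul s (x i)).le)).const_mul _
  refine ⟨fun p q => ?_, fun S hS => ?_, fun p q => ?_⟩
  · simp only [e]
    exact Integrable.fintype_prod (hint p q)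
  · obtain ⟨C, hC, hCS⟩ := exists_sq_le_geometric hS
    refine ⟨C ^ m, fun p q => ?_⟩
    simp only [e, norm_prod]
    rw [integral_fintype_prod_volume_eq_prod (fun i (s : ℝ) => ‖(((2 * Real.pi)⁻¹ : ℝ) : ℂ) *
      (Complex.exp (-(Complex.I * s * x i)) * quadElem (p i) (q i) s)‖)]
    have h1 : ∀ i, ∫ s : ℝ, ‖(((2 * Real.pi)⁻¹ : ℝ) : ℂ) *
        (Complex.exp (-(Complex.I * s * x i)) * quadElem (p i) (q i) s)‖ ≤ C * (S ^ p i * S ^ q i) := fun i => by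
      simp only [norm_mul, norm_exp_neg_I_mul, one_mul, Complex.norm_real]
      rw [integral_const_mul, Real.norm_of_nonneg (by positivity), ← pow_add]
      refine le_trans ?_ (hCS (p i + q i))
      refine le_trans (mul_le_of_le_one_left (integral_nonneg fun _ => norm_nonneg _) ?_)
        (integral_norm_quadElem_le _ _)
      refine inv_le_one_of_one_le₀ ?_
      linarith [Real.pi_gt_three]
    refine (Finset.prod_le_prod (fun i _ => integral_nonneg fun _ => norm_nonneg _) fun i _ => h1 i).trans_eq ?_
    rw [Finset.prod_mul_distrib, Finset.prod_mul_distrib, Finset.prod_const, Finset.card_univ, Fintype.card_fin,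
      Finset.prod_pow_eq_pow_sum, Finset.prod_pow_eq_pow_sum, deg, deg]
  · simp only [e]
    rw [integral_fintype_prod_volume_eq_prod (fun i (s : ℝ) => (((2 * Real.pi)⁻¹ : ℝ) : ℂ) *
      (Complex.exp (-(Complex.I * s * x i)) * quadElem (p i) (q i) s)), homodyne]
    refine Finset.prod_congr rfl fun i _ => ?_
    rw [hermiteFn_mul, integral_const_mul]

/-- If the variance along `x` vanished, the uncertainty relation against `s • u`, with `u` the
quarter turn of `x`, would read `s |x|² ≤ s² V(u, u)`, which fails for small positive `s`. -/
theorem IsGaussian.isPosForm {n : ℕ} {ρ : FockMatrix n} {d V} (h : IsGaussian ρ d V) : IsPosForm (covForm V) :=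
  ⟨covForm_symm h.symm, fun x hx => by
    refine lt_of_le_of_ne (h.covForm_nonneg x) fun h0 => ?_
    set u : Fin n × Fin 2 → ℝ := fun i => if i.2 = 0 then -x (i.1, 1) else x (i.1, 0)
    have hu : ∀ s : ℝ, sympl x (s • u) = s * (x ⬝ᵥ x) := fun s => by
      rw [dotProduct, Fintype.sum_prod_type, Finset.mul_sum]
      refine Finset.sum_congr rfl fun i _ => ?_
      rw [Fin.sum_univ_two]
      simp [u]; ring
    have hx' := dotProduct_self_pos hx
    have hu0 := h.covForm_nonneg u
    have hs := fun s : ℝ => h.sympl_le x (s • u)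
    simp only [hu, ← h0, zero_add, map_smul, LinearMap.smul_apply, smul_eq_mul] at hs
    have h1 := hs ((x ⬝ᵥ x) / (2 * (covForm V u u + 1)))
    have hp : 0 < covForm V u u + 1 := by linarith
    have h2 : (x ⬝ᵥ x) / (2 * (covForm V u u + 1)) * (x ⬝ᵥ x) =
        2 * (covForm V u u + 1) * ((x ⬝ᵥ x) / (2 * (covForm V u u + 1))) ^ 2 := by
      field_simp
    rw [h2] at h1
    have h3 : 0 < ((x ⬝ᵥ x) / (2 * (covForm V u u + 1))) ^ 2 := by positivity
    nlinarith⟩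

theorem IsGaussian.charFn_eq' {n : ℕ} {ρ : FockMatrix n} {d V} (h : IsGaussian ρ d V) (ξ : Fin n × Fin 2 → ℝ) :
    charFn ρ ξ = Complex.exp (Complex.I * ((ξ ⬝ᵥ d : ℝ) : ℂ) - ((covForm V ξ ξ : ℝ) : ℂ) / 2) := by
  rw [h.charFn_eq, covForm_apply]

theorem IsGaussian.integrable_charFn {n : ℕ} {ρ : FockMatrix n} {d V} (h : IsGaussian ρ d V) :
    Integrable (charFn ρ) := by
  classical
  have := h.isPosForm.integral_exp.1
  refine this.mono h.isState.isTame.measurable_charFn.aestronglyMeasurable (ae_of_all _ fun ξ => ?_)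
  rw [h.charFn_eq', norm_exp_gaussian, Complex.norm_exp]
  simp [neg_div]

/-- Weyl inversion of the displaced state: the displacement is a phase in the weight, and the
reflected argument comes from the inversion formula. -/
theorem isWeylIntegral_generalDyne {m : ℕ} {Λ : FockMatrix m} {d V} (h : IsGaussian Λ d V) (α : Fin m → ℂ) :
    IsWeylIntegral volume (generalDyne Λ α) (fun ξ => ((((Real.pi ^ m)⁻¹ * ((2 * Real.pi) ^ m)⁻¹ : ℝ)) : ℂ) *
      (Complex.exp (Complex.I * ((ξ ⬝ᵥ meanShift α : ℝ) : ℂ)) * charFn Λ ξ)) fun ξ => -ξ := by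
  have hG := h.isGeo.conjBy (isGeoOp_displacement α)
  have hc : ∀ ξ, Complex.exp (Complex.I * ((ξ ⬝ᵥ meanShift α : ℝ) : ℂ)) * charFn Λ ξ =
      charFn (conjBy (displacement α) Λ) ξ := fun ξ => (h.isGeo.charFn_displacement α ξ).symm
  have hn : ∀ ξ, ‖charFn (conjBy (displacement α) Λ) ξ‖ = ‖charFn Λ ξ‖ := fun ξ => by
    rw [← hc, norm_mul, mul_comm Complex.I, Complex.norm_exp_ofReal_mul_I, one_mul]
  have hi : Integrable (charFn (conjBy (displacement α) Λ)) :=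
    h.integrable_charFn.mono hG.isTame.measurable_charFn.aestronglyMeasurable (ae_of_all _ fun ξ => (hn ξ).le)
  simp only [hc]
  refine ⟨fun p q => integrable_mul_weyl (hi.const_mul _) measurable_neg p q, fun S hS => ?_, fun p q => ?_⟩
  · refine ⟨∫ ξ, ‖((((Real.pi ^ m)⁻¹ * ((2 * Real.pi) ^ m)⁻¹ : ℝ)) : ℂ) * charFn (conjBy (displacement α) Λ) ξ‖,
      fun p q => ?_⟩
    have h1 : 1 ≤ S ^ deg p * S ^ deg q := by
      rw [← pow_add]; exact one_le_pow₀ hS.le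
    refine le_trans ?_ (le_mul_of_one_le_right (integral_nonneg fun _ => norm_nonneg _) h1)
    refine integral_mono (integrable_mul_weyl (hi.const_mul _) measurable_neg p q).norm (hi.const_mul _).norm fun ξ => ?_
    simp only [norm_mul _ (weyl _ _ _)]
    exact mul_le_of_le_one_right (norm_nonneg _) (norm_weyl_le _ _ _)
  · rw [generalDyne, hG.isTame.eq_integral hi, ← mul_assoc, ← Complex.ofReal_mul, ← integral_const_mul]
    exact integral_congr_ae (ae_of_all _ fun ξ => by ring)

/-! ### Gaussian families of unnormalised states -/

/-- `joinPhase` as a linear map. -/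
def joinPhaseL (n m : ℕ) : ((Fin n × Fin 2 → ℝ) × (Fin m × Fin 2 → ℝ)) →ₗ[ℝ] (Fin (n + m) × Fin 2 → ℝ) where
  toFun p := joinPhase p.1 p.2
  map_add' p q := by
    funext ⟨i, j⟩
    refine Fin.addCases (fun a => ?_) (fun a => ?_) i <;> simp [joinPhase]
  map_smul' c p := by
    funext ⟨i, j⟩
    refine Fin.addCases (fun a => ?_) (fun a => ?_) i <;> simp [joinPhase]

theorem joinPhase_dotProduct {n m : ℕ} (ξ ξ' : Fin n × Fin 2 → ℝ) (η η' : Fin m × Fin 2 → ℝ) :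
    joinPhase ξ η ⬝ᵥ joinPhase ξ' η' = ξ ⬝ᵥ ξ' + η ⬝ᵥ η' := by
  simp only [dotProduct, Fintype.sum_prod_type, Fin.sum_univ_add, joinPhase, Fin.append_left, Fin.append_right]

theorem sympl_joinPhase {n m : ℕ} (ξ ξ' : Fin n × Fin 2 → ℝ) (η η' : Fin m × Fin 2 → ℝ) :
    sympl (joinPhase ξ η) (joinPhase ξ' η') = sympl ξ ξ' + sympl η η' := by
  simp only [sympl, Fin.sum_univ_add, joinPhase, Fin.append_left, Fin.append_right]

theorem joinPhase_fst_snd {n m : ℕ} (ζ : Fin (n + m) × Fin 2 → ℝ) : joinPhase (fstPhase ζ) (sndPhase ζ) = ζ := by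
  funext ⟨i, j⟩
  refine Fin.addCases (fun a => ?_) (fun a => ?_) i <;> simp [joinPhase, fstPhase, sndPhase]

/-- `fstPhase` as a linear map. -/
def fstPhaseL (n m : ℕ) : (Fin (n + m) × Fin 2 → ℝ) →ₗ[ℝ] (Fin n × Fin 2 → ℝ) where
  toFun := fstPhase
  map_add' _ _ := rfl
  map_smul' _ _ := rfl

/-- `sndPhase` as a linear map. -/
def sndPhaseL (n m : ℕ) : (Fin (n + m) × Fin 2 → ℝ) →ₗ[ℝ] (Fin m × Fin 2 → ℝ) where
  toFun := sndPhase
  map_add' _ _ := rfl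
  map_smul' _ _ := rfl

/-- The characteristic functions of the family `F` are `c(y) exp(i ℓ_y(ξ) - B(ξ, ξ) / 2)`. -/
structure IsGaussianFamily {r n : ℕ} (F : (Fin r → ℝ) → FockMatrix n)
    (B : LinearMap.BilinForm ℝ (Fin n × Fin 2 → ℝ)) : Prop where
  isGeo : ∀ y, IsGeo (F y)
  isPosForm : IsPosForm B
  charFn_eq : ∃ (c : (Fin r → ℝ) → ℂ) (ℓ : (Fin r → ℝ) → ((Fin n × Fin 2 → ℝ) →ₗ[ℝ] ℝ)),
    Integrable c ∧ (∀ ξ, Measurable fun y => ℓ y ξ) ∧ ∀ y ξ,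
      charFn (F y) ξ = c y * Complex.exp (Complex.I * ((ℓ y ξ : ℝ) : ℂ) - ((B ξ ξ : ℝ) : ℂ) / 2)

theorem IsPosForm.comp_injective {E E' : Type*} [AddCommGroup E] [Module ℝ E] [AddCommGroup E'] [Module ℝ E']
    {B : LinearMap.BilinForm ℝ E} (h : IsPosForm B) {f : E' →ₗ[ℝ] E} (hf : Function.Injective f) :
    IsPosForm (B.compl₁₂ f f) :=
  ⟨fun x y => h.symm _ _, fun x hx => h.pos _ fun h0 => hx (hf (by rw [h0, map_zero]))⟩

/-- `ξ ↦ ξ ⬝ᵥ d` as a linear map. -/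
def dotL {ι : Type*} [Fintype ι] (d : ι → ℝ) : (ι → ℝ) →ₗ[ℝ] ℝ where
  toFun ξ := ξ ⬝ᵥ d
  map_add' _ _ := add_dotProduct _ _ _
  map_smul' _ _ := by simp

theorem dotL_apply {ι : Type*} [Fintype ι] (d ξ : ι → ℝ) : dotL d ξ = ξ ⬝ᵥ d := rfl

theorem compl₁₂_apply' {E E' : Type*} [AddCommGroup E] [Module ℝ E] [AddCommGroup E'] [Module ℝ E']
    (B : LinearMap.BilinForm ℝ E) (f : E' →ₗ[ℝ] E) (x y : E') : B.compl₁₂ f f x y = B (f x) (f y) := rfl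

theorem pullback_injective {n : ℕ} {u : Matrix (Fin n) (Fin n) ℂ} (hu : u ∈ Matrix.unitaryGroup (Fin n) ℂ) :
    Function.Injective (pullback u) := fun ξ η h => by
  have h1 := congrArg toComplex h
  rw [toComplex_pullback, toComplex_pullback] at h1
  have h2 := congrArg u.mulVec h1
  have h3 : u * u.conjTranspose = 1 := Matrix.mem_unitaryGroup_iff.1 hu
  rw [Matrix.mulVec_mulVec, Matrix.mulVec_mulVec, h3, Matrix.one_mulVec, Matrix.one_mulVec] at h2
  rw [← ofComplex_toComplex ξ, h2, ofComplex_toComplex]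

theorem IsGaussianFamily.tensor {r n m : ℕ} {F : (Fin r → ℝ) → FockMatrix n} {B} (h : IsGaussianFamily F B)
    {τ : FockMatrix m} {d V} (hτ : IsGaussian τ d V) :
    IsGaussianFamily (fun y => FockMatrix.tensor (F y) τ)
      (B.compl₁₂ (fstPhaseL n m) (fstPhaseL n m) + (covForm V).compl₁₂ (sndPhaseL n m) (sndPhaseL n m)) := by
  obtain ⟨c, ℓ, hc, hℓ, hF⟩ := h.charFn_eq
  refine ⟨fun y => (h.isGeo y).tensor hτ.isGeo, ⟨fun x y => ?_, fun x hx => ?_⟩, c,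
    fun y => ℓ y ∘ₗ fstPhaseL n m + dotL d ∘ₗ sndPhaseL n m, hc, fun ξ => ?_, fun y ξ => ?_⟩
  · simp only [LinearMap.add_apply, compl₁₂_apply']
    rw [h.isPosForm.symm, hτ.isPosForm.symm]
  · simp only [LinearMap.add_apply, compl₁₂_apply']
    have h1 := h.isPosForm.nonneg (fstPhaseL n m x)
    have h2 := hτ.isPosForm.nonneg (sndPhaseL n m x)
    by_cases h0 : fstPhaseL n m x = 0
    · have h3 : sndPhaseL n m x ≠ 0 := fun h3 => hx (by
        rw [← joinPhase_fst_snd x, show fstPhase x = 0 from h0, show sndPhase x = 0 from h3]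
        exact (joinPhaseL n m).map_zero)
      linarith [hτ.isPosForm.pos _ h3]
    · linarith [h.isPosForm.pos _ h0]
  · exact (hℓ _).add_const _
  · rw [(h.isGeo y).charFn_tensor hτ.isGeo, hF, hτ.charFn_eq', mul_assoc, ← Complex.exp_add]
    simp only [LinearMap.add_apply, compl₁₂_apply', LinearMap.comp_apply, dotL_apply,
      show fstPhaseL n m ξ = fstPhase ξ from rfl, show sndPhaseL n m ξ = sndPhase ξ from rfl]
    push_cast
    ring_nf

theorem IsGaussianFamily.passive {r n : ℕ} {F : (Fin r → ℝ) → FockMatrix n} {B} (h : IsGaussianFamily F B)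
    {u : Matrix (Fin n) (Fin n) ℂ} (hu : u ∈ Matrix.unitaryGroup (Fin n) ℂ) :
    IsGaussianFamily (fun y => FockMatrix.conjBy (FockMatrix.passive u) (F y)) (B.compl₁₂ (pullback u) (pullback u)) := by
  obtain ⟨c, ℓ, hc, hℓ, hF⟩ := h.charFn_eq
  refine ⟨fun y => (h.isGeo y).conjBy (isGeoOp_passive hu), h.isPosForm.comp_injective (pullback_injective hu), c,
    fun y => ℓ y ∘ₗ pullback u, hc, fun ξ => hℓ _, fun y ξ => ?_⟩
  rw [(h.isGeo y).charFn_passive hu, hF]; rfl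

theorem meanShift_add {n : ℕ} (α β : Fin n → ℂ) : meanShift (α + β) = meanShift α + meanShift β := by
  funext ⟨i, j⟩
  fin_cases j <;> simp [meanShift, ofComplex, mul_add]

theorem continuous_meanShift {n : ℕ} : Continuous (meanShift : (Fin n → ℂ) → _) := by
  refine continuous_pi fun ⟨i, j⟩ => ?_
  fin_cases j <;> simp [meanShift, ofComplex] <;> fun_prop

theorem IsGaussianFamily.displace {r n : ℕ} {F : (Fin r → ℝ) → FockMatrix n} {B} (h : IsGaussianFamily F B)
    (δ : Fin n → ℂ) (G : (Fin r → ℝ) →ₗ[ℝ] (Fin n → ℂ)) :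
    IsGaussianFamily (fun y => FockMatrix.conjBy (displacement (δ + G y)) (F y)) B := by
  obtain ⟨c, ℓ, hc, hℓ, hF⟩ := h.charFn_eq
  refine ⟨fun y => (h.isGeo y).conjBy (isGeoOp_displacement _), h.isPosForm, c,
    fun y => ℓ y + dotL (meanShift (δ + G y)), hc, fun ξ => (hℓ _).add ?_, fun y ξ => ?_⟩
  · have h1 : Continuous fun y => meanShift (δ + G y) :=
      continuous_meanShift.comp (continuous_const.add (LinearMap.continuous_of_finiteDimensional G))
    have h2 : Continuous fun y => ξ ⬝ᵥ meanShift (δ + G y) := by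
      simp only [dotProduct]; fun_prop
    exact h2.measurable
  · rw [(h.isGeo y).charFn_displacement, hF, LinearMap.add_apply, dotL_apply, mul_left_comm, ← Complex.exp_add]
    push_cast
    ring_nf

theorem joinPhaseL_injective (n m : ℕ) : Function.Injective (joinPhaseL n m) := fun p q h => by
  have h1 := congrArg fstPhase h
  have h2 := congrArg sndPhase h
  simp only [joinPhaseL, LinearMap.coe_mk, AddHom.coe_mk, fstPhase_joinPhase, sndPhase_joinPhase] at h1 h2
  exact Prod.ext h1 h2

theorem IsGaussianFamily.discard {r n m : ℕ} {F : (Fin r → ℝ) → FockMatrix (n + m)} {B} (h : IsGaussianFamily F B) :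
    IsGaussianFamily (fun y => FockMatrix.partialTrace (F y))
      (B.compl₁₂ (joinPhaseL n m ∘ₗ LinearMap.inl ℝ _ _) (joinPhaseL n m ∘ₗ LinearMap.inl ℝ _ _)) := by
  obtain ⟨c, ℓ, hc, hℓ, hF⟩ := h.charFn_eq
  refine ⟨fun y => (h.isGeo y).partialTrace,
    h.isPosForm.comp_injective ((joinPhaseL_injective n m).comp LinearMap.inl_injective), c,
    fun y => ℓ y ∘ₗ joinPhaseL n m ∘ₗ LinearMap.inl ℝ _ _, hc, fun ξ => hℓ _, fun y ξ => ?_⟩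
  rw [(h.isGeo y).charFn_partialTrace, hF]; rfl

/-! ### Gaussian measurements -/

/-- The stationary point of a positive form in the last variables. -/
theorem IsPosForm.exists_orthogonal {E T : Type*} [AddCommGroup E] [Module ℝ E] [AddCommGroup T] [Module ℝ T]
    [FiniteDimensional ℝ T] {B : LinearMap.BilinForm ℝ (E × T)} (h : IsPosForm B) :
    ∃ L : E →ₗ[ℝ] T, ∀ x t, B (x, L x) (0, t) = 0 := by
  set D : T →ₗ[ℝ] Module.Dual ℝ T := B.compl₁₂ (LinearMap.inr ℝ E T) (LinearMap.inr ℝ E T) with hD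
  -- Positivity makes the restriction of `B` to the last variables an isomorphism onto the dual, so
  -- the linear equation for the stationary point is solvable.
  have hD' : ∀ s t, D s t = B (0, s) (0, t) := fun s t => rfl
  have hinj : Function.Injective D := by
    rw [injective_iff_map_eq_zero]
    intro s hs
    by_contra h0
    have h1 := h.pos (0, s) (by simpa using h0)
    rw [← hD', hs] at h1
    simp at h1
  have hbij := LinearMap.linearEquivOfInjective D hinj (Subspace.dual_finrank_eq).symm
  set e := LinearMap.linearEquivOfInjective D hinj (Subspace.dual_finrank_eq).symm
  set M : E →ₗ[ℝ] Module.Dual ℝ T := B.compl₁₂ (LinearMap.inl ℝ E T) (LinearMap.inr ℝ E T) with hM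
  refine ⟨-(e.symm.toLinearMap ∘ₗ M), fun x t => ?_⟩
  have h1 : D (e.symm (M x)) = M x := e.apply_symm_apply (M x)
  have h2 : B (0, e.symm (M x)) (0, t) = B (x, 0) (0, t) := by
    rw [← hD', h1]; rfl
  have h3 : ((x, (-(e.symm.toLinearMap ∘ₗ M)) x) : E × T) = (x, 0) - (0, e.symm (M x)) := by
    simp
  rw [h3, map_sub, LinearMap.sub_apply, h2, sub_self]

/-- Completing the square. -/
theorem apply_add_of_orthogonal {E T : Type*} [AddCommGroup E] [Module ℝ E] [AddCommGroup T] [Module ℝ T]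
    {B : LinearMap.BilinForm ℝ (E × T)} (h : IsPosForm B) {L : E →ₗ[ℝ] T} (hL : ∀ x t, B (x, L x) (0, t) = 0)
    (x : E) (s : T) : B (x, s + L x) (x, s + L x) = B (x, L x) (x, L x) + B (0, s) (0, s) := by
  have h3 : ((x, s + L x) : E × T) = (x, L x) + (0, s) := by simp [add_comm]
  have h4 : B (0, s) (x, L x) = 0 := by rw [h.symm]; exact hL x s
  rw [h3]
  simp only [map_add, LinearMap.add_apply, hL, h4]
  ring

/-- The form after a measurement of the last modes. -/
def measuredForm {n m : ℕ} {T : Type*} [AddCommGroup T] [Module ℝ T]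
    (B : LinearMap.BilinForm ℝ (Fin (n + m) × Fin 2 → ℝ)) (Q : LinearMap.BilinForm ℝ T)
    (ι : T →ₗ[ℝ] (Fin m × Fin 2 → ℝ)) : LinearMap.BilinForm ℝ ((Fin n × Fin 2 → ℝ) × T) :=
  B.compl₁₂ (joinPhaseL n m ∘ₗ LinearMap.id.prodMap ι) (joinPhaseL n m ∘ₗ LinearMap.id.prodMap ι) +
    Q.compl₁₂ (LinearMap.snd ℝ _ _) (LinearMap.snd ℝ _ _)

theorem measuredForm_apply {n m : ℕ} {T : Type*} [AddCommGroup T] [Module ℝ T]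
    (B : LinearMap.BilinForm ℝ (Fin (n + m) × Fin 2 → ℝ)) (Q : LinearMap.BilinForm ℝ T)
    (ι : T →ₗ[ℝ] (Fin m × Fin 2 → ℝ)) (x y : (Fin n × Fin 2 → ℝ) × T) :
    measuredForm B Q ι x y = B (joinPhase x.1 (ι x.2)) (joinPhase y.1 (ι y.2)) + Q x.2 y.2 := rfl

theorem isPosForm_measuredForm {n m : ℕ} {T : Type*} [AddCommGroup T] [Module ℝ T]
    {B : LinearMap.BilinForm ℝ (Fin (n + m) × Fin 2 → ℝ)} (hB : IsPosForm B) {Q : LinearMap.BilinForm ℝ T}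
    (hQ : ∀ s t, Q s t = Q t s) (hQ0 : ∀ s, 0 ≤ Q s s) {ι : T →ₗ[ℝ] (Fin m × Fin 2 → ℝ)}
    (hι : Function.Injective ι) : IsPosForm (measuredForm (n := n) B Q ι) := by
  refine ⟨fun x y => by rw [measuredForm_apply, measuredForm_apply, hB.symm, hQ], fun x hx => ?_⟩
  rw [measuredForm_apply]
  have h1 : joinPhase x.1 (ι x.2) ≠ 0 := fun h0 => hx (by
    have := joinPhaseL_injective n m (a₁ := (x.1, ι x.2)) (a₂ := 0) (by rw [map_zero]; exact h0)
    have h2 := (Prod.ext_iff.1 this)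
    exact Prod.ext h2.1 (hι (by rw [show ι x.2 = 0 from h2.2]; simp)))
  linarith [hB.pos _ h1, hQ0 x.2]

/-- Splitting a record of outcomes preserves Lebesgue measure. -/
theorem measurePreserving_splitRecord (r s : ℕ) : MeasurePreserving
    (fun y : Fin (r + s) → ℝ => ((fun i => y (Fin.castAdd s i), fun j => y (Fin.natAdd r j)) :
      (Fin r → ℝ) × (Fin s → ℝ))) := by
  have h1 := volume_measurePreserving_piCongrLeft (fun _ : Fin r ⊕ Fin s => ℝ) finSumFinEquiv.symm
  have h2 := volume_measurePreserving_sumPiEquivProdPi (fun _ : Fin r ⊕ Fin s => ℝ)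
  have h3 := h2.comp h1
  refine Eq.mp (congrArg (fun f => MeasurePreserving f volume volume) (funext fun y => ?_)) h3
  refine Prod.ext (funext fun i => ?_) (funext fun j => ?_)
  · have := MeasurableEquiv.piCongrLeft_apply_apply (β := fun _ : Fin r ⊕ Fin s => ℝ) finSumFinEquiv.symm y (Fin.castAdd s i)
    simpa [MeasurableEquiv.coe_sumPiEquivProdPi] using this
  · have := MeasurableEquiv.piCongrLeft_apply_apply (β := fun _ : Fin r ⊕ Fin s => ℝ) finSumFinEquiv.symm y (Fin.natAdd r j)
    simpa [MeasurableEquiv.coe_sumPiEquivProdPi] using this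

/-- For a fixed earlier record the Gaussian is a translate in the new outcomes, so its integral does
not depend on that record and Fubini leaves the norm of `c`. -/
theorem integrable_mul_gaussian {r s : ℕ} {κ : Type*} [Fintype κ] [DecidableEq κ] {c : (Fin r → ℝ) → ℂ}
    (hc : Integrable c) {a : (Fin r → ℝ) → κ → ℝ} (ha : Measurable a) {A : (Fin s → ℝ) →ₗ[ℝ] (κ → ℝ)}
    (hA : Function.Bijective A) {M : Matrix κ κ ℝ} (hM : M.det ≠ 0) :
    Integrable fun y : Fin (r + s) → ℝ => c (fun i => y (Fin.castAdd s i)) *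
      ((Real.exp (-(M.mulVec (a (fun i => y (Fin.castAdd s i)) + A fun j => y (Fin.natAdd r j)) ⬝ᵥ
        M.mulVec (a (fun i => y (Fin.castAdd s i)) + A fun j => y (Fin.natAdd r j))) / 2) : ℝ) : ℂ) := by
  set e := LinearEquiv.ofBijective A hA with he
  set f : (Fin s → ℝ) → ℂ := fun x => ((Real.exp (-(M.mulVec (A x) ⬝ᵥ M.mulVec (A x)) / 2) : ℝ) : ℂ) with hf
  have hfi : Integrable f := by
    have hinj : Function.Injective (M.mulVecLin ∘ₗ A) :=
      (Matrix.mulVec_injective_iff_isUnit.2 ((Matrix.isUnit_iff_isUnit_det _).2 hM.isUnit)).comp hA.1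
    have h1 : IsPosForm (covForm (1 : Matrix κ κ ℝ)) := ⟨covForm_symm Matrix.transpose_one, fun x hx => by
      rw [covForm_apply, Matrix.one_mulVec]; exact dotProduct_self_pos hx⟩
    refine (h1.comp_injective hinj).integral_exp.1.congr (ae_of_all _ fun x => ?_)
    simp [hf, covForm_apply]
  have hcont : Continuous fun v : κ → ℝ => ((Real.exp (-(M.mulVec v ⬝ᵥ M.mulVec v) / 2) : ℝ) : ℂ) := by
    simp only [dotProduct, Matrix.mulVec]; fun_prop
  have hAc : Continuous A := LinearMap.continuous_of_finiteDimensional A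
  have htr : ∀ y x, ((Real.exp (-(M.mulVec (a y + A x) ⬝ᵥ M.mulVec (a y + A x)) / 2) : ℝ) : ℂ) =
      f (x + e.symm (a y)) := fun y x => by
    have : A (e.symm (a y)) = a y := e.apply_symm_apply _
    simp only [hf, map_add, this, add_comm (a y)]
  refine ((measurePreserving_splitRecord r s).integrable_comp_of_integrable
    (g := fun p : (Fin r → ℝ) × (Fin s → ℝ) => c p.1 *
      ((Real.exp (-(M.mulVec (a p.1 + A p.2) ⬝ᵥ M.mulVec (a p.1 + A p.2)) / 2) : ℝ) : ℂ)) ?_)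
  have hmeas : AEStronglyMeasurable (fun p : (Fin r → ℝ) × (Fin s → ℝ) => c p.1 *
      ((Real.exp (-(M.mulVec (a p.1 + A p.2) ⬝ᵥ M.mulVec (a p.1 + A p.2)) / 2) : ℝ) : ℂ))
      ((volume : Measure (Fin r → ℝ)).prod volume) :=
    hc.aestronglyMeasurable.comp_fst.mul (hcont.measurable.comp
      ((ha.comp measurable_fst).add (hAc.measurable.comp measurable_snd))).aestronglyMeasurable
  refine (integrable_prod_iff hmeas).2 ⟨ae_of_all _ fun y => ?_, ?_⟩
  · simp only [htr]
    exact (hfi.comp_add_right _).const_mul _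
  · simp only [htr, norm_mul, integral_const_mul]
    have : ∀ y, ∫ x, ‖f (x + e.symm (a y))‖ = ∫ x, ‖f x‖ := fun y =>
      integral_add_right_eq_self (fun x => ‖f x‖) _
    simp only [this]
    exact hc.norm.mul_const _

/-- The measurement is a Gaussian integral over `t`. Shifting `t` to the stationary point `L ξ`
separates the variables: what remains in `ξ` is the form minimised over `t`, and the integral
depends on the record only. The outcome enters the exponent linearly, hence the new form is the same
for all records. -/
theorem IsGaussianFamily.measured {r s n m : ℕ} {F : (Fin r → ℝ) → FockMatrix (n + m)} {B}
    (h : IsGaussianFamily F B) {κ : Type*} [Fintype κ] [DecidableEq κ] {E : (Fin s → ℝ) → FockMatrix m} {K : ℂ}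
    {Q : LinearMap.BilinForm ℝ (κ → ℝ)} {ι : (κ → ℝ) →ₗ[ℝ] (Fin m × Fin 2 → ℝ)} {a₀ : κ → ℝ}
    {A : (Fin s → ℝ) →ₗ[ℝ] (κ → ℝ)} (hA : Function.Bijective A) (hQ : ∀ s t, Q s t = Q t s)
    (hQ0 : ∀ s, 0 ≤ Q s s) (hι : Function.Injective ι)
    (hE : ∀ x, IsWeylIntegral volume (E x) (fun t => K * Complex.exp (Complex.I * ((t ⬝ᵥ (a₀ + A x) : ℝ) : ℂ) -
      ((Q t t : ℝ) : ℂ) / 2)) ι) :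
    ∃ L : (Fin n × Fin 2 → ℝ) →ₗ[ℝ] (κ → ℝ), IsGaussianFamily
      (fun y : Fin (r + s) → ℝ => FockMatrix.measured (E fun j => y (Fin.natAdd r j)) (F fun i => y (Fin.castAdd s i)))
      ((measuredForm B Q ι).compl₁₂ (LinearMap.id.prod L) (LinearMap.id.prod L)) := by
  obtain ⟨c, ℓ, hc, hℓ, hF⟩ := h.charFn_eq
  have hP := isPosForm_measuredForm (n := n) h.isPosForm hQ hQ0 hι
  obtain ⟨L, hL⟩ := hP.exists_orthogonal
  obtain ⟨-, C, M, hC, hM, hint⟩ := (hP.comp_injective (LinearMap.inr_injective (R := ℝ)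
    (M := Fin n × Fin 2 → ℝ) (M₂ := κ → ℝ))).integral_exp
  -- The earlier linear form restricted to the measured directions, written as a vector so that it
  -- can be added to the outcome.
  set a : (Fin r → ℝ) → κ → ℝ := fun y i => ℓ y (joinPhase 0 (ι (Pi.single i 1))) with ha
  have hℓa : ∀ y t, ℓ y (joinPhase 0 (ι t)) = t ⬝ᵥ a y := fun y t => by
    have := LinearMap.pi_apply_eq_sum_univ (ℓ y ∘ₗ joinPhaseL n m ∘ₗ LinearMap.inr ℝ _ _ ∘ₗ ι) t
    refine this.trans ?_
    simp only [dotProduct, smul_eq_mul]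
    refine Finset.sum_congr rfl fun i _ => ?_
    simp only [ha, LinearMap.comp_apply, LinearMap.inr_apply]
    congr 3
    refine congrArg (joinPhaseL n m) (congrArg _ (congrArg ι ?_))
    funext j
    simp [Pi.single_apply, eq_comm]
  refine ⟨L, fun y => (h.isGeo _).measured (hE _),
    hP.comp_injective fun x y hxy => (Prod.ext_iff.1 hxy).1,
    fun y => (K * C) * (c (fun i => y (Fin.castAdd s i)) *
      ((Real.exp (-(M.mulVec ((a₀ + a (fun i => y (Fin.castAdd s i))) + A fun j => y (Fin.natAdd r j)) ⬝ᵥ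
        M.mulVec ((a₀ + a (fun i => y (Fin.castAdd s i))) + A fun j => y (Fin.natAdd r j))) / 2) : ℝ) : ℂ)),
    fun y => ℓ (fun i => y (Fin.castAdd s i)) ∘ₗ joinPhaseL n m ∘ₗ LinearMap.id.prodMap ι ∘ₗ LinearMap.id.prod L +
      dotL (a₀ + A fun j => y (Fin.natAdd r j)) ∘ₗ L, ?_, fun ξ => ?_, fun y ξ => ?_⟩
  · exact (integrable_mul_gaussian hc (measurable_const.add (measurable_pi_lambda _ fun i => hℓ _)) hA hM).const_mul _
  · refine ((hℓ _).comp ?_).add ?_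
    · fun_prop
    · have hAc : Continuous A := LinearMap.continuous_of_finiteDimensional A
      have : Continuous fun y : Fin (r + s) → ℝ => (L ξ) ⬝ᵥ (a₀ + A fun j => y (Fin.natAdd r j)) := by
        simp only [dotProduct]; fun_prop
      exact this.measurable
  · rw [(h.isGeo _).charFn_measured (hE _)]
    simp only [hF]
    rw [← integral_add_right_eq_self _ (L ξ)]
    generalize (fun i => y (Fin.castAdd s i)) = y₁
    generalize (fun j => y (Fin.natAdd r j)) = y₂
    have key : ∀ t, K * Complex.exp (Complex.I * (((t + L ξ) ⬝ᵥ (a₀ + A y₂) : ℝ) : ℂ) -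
        ((Q (t + L ξ) (t + L ξ) : ℝ) : ℂ) / 2) * (c y₁ * Complex.exp (Complex.I *
          ((ℓ y₁ (joinPhase ξ (ι (t + L ξ))) : ℝ) : ℂ) -
            ((B (joinPhase ξ (ι (t + L ξ))) (joinPhase ξ (ι (t + L ξ))) : ℝ) : ℂ) / 2)) =
        (K * (c y₁ * Complex.exp (Complex.I * ((ℓ y₁ (joinPhase ξ (ι (L ξ))) + L ξ ⬝ᵥ (a₀ + A y₂) : ℝ) : ℂ) -
          ((measuredForm B Q ι (ξ, L ξ) (ξ, L ξ) : ℝ) : ℂ) / 2))) *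
        Complex.exp (Complex.I * ((t ⬝ᵥ ((a₀ + a y₁) + A y₂) : ℝ) : ℂ) -
          (((measuredForm B Q ι).compl₁₂ (LinearMap.inr ℝ (Fin n × Fin 2 → ℝ) (κ → ℝ))
            (LinearMap.inr ℝ (Fin n × Fin 2 → ℝ) (κ → ℝ)) t t : ℝ) : ℂ) / 2) := fun t => by
      have e1 := apply_add_of_orthogonal hP hL ξ t
      rw [measuredForm_apply] at e1
      have e2 : ℓ y₁ (joinPhase ξ (ι (t + L ξ))) = ℓ y₁ (joinPhase ξ (ι (L ξ))) + t ⬝ᵥ a y₁ := by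
        rw [← hℓa, ← map_add]
        congr 1
        have := (joinPhaseL n m).map_add (ξ, ι (L ξ)) (0, ι t)
        refine Eq.trans ?_ this
        rw [map_add, Prod.mk_add_mk, add_zero, add_comm (ι t)]; rfl
      rw [e2, compl₁₂_apply', LinearMap.inr_apply]
      calc _ = K * c y₁ * (Complex.exp (Complex.I * (((t + L ξ) ⬝ᵥ (a₀ + A y₂) : ℝ) : ℂ) -
            ((Q (t + L ξ) (t + L ξ) : ℝ) : ℂ) / 2) * Complex.exp (Complex.I *
              ((ℓ y₁ (joinPhase ξ (ι (L ξ))) + t ⬝ᵥ a y₁ : ℝ) : ℂ) -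
            ((B (joinPhase ξ (ι (t + L ξ))) (joinPhase ξ (ι (t + L ξ))) : ℝ) : ℂ) / 2)) := by ring
        _ = K * c y₁ * (Complex.exp (Complex.I * ((ℓ y₁ (joinPhase ξ (ι (L ξ))) + L ξ ⬝ᵥ (a₀ + A y₂) : ℝ) : ℂ) -
              ((measuredForm B Q ι (ξ, L ξ) (ξ, L ξ) : ℝ) : ℂ) / 2) *
            Complex.exp (Complex.I * ((t ⬝ᵥ ((a₀ + a y₁) + A y₂) : ℝ) : ℂ) -
              ((measuredForm B Q ι (0, t) (0, t) : ℝ) : ℂ) / 2)) := by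
          rw [← Complex.exp_add, ← Complex.exp_add]
          congr 2
          have e3 := congrArg (fun x : ℝ => (x : ℂ)) e1
          simp only [Complex.ofReal_add] at e3
          simp only [add_dotProduct, dotProduct_add]
          push_cast
          linear_combination (-1 / 2 : ℂ) * e3
        _ = _ := by ring
    simp only [key]
    rw [integral_const_mul, hint]
    simp only [LinearMap.add_apply, LinearMap.comp_apply, dotL_apply, compl₁₂_apply']
    push_cast
    have e4 : joinPhaseL n m (LinearMap.id.prodMap ι (LinearMap.id.prod L ξ)) = joinPhase ξ (ι (L ξ)) := rfl
    have e5 : (LinearMap.id.prod L) ξ = (ξ, L ξ) := rfl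
    rw [e4, e5]
    ring

/-! ### Mixtures of states -/

section Mixture

variable {n : ℕ} {T : Type*} [MeasurableSpace T] {μ : Measure T} {X : T → FockMatrix n} {σ : FockMatrix n}

theorem IsState.norm_entry_le {ρ : FockMatrix n} (h : IsState ρ) (k l : Fin n → ℕ) : ‖ρ k l‖ ≤ 1 := by
  have h1 := h.normSq_le k l
  have h2 := h.sum_diag_le {k}
  have h3 := h.sum_diag_le {l}
  rw [Finset.sum_singleton] at h2 h3
  have := (h.diag_re k).1
  have := (h.diag_re l).1
  nlinarith [norm_nonneg (ρ k l)]

theorem integrable_entry [IsProbabilityMeasure μ] (hX : ∀ t, IsState (X t)) (hm : ∀ k l, Measurable fun t => X t k l)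
    (k l : Fin n → ℕ) : Integrable (fun t => X t k l) μ :=
  Integrable.of_bound (hm k l).aestronglyMeasurable 1 (ae_of_all _ fun t => (hX t).norm_entry_le k l)

theorem measurable_charFn_mixture (hX : ∀ t, IsState (X t)) (hm : ∀ k l, Measurable fun t => X t k l)
    (ξ : Fin n × Fin 2 → ℝ) : Measurable fun t => charFn (X t) ξ :=
  measurable_tsum_complex (fun k => measurable_tsum_complex (fun l => (hm k l).mul_const _)
    fun t => ((hX t).row_aux k ξ).1.of_norm) fun t => ((hX t).isTame.summable_charFn ξ).of_norm

/-- The bounds for states are uniform in `t` and permit the exchange even though a mixture need not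
decay geometrically. -/
theorem charFn_mixture [IsProbabilityMeasure μ] (hX : ∀ t, IsState (X t)) (hm : ∀ k l, Measurable fun t => X t k l)
    (hσ : ∀ k l, σ k l = ∫ t, X t k l ∂μ) (ξ : Fin n × Fin 2 → ℝ) : charFn σ ξ = ∫ t, charFn (X t) ξ ∂μ := by
  have hi := integrable_entry (μ := μ) hX hm
  have hrowm : ∀ k, Measurable fun t => ∑' l, X t k l * weyl ξ l k := fun k =>
    measurable_tsum_complex (fun l => (hm k l).mul_const _) fun t => ((hX t).row_aux k ξ).1.of_norm
  have hrow : ∀ k, HasSum (fun l => ∫ t, X t k l * weyl ξ l k ∂μ) (∫ t, ∑' l, X t k l * weyl ξ l k ∂μ) := fun k => by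
    refine hasSum_integral_of_summable_integral_norm (fun l => (hi k l).mul_const _) ?_
    refine summable_of_sum_le (c := 1) (fun l => integral_nonneg fun _ => norm_nonneg _) fun F => ?_
    rw [← integral_finsetSum _ fun l _ => ((hi k l).mul_const _).norm]
    refine (integral_mono (integrable_finsetSum _ fun l _ => ((hi k l).mul_const _).norm) (integrable_const 1)
      fun t => ((hX t).row_aux k ξ).2 F).trans_eq ?_
    simp
  have hb : ∀ k t, ‖∑' l, X t k l * weyl ξ l k‖ ≤ 1 := fun k t => by
    have := (hX t).sum_tsum_le ξ {k}
    rwa [Finset.sum_singleton] at this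
  have hri : ∀ k, Integrable (fun t => ∑' l, X t k l * weyl ξ l k) μ := fun k =>
    Integrable.of_bound (hrowm k).aestronglyMeasurable 1 (ae_of_all _ (hb k))
  have htot : HasSum (fun k => ∫ t, ∑' l, X t k l * weyl ξ l k ∂μ) (∫ t, ∑' k, ∑' l, X t k l * weyl ξ l k ∂μ) := by
    refine hasSum_integral_of_summable_integral_norm hri ?_
    refine summable_of_sum_le (c := 1) (fun l => integral_nonneg fun _ => norm_nonneg _) fun F => ?_
    rw [← integral_finsetSum _ fun k _ => (hri k).norm]
    refine (integral_mono (integrable_finsetSum _ fun k _ => (hri k).norm) (integrable_const 1)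
      fun t => (hX t).sum_tsum_le ξ F).trans_eq ?_
    simp
  refine Eq.trans ?_ htot.tsum_eq
  refine tsum_congr fun k => ?_
  rw [← (hrow k).tsum_eq]
  refine tsum_congr fun l => ?_
  rw [integral_mul_const, hσ]; rfl

open scoped ComplexOrder in
theorem isState_mixture [IsProbabilityMeasure μ] (hX : ∀ t, IsState (X t)) (hm : ∀ k l, Measurable fun t => X t k l)
    (hσ : ∀ k l, σ k l = ∫ t, X t k l ∂μ) : IsState σ := by
  have hi := integrable_entry (μ := μ) hX hm
  refine ⟨⟨?_, fun x => ?_⟩, ?_⟩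
  · ext k l
    rw [Matrix.conjTranspose_apply, hσ, hσ, Complex.star_def, ← integral_conj]
    exact integral_congr_ae (ae_of_all _ fun t => (hX t).posSemidef.1.apply k l)
  · have e : (x.sum fun a xa => x.sum fun b xb => star xa * σ a b * xb) =
        ∫ t, (x.sum fun a xa => x.sum fun b xb => star xa * X t a b * xb) ∂μ := by
      simp only [Finsupp.sum]
      rw [integral_finsetSum _ fun a _ => integrable_finsetSum _ fun b _ => ((hi a b).const_mul _).mul_const _]
      refine Finset.sum_congr rfl fun a _ => ?_
      rw [integral_finsetSum _ fun b _ => ((hi a b).const_mul _).mul_const _]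
      refine Finset.sum_congr rfl fun b _ => ?_
      rw [integral_mul_const, integral_const_mul, hσ]
    rw [e]
    exact integral_nonneg fun t => (hX t).posSemidef.2 x
  · have : HasSum (fun k => ∫ t, X t k k ∂μ) (∫ t, ∑' k, X t k k ∂μ) := by
      refine hasSum_integral_of_summable_integral_norm (fun k => hi k k) ?_
      refine summable_of_sum_le (c := 1) (fun l => integral_nonneg fun _ => norm_nonneg _) fun F => ?_
      rw [← integral_finsetSum _ fun k _ => (hi k k).norm]
      refine (integral_mono (integrable_finsetSum _ fun k _ => (hi k k).norm) (integrable_const 1)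
        fun t => ?_).trans_eq (by simp)
      refine (Finset.sum_le_sum fun k _ => ?_).trans ((hX t).sum_diag_le F)
      rw [((hX t).diag_re k).2, Complex.norm_real, Complex.ofReal_re, Real.norm_of_nonneg ((hX t).diag_re k).1]
    simp only [(hX _).trace_eq_one.tsum_eq, integral_const, probReal_univ, one_smul] at this
    exact this.congr_fun fun k => hσ k k

theorem norm_charFn_mixture_le [IsProbabilityMeasure μ] (hX : ∀ t, IsState (X t))
    (hm : ∀ k l, Measurable fun t => X t k l) (hσ : ∀ k l, σ k l = ∫ t, X t k l ∂μ) {ξ : Fin n × Fin 2 → ℝ} {C : ℝ}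
    (hC : ∀ t, ‖charFn (X t) ξ‖ ≤ C) : ‖charFn σ ξ‖ ≤ C := by
  rw [charFn_mixture hX hm hσ]
  refine (norm_integral_le_integral_norm _).trans ?_
  refine (integral_mono (Integrable.of_bound (measurable_charFn_mixture hX hm ξ).aestronglyMeasurable 1
    (ae_of_all _ fun t => (hX t).norm_charFn_le ξ)).norm (integrable_const C) hC).trans_eq ?_
  simp

end Mixture

/-! ### Coherent states -/

/-- The vacuum state. -/
def vacuum (n : ℕ) : FockMatrix n := fun k l => if k = 0 ∧ l = 0 then 1 else 0

theorem isGeo_vacuum (n : ℕ) : IsGeo (vacuum n) := by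
  refine ⟨1, 1 / 2, zero_le_one, by norm_num, by norm_num, fun k l => ?_⟩
  rw [vacuum]
  split_ifs with h
  · simp [h.1, h.2, deg]
  · rw [norm_zero]; positivity

theorem conjBy_vacuum {n : ℕ} (A : FockMatrix n) (k l : Fin n → ℕ) :
    conjBy A (vacuum n) k l = A k 0 * star (A l 0) := by
  rw [conjBy, tsum_eq_single (0, 0)]
  · simp [vacuum]
  · rintro ⟨a, b⟩ h
    have : ¬ (a = 0 ∧ b = 0) := fun h' => h (by rw [h'.1, h'.2])
    simp [vacuum, this]

theorem charFn_vacuum {n : ℕ} (ξ : Fin n × Fin 2 → ℝ) :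
    charFn (vacuum n) ξ = Real.exp (-(ξ ⬝ᵥ ξ) / 4) := by
  rw [charFn, tsum_eq_single 0, tsum_eq_single 0]
  · have h2 : Real.sqrt 2 ^ 2 = 2 := Real.sq_sqrt (by norm_num)
    have e : ∀ i, ‖weylAmplitude ξ i‖ ^ 2 = (ξ (i, 0) ^ 2 + ξ (i, 1) ^ 2) / 2 := fun i => by
      rw [← Complex.normSq_eq_norm_sq, weylAmplitude]
      simp only [Complex.normSq_div, Complex.normSq_mul, Complex.normSq_I, Complex.normSq_ofReal, one_mul]
      rw [← sq (Real.sqrt 2), h2, Complex.normSq_apply]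
      simp; ring
    simp only [vacuum, and_self, if_true, one_mul, displacement, Pi.zero_apply, dispElem]
    simp only [min_self, zero_add, Finset.range_one, Finset.sum_singleton, Nat.factorial_zero, Nat.sub_self, pow_zero,
      Nat.cast_one, mul_one, Real.sqrt_one, div_one]
    rw [← Complex.ofReal_prod, ← Real.exp_sum]
    congr 2
    simp only [e]
    rw [dotProduct, Fintype.sum_prod_type, ← Finset.sum_neg_distrib, Finset.sum_div]
    refine Finset.sum_congr rfl fun i _ => ?_
    rw [Fin.sum_univ_two]; ring
  · intro l hl; simp [vacuum, hl]
  · intro k hk; simp [vacuum, hk]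

open scoped ComplexOrder in
theorem isState_vacuum (n : ℕ) : IsState (vacuum n) := by
  refine ⟨posSemidef_of_gram fun S => ⟨1, fun _ k => if k = 0 then 1 else 0, fun k _ l _ => ?_⟩, ?_⟩
  · rw [vacuum]
    by_cases hk : k = 0 <;> by_cases hl : l = 0 <;> simp [hk, hl]
  · have := hasSum_ite_eq (0 : Fin n → ℕ) (1 : ℂ)
    refine this.congr_fun fun k => ?_
    simp [vacuum]

theorem isGaussian_vacuum (n : ℕ) : IsGaussian (vacuum n) 0 ((1 / 2 : ℝ) • 1) := by
  refine ⟨isState_vacuum n, Matrix.IsSymm.smul Matrix.isSymm_one _, fun ξ => ?_⟩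
  rw [charFn_vacuum, Matrix.smul_mulVec, Matrix.one_mulVec, dotProduct_smul, dotProduct_zero, Complex.ofReal_exp]
  congr 1
  push_cast
  simp; ring

theorem coherent_eq {n : ℕ} (γ : Fin n → ℂ) (k : Fin n → ℕ) : coherent γ k = displacement γ k 0 := by
  rw [coherent, displacement]
  refine Finset.prod_congr rfl fun i _ => ?_
  simp only [dispElem, Pi.zero_apply, min_zero, zero_add, Finset.range_one, Finset.sum_singleton,
    Nat.factorial_zero, Nat.cast_one, mul_one, Nat.sub_zero, pow_zero, Nat.sub_self, one_mul]
  have h0 : (0 : ℝ) < (k i).factorial := by positivity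
  have h1 : ((Real.sqrt (k i).factorial : ℝ) : ℂ) ≠ 0 := by exact_mod_cast (Real.sqrt_pos.2 h0).ne'
  have h2 : ((k i).factorial : ℂ) = ((Real.sqrt (k i).factorial : ℝ) : ℂ) * ((Real.sqrt (k i).factorial : ℝ) : ℂ) := by
    rw [← Complex.ofReal_mul, Real.mul_self_sqrt h0.le]; simp
  rw [h2]
  push_cast
  field_simp

theorem coherent_mul_star {n : ℕ} (γ : Fin n → ℂ) :
    (fun k l => coherent γ k * star (coherent γ l)) = conjBy (displacement γ) (vacuum n) := by
  funext k l
  rw [conjBy_vacuum, coherent_eq, coherent_eq]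

theorem measurable_coherent {n : ℕ} (k l : Fin n → ℕ) :
    Measurable fun γ : Fin n → ℂ => coherent γ k * star (coherent γ l) := by
  have h : ∀ k, Continuous fun γ : Fin n → ℂ => coherent γ k := fun k => by
    simp only [coherent]; fun_prop
  exact ((h k).mul (h l).star).measurable

/-- Displacement operators preserve states. -/
theorem IsState.conjBy_displacement {n : ℕ} {ρ : FockMatrix n} (h : IsGeo ρ) (hρ : IsState ρ) (α : Fin n → ℂ) :
    IsState (FockMatrix.conjBy (displacement α) ρ) := by
  refine hρ.conjBy (isGeoOp_displacement α) ?_ h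
  rw [sandwich_displacement_one]
  funext k l
  simp [displacement_zero, mul_comm]

theorem isGeo_coherent {n : ℕ} (γ : Fin n → ℂ) : IsGeo (conjBy (displacement γ) (vacuum n)) :=
  (isGeo_vacuum n).conjBy (isGeoOp_displacement γ)

theorem isState_coherent {n : ℕ} (γ : Fin n → ℂ) : IsState (conjBy (displacement γ) (vacuum n)) :=
  (isState_vacuum n).conjBy_displacement (isGeo_vacuum n) γ

theorem norm_charFn_coherent {n : ℕ} (γ : Fin n → ℂ) (ξ : Fin n × Fin 2 → ℝ) :
    ‖charFn (conjBy (displacement γ) (vacuum n)) ξ‖ = Real.exp (-(ξ ⬝ᵥ ξ) / 4) := by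
  rw [(isGeo_vacuum n).charFn_displacement, charFn_vacuum, norm_mul, mul_comm Complex.I, Complex.norm_exp_ofReal_mul_I,
    one_mul, Complex.norm_real, Real.norm_of_nonneg (Real.exp_nonneg _)]

/-- Every coherent state has the modulus of the vacuum, and mixing cannot increase a modulus. -/
theorem IsClassical.norm_charFn_le {n : ℕ} {τ : FockMatrix n} (h : IsClassical τ) (ξ : Fin n × Fin 2 → ℝ) :
    ‖charFn τ ξ‖ ≤ Real.exp (-(ξ ⬝ᵥ ξ) / 4) := by
  obtain ⟨P, hP, h⟩ := h
  have e := fun γ : Fin n → ℂ => congrFun₂ (coherent_mul_star γ)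
  refine norm_charFn_mixture_le (μ := P) isState_coherent (fun k l => ?_) (fun k l => ?_)
    fun γ => (norm_charFn_coherent γ ξ).le
  · simp only [← e]; exact measurable_coherent k l
  · simp only [← e]; exact h k l

theorem IsClassical.le_covForm {n : ℕ} {τ : FockMatrix n} (h : IsClassical τ) {d V} (hG : IsGaussian τ d V)
    (ξ : Fin n × Fin 2 → ℝ) : (ξ ⬝ᵥ ξ) / 2 ≤ covForm V ξ ξ := by
  have := h.norm_charFn_le ξ
  rw [hG.charFn_eq', norm_exp_gaussian, Real.exp_le_exp] at this
  linarith

theorem isClassical_vacuum (n : ℕ) : IsClassical (vacuum n) := by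
  refine ⟨Measure.dirac 0, inferInstance, fun k l => ?_⟩
  rw [integral_dirac, congrFun₂ (coherent_mul_star (0 : Fin n → ℂ)) k l, conjBy_vacuum, displacement_zero]
  by_cases hk : k = 0 <;> by_cases hl : l = 0 <;> simp [vacuum, hk, hl, Matrix.one_apply]

/-! ### Invariants of Gaussian protocols -/

/-- The two inequalities that Gaussian protocols preserve. -/
structure IsBounded {n : ℕ} (B : LinearMap.BilinForm ℝ (Fin n × Fin 2 → ℝ)) (m κ : ℝ) : Prop where
  le : ∀ x, m * (x ⬝ᵥ x) ≤ B x x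
  sympl_le : ∀ x u, κ * sympl u x + (1 - κ) / 2 * (x ⬝ᵥ x) ≤ B x x + κ * B u u

theorem fstPhase_dotProduct {n m : ℕ} (ζ ζ' : Fin (n + m) × Fin 2 → ℝ) :
    ζ ⬝ᵥ ζ' = fstPhase ζ ⬝ᵥ fstPhase ζ' + sndPhase ζ ⬝ᵥ sndPhase ζ' := by
  rw [← joinPhase_dotProduct, joinPhase_fst_snd, joinPhase_fst_snd]

theorem sympl_fst_snd {n m : ℕ} (ζ ζ' : Fin (n + m) × Fin 2 → ℝ) :
    sympl ζ ζ' = sympl (fstPhase ζ) (fstPhase ζ') + sympl (sndPhase ζ) (sndPhase ζ') := by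
  rw [← sympl_joinPhase, joinPhase_fst_snd, joinPhase_fst_snd]

theorem sum_star_mul_toComplex {n : ℕ} (ξ η : Fin n × Fin 2 → ℝ) :
    star (toComplex ξ) ⬝ᵥ toComplex η = ((ξ ⬝ᵥ η : ℝ) : ℂ) + Complex.I * ((sympl ξ η : ℝ) : ℂ) := by
  simp only [dotProduct, sympl, Fintype.sum_prod_type, Fin.sum_univ_two]
  push_cast
  rw [Finset.mul_sum, ← Finset.sum_add_distrib]
  refine Finset.sum_congr rfl fun i _ => ?_
  simp only [toComplex, Pi.star_apply, star_add, star_mul', Complex.star_def, Complex.conj_ofReal, Complex.conj_I]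
  linear_combination -(ξ (i, 1) : ℂ) * (η (i, 1) : ℂ) * Complex.I_mul_I

theorem pullback_invariant {n : ℕ} {u : Matrix (Fin n) (Fin n) ℂ} (hu : u ∈ Matrix.unitaryGroup (Fin n) ℂ)
    (ξ η : Fin n × Fin 2 → ℝ) : pullback u ξ ⬝ᵥ pullback u η = ξ ⬝ᵥ η ∧
      sympl (pullback u ξ) (pullback u η) = sympl ξ η := by
  have h3 : u * u.conjTranspose = 1 := Matrix.mem_unitaryGroup_iff.1 hu
  have h : star (toComplex (pullback u ξ)) ⬝ᵥ toComplex (pullback u η) = star (toComplex ξ) ⬝ᵥ toComplex η := by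
    rw [toComplex_pullback, toComplex_pullback, Matrix.star_mulVec, Matrix.conjTranspose_conjTranspose,
      ← Matrix.dotProduct_mulVec, Matrix.mulVec_mulVec, h3, Matrix.one_mulVec]
  rw [sum_star_mul_toComplex, sum_star_mul_toComplex] at h
  have h1 := congrArg Complex.re h
  have h2 := congrArg Complex.im h
  simp at h1 h2
  exact ⟨h1, h2⟩

theorem sympl_half_le {n : ℕ} (x u : Fin n × Fin 2 → ℝ) : sympl u x ≤ (x ⬝ᵥ x) / 2 + (u ⬝ᵥ u) / 2 := by
  simp only [dotProduct, sympl, Fintype.sum_prod_type, Fin.sum_univ_two, Finset.sum_div]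
  rw [← Finset.sum_add_distrib]
  refine Finset.sum_le_sum fun i _ => ?_
  nlinarith [sq_nonneg (u (i, 0) - x (i, 1)), sq_nonneg (u (i, 1) + x (i, 0))]

/-- A form that is at least one half satisfies both inequalities: the first because `m ≤ 1/2`, the
second because `κ sympl u x ≤ κ |x|²/2 + κ |u|²/2` and `(1 - κ)/2 + κ/2 = 1/2`. -/
theorem IsBounded.tensor {n k : ℕ} {B : LinearMap.BilinForm ℝ (Fin n × Fin 2 → ℝ)} {m κ : ℝ} (h : IsBounded B m κ)
    (hm : m ≤ 1 / 2) (hκ : 0 ≤ κ) {C : LinearMap.BilinForm ℝ (Fin k × Fin 2 → ℝ)} (hC : ∀ x, (x ⬝ᵥ x) / 2 ≤ C x x) :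
    IsBounded (B.compl₁₂ (fstPhaseL n k) (fstPhaseL n k) + C.compl₁₂ (sndPhaseL n k) (sndPhaseL n k)) m κ := by
  refine ⟨fun x => ?_, fun x u => ?_⟩
  · simp only [LinearMap.add_apply, compl₁₂_apply']
    have h1 := h.le (fstPhase x)
    have h2 := hC (sndPhase x)
    have h3 := dotProduct_self_nonneg' (sndPhase x)
    rw [fstPhase_dotProduct (n := n) (m := k)]
    change _ ≤ B (fstPhase x) (fstPhase x) + C (sndPhase x) (sndPhase x)
    nlinarith
  · simp only [LinearMap.add_apply, compl₁₂_apply']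
    have h1 := h.sympl_le (fstPhase x) (fstPhase u)
    have h2 := hC (sndPhase x)
    have h3 := mul_le_mul_of_nonneg_left (hC (sndPhase u)) hκ
    have h4 := mul_le_mul_of_nonneg_left (sympl_half_le (sndPhase x) (sndPhase u)) hκ
    rw [fstPhase_dotProduct (n := n) (m := k), sympl_fst_snd (n := n) (m := k)]
    change _ ≤ B (fstPhase x) (fstPhase x) + C (sndPhase x) (sndPhase x) +
      κ * (B (fstPhase u) (fstPhase u) + C (sndPhase u) (sndPhase u))
    linarith

theorem IsBounded.pullback {n : ℕ} {B : LinearMap.BilinForm ℝ (Fin n × Fin 2 → ℝ)} {m κ : ℝ} (h : IsBounded B m κ)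
    {u : Matrix (Fin n) (Fin n) ℂ} (hu : u ∈ Matrix.unitaryGroup (Fin n) ℂ) :
    IsBounded (B.compl₁₂ (pullback u) (pullback u)) m κ := by
  refine ⟨fun x => ?_, fun x v => ?_⟩
  · rw [← (pullback_invariant hu x x).1]; exact h.le _
  · rw [← (pullback_invariant hu x x).1, ← (pullback_invariant hu v x).2]; exact h.sympl_le _ _

/-- Evaluate the inequalities of `B` at the joint vectors. The symplectic term of the measured modes
is paid for by the uncertainty relation `hQs` of the measurement, which costs `κ Q` at `x` and at
`u`; `κ ≤ 1` makes the former affordable. Stationarity of `L` plays no role. -/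
theorem IsBounded.measured {n k : ℕ} {B : LinearMap.BilinForm ℝ (Fin (n + k) × Fin 2 → ℝ)} {m κ : ℝ}
    (h : IsBounded B m κ) (hm : 0 ≤ m) (hκ : 0 ≤ κ) (hκ1 : κ ≤ 1) {T : Type*} [AddCommGroup T] [Module ℝ T]
    {Q : LinearMap.BilinForm ℝ T} {ι : T →ₗ[ℝ] (Fin k × Fin 2 → ℝ)} (hQ : ∀ t, 0 ≤ Q t t)
    (hQs : ∀ s t, 0 ≤ sympl (ι s) (ι t) + (Q s s + Q t t)) (L : (Fin n × Fin 2 → ℝ) →ₗ[ℝ] T) :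
    IsBounded ((measuredForm B Q ι).compl₁₂ (LinearMap.id.prod L) (LinearMap.id.prod L)) m κ := by
  have e : ∀ x, (measuredForm B Q ι).compl₁₂ (LinearMap.id.prod L) (LinearMap.id.prod L) x x =
    B (joinPhase x (ι (L x))) (joinPhase x (ι (L x))) + Q (L x) (L x) := fun x => rfl
  refine ⟨fun x => ?_, fun x u => ?_⟩
  · rw [e]
    have h1 := h.le (joinPhase x (ι (L x)))
    rw [joinPhase_dotProduct] at h1
    nlinarith [hQ (L x), dotProduct_self_nonneg' (ι (L x))]
  · rw [e, e]
    have h1 := h.sympl_le (joinPhase x (ι (L x))) (joinPhase u (ι (L u)))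
    rw [joinPhase_dotProduct, sympl_joinPhase] at h1
    have h2 := mul_le_mul_of_nonneg_left (hQs (L u) (L x)) hκ
    have h3 := hQ (L x)
    have h4 := dotProduct_self_nonneg' (ι (L x))
    nlinarith

/-- The outputs of a Gaussian protocol are a Gaussian family that satisfies the bounds of its input. -/
theorem GaussianProtocol.exists_isGaussianFamily {n₀ : ℕ} {ρ : FockMatrix n₀} {d V} (hρ : IsGaussian ρ d V) {m κ : ℝ}
    (hm : 0 ≤ m) (hm2 : m ≤ 1 / 2) (hκ : 0 ≤ κ) (hκ1 : κ ≤ 1) (hV : IsBounded (covForm V) m κ) {r n : ℕ}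
    (P : GaussianProtocol n₀ r n) : ∃ B, IsGaussianFamily (P.run ρ) B ∧ IsBounded B m κ := by
  induction P with
  | start =>
    refine ⟨covForm V, ⟨fun _ => hρ.isGeo, hρ.isPosForm, fun _ => 1, fun _ => dotL d, ?_, fun _ => measurable_const,
      fun y ξ => ?_⟩, hV⟩
    -- The space of empty records has finite volume, so the constant density is integrable.
    · rw [integrable_const_iff]
      right
      rw [isFiniteMeasure_iff, ← Set.pi_univ Set.univ, volume_pi, Measure.pi_pi]
      simp
    · rw [one_mul]; exact hρ.charFn_eq' ξ
  | ancilla P k τ hG hC ih =>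
    obtain ⟨B, h1, h2⟩ := ih
    obtain ⟨e, C, hτ⟩ := hG
    exact ⟨_, h1.tensor hτ, h2.tensor hm2 hκ (hC.le_covForm hτ)⟩
  | passive P u hu ih =>
    obtain ⟨B, h1, h2⟩ := ih
    exact ⟨_, h1.passive hu, h2.pullback hu⟩
  | displace P δ G ih =>
    obtain ⟨B, h1, h2⟩ := ih
    exact ⟨_, h1.displace δ G, h2⟩
  | discard P ih =>
    obtain ⟨B, h1, h2⟩ := ih
    refine ⟨_, h1.discard, ?_⟩
    -- Discarding is treated as a measurement with no integration variable.
    have := h2.measured hm hκ hκ1 (Q := (0 : LinearMap.BilinForm ℝ (Fin 0 → ℝ))) (ι := 0) (fun _ => le_rfl)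
      (fun _ _ => by simp [sympl]) 0
    refine ⟨fun x => (this.le x).trans_eq ?_, fun x u => (this.sympl_le x u).trans_eq ?_⟩
    all_goals simp [measuredForm]
  | @generalDyne r n k P Λ hΛ ih =>
    obtain ⟨B, h1, h2⟩ := ih
    obtain ⟨e, C, hΛ⟩ := hΛ
    set A : (Fin (k + k) → ℝ) →ₗ[ℝ] (Fin k × Fin 2 → ℝ) :=
      { toFun := fun x => meanShift fun j => (x (Fin.castAdd k j) : ℂ) + Complex.I * (x (Fin.natAdd k j) : ℂ)
        map_add' := fun x y => by
          rw [← meanShift_add]; congr 1; funext j; simp; ring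
        map_smul' := fun c x => by
          funext ⟨i, j⟩
          fin_cases j <;> simp [meanShift, ofComplex] <;> ring } with hA
    have hbij : Function.Bijective A := by
      have h2 : Real.sqrt 2 ≠ 0 := by positivity
      refine Function.bijective_iff_has_inverse.2 ⟨fun z => Fin.append (fun j => z (j, 0) / Real.sqrt 2)
        (fun j => z (j, 1) / Real.sqrt 2), fun x => ?_, fun z => ?_⟩
      · funext i
        refine Fin.addCases (fun a => ?_) (fun a => ?_) i <;>
          simp [hA, meanShift, ofComplex, h2, -Fin.natAdd_eq_addNat]
      · funext ⟨i, j⟩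
        fin_cases j <;> simp [hA, meanShift, ofComplex, -Fin.natAdd_eq_addNat] <;> field_simp
    have hE := fun x : Fin (k + k) → ℝ => isWeylIntegral_generalDyne hΛ
      (fun j => (x (Fin.castAdd k j) : ℂ) + Complex.I * (x (Fin.natAdd k j) : ℂ))
    obtain ⟨L, hL⟩ := h1.measured (K := ((((Real.pi ^ k)⁻¹ * ((2 * Real.pi) ^ k)⁻¹ : ℝ)) : ℂ)) (Q := covForm C)
      (ι := -LinearMap.id) (a₀ := e) hbij hΛ.isPosForm.symm hΛ.isPosForm.nonneg neg_injective (fun x => by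
        have := hE x
        simp only [hΛ.charFn_eq'] at this
        convert this using 4 with t
        · rw [← Complex.exp_add]
          congr 1
          rw [dotProduct_add]
          push_cast
          simp only [hA, LinearMap.coe_mk, AddHom.coe_mk]
          ring
        · rfl)
    refine ⟨_, hL, h2.measured hm hκ hκ1 hΛ.isPosForm.nonneg (fun s t => ?_) L⟩
    -- Reflecting one argument turns the uncertainty relation of `Λ` into the lower bound on the
    -- symplectic form.
    have := hΛ.sympl_le (-s) t
    have e1 : sympl (-s) t = -sympl (-s) (-t) := by
      simp only [sympl, ← Finset.sum_neg_distrib, Pi.neg_apply]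
      exact Finset.sum_congr rfl fun i _ => by ring
    have e2 : covForm C (-s) (-s) = covForm C s s := by simp
    rw [e1, e2] at this
    change 0 ≤ sympl (-s) (-t) + _
    linarith
  | @homodyne r n k P ih =>
    obtain ⟨B, h1, h2⟩ := ih
    obtain ⟨L, hL⟩ := h1.measured (s := k) (E := FockMatrix.homodyne) (K := ((((2 * Real.pi) ^ k)⁻¹ : ℝ) : ℂ)) (Q := 0)
      (ι := quadPhase) (a₀ := 0) (A := -LinearMap.id) neg_involutive.bijective (fun _ _ => rfl) (fun _ => le_rfl)
      (fun s t h => by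
        funext i
        simpa [quadPhase] using congrFun h (i, 0)) (fun x => by
        have := isWeylIntegral_homodyne x
        convert this using 4 with t
        simp)
    refine ⟨_, hL, h2.measured hm hκ hκ1 (fun _ => le_rfl) (fun s t => ?_) L⟩
    -- The measured quadratures commute, so the symplectic form vanishes on them.
    simp [sympl, quadPhase]


/-! ### The target's covariance against the form of the outputs -/

theorem le_of_forall_exp_le {p K b w : ℝ} (hp : 0 < p)
    (h : ∀ s : ℝ, p * Real.exp (-(s ^ 2 * w) / 2) ≤ K * Real.exp (-(s ^ 2 * b) / 2)) : b ≤ w := by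
  by_contra! hlt
  have hK : 0 < K := by
    have := h 0
    simp at this
    linarith
  have hd : 0 < b - w := by linarith
  -- At this `s` the ratio of the two exponentials is `exp(K/p) ≥ K/p + 1`, too large for the
  -- assumed bound.
  set s := Real.sqrt (2 * K / (p * (b - w))) with hs
  have hs2 : s ^ 2 * (b - w) = 2 * K / p := by
    rw [hs, Real.sq_sqrt (by positivity)]; field_simp
  have h1 := h s
  have h2 : Real.exp (-(s ^ 2 * w) / 2) = Real.exp (-(s ^ 2 * b) / 2) * Real.exp (K / p) := by
    rw [← Real.exp_add]
    congr 1
    have : K / p = s ^ 2 * (b - w) / 2 := by rw [hs2]; ring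
    rw [this]; ring
  have h3 := Real.add_one_le_exp (K / p)
  have h4 := Real.exp_pos (-(s ^ 2 * b) / 2)
  have h5 : p * Real.exp (K / p) ≤ K := by
    rw [h2] at h1
    refine le_of_mul_le_mul_left ?_ h4
    linarith
  have h6 : p * (K / p + 1) ≤ K := le_trans (mul_le_mul_of_nonneg_left h3 hp.le) h5
  have h7 : p * (K / p + 1) = K + p := by field_simp
  linarith

theorem norm_exp_I_mul (a : ℝ) : ‖Complex.exp (Complex.I * (a : ℂ))‖ = 1 := by
  rw [mul_comm, Complex.norm_exp_ofReal_mul_I]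

section Family

variable {r n : ℕ} {F : (Fin r → ℝ) → FockMatrix n} {B : LinearMap.BilinForm ℝ (Fin n × Fin 2 → ℝ)}

theorem IsGaussianFamily.exists_split (h : IsGaussianFamily F B) :
    ∃ (c : (Fin r → ℝ) → ℂ) (ℓ : (Fin r → ℝ) → ((Fin n × Fin 2 → ℝ) →ₗ[ℝ] ℝ)),
      Integrable c ∧ (∀ ξ, Measurable fun y => ℓ y ξ) ∧ ∀ y ξ, charFn (F y) ξ =
        (c y * Complex.exp (-((B ξ ξ : ℝ) : ℂ) / 2)) * Complex.exp (Complex.I * ((ℓ y ξ : ℝ) : ℂ)) := by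
  obtain ⟨c, ℓ, hc, hℓ, hF⟩ := h.charFn_eq
  refine ⟨c, ℓ, hc, hℓ, fun y ξ => ?_⟩
  rw [hF, mul_assoc, ← Complex.exp_add]
  congr 2
  ring

theorem IsGaussianFamily.integrable_charFn (h : IsGaussianFamily F B) (y : Fin r → ℝ) :
    Integrable (charFn (F y)) := by
  classical
  obtain ⟨c, ℓ, -, -, hF⟩ := h.exists_split
  refine (h.isPosForm.integral_exp.1.const_mul (c y)).mono (h.isGeo y).isTame.measurable_charFn.aestronglyMeasurable
    (ae_of_all _ fun ξ => ?_)
  rw [hF, norm_mul _ (Complex.exp (Complex.I * _)), norm_exp_I_mul, mul_one]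

theorem IsGaussianFamily.integrable_prod (h : IsGaussianFamily F B) (S : Set (Fin r → ℝ)) :
    Integrable (fun q : (Fin r → ℝ) × (Fin n × Fin 2 → ℝ) => charFn (F q.1) q.2)
      ((volume.restrict S).prod volume) := by
  classical
  obtain ⟨c, ℓ, hc, hℓ, hF⟩ := h.exists_split
  have hℓm : Measurable fun q : (Fin r → ℝ) × (Fin n × Fin 2 → ℝ) => ℓ q.1 q.2 := by
    have : (fun q : (Fin r → ℝ) × (Fin n × Fin 2 → ℝ) => ℓ q.1 q.2) =
        fun q => ∑ i, q.2 i * ℓ q.1 (Pi.single i 1) := by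
      funext q
      rw [LinearMap.pi_apply_eq_sum_univ (ℓ q.1) q.2]
      refine Finset.sum_congr rfl fun i _ => ?_
      rw [smul_eq_mul]
      congr 2
      funext j
      simp [Pi.single_apply, eq_comm]
    rw [this]
    refine Finset.measurable_sum _ fun i _ => ?_
    exact ((measurable_pi_apply i).comp measurable_snd).mul ((hℓ _).comp measurable_fst)
  simp only [hF]
  have hi := (hc.restrict (s := S)).mul_prod h.isPosForm.integral_exp.1
  refine hi.mono (hi.aestronglyMeasurable.mul ?_) (ae_of_all _ fun q => ?_)
  · exact (Complex.continuous_exp.measurable.comp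
      ((Complex.continuous_ofReal.measurable.comp hℓm).const_mul _)).aestronglyMeasurable
  · rw [norm_mul _ (Complex.exp (Complex.I * _)), norm_exp_I_mul, mul_one]

theorem IsGaussianFamily.integral_entry (h : IsGaussianFamily F B) (S : Set (Fin r → ℝ)) (k l : Fin n → ℕ) :
    ∫ y in S, F y k l = ((((2 * Real.pi) ^ n)⁻¹ : ℝ) : ℂ) *
      ∫ ξ, (∫ y in S, charFn (F y) ξ) * weyl (-ξ) k l := by
  have hprod := h.integrable_prod S
  simp only [fun y => (h.isGeo y).isTame.eq_integral (h.integrable_charFn y) k l]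
  have hpi : Integrable (fun q : (Fin r → ℝ) × (Fin n × Fin 2 → ℝ) => charFn (F q.1) q.2 * weyl (-q.2) k l)
      ((volume.restrict S).prod volume) := by
    refine hprod.mono (hprod.aestronglyMeasurable.mul ?_) (ae_of_all _ fun q => ?_)
    · exact ((continuous_weyl k l).measurable.comp (measurable_neg.comp measurable_snd)).aestronglyMeasurable
    · rw [norm_mul]; exact mul_le_of_le_one_right (norm_nonneg _) (norm_weyl_le _ _ _)
  rw [integral_const_mul, integral_integral_swap hpi]
  simp only [integral_mul_const]

/-- Equality of entries lifts to characteristic functions. The means of the individual outputs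
contribute only phases, so `p |χ_σ|` is at most the total weight times `exp(-B/2)`; following a ray
to infinity forces `B ≤ W`. -/
theorem IsGaussianFamily.le_covForm (h : IsGaussianFamily F B)
    {σ : FockMatrix n} {e W} (hσ : IsGaussian σ e W) {S : Set (Fin r → ℝ)} {p : ℝ}
    (hp : 0 < p) (hpσ : ∀ k l, (p : ℂ) * σ k l = ∫ y in S, F y k l) (ξ : Fin n × Fin 2 → ℝ) :
    B ξ ξ ≤ covForm W ξ ξ := by
  classical
  obtain ⟨c, ℓ, hc, hℓ, hF⟩ := h.exists_split
  have hcS : Integrable c (volume.restrict S) := hc.restrict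
  set g : (Fin n × Fin 2 → ℝ) → ℂ := fun ξ => Complex.exp (-((B ξ ξ : ℝ) : ℂ) / 2) with hg
  set G : (Fin n × Fin 2 → ℝ) → ℂ := fun ξ => ∫ y in S, charFn (F y) ξ with hG
  have hGi : Integrable G := (h.integrable_prod S).integral_prod_right
  have hGe : ∀ ξ, G ξ = (∫ y in S, c y * Complex.exp (Complex.I * ((ℓ y ξ : ℝ) : ℂ))) * g ξ := fun ξ => by
    simp only [hG, hF]
    rw [← integral_mul_const]
    exact integral_congr_ae (ae_of_all _ fun y => by ring)
  have hBc : Continuous fun ξ => B ξ ξ := by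
    obtain ⟨A, -, hA⟩ := h.isPosForm.exists_root
    simp only [hA, dotProduct, Matrix.mulVec]; fun_prop
  have hGc : Continuous G := by
    have h1 : Continuous fun ξ => ∫ y in S, c y * Complex.exp (Complex.I * ((ℓ y ξ : ℝ) : ℂ)) := by
      refine continuous_of_dominated (bound := fun y => ‖c y‖) (fun ξ => ?_) (fun ξ => ae_of_all _ fun y => ?_)
        hcS.norm (ae_of_all _ fun y => ?_)
      · exact hcS.aestronglyMeasurable.mul (Complex.continuous_exp.measurable.comp
          ((Complex.continuous_ofReal.measurable.comp (hℓ ξ)).const_mul _)).aestronglyMeasurable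
      · rw [norm_mul, norm_exp_I_mul, mul_one]
      · have := LinearMap.continuous_of_finiteDimensional (ℓ y)
        fun_prop
    have h2 : Continuous g := by simp only [hg]; fun_prop
    simp only [funext hGe]
    exact h1.mul h2
  have hzero := eq_zero_of_integral_weyl_eq_zero (F := fun ξ => (p : ℂ) * charFn σ ξ - G ξ)
    (by
      refine Continuous.sub (continuous_const.mul ?_) hGc
      simp only [funext hσ.charFn_eq, dotProduct, Matrix.mulVec]; fun_prop)
    ((hσ.integrable_charFn.const_mul _).sub hGi) (fun k l => by
      have e1 := hpσ k l
      have h2 : ((((2 * Real.pi) ^ n)⁻¹ : ℝ) : ℂ) ≠ 0 := by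
        have : ((2 * Real.pi) ^ n)⁻¹ ≠ 0 := by positivity
        exact_mod_cast this
      rw [hσ.isState.isTame.eq_integral hσ.integrable_charFn, h.integral_entry, mul_left_comm] at e1
      have e2 := mul_left_cancel₀ h2 e1
      simp only [sub_mul, mul_assoc]
      rw [integral_sub, integral_const_mul, e2, sub_self]
      · exact (integrable_mul_weyl hσ.integrable_charFn measurable_neg k l).const_mul _
      · exact integrable_mul_weyl hGi measurable_neg k l)
  refine le_of_forall_exp_le (K := ∫ y in S, ‖c y‖) hp fun s => ?_
  have h1 : (p : ℂ) * charFn σ (s • ξ) = G (s • ξ) := sub_eq_zero.1 (congrFun hzero (s • ξ))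
  have h2 := congrArg norm h1
  rw [norm_mul, hσ.charFn_eq', norm_exp_gaussian, Complex.norm_real, Real.norm_of_nonneg hp.le, hGe, norm_mul] at h2
  have h3 : ∀ Q : LinearMap.BilinForm ℝ (Fin n × Fin 2 → ℝ), Q (s • ξ) (s • ξ) = s ^ 2 * Q ξ ξ := fun Q => by
    simp only [map_smul, LinearMap.smul_apply, smul_eq_mul]; ring
  have h4 : ‖g (s • ξ)‖ = Real.exp (-(s ^ 2 * B ξ ξ) / 2) := by
    rw [hg, Complex.norm_exp, h3]
    congr 1
    rw [neg_div, neg_div, Complex.neg_re, ← Complex.ofReal_ofNat, ← Complex.ofReal_div, Complex.ofReal_re]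
  rw [h3, h4] at h2
  rw [h2]
  refine mul_le_mul_of_nonneg_right ((norm_integral_le_integral_norm _).trans_eq ?_) (Real.exp_nonneg _)
  simp only [norm_mul, norm_exp_I_mul, mul_one]

end Family

/-- In both inequalities the form occurs only on the larger side with nonnegative coefficients, so
they pass from `B` to any larger form. -/
theorem TransformsGP.isBounded {n : ℕ} {ρ σ : FockMatrix n} {d V e W} (h : TransformsGP ρ σ)
    (hρ : IsGaussian ρ d V) (hσ : IsGaussian σ e W) {m κ : ℝ} (hm : 0 ≤ m) (hm2 : m ≤ 1 / 2) (hκ : 0 ≤ κ)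
    (hκ1 : κ ≤ 1) (hV : IsBounded (covForm V) m κ) : IsBounded (covForm W) m κ := by
  obtain ⟨r, P, S, p, -, hp, hpσ⟩ := h
  obtain ⟨B, hB, hBb⟩ := P.exists_isGaussianFamily hρ hm hm2 hκ hκ1 hV
  have hle := hB.le_covForm hσ hp hpσ
  refine ⟨fun x => (hBb.le x).trans (hle x), fun x u => (hBb.sympl_le x u).trans ?_⟩
  have := mul_le_mul_of_nonneg_left (hle u) hκ
  linarith [hle x]

/-! ### The principal axes of a single-mode covariance matrix -/

/-- The coordinate of `ξ` along `(c, s)`. -/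
def majorCoord (c s : ℝ) (ξ : Fin 1 × Fin 2 → ℝ) : ℝ := c * ξ (0, 0) + s * ξ (0, 1)

/-- The coordinate of `ξ` along `(-s, c)`. -/
def minorCoord (c s : ℝ) (ξ : Fin 1 × Fin 2 → ℝ) : ℝ := c * ξ (0, 1) - s * ξ (0, 0)

/-- The vector with given coordinates along `(c, s)` and `(-s, c)`. -/
def axisVec (c s a b : ℝ) : Fin 1 × Fin 2 → ℝ := fun i => if i.2 = 0 then c * a - s * b else s * a + c * b

theorem majorCoord_axisVec {c s : ℝ} (h : c ^ 2 + s ^ 2 = 1) (a b : ℝ) : majorCoord c s (axisVec c s a b) = a := by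
  simp [majorCoord, axisVec]; linear_combination a * h

theorem minorCoord_axisVec {c s : ℝ} (h : c ^ 2 + s ^ 2 = 1) (a b : ℝ) : minorCoord c s (axisVec c s a b) = b := by
  simp [minorCoord, axisVec]; linear_combination b * h

theorem dotProduct_eq_coord {c s : ℝ} (h : c ^ 2 + s ^ 2 = 1) (ξ : Fin 1 × Fin 2 → ℝ) :
    ξ ⬝ᵥ ξ = majorCoord c s ξ ^ 2 + minorCoord c s ξ ^ 2 := by
  simp [dotProduct, Fintype.sum_prod_type, majorCoord, minorCoord]
  linear_combination -(ξ (0, 0) ^ 2 + ξ (0, 1) ^ 2) * h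

theorem sympl_eq_coord {c s : ℝ} (h : c ^ 2 + s ^ 2 = 1) (ξ η : Fin 1 × Fin 2 → ℝ) :
    sympl ξ η = majorCoord c s ξ * minorCoord c s η - minorCoord c s ξ * majorCoord c s η := by
  simp [sympl, majorCoord, minorCoord]
  linear_combination -(ξ (0, 0) * η (0, 1) - ξ (0, 1) * η (0, 0)) * h

/-- `(c, s)` and `(-s, c)` are eigenvectors of `V` for the eigenvalues `p` and `m`. -/
structure HasAxes (V : Matrix (Fin 1 × Fin 2) (Fin 1 × Fin 2) ℝ) (c s p m : ℝ) : Prop where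
  unit : c ^ 2 + s ^ 2 = 1
  covForm_eq : ∀ ξ, covForm V ξ ξ = p * majorCoord c s ξ ^ 2 + m * minorCoord c s ξ ^ 2
  minor_pos : 0 < m
  minor_le : m ≤ p
  uncertainty : 1 / 4 ≤ p * m

/-- A unit eigenvector for `v₊` is enough: its quarter turn is the other axis, and the trace
identifies the other eigenvalue. -/
theorem IsGaussian.exists_hasAxes {ρ : FockMatrix 1} {d V} (h : IsGaussian ρ d V) :
    ∃ c s, HasAxes V c s (vPlus V) (vMinus V) := by
  have hH : V.IsHermitian := by
    rw [Matrix.IsHermitian, Matrix.conjTranspose_eq_transpose_of_trivial]; exact h.symm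
  have hspec := hH.spectrum_real_eq_range_eigenvalues
  set e := hH.eigenvalues with he
  have hrange : Set.range e = {e (0, 0), e (0, 1)} := by
    ext x
    constructor
    · rintro ⟨⟨i, j⟩, rfl⟩
      fin_cases i; fin_cases j <;> simp
    · rintro (h | h)
      · exact ⟨_, h.symm⟩
      · exact ⟨_, (Set.mem_singleton_iff.1 h).symm⟩
  have hp : vPlus V = max (e (0, 0)) (e (0, 1)) := by
    rw [vPlus, hspec, hrange, csSup_pair]
  have hm : vMinus V = min (e (0, 0)) (e (0, 1)) := by
    rw [vMinus, hspec, hrange, csInf_pair]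
  have htr : V (0, 0) (0, 0) + V (0, 1) (0, 1) = vPlus V + vMinus V := by
    have := hH.trace_eq_sum_eigenvalues
    simp only [Matrix.trace, Fintype.sum_prod_type, Fin.sum_univ_two, Finset.univ_unique, Fin.default_eq_zero,
      Finset.sum_singleton, Matrix.diag_apply, RCLike.ofReal_real_eq_id, id] at this
    rw [hp, hm, max_add_min, this]
  obtain ⟨i, hi⟩ : ∃ i, vPlus V = e i := by
    rcases max_choice (e (0, 0)) (e (0, 1)) with h | h
    · exact ⟨_, hp.trans h⟩
    · exact ⟨_, hp.trans h⟩
  set w := hH.eigenvectorBasis i with hw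
  have hw1 : w (0, 0) ^ 2 + w (0, 1) ^ 2 = 1 := by
    have h1 := hH.eigenvectorBasis.norm_eq_one i
    have h2 := EuclideanSpace.norm_sq_eq w
    rw [h1] at h2
    simp only [Fintype.sum_prod_type, Fin.sum_univ_two, Finset.univ_unique, Fin.default_eq_zero,
      Finset.sum_singleton, Real.norm_eq_abs, sq_abs] at h2
    linarith
  have hVw := hH.mulVec_eigenvectorBasis i
  rw [← he, ← hi] at hVw
  have e0 := congrFun hVw (0, 0)
  have e1 := congrFun hVw (0, 1)
  simp only [Matrix.mulVec, dotProduct, Fintype.sum_prod_type, Fin.sum_univ_two, Finset.univ_unique,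
    Fin.default_eq_zero, Finset.sum_singleton, Pi.smul_apply, smul_eq_mul] at e0 e1
  change V (0, 0) (0, 0) * w (0, 0) + V (0, 0) (0, 1) * w (0, 1) = vPlus V * w (0, 0) at e0
  change V (0, 1) (0, 0) * w (0, 0) + V (0, 1) (0, 1) * w (0, 1) = vPlus V * w (0, 1) at e1
  have hs : V (0, 1) (0, 0) = V (0, 0) (0, 1) := h.symm.apply _ _
  rw [hs] at e1
  set a := V (0, 0) (0, 0)
  set b := V (0, 0) (0, 1)
  set g := V (0, 1) (0, 1)
  set c := w (0, 0)
  set s := w (0, 1)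
  set P := vPlus V
  set M := vMinus V
  have ha : a = P * c ^ 2 + M * s ^ 2 := by
    linear_combination -a * hw1 + c * e0 - s * e1 + s ^ 2 * htr
  have hg : g = P * s ^ 2 + M * c ^ 2 := by
    linear_combination -g * hw1 + s * e1 - c * e0 + c ^ 2 * htr
  have hb : b = (P - M) * (c * s) := by
    linear_combination -b * hw1 + s * e0 + c * e1 - c * s * htr
  have hform : ∀ ξ, covForm V ξ ξ = P * majorCoord c s ξ ^ 2 + M * minorCoord c s ξ ^ 2 := fun ξ => by
    rw [covForm_apply]
    simp only [Matrix.mulVec, dotProduct, Fintype.sum_prod_type, Fin.sum_univ_two, Finset.univ_unique,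
      Fin.default_eq_zero, Finset.sum_singleton, hs]
    change ξ (0, 0) * (a * ξ (0, 0) + b * ξ (0, 1)) + ξ (0, 1) * (b * ξ (0, 0) + g * ξ (0, 1)) = _
    rw [ha, hb, hg, majorCoord, minorCoord]
    ring
  have hle : M ≤ P := by
    rw [hp, hm]; exact min_le_max
  have hpos : 0 < M := by
    have h1 := h.isPosForm.pos (axisVec c s 0 1) fun h0 => by
      have := minorCoord_axisVec hw1 0 1
      rw [h0] at this
      simp [minorCoord] at this
    rw [hform, majorCoord_axisVec hw1, minorCoord_axisVec hw1] at h1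
    linarith
  refine ⟨c, s, hw1, hform, hpos, hle, ?_⟩
  have hP : 0 < P := hpos.trans_le hle
  -- For these vectors the uncertainty relation reads `2P ≤ P + 4 P² M`.
  have h1 := h.sympl_le (axisVec c s 1 0) (axisVec c s 0 (2 * P))
  rw [hform, hform, sympl_eq_coord hw1] at h1
  simp only [majorCoord_axisVec hw1, minorCoord_axisVec hw1] at h1
  have : P * 1 ≤ P * (4 * P * M) := by linarith
  have := le_of_mul_le_mul_left this hP
  linarith

theorem N₁_eq (V : Matrix (Fin 1 × Fin 2) (Fin 1 × Fin 2) ℝ) :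
    N₁ V = 1 - 2 * min (vMinus V) (1 / 2) := by
  rw [N₁]
  rcases le_total (vMinus V) (1 / 2) with h1 | h1
  · rw [min_eq_left h1, max_eq_left (by linarith)]
  · rw [min_eq_right h1, max_eq_right (by linarith)]; norm_num

theorem HasAxes.half_lt {V c s p m} (h : HasAxes V c s p m) (hm : m < 1 / 2) : 1 / 2 < p := by
  by_contra! hp
  nlinarith [h.uncertainty, h.minor_pos, h.minor_le]

theorem HasAxes.half_le {V c s p m} (h : HasAxes V c s p m) : 1 / 2 ≤ p := by
  rcases lt_or_ge m (1 / 2) with h1 | h1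
  · exact (h.half_lt h1).le
  · exact h1.trans h.minor_le

theorem HasAxes.N₂_nonneg {V c s} (h : HasAxes V c s (vPlus V) (vMinus V)) : 0 ≤ N₂ V :=
  div_nonneg (le_max_right _ _) (by linarith [h.half_le])

theorem HasAxes.N₃_nonneg {V c s} (h : HasAxes V c s (vPlus V) (vMinus V)) : 0 ≤ N₃ V :=
  mul_nonneg (by linarith [h.half_le]) h.N₂_nonneg

theorem HasAxes.N₃_mul {V c s} (h : HasAxes V c s (vPlus V) (vMinus V)) (hm : vMinus V < 1 / 2) :
    N₃ V * (2 * vPlus V - 1) = vPlus V * (1 - 2 * vMinus V) := by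
  have := h.half_lt hm
  have h0 : 2 * vPlus V - 1 ≠ 0 := by linarith
  rw [N₃, N₂, N₁, max_eq_left (by linarith), mul_assoc, div_mul_cancel₀ _ h0]

theorem HasAxes.N₃_eq_zero {V c s} (_ : HasAxes V c s (vPlus V) (vMinus V)) (hm : 1 / 2 ≤ vMinus V) : N₃ V = 0 := by
  rw [N₃, N₂, N₁, max_eq_right (by linarith), zero_div, mul_zero]

/-- For a squeezed state, multiplication by `2 v₊ - 1` turns this into `4 v₊ v₋ ≥ 1`. It allows `κ =
2 𝒩₃` as a constant at most one. -/
theorem HasAxes.N₃_le {V c s} (h : HasAxes V c s (vPlus V) (vMinus V)) : 2 * N₃ V ≤ 1 := by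
  rcases lt_or_ge (vMinus V) (1 / 2) with h1 | h1
  · have h2 := h.N₃_mul h1
    have h3 := h.half_lt h1
    have h4 := h.uncertainty
    refine le_of_mul_le_mul_right (a := 2 * vPlus V - 1) ?_ (by linarith)
    linarith
  · rw [h.N₃_eq_zero h1]; norm_num

/-- The bounds of a state in terms of its nonclassicality measures. -/
theorem HasAxes.isBounded {V c s} (h : HasAxes V c s (vPlus V) (vMinus V)) :
    IsBounded (covForm V) (min (vMinus V) (1 / 2)) (2 * N₃ V) := by
  have hle := h.minor_le
  have hpos := h.minor_pos
  have hun := h.uncertainty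
  have hN := h.N₃_nonneg
  refine ⟨fun x => ?_, fun x u => ?_⟩
  · rw [h.covForm_eq, dotProduct_eq_coord h.unit]
    have h1 : min (vMinus V) (1 / 2) ≤ vMinus V := min_le_left _ _
    nlinarith [sq_nonneg (majorCoord c s x), sq_nonneg (minorCoord c s x)]
  · rw [h.covForm_eq, h.covForm_eq, dotProduct_eq_coord h.unit, sympl_eq_coord h.unit]
    set a := majorCoord c s x
    set b := minorCoord c s x
    set p := majorCoord c s u
    set q := minorCoord c s u
    rcases lt_or_ge (vMinus V) (1 / 2) with h1 | h1
    · have h2 := h.N₃_mul h1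
      have h3 := h.half_lt h1
      set k := N₃ V
      set P := vPlus V
      set M := vMinus V
      have hP : 0 < P := by linarith
      -- With `κ = 2k` the minor axis has exactly the slack needed to complete the square in `b - 2
      -- P p`: this is where `𝒩₃` comes from.
      have e1 : M - (1 - 2 * k) / 2 = k / (2 * P) := by
        field_simp
        linarith
      -- On the major axis the square needs no more than the available slack, by the uncertainty
      -- relation and `M ≤ P`.
      have e2 : 0 ≤ P - (1 - 2 * k) / 2 - k / (2 * M) := by
        have e3 : (2 * P - 1) * (2 * M) * (P - (1 - 2 * k) / 2 - k / (2 * M)) = (4 * P * M - 1) * (P - M) := by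
          field_simp
          linear_combination (-1 + 2 * M) * h2
        have e4 : 0 ≤ (4 * P * M - 1) * (P - M) := mul_nonneg (by linarith) (by linarith)
        rw [← e3] at e4
        exact nonneg_of_mul_nonneg_right e4 (by nlinarith)
      have e5 : 0 ≤ k / (2 * P) * (b - 2 * P * p) ^ 2 := by positivity
      have e6 : 0 ≤ k / (2 * M) * (a + 2 * M * q) ^ 2 := by positivity
      have e7 : k / (2 * P) * (b - 2 * P * p) ^ 2 = k / (2 * P) * b ^ 2 - 2 * k * (b * p) + 2 * k * P * p ^ 2 := by
        field_simp; ring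
      have e8 : k / (2 * M) * (a + 2 * M * q) ^ 2 = k / (2 * M) * a ^ 2 + 2 * k * (a * q) + 2 * k * M * q ^ 2 := by
        field_simp; ring
      have e9 := mul_nonneg e2 (sq_nonneg a)
      rw [← e1] at e7
      rw [← e1] at e5
      nlinarith
    · rw [h.N₃_eq_zero h1]
      nlinarith [sq_nonneg a, sq_nonneg b]

/-- Test the first inequality on the target's minor axis. For the second take `x` there and `u` on
the major axis with length `1 / (2 v₊)`, the choice that makes the inequality strongest. -/
theorem HasAxes.of_isBounded {V c s W c' s'} (h : HasAxes V c s (vPlus V) (vMinus V))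
    (h' : HasAxes W c' s' (vPlus W) (vMinus W))
    (hW : IsBounded (covForm W) (min (vMinus V) (1 / 2)) (2 * N₃ V)) : N₁ W ≤ N₁ V ∧ N₃ W ≤ N₃ V := by
  constructor
  · rw [N₁_eq, N₁_eq]
    have h1 := hW.le (axisVec c' s' 0 1)
    rw [h'.covForm_eq, dotProduct_eq_coord h'.unit, majorCoord_axisVec h'.unit, minorCoord_axisVec h'.unit] at h1
    have : min (vMinus V) (1 / 2) ≤ min (vMinus W) (1 / 2) := le_min (by linarith) (min_le_right _ _)
    linarith
  · rcases lt_or_ge (vMinus W) (1 / 2) with h1 | h1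
    · have h2 := h'.N₃_mul h1
      have h3 := h'.half_lt h1
      have h4 := hW.sympl_le (axisVec c' s' 0 1) (axisVec c' s' (1 / (2 * vPlus W)) 0)
      rw [h'.covForm_eq, h'.covForm_eq, dotProduct_eq_coord h'.unit, sympl_eq_coord h'.unit] at h4
      simp only [majorCoord_axisVec h'.unit, minorCoord_axisVec h'.unit] at h4
      set P := vPlus W
      have hP : 0 < P := by linarith
      have e1 : P * (1 / (2 * P)) ^ 2 = 1 / (4 * P) := by field_simp; norm_num
      have e2 : 1 / (2 * P) = 2 * (1 / (4 * P)) := by field_simp; norm_num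
      have e3 : 4 * P * (1 / (4 * P)) = 1 := by field_simp
      refine le_of_mul_le_mul_right (a := 2 * P - 1) ?_ (by linarith)
      rw [h2]
      rw [e1, e2] at h4
      set y := 1 / (4 * P)
      have h5 : (1 - 2 * vMinus W) / 2 ≤ N₃ V * (1 - 2 * y) := by linarith
      have h6 := mul_le_mul_of_nonneg_left h5 (by linarith : 0 ≤ 2 * P)
      have h7 : 2 * P * (N₃ V * (1 - 2 * y)) = N₃ V * (2 * P - 1) := by
        linear_combination -N₃ V * e3
      linarith
    · rw [h'.N₃_eq_zero h1]; exact h.N₃_nonneg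

/-- Gaussian protocols do not increase `𝒩₁` and `𝒩₃`. -/
theorem TransformsGP.N_le {ρ σ : FockMatrix 1} {d V e W} (h : TransformsGP ρ σ) (hρ : IsGaussian ρ d V)
    (hσ : IsGaussian σ e W) : N₁ W ≤ N₁ V ∧ N₃ W ≤ N₃ V := by
  obtain ⟨c, s, hV⟩ := hρ.exists_hasAxes
  obtain ⟨c', s', hW⟩ := hσ.exists_hasAxes
  exact hV.of_isBounded hW (h.isBounded hρ hσ (le_min hV.minor_pos.le (by norm_num)) (min_le_right _ _)
    (mul_nonneg (by norm_num) hV.N₃_nonneg) hV.N₃_le hV.isBounded)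

/-! ### Beam splitters -/

/-- The adjoint of the beam splitter of amplitudes `a`, `b` between the first two modes, with phases that
turn the axes `(c, s)` of the input into the axes `(c', s')` of the output. -/
def splitterAdj (c s c' s' a b : ℝ) : Matrix (Fin (1 + 2)) (Fin (1 + 2)) ℂ :=
  !![(c + Complex.I * s) * a * (c' - Complex.I * s'), -((c + Complex.I * s) * b), 0;
    b * (c' - Complex.I * s'), a, 0; 0, 0, 1]

theorem splitter_mem {c s c' s' a b : ℝ} (h : c ^ 2 + s ^ 2 = 1) (h' : c' ^ 2 + s' ^ 2 = 1) (hab : a ^ 2 + b ^ 2 = 1) :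
    (splitterAdj c s c' s' a b).conjTranspose ∈ Matrix.unitaryGroup (Fin (1 + 2)) ℂ := by
  rw [Matrix.mem_unitaryGroup_iff', Matrix.star_eq_conjTranspose, Matrix.conjTranspose_conjTranspose]
  have e1 : (c : ℂ) ^ 2 + s ^ 2 = 1 := by exact_mod_cast h
  have e2 : (c' : ℂ) ^ 2 + s' ^ 2 = 1 := by exact_mod_cast h'
  have e3 : (a : ℂ) ^ 2 + b ^ 2 = 1 := by exact_mod_cast hab
  have hI := Complex.I_sq
  have f1 : ((c : ℂ) + Complex.I * s) * (c + -(Complex.I * s)) = 1 := by linear_combination e1 - s ^ 2 * hI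
  have f2 : ((c' : ℂ) - Complex.I * s') * (c' + Complex.I * s') = 1 := by linear_combination e2 - s' ^ 2 * hI
  have hsum : ∀ f : Fin (1 + 2) → ℂ, ∑ i, f i = f 0 + f 1 + f 2 := Fin.sum_univ_three
  ext i j
  rw [Matrix.mul_apply, hsum]
  simp only [Matrix.conjTranspose_apply]
  change Fin 3 at i j
  fin_cases i <;> fin_cases j <;> simp [splitterAdj]
  -- The phases have modulus one (`f1`, `f2`), so unitarity reduces to `a² + b² = 1`.
  · linear_combination (a : ℂ) ^ 2 * ((c' - Complex.I * s') * (c' + Complex.I * s')) * f1 + (a : ℂ) ^ 2 * f2 +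
      (b : ℂ) ^ 2 * f1 + e3
  · linear_combination (a * b * (c + Complex.I * s) : ℂ) * f2
  · linear_combination (a * b * (c + -(Complex.I * s)) : ℂ) * f2
  · linear_combination (b : ℂ) ^ 2 * f2 + e3

/-- Ancilla components in the `x` quadratures suffice: homodyne detection probes nothing else, and
`w = 0` is the partial trace. The last mode stays uncoupled and serves as a source of vacuum noise.
-/
theorem pullback_splitter {c s c' s' a b : ℝ} (ξ : Fin 1 × Fin 2 → ℝ) (w : Fin 2 → ℝ) :
    fstPhase (pullback (splitterAdj c s c' s' a b).conjTranspose (joinPhase ξ (quadPhase w))) =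
      axisVec c s (a * majorCoord c' s' ξ - b * w 0) (a * minorCoord c' s' ξ) ∧
    sndPhase (pullback (splitterAdj c s c' s' a b).conjTranspose (joinPhase ξ (quadPhase w))) =
      fun i => if i.1 = 0 then (if i.2 = 0 then b * majorCoord c' s' ξ + a * w 0 else b * minorCoord c' s' ξ) else
        if i.2 = 0 then w 1 else 0 := by
  have hsum : ∀ f : Fin (1 + 2) → ℂ, ∑ i, f i = f 0 + f 1 + f 2 := Fin.sum_univ_three
  have e : pullback (splitterAdj c s c' s' a b).conjTranspose (joinPhase ξ (quadPhase w)) =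
      ofComplex ((splitterAdj c s c' s' a b).mulVec (toComplex (joinPhase ξ (quadPhase w)))) := by
    rw [← ofComplex_toComplex (pullback _ _), toComplex_pullback, Matrix.conjTranspose_conjTranspose]
  have z0 : toComplex (joinPhase ξ (quadPhase w)) 0 = ξ (0, 0) + Complex.I * ξ (0, 1) := rfl
  have z1 : toComplex (joinPhase ξ (quadPhase w)) 1 = w 0 := by
    change ((w 0 : ℝ) : ℂ) + Complex.I * ((0 : ℝ) : ℂ) = w 0
    simp
  have z2 : toComplex (joinPhase ξ (quadPhase w)) 2 = w 1 := by
    change ((w 1 : ℝ) : ℂ) + Complex.I * ((0 : ℝ) : ℂ) = w 1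
    simp
  have hm : ∀ i, (splitterAdj c s c' s' a b).mulVec (toComplex (joinPhase ξ (quadPhase w))) i =
      splitterAdj c s c' s' a b i 0 * (ξ (0, 0) + Complex.I * ξ (0, 1)) + splitterAdj c s c' s' a b i 1 * w 0 +
        splitterAdj c s c' s' a b i 2 * w 1 := fun i => by
    rw [Matrix.mulVec, dotProduct, hsum, z0, z1, z2]
  rw [e]
  constructor
  · funext ⟨i, j⟩
    fin_cases i
    fin_cases j
    · change ((splitterAdj c s c' s' a b).mulVec (toComplex (joinPhase ξ (quadPhase w))) 0).re = _
      rw [hm]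
      simp [splitterAdj, axisVec, majorCoord, minorCoord]
      ring
    · change ((splitterAdj c s c' s' a b).mulVec (toComplex (joinPhase ξ (quadPhase w))) 0).im = _
      rw [hm]
      simp [splitterAdj, axisVec, majorCoord, minorCoord]
      ring
  · funext ⟨i, j⟩
    fin_cases i
    · fin_cases j
      · change ((splitterAdj c s c' s' a b).mulVec (toComplex (joinPhase ξ (quadPhase w))) 1).re = _
        rw [hm]
        simp [splitterAdj, majorCoord]
        ring
      · change ((splitterAdj c s c' s' a b).mulVec (toComplex (joinPhase ξ (quadPhase w))) 1).im = _
        rw [hm]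
        simp [splitterAdj, minorCoord]
        ring
    · fin_cases j
      · change ((splitterAdj c s c' s' a b).mulVec (toComplex (joinPhase ξ (quadPhase w))) 2).re = _
        rw [hm]
        simp [splitterAdj]
      · change ((splitterAdj c s c' s' a b).mulVec (toComplex (joinPhase ξ (quadPhase w))) 2).im = _
        rw [hm]
        simp [splitterAdj]

theorem axisVec_dotProduct (c s a b : ℝ) (d : Fin 1 × Fin 2 → ℝ) :
    axisVec c s a b ⬝ᵥ d = a * majorCoord c s d + b * minorCoord c s d := by
  simp [dotProduct, Fintype.sum_prod_type, axisVec, majorCoord, minorCoord]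
  ring

/-- The state behind a beam splitter with vacuum in the other ports. -/
def split (c s c' s' a b : ℝ) (ρ : FockMatrix 1) : FockMatrix (1 + 2) :=
  conjBy (passive (splitterAdj c s c' s' a b).conjTranspose) (tensor ρ (vacuum 2))

theorem IsGaussian.isGeo_split {ρ : FockMatrix 1} {d V} (h : IsGaussian ρ d V) {c s c' s' a b : ℝ}
    (hc : c ^ 2 + s ^ 2 = 1) (hc' : c' ^ 2 + s' ^ 2 = 1) (hab : a ^ 2 + b ^ 2 = 1) :
    IsGeo (split c s c' s' a b ρ) :=
  (h.isGeo.tensor (isGeo_vacuum 2)).conjBy (isGeoOp_passive (splitter_mem hc hc' hab))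

theorem IsGaussian.charFn_split {ρ : FockMatrix 1} {d V} (h : IsGaussian ρ d V) {c s c' s' a b p m : ℝ}
    (hV : HasAxes V c s p m) (hc' : c' ^ 2 + s' ^ 2 = 1) (hab : a ^ 2 + b ^ 2 = 1)
    (ξ : Fin 1 × Fin 2 → ℝ) (w : Fin 2 → ℝ) : charFn (split c s c' s' a b ρ) (joinPhase ξ (quadPhase w)) =
      Complex.exp (Complex.I * (((a * majorCoord c' s' ξ - b * w 0) * majorCoord c s d +
        a * minorCoord c' s' ξ * minorCoord c s d : ℝ) : ℂ) -
        ((p * (a * majorCoord c' s' ξ - b * w 0) ^ 2 + m * (a * minorCoord c' s' ξ) ^ 2 +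
          ((b * majorCoord c' s' ξ + a * w 0) ^ 2 + (b * minorCoord c' s' ξ) ^ 2 + w 1 ^ 2) / 2 : ℝ) : ℂ) / 2) := by
  rw [split, (h.isGeo.tensor (isGeo_vacuum 2)).charFn_passive (splitter_mem hV.unit hc' hab),
    h.isGeo.charFn_tensor (isGeo_vacuum 2), charFn_vacuum, h.charFn_eq', (pullback_splitter ξ w).1,
    (pullback_splitter ξ w).2, axisVec_dotProduct, hV.covForm_eq, majorCoord_axisVec hV.unit,
    minorCoord_axisVec hV.unit, Complex.ofReal_exp, ← Complex.exp_add]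
  congr 1
  simp [dotProduct, Fintype.sum_prod_type]
  ring

/-! ### Conversion by Gaussian protocols -/

/-- Here `a²` is the transmissivity, `g` the gain of the homodyne outcome fed into the major axis,
and `h` the gain of the outcome of the uncoupled vacuum mode fed into the minor axis. For a target
with `v₋ < 1/2` the minor axis is met by loss alone, which fixes `a`; the condition on `𝒩₃` then
makes the equation for `g` solvable. -/
theorem HasAxes.exists_feedforward {V c s W c' s'} (hV : HasAxes V c s (vPlus V) (vMinus V))
    (hW : HasAxes W c' s' (vPlus W) (vMinus W)) (h1 : N₁ W ≤ N₁ V) (h3 : N₃ W ≤ N₃ V) :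
    ∃ a b g h : ℝ, a ^ 2 + b ^ 2 = 1 ∧ vMinus W = vMinus V * a ^ 2 + (b ^ 2 + h ^ 2) / 2 ∧
      vPlus W = vPlus V * (a - b * g) ^ 2 + (b + a * g) ^ 2 / 2 := by
  have hp : 0 < vPlus V := by linarith [hV.half_le]
  rcases lt_or_ge (vMinus W) (1 / 2) with hw | hw
  · have hv : vMinus V < 1 / 2 := by
      rw [N₁_eq, N₁_eq, min_eq_left hw.le] at h1
      by_contra! h
      rw [min_eq_right h] at h1
      linarith
    have hp' := hV.half_lt hv
    have hw' := hW.half_lt hw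
    set p := vPlus V
    set m := vMinus V
    set P := vPlus W
    set M := vMinus W
    set t := (1 - 2 * M) / (1 - 2 * m) with ht
    have hd : 0 < 1 - 2 * m := by linarith
    have htm : t * (1 - 2 * m) = 1 - 2 * M := div_mul_cancel₀ _ hd.ne'
    have ht0 : 0 ≤ t := div_nonneg (by linarith) hd.le
    have ht1 : t ≤ 1 := by
      rw [ht, div_le_one hd]
      rw [N₁_eq, N₁_eq, min_eq_left hw.le, min_eq_left hv.le] at h1
      linarith
    have hkey : t * (2 * p - 1) * P ≤ p * (2 * P - 1) := by
      have e1 := hV.N₃_mul hv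
      have e2 := hW.N₃_mul hw
      have e3 := mul_le_mul_of_nonneg_right h3 (mul_nonneg (by linarith : 0 ≤ 2 * p - 1) (by linarith : 0 ≤ 2 * P - 1))
      refine le_of_mul_le_mul_right (a := 1 - 2 * m) ?_ hd
      have e4 : N₃ W * ((2 * p - 1) * (2 * P - 1)) = P * (1 - 2 * M) * (2 * p - 1) := by
        rw [← e2]; ring
      have e5 : N₃ V * ((2 * p - 1) * (2 * P - 1)) = p * (1 - 2 * m) * (2 * P - 1) := by
        rw [← e1]; ring
      rw [e4, e5, ← htm] at e3
      linarith
    set a := Real.sqrt t with ha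
    set b := Real.sqrt (1 - t) with hb
    have ha2 : a ^ 2 = t := Real.sq_sqrt ht0
    have hb2 : b ^ 2 = 1 - t := Real.sq_sqrt (by linarith)
    -- The variance of the homodyned major quadrature.
    set A := (1 - t) * p + t / 2 with hA
    have hA0 : 0 < A := by nlinarith
    -- Twice this number is `p (2P - 1) - t P (2p - 1)`, nonnegative by `hkey`.
    have hD : 0 ≤ P * A - p / 2 := by nlinarith
    set D := Real.sqrt (P * A - p / 2) with hDd
    have hD2 : D ^ 2 = P * A - p / 2 := Real.sq_sqrt hD
    -- The gain is a root of `A g² - 2 a b (p - 1/2) g + t p + (1 - t)/2 = P`.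
    refine ⟨a, b, (a * b * (p - 1 / 2) + D) / A, 0, by rw [ha2, hb2]; ring, ?_, ?_⟩
    · rw [ha2, hb2]; linarith
    · set g := (a * b * (p - 1 / 2) + D) / A with hg
      have hgA : g * A = a * b * (p - 1 / 2) + D := div_mul_cancel₀ _ hA0.ne'
      refine mul_left_cancel₀ hA0.ne' ?_
      have e1 : p * (a - b * g) ^ 2 + (b + a * g) ^ 2 / 2 =
          A * g ^ 2 - 2 * (a * b * (p - 1 / 2)) * g + (t * p + (1 - t) / 2) := by
        rw [hA]
        linear_combination p * ha2 + p * g ^ 2 * hb2 + hb2 / 2 + g ^ 2 / 2 * ha2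
      have e2 : (a * b * (p - 1 / 2)) ^ 2 = t * (1 - t) * (p - 1 / 2) ^ 2 := by
        rw [mul_pow, mul_pow, ha2, hb2]
      rw [e1]
      have e3 : A * (A * g ^ 2 - 2 * (a * b * (p - 1 / 2)) * g + (t * p + (1 - t) / 2)) =
          (g * A - a * b * (p - 1 / 2)) ^ 2 - (a * b * (p - 1 / 2)) ^ 2 + A * (t * p + (1 - t) / 2) := by ring
      rw [e3, e2, hgA, add_sub_cancel_left, hD2, hA]
      ring
  -- For `v₋ ≥ 1/2` in the target the input is reflected completely; the output mode carries vacuum,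
  -- and the homodyne outcomes supply the additional variances.
  · refine ⟨0, 1, Real.sqrt ((vPlus W - 1 / 2) / vPlus V), Real.sqrt (2 * vMinus W - 1), by norm_num, ?_, ?_⟩
    · rw [Real.sq_sqrt (by linarith)]; ring
    · rw [zero_sub, one_mul, neg_sq, Real.sq_sqrt (div_nonneg (by linarith [hW.half_le]) hp.le)]
      field_simp
      ring

theorem integrable_exp_dotProduct {κ : Type*} [Fintype κ] :
    Integrable fun w : κ → ℝ => Real.exp (-(w ⬝ᵥ w) / 4) := by
  have := (integrable_gaussian_linear (ι := κ) (b := 1 / 4) (by norm_num) 0).norm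
  refine this.congr (ae_of_all _ fun w => ?_)
  simp only [Complex.norm_exp]
  congr 1
  simp only [Pi.zero_apply, zero_mul, Finset.sum_const_zero, add_zero, ← Complex.ofReal_pow, ← Complex.ofReal_sum]
  rw [show (-(1 / 4) : ℂ) = ((-(1 / 4) : ℝ) : ℂ) by norm_num, ← Complex.ofReal_mul, Complex.ofReal_re]
  simp only [dotProduct, ← sq]
  ring

/-- Since `p ≥ 1/2` and the splitter acts orthogonally, the exponent dominates that of the vacuum in
`w`. -/
theorem IsGaussian.integrable_charFn_split {ρ : FockMatrix 1} {d V} (h : IsGaussian ρ d V) {c s c' s' a b p m : ℝ}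
    (hV : HasAxes V c s p m) (hc' : c' ^ 2 + s' ^ 2 = 1) (hab : a ^ 2 + b ^ 2 = 1) (ξ : Fin 1 × Fin 2 → ℝ) :
    Continuous (fun w => charFn (split c s c' s' a b ρ) (joinPhase ξ (quadPhase w))) ∧
    Integrable fun w => charFn (split c s c' s' a b ρ) (joinPhase ξ (quadPhase w)) := by
  have hcont : Continuous (fun w => charFn (split c s c' s' a b ρ) (joinPhase ξ (quadPhase w))) := by
    simp only [h.charFn_split hV hc' hab]
    fun_prop
  refine ⟨hcont, integrable_exp_dotProduct.mono hcont.aestronglyMeasurable (ae_of_all _ fun w => ?_)⟩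
  rw [h.charFn_split hV hc' hab, norm_exp_gaussian, Real.norm_of_nonneg (Real.exp_nonneg _), Real.exp_le_exp]
  have hp := hV.half_le
  have hm := hV.minor_pos
  simp only [dotProduct, Fin.sum_univ_two]
  set x := majorCoord c' s' ξ
  set y := minorCoord c' s' ξ
  have e1 : (a * x - b * w 0) ^ 2 + (b * x + a * w 0) ^ 2 = x ^ 2 + w 0 ^ 2 := by
    linear_combination (x ^ 2 + w 0 ^ 2) * hab
  have e2 : 1 / 2 * (a * x - b * w 0) ^ 2 ≤ p * (a * x - b * w 0) ^ 2 := by gcongr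
  have e3 : 0 ≤ m * (a * y) ^ 2 := by positivity
  nlinarith [sq_nonneg x, sq_nonneg (b * y)]

theorem IsGaussianFamily.integrable_record {r n : ℕ} {F : (Fin r → ℝ) → FockMatrix n} {B}
    (h : IsGaussianFamily F B) (ξ : Fin n × Fin 2 → ℝ) : Integrable fun y => charFn (F y) ξ := by
  obtain ⟨c, ℓ, hc, hℓ, hF⟩ := h.exists_split
  simp only [hF]
  have hi := hc.mul_const (Complex.exp (-((B ξ ξ : ℝ) : ℂ) / 2))
  refine hi.mono (hi.aestronglyMeasurable.mul ?_) (ae_of_all _ fun y => ?_)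
  · exact (Complex.continuous_exp.measurable.comp
      ((Complex.continuous_ofReal.measurable.comp (hℓ ξ)).const_mul _)).aestronglyMeasurable
  · rw [norm_mul _ (Complex.exp (Complex.I * _)), norm_exp_I_mul, mul_one]

/-- Feed-forward multiplies the output by a character of the record, so integrating over all records
is Fourier inversion: the result is the characteristic function behind the splitter at `w = (g x, h
y)`, with `x`, `y` the major and minor coordinates of `ξ`. No record is rejected, hence the success
probability is one. -/
theorem transformsGP_of_split {ρ σ : FockMatrix 1} {d V e W} (hρ : IsGaussian ρ d V) (hσ : IsGaussian σ e W)
    {c s c' s' a b g h : ℝ} (hV : HasAxes V c s (vPlus V) (vMinus V)) (hW : HasAxes W c' s' (vPlus W) (vMinus W))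
    (hab : a ^ 2 + b ^ 2 = 1) (hm : vMinus W = vMinus V * a ^ 2 + (b ^ 2 + h ^ 2) / 2)
    (hp : vPlus W = vPlus V * (a - b * g) ^ 2 + (b + a * g) ^ 2 / 2) : TransformsGP ρ σ := by
  obtain ⟨δ, hδ⟩ := exists_meanShift
    (e - axisVec c' s' ((a - b * g) * majorCoord c s d) (a * minorCoord c s d))
  set G : (Fin (0 + 2) → ℝ) →ₗ[ℝ] (Fin 1 → ℂ) :=
    { toFun := fun y => ((Real.sqrt 2 : ℂ)⁻¹) • toComplex (axisVec c' s' (g * y 0) (h * y 1))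
      map_add' := fun y z => by
        funext i
        simp [toComplex, axisVec]; ring
      map_smul' := fun t y => by
        funext i
        simp [toComplex, axisVec]; ring } with hG
  have hGm : ∀ y, meanShift (G y) = axisVec c' s' (g * y 0) (h * y 1) := fun y => by
    simp only [hG, LinearMap.coe_mk, AddHom.coe_mk]
    rw [meanShift, smul_smul, mul_inv_cancel₀ sqrt_two_ne_zero, one_smul, ofComplex_toComplex]
  set P₀ : GaussianProtocol 1 (0 + 2) 1 := .homodyne (.passive (.ancilla .start 2 (vacuum 2)
    ⟨_, _, isGaussian_vacuum 2⟩ (isClassical_vacuum 2)) _ (splitter_mem hV.unit hW.unit hab)) with hP₀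
  have hrun₀ : ∀ y, P₀.run ρ y = measured (homodyne y) (split c s c' s' a b ρ) := fun y => by
    have : (fun j => y (Fin.natAdd 0 j)) = y := by
      funext j; fin_cases j <;> rfl
    conv_rhs => rw [← this]
    rfl
  have hfam : ∀ P : GaussianProtocol 1 (0 + 2) 1, ∃ B, IsGaussianFamily (P.run ρ) B := fun P => by
    obtain ⟨B, hB, -⟩ := P.exists_isGaussianFamily hρ (le_min hV.minor_pos.le (by norm_num)) (min_le_right _ _)
      (mul_nonneg (by norm_num) hV.N₃_nonneg) hV.N₃_le hV.isBounded
    exact ⟨B, hB⟩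
  set K : ℂ := ((((2 * Real.pi) ^ 2)⁻¹ : ℝ) : ℂ) with hK
  have hchi : ∀ y ξ, charFn (P₀.run ρ y) ξ = K * ∫ w, Complex.exp (-(Complex.I * ((w ⬝ᵥ y : ℝ) : ℂ))) *
      charFn (split c s c' s' a b ρ) (joinPhase ξ (quadPhase w)) := fun y ξ => by
    rw [hrun₀, (hρ.isGeo_split hV.unit hW.unit hab).charFn_measured (isWeylIntegral_homodyne y), ← integral_const_mul]
    exact integral_congr_ae (ae_of_all _ fun w => by simp only [hK]; ring)
  have hK0 : K * (((2 * Real.pi) ^ Fintype.card (Fin 2) : ℝ) : ℂ) = 1 := by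
    rw [hK, Fintype.card_fin, ← Complex.ofReal_mul, inv_mul_cancel₀ (by positivity), Complex.ofReal_one]
  have hKne : K ≠ 0 := left_ne_zero_of_mul_eq_one hK0
  refine ⟨0 + 2, .displace P₀ δ G, Set.univ, 1, MeasurableSet.univ, one_pos, fun k l => ?_⟩
  obtain ⟨B, hB⟩ := hfam (.displace P₀ δ G)
  rw [Complex.ofReal_one, one_mul, hB.integral_entry, hσ.isState.isTame.eq_integral hσ.integrable_charFn]
  congr 2
  funext ξ
  congr 1
  obtain ⟨hfc, hfi⟩ := hρ.integrable_charFn_split hV hW.unit hab ξ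
  -- Integrability over the record comes from the Gaussian family of the protocol before
  -- feed-forward; the constant `K` is nonzero and can be removed.
  have hFi : Integrable fun y : Fin 2 → ℝ => ∫ w, Complex.exp (-(Complex.I * ((w ⬝ᵥ y : ℝ) : ℂ))) *
      charFn (split c s c' s' a b ρ) (joinPhase ξ (quadPhase w)) := by
    obtain ⟨B₀, hB₀⟩ := hfam P₀
    have := hB₀.integrable_record ξ
    simp only [hchi] at this
    exact (integrable_const_mul_iff hKne.isUnit _).1 this
  have hinv := integral_exp_mul_fourier hfc hfi hFi ![g * majorCoord c' s' ξ, h * minorCoord c' s' ξ]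
  have hdisp : ∀ y : Fin 2 → ℝ, charFn (GaussianProtocol.run ρ (.displace P₀ δ G) y) ξ =
      (Complex.exp (Complex.I * ((ξ ⬝ᵥ meanShift δ : ℝ) : ℂ)) * K) *
      (Complex.exp (Complex.I * ((y ⬝ᵥ ![g * majorCoord c' s' ξ, h * minorCoord c' s' ξ] : ℝ) : ℂ)) *
        ∫ w, Complex.exp (-(Complex.I * ((w ⬝ᵥ y : ℝ) : ℂ))) *
          charFn (split c s c' s' a b ρ) (joinPhase ξ (quadPhase w))) := fun y => by
    obtain ⟨B₀, hB₀⟩ := hfam P₀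
    refine ((hB₀.isGeo y).charFn_displacement (δ + G y) ξ).trans ?_
    rw [hchi, meanShift_add, hGm, dotProduct_add, dotProduct_comm ξ (axisVec _ _ _ _), axisVec_dotProduct]
    have : y ⬝ᵥ ![g * majorCoord c' s' ξ, h * minorCoord c' s' ξ] =
      g * y 0 * majorCoord c' s' ξ + h * y 1 * minorCoord c' s' ξ := by
      simp [dotProduct, Fin.sum_univ_two]; ring
    rw [this, Complex.ofReal_add, mul_add, Complex.exp_add]
    ring
  rw [Measure.restrict_univ]
  refine Eq.symm ((integral_congr_ae (ae_of_all _ hdisp)).trans ?_)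
  rw [integral_const_mul, hinv, mul_assoc, ← mul_assoc K, hK0, one_mul, hρ.charFn_split hV hW.unit hab, hσ.charFn_eq',
    hδ, ← Complex.exp_add, dotProduct_sub, dotProduct_comm ξ (axisVec _ _ _ _), axisVec_dotProduct, hW.covForm_eq, hm, hp]
  congr 1
  simp
  ring

/-! ### Operations on states -/

open scoped ComplexOrder in
theorem IsGeo.isState {n : ℕ} {ρ : FockMatrix n} (h : IsGeo ρ) (hp : ρ.PosSemidef) (h1 : charFn ρ 0 = 1) :
    IsState ρ := by
  refine ⟨hp, ?_⟩
  rw [← h1, h.charFn_eq, weyl_zero, trMul_one]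
  exact h.summable_diag.hasSum

theorem IsState.charFn_zero {n : ℕ} {ρ : FockMatrix n} (hρ : IsState ρ) (h : IsGeo ρ) : charFn ρ 0 = 1 := by
  rw [h.charFn_eq, weyl_zero, trMul_one, hρ.trace_eq_one.tsum_eq]

theorem IsState.conjBy_passive {n : ℕ} {ρ : FockMatrix n} (hρ : IsState ρ) (h : IsGeo ρ)
    {u : Matrix (Fin n) (Fin n) ℂ} (hu : u ∈ Matrix.unitaryGroup (Fin n) ℂ) :
    IsState (FockMatrix.conjBy (passive u) ρ) :=
  hρ.conjBy (isGeoOp_passive hu) (sandwich_passive_one hu) h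

open scoped ComplexOrder in
theorem posSemidef_tensor {n m : ℕ} {ρ : FockMatrix n} {τ : FockMatrix m} (hρ : ρ.PosSemidef) (hτ : τ.PosSemidef) :
    (FockMatrix.tensor ρ τ).PosSemidef := by
  classical
  refine posSemidef_of_gram fun S => ?_
  obtain ⟨a, B, hB⟩ := exists_gram hρ (S.image fun k i => k (Fin.castAdd m i))
  obtain ⟨b, C, hC⟩ := exists_gram hτ (S.image fun k i => k (Fin.natAdd n i))
  refine ⟨a * b, fun x k => B (finProdFinEquiv.symm x).1 (fun i => k (Fin.castAdd m i)) *
    C (finProdFinEquiv.symm x).2 (fun i => k (Fin.natAdd n i)), fun k hk l hl => ?_⟩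
  rw [FockMatrix.tensor, hB _ (Finset.mem_image_of_mem _ hk) _ (Finset.mem_image_of_mem _ hl),
    hC _ (Finset.mem_image_of_mem _ hk) _ (Finset.mem_image_of_mem _ hl), Finset.sum_mul_sum, ← Finset.sum_product',
    Finset.univ_product_univ, ← finProdFinEquiv.symm.sum_comp]
  refine Finset.sum_congr rfl fun x _ => ?_
  rw [star_mul']
  ring

theorem IsState.tensor {n m : ℕ} {ρ : FockMatrix n} {τ : FockMatrix m} (hρ : IsState ρ) (h : IsGeo ρ)
    (hτ : IsState τ) (h' : IsGeo τ) : IsState (FockMatrix.tensor ρ τ) := by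
  refine (h.tensor h').isState (posSemidef_tensor hρ.posSemidef hτ.posSemidef) ?_
  rw [h.charFn_tensor h']
  have e1 : charFn ρ (fstPhase (0 : Fin (n + m) × Fin 2 → ℝ)) = 1 := hρ.charFn_zero h
  have e2 : charFn τ (sndPhase (0 : Fin (n + m) × Fin 2 → ℝ)) = 1 := hτ.charFn_zero h'
  rw [e1, e2, one_mul]

open scoped ComplexOrder in
theorem posSemidef_partialTrace {n m : ℕ} {ρ : FockMatrix (n + m)} (h : IsGeo ρ) (hρ : ρ.PosSemidef) :
    (FockMatrix.partialTrace ρ).PosSemidef := by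
  classical
  have hinj : ∀ k l : Fin n → ℕ, Function.Injective fun j : Fin m → ℕ => (Fin.append k j, Fin.append l j) :=
    fun k l i j hij => by
      funext a
      have := congrFun (Prod.ext_iff.1 hij).1 (Fin.natAdd n a)
      simpa only [Fin.append_right] using this
  refine posSemidef_of_tendsto (l := (Filter.atTop : Filter (Finset (Fin m → ℕ))))
    (M := fun S => ∑ j ∈ S, ρ.submatrix (fun k => Fin.append k j) (fun k => Fin.append k j))
    (fun S => Matrix.posSemidef_sum S fun j _ => hρ.submatrix _) fun k l => ?_
  have : HasSum (fun j : Fin m → ℕ => ρ (Fin.append k j) (Fin.append l j)) (FockMatrix.partialTrace ρ k l) :=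
    (h.summable_norm.of_norm.comp_injective (hinj k l)).hasSum
  refine Filter.Tendsto.congr (fun S => ?_) this
  rw [Matrix.sum_apply]; rfl

theorem IsState.partialTrace {n m : ℕ} {ρ : FockMatrix (n + m)} (hρ : IsState ρ) (h : IsGeo ρ) :
    IsState (FockMatrix.partialTrace ρ) := by
  refine h.partialTrace.isState (posSemidef_partialTrace h hρ.posSemidef) ?_
  rw [h.charFn_partialTrace]
  have e : joinPhase (0 : Fin n × Fin 2 → ℝ) (0 : Fin m × Fin 2 → ℝ) = 0 := (joinPhaseL n m).map_zero
  rw [e, hρ.charFn_zero h]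

/-! ### Operations and mixtures -/

/-- The rows of `A` are absolutely summable. -/
def RowSummable {n : ℕ} (A : FockMatrix n) : Prop := ∀ k, Summable fun l => ‖A k l‖

theorem rowSummable_displacement {n : ℕ} (α : Fin n → ℂ) : RowSummable (displacement α) := fun k => by
  -- The row bound holds for every positive weight; weight one gives plain summability.
  obtain ⟨C, -, h⟩ := displacement_row α one_pos one_lt_two
  simpa using (h k).1

theorem rowSummable_passive {n : ℕ} {u : Matrix (Fin n) (Fin n) ℂ} (hu : u ∈ Matrix.unitaryGroup (Fin n) ℂ) :
    RowSummable (passive u) := fun k => by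
  refine Summable.of_nonneg_of_le (fun _ => norm_nonneg _) (fun l => ?_)
    ((summable_pow_deg (n := n) (R := 1 / 2) (by norm_num) (by norm_num)).mul_left (2 ^ deg k))
  by_cases h : deg k = deg l
  · rw [h, ← mul_pow]
    simpa using norm_passive_le hu k l
  · rw [passive_eq_zero u h, norm_zero]; positivity

theorem RowSummable.summable_pair {n : ℕ} {A : FockMatrix n} (hA : RowSummable A) (k l : Fin n → ℕ) :
    Summable fun p : (Fin n → ℕ) × (Fin n → ℕ) => ‖A k p.1‖ * ‖A l p.2‖ :=
  (hasSum_mul_of_summable_norm (f := fun p => ‖A k p‖) (g := fun p => ‖A l p‖) (hA k).hasSum (hA l).hasSum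
    (hA k).norm (hA l).norm).summable

theorem RowSummable.norm_term_le {n : ℕ} {A ρ : FockMatrix n} (hρ : ∀ k l, ‖ρ k l‖ ≤ 1) (k l p q : Fin n → ℕ) :
    ‖A k p * ρ p q * star (A l q)‖ ≤ ‖A k p‖ * ‖A l q‖ := by
  rw [norm_mul, norm_mul, norm_star]
  gcongr
  exact mul_le_of_le_one_right (norm_nonneg _) (hρ _ _)

theorem RowSummable.summable_conjBy {n : ℕ} {A ρ : FockMatrix n} (hA : RowSummable A) (hρ : ∀ k l, ‖ρ k l‖ ≤ 1)
    (k l : Fin n → ℕ) :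
    Summable fun p : (Fin n → ℕ) × (Fin n → ℕ) => A k p.1 * ρ p.1 p.2 * star (A l p.2) :=
  Summable.of_norm_bounded (hA.summable_pair k l) fun _ => norm_term_le hρ _ _ _ _

section Measurable

variable {n m : ℕ} {T : Type*} [MeasurableSpace T] {X : T → FockMatrix n}

theorem measurable_conjBy {A : T → FockMatrix n} (hA : ∀ t, RowSummable (A t)) (hAm : ∀ k l, Measurable fun t => A t k l)
    (hX : ∀ t k l, ‖X t k l‖ ≤ 1) (hXm : ∀ k l, Measurable fun t => X t k l) (k l : Fin n → ℕ) :
    Measurable fun t => FockMatrix.conjBy (A t) (X t) k l :=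
  measurable_tsum_complex (fun _ => ((hAm _ _).mul (hXm _ _)).mul (continuous_star.measurable.comp (hAm _ _)))
    fun t => (hA t).summable_conjBy (hX t) k l

theorem conjBy_integral {μ : Measure T} [IsProbabilityMeasure μ] {A σ : FockMatrix n} (hA : RowSummable A)
    (hX : ∀ t k l, ‖X t k l‖ ≤ 1) (hXm : ∀ k l, Measurable fun t => X t k l) (hσ : ∀ k l, σ k l = ∫ t, X t k l ∂μ)
    (k l : Fin n → ℕ) : FockMatrix.conjBy A σ k l = ∫ t, FockMatrix.conjBy A (X t) k l ∂μ := by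
  have hi : ∀ k l, Integrable (fun t => X t k l) μ := fun k l =>
    Integrable.of_bound (hXm k l).aestronglyMeasurable 1 (ae_of_all _ fun t => hX t k l)
  have hi' : ∀ p : (Fin n → ℕ) × (Fin n → ℕ), Integrable (fun t => A k p.1 * X t p.1 p.2 * star (A l p.2)) μ :=
    fun _ => ((hi _ _).const_mul _).mul_const _
  have := hasSum_integral_of_summable_integral_norm hi' (Summable.of_nonneg_of_le
    (fun _ => integral_nonneg fun _ => norm_nonneg _) (fun p => ?_) (hA.summable_pair k l))
  · refine Eq.trans ?_ this.tsum_eq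
    refine tsum_congr fun p => ?_
    rw [integral_mul_const, integral_const_mul, hσ]
  · refine (integral_mono (hi' p).norm (integrable_const _)
      fun t => RowSummable.norm_term_le (hX t) k l p.1 p.2).trans_eq (by simp)

/-- Positivity bounds each entry by the mean of two diagonal entries, and each diagonal sum is at
most the trace. -/
theorem IsState.sum_norm_append_le {ρ : FockMatrix (n + m)} (h : IsState ρ) (k l : Fin n → ℕ) (F : Finset (Fin m → ℕ)) :
    ∑ j ∈ F, ‖ρ (Fin.append k j) (Fin.append l j)‖ ≤ 1 := by
  have hinj : ∀ k : Fin n → ℕ, Function.Injective fun j : Fin m → ℕ => Fin.append k j := fun k i j hij => by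
    funext a
    have := congrFun hij (Fin.natAdd n a)
    simpa only [Fin.append_right] using this
  have hs : ∀ k : Fin n → ℕ, ∑ j ∈ F, (ρ (Fin.append k j) (Fin.append k j)).re ≤ 1 := fun k => by
    have := h.sum_diag_le (F.map ⟨_, hinj k⟩)
    rwa [Finset.sum_map] at this
  have hle : ∀ j ∈ F, ‖ρ (Fin.append k j) (Fin.append l j)‖ ≤
      ((ρ (Fin.append k j) (Fin.append k j)).re + (ρ (Fin.append l j) (Fin.append l j)).re) / 2 := fun j _ => by
    have h1 := h.normSq_le (Fin.append k j) (Fin.append l j)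
    have h2 := (h.diag_re (Fin.append k j)).1
    have h3 := (h.diag_re (Fin.append l j)).1
    refine abs_le_of_sq_le_sq' ?_ (by linarith) |>.2
    nlinarith [sq_nonneg ((ρ (Fin.append k j) (Fin.append k j)).re - (ρ (Fin.append l j) (Fin.append l j)).re)]
  refine (Finset.sum_le_sum hle).trans ?_
  rw [← Finset.sum_div, Finset.sum_add_distrib]
  linarith [hs k, hs l]

theorem IsState.summable_append {ρ : FockMatrix (n + m)} (h : IsState ρ) (k l : Fin n → ℕ) :
    Summable fun j : Fin m → ℕ => ρ (Fin.append k j) (Fin.append l j) :=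
  (summable_of_sum_le (fun _ => norm_nonneg _) (h.sum_norm_append_le k l)).of_norm

theorem measurable_partialTrace {Z : T → FockMatrix (n + m)} (hZ : ∀ t, IsState (Z t))
    (hZm : ∀ k l, Measurable fun t => Z t k l) (k l : Fin n → ℕ) :
    Measurable fun t => FockMatrix.partialTrace (Z t) k l :=
  measurable_tsum_complex (fun _ => hZm _ _) fun t => (hZ t).summable_append k l

theorem partialTrace_integral {μ : Measure T} [IsProbabilityMeasure μ] {Z : T → FockMatrix (n + m)}
    {σ : FockMatrix (n + m)} (hZ : ∀ t, IsState (Z t)) (hZm : ∀ k l, Measurable fun t => Z t k l)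
    (hσ : ∀ k l, σ k l = ∫ t, Z t k l ∂μ) (k l : Fin n → ℕ) :
    FockMatrix.partialTrace σ k l = ∫ t, FockMatrix.partialTrace (Z t) k l ∂μ := by
  have hi := integrable_entry (μ := μ) hZ hZm
  have := hasSum_integral_of_summable_integral_norm
    (F := fun (j : Fin m → ℕ) t => Z t (Fin.append k j) (Fin.append l j)) (μ := μ) (fun j => hi _ _)
    (summable_of_sum_le (c := 1) (fun _ => integral_nonneg fun _ => norm_nonneg _) fun F => by
      rw [← integral_finsetSum _ fun j _ => (hi _ _).norm]
      exact (integral_mono (integrable_finsetSum _ fun j _ => (hi _ _).norm) (integrable_const 1)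
        fun t => (hZ t).sum_norm_append_le k l F).trans_eq (by simp))
  exact (tsum_congr fun j => hσ _ _).trans this.tsum_eq

theorem measurable_displacement {δ : T → Fin n → ℂ} (hδ : ∀ i, Measurable fun t => δ t i) (k l : Fin n → ℕ) :
    Measurable fun t => displacement (δ t) k l := by
  simp only [displacement]
  exact Finset.measurable_prod _ fun i _ => (continuous_dispElem _ _).measurable.comp (hδ i)

theorem measurable_passive {u : T → Matrix (Fin n) (Fin n) ℂ} (hu : ∀ i j, Measurable fun t => u t i j)
    (k l : Fin n → ℕ) : Measurable fun t => passive (u t) k l := by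
  have hmul : ∀ p q : T → MvPolynomial (Fin n) ℂ, (∀ k, Measurable fun t => (p t).coeff k) →
      (∀ k, Measurable fun t => (q t).coeff k) → ∀ k, Measurable fun t => (p t * q t).coeff k := fun p q hp hq k => by
    simp only [MvPolynomial.coeff_mul]
    exact Finset.measurable_sum _ fun x _ => (hp _).mul (hq _)
  have hone : ∀ k : Fin n →₀ ℕ, Measurable fun _ : T => (1 : MvPolynomial (Fin n) ℂ).coeff k := fun _ => measurable_const
  have hlin : ∀ j k, Measurable fun t => (∑ i, MvPolynomial.C (u t i j) * MvPolynomial.X i : MvPolynomial (Fin n) ℂ).coeff k :=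
    fun j k => by
      simp only [MvPolynomial.coeff_sum, MvPolynomial.coeff_C_mul]
      exact Finset.measurable_sum _ fun i _ => (hu i j).mul_const _
  have hpow : ∀ j (e : ℕ) k, Measurable fun t =>
      ((∑ i, MvPolynomial.C (u t i j) * MvPolynomial.X i : MvPolynomial (Fin n) ℂ) ^ e).coeff k := fun j e => by
    induction e with
    | zero => simp only [pow_zero]; exact hone
    | succ e ih => simp only [pow_succ]; exact hmul _ _ ih (hlin j)
  have hprod : ∀ (S : Finset (Fin n)) k, Measurable fun t => (∏ j ∈ S,
      (∑ i, MvPolynomial.C (u t i j) * MvPolynomial.X i : MvPolynomial (Fin n) ℂ) ^ l j).coeff k := fun S => by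
    classical
    induction S using Finset.induction_on with
    | empty => simp only [Finset.prod_empty]; exact hone
    | insert j S hj ih => simp only [Finset.prod_insert hj]; exact hmul _ _ (hpow j _) ih
  exact (hprod _ _).mul_const _

end Measurable

/-! ### Conversion without measurements -/

/-- For a nonclassical target the minor axis again fixes the transmissivity, and the condition on
`𝒩₂` says that the variance missing on the major axis is nonnegative. Otherwise the input is
replaced by vacuum and noise is added on both axes. -/
theorem HasAxes.exists_noise {V c s W c' s'} (hV : HasAxes V c s (vPlus V) (vMinus V))
    (hW : HasAxes W c' s' (vPlus W) (vMinus W)) (h1 : N₁ W ≤ N₁ V) (h2 : N₂ W ≤ N₂ V) :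
    ∃ a b g h : ℝ, a ^ 2 + b ^ 2 = 1 ∧ vMinus W = vMinus V * a ^ 2 + b ^ 2 / 2 + h ^ 2 ∧
      vPlus W = vPlus V * a ^ 2 + b ^ 2 / 2 + g ^ 2 := by
  rcases lt_or_ge (vMinus W) (1 / 2) with hw | hw
  · have hv : vMinus V < 1 / 2 := by
      rw [N₁_eq, N₁_eq, min_eq_left hw.le] at h1
      by_contra! h
      rw [min_eq_right h] at h1
      linarith
    have hp' := hV.half_lt hv
    have hw' := hW.half_lt hw
    rw [N₂, N₂, N₁_eq, N₁_eq, min_eq_left hw.le, min_eq_left hv.le, div_le_div_iff₀ (by linarith) (by linarith)] at h2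
    rw [N₁_eq, N₁_eq, min_eq_left hw.le, min_eq_left hv.le] at h1
    set p := vPlus V
    set m := vMinus V
    set P := vPlus W
    set M := vMinus W
    set t := (1 - 2 * M) / (1 - 2 * m) with ht
    have hd : 0 < 1 - 2 * m := by linarith
    have htm : t * (1 - 2 * m) = 1 - 2 * M := div_mul_cancel₀ _ hd.ne'
    have ht0 : 0 ≤ t := div_nonneg (by linarith) hd.le
    have ht1 : t ≤ 1 := by
      rw [ht, div_le_one hd]
      linarith
    have hkey : t * (2 * p - 1) ≤ 2 * P - 1 := by
      refine le_of_mul_le_mul_right (a := 1 - 2 * m) ?_ hd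
      rw [← htm] at h2
      linarith
    refine ⟨Real.sqrt t, Real.sqrt (1 - t), Real.sqrt (P - (p * t + (1 - t) / 2)), 0, ?_, ?_, ?_⟩
    all_goals rw [Real.sq_sqrt ht0, Real.sq_sqrt (by linarith)]
    · ring
    · linarith
    · rw [Real.sq_sqrt (by linarith)]; ring
  · refine ⟨0, 1, Real.sqrt (vPlus W - 1 / 2), Real.sqrt (vMinus W - 1 / 2), by norm_num, ?_, ?_⟩
    · rw [Real.sq_sqrt (by linarith)]; ring
    · rw [Real.sq_sqrt (by linarith [hW.half_le])]; ring

open ProbabilityTheory in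
theorem integral_exp_gaussianReal (t : ℝ) :
    ∫ x, Complex.exp (Complex.I * ((t * x : ℝ) : ℂ)) ∂(gaussianReal 0 1) = Complex.exp (-((t ^ 2 : ℝ) : ℂ) / 2) := by
  have := charFun_gaussianReal (μ := 0) (v := 1) t
  rw [charFun_apply_real] at this
  refine Eq.trans (integral_congr_ae (ae_of_all _ fun x => ?_)) (this.trans ?_)
  · dsimp only
    congr 1; push_cast; ring
  · congr 1; push_cast; simp [neg_div]

open ProbabilityTheory in
-- Independent normal displacements of standard deviations `g` and `h` along the target's axes add
-- `g²` and `h²` to the variances left by the lossy splitter.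
theorem transformsP0_of_split {ρ σ : FockMatrix 1} {d V e W} (hρ : IsGaussian ρ d V) (hσ : IsGaussian σ e W)
    {c s c' s' a b g h : ℝ} (hV : HasAxes V c s (vPlus V) (vMinus V)) (hW : HasAxes W c' s' (vPlus W) (vMinus W))
    (hab : a ^ 2 + b ^ 2 = 1) (hm : vMinus W = vMinus V * a ^ 2 + b ^ 2 / 2 + h ^ 2)
    (hp : vPlus W = vPlus V * a ^ 2 + b ^ 2 / 2 + g ^ 2) : TransformsP0 ρ σ := by
  set y₀ := e - axisVec c' s' (a * majorCoord c s d) (a * minorCoord c s d) with hy₀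
  set δ : ℝ × ℝ → Fin 1 → ℂ := fun ω => ((Real.sqrt 2 : ℂ)⁻¹) • toComplex (y₀ + axisVec c' s' (g * ω.1) (h * ω.2)) with hδ
  have hδm : ∀ ω, meanShift (δ ω) = y₀ + axisVec c' s' (g * ω.1) (h * ω.2) := fun ω => by
    rw [hδ, meanShift, smul_smul, mul_inv_cancel₀ sqrt_two_ne_zero, one_smul, ofComplex_toComplex]
  have hδmeas : ∀ i, Measurable fun ω => δ ω i := fun i => by
    have : Continuous fun ω => δ ω i := by
      simp only [hδ, Pi.smul_apply, smul_eq_mul, toComplex, Pi.add_apply, axisVec, one_ne_zero, if_true, if_false]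
      fun_prop
    exact this.measurable
  have hgeo := hρ.isGeo_split hV.unit hW.unit hab
  have hst : IsState (split c s c' s' a b ρ) :=
    (hρ.isState.tensor hρ.isGeo (isState_vacuum 2) (isGeo_vacuum 2)).conjBy_passive
      (hρ.isGeo.tensor (isGeo_vacuum 2)) (splitter_mem hV.unit hW.unit hab)
  set X := partialTrace (split c s c' s' a b ρ) with hX
  have hXg : IsGeo X := hgeo.partialTrace
  have hXs : IsState X := hst.partialTrace hgeo
  have hDs : ∀ ω, IsState (conjBy (displacement (δ ω)) X) := fun ω => hXs.conjBy_displacement hXg _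
  have hDm : ∀ k l, Measurable fun ω => conjBy (displacement (δ ω)) X k l :=
    measurable_conjBy (fun ω => rowSummable_displacement _) (measurable_displacement hδmeas)
      (fun _ => hXs.norm_entry_le) fun _ _ => measurable_const
  refine ⟨ℝ × ℝ, inferInstance, (gaussianReal 0 1).prod (gaussianReal 0 1), 2, fun _ => vacuum 2,
    fun _ => (splitterAdj c s c' s' a b).conjTranspose, δ, inferInstance, fun _ _ => measurable_const,
    fun _ _ => measurable_const, hδmeas, fun _ => isClassical_vacuum 2,
    fun _ => splitter_mem hV.unit hW.unit hab, ?_⟩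
  set σ' : FockMatrix 1 := fun k l => ∫ ω, conjBy (displacement (δ ω)) X k l ∂(gaussianReal 0 1).prod (gaussianReal 0 1)
    with hσ'
  have hσs : IsState σ' := isState_mixture hDs hDm fun _ _ => rfl
  have heq : σ = σ' := by
    refine hσ.isState.isTame.eq_of_charFn_eq hσs.isTame fun ξ => ?_
    rw [charFn_mixture hDs hDm fun _ _ => rfl, hσ.charFn_eq']
    -- Tracing out the ancillas is evaluation at `w = 0`.
    have hq : joinPhase ξ (0 : Fin 2 × Fin 2 → ℝ) = joinPhase ξ (quadPhase 0) := by rw [map_zero]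
    have hint : ∀ ω, charFn (conjBy (displacement (δ ω)) X) ξ = (Complex.exp (Complex.I * ((ξ ⬝ᵥ y₀ : ℝ) : ℂ)) *
        charFn X ξ) * (Complex.exp (Complex.I * ((g * majorCoord c' s' ξ * ω.1 : ℝ) : ℂ)) *
          Complex.exp (Complex.I * ((h * minorCoord c' s' ξ * ω.2 : ℝ) : ℂ))) := fun ω => by
      rw [hXg.charFn_displacement, hδm, dotProduct_add, dotProduct_comm ξ (axisVec _ _ _ _), axisVec_dotProduct,
        ← Complex.exp_add, mul_right_comm _ (charFn X ξ), ← Complex.exp_add]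
      congr 2
      push_cast
      ring
    simp only [hint]
    rw [integral_const_mul, integral_prod_mul (fun x : ℝ => Complex.exp (Complex.I * ((g * majorCoord c' s' ξ * x : ℝ) : ℂ)))
      (fun x : ℝ => Complex.exp (Complex.I * ((h * minorCoord c' s' ξ * x : ℝ) : ℂ))),
      integral_exp_gaussianReal, integral_exp_gaussianReal, hX, hgeo.charFn_partialTrace, hq,
      hρ.charFn_split hV hW.unit hab, ← Complex.exp_add, ← Complex.exp_add, ← Complex.exp_add, hW.covForm_eq, hm, hp,
      hy₀, dotProduct_sub, dotProduct_comm ξ (axisVec _ _ _ _), axisVec_dotProduct]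
    congr 1
    simp
    ring
  intro k l
  exact congrFun (congrFun heq k) l

/-! ### Monotones of conversion without measurements -/

/-- The exponent of the characteristic function after adding vacuum, applying `u` and tracing out. -/
def outForm {n m : ℕ} (V : Matrix (Fin n × Fin 2) (Fin n × Fin 2) ℝ) (u : Matrix (Fin (n + m)) (Fin (n + m)) ℂ)
    (ξ : Fin n × Fin 2 → ℝ) : ℝ :=
  covForm V (fstPhase (pullback u (joinPhase ξ 0))) (fstPhase (pullback u (joinPhase ξ 0))) +
    (ξ ⬝ᵥ ξ - fstPhase (pullback u (joinPhase ξ 0)) ⬝ᵥ fstPhase (pullback u (joinPhase ξ 0))) / 2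

/-- The output of a measurement-free operation for given values of the random numbers. -/
theorem classical_output {n m : ℕ} {ρ : FockMatrix n} {d V} (hρ : IsGaussian ρ d V) {τ : FockMatrix m}
    (hτ : IsClassical τ) {u : Matrix (Fin (n + m)) (Fin (n + m)) ℂ} (hu : u ∈ Matrix.unitaryGroup (Fin (n + m)) ℂ)
    (δ : Fin n → ℂ) :
    IsState (tensor ρ τ) ∧ IsState (conjBy (passive u) (tensor ρ τ)) ∧
    IsState (partialTrace (conjBy (passive u) (tensor ρ τ))) ∧
    IsState (conjBy (displacement δ) (partialTrace (conjBy (passive u) (tensor ρ τ)))) ∧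
    ∀ ξ, ‖charFn (conjBy (displacement δ) (partialTrace (conjBy (passive u) (tensor ρ τ)))) ξ‖ ≤
      Real.exp (-outForm V u ξ / 2) := by
  obtain ⟨P, hP, hτ⟩ := hτ
  -- A general classical ancilla need not decay geometrically, so each stage is treated for coherent
  -- ancillas and then integrated over `P`.
  set C : (Fin m → ℂ) → FockMatrix m := fun γ => conjBy (displacement γ) (vacuum m) with hC
  have hg1 : ∀ γ, IsGeo (tensor ρ (C γ)) := fun γ => hρ.isGeo.tensor (isGeo_coherent γ)
  have hs1 : ∀ γ, IsState (tensor ρ (C γ)) := fun γ =>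
    hρ.isState.tensor hρ.isGeo (isState_coherent γ) (isGeo_coherent γ)
  have hm1 : ∀ k l, Measurable fun γ => tensor ρ (C γ) k l := fun k l => by
    refine Measurable.const_mul ?_ _
    simp only [hC, ← congrFun₂ (coherent_mul_star _)]
    exact measurable_coherent _ _
  have hi1 : ∀ k l, tensor ρ τ k l = ∫ γ, tensor ρ (C γ) k l ∂P := fun k l => by
    simp only [FockMatrix.tensor]
    rw [integral_const_mul, hτ]
    simp only [hC, ← congrFun₂ (coherent_mul_star _)]
  have hg2 : ∀ γ, IsGeo (conjBy (passive u) (tensor ρ (C γ))) := fun γ => (hg1 γ).conjBy (isGeoOp_passive hu)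
  have hs2 : ∀ γ, IsState (conjBy (passive u) (tensor ρ (C γ))) := fun γ => (hs1 γ).conjBy_passive (hg1 γ) hu
  have hm2 : ∀ k l, Measurable fun γ => conjBy (passive u) (tensor ρ (C γ)) k l :=
    measurable_conjBy (fun _ => rowSummable_passive hu) (fun _ _ => measurable_const) (fun γ => (hs1 γ).norm_entry_le) hm1
  have hi2 := conjBy_integral (rowSummable_passive hu) (fun γ => (hs1 γ).norm_entry_le) hm1 hi1
  have hg3 : ∀ γ, IsGeo (partialTrace (conjBy (passive u) (tensor ρ (C γ)))) := fun γ => (hg2 γ).partialTrace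
  have hs3 : ∀ γ, IsState (partialTrace (conjBy (passive u) (tensor ρ (C γ)))) := fun γ => (hs2 γ).partialTrace (hg2 γ)
  have hm3 := measurable_partialTrace hs2 hm2
  have hi3 := partialTrace_integral hs2 hm2 hi2
  have hs4 : ∀ γ, IsState (conjBy (displacement δ) (partialTrace (conjBy (passive u) (tensor ρ (C γ))))) :=
    fun γ => (hs3 γ).conjBy_displacement (hg3 γ) δ
  have hm4 := measurable_conjBy (fun _ : Fin m → ℂ => rowSummable_displacement δ) (fun _ _ => measurable_const)
    (fun γ => (hs3 γ).norm_entry_le) hm3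
  have hi4 := conjBy_integral (rowSummable_displacement δ) (fun γ => (hs3 γ).norm_entry_le) hm3 hi3
  refine ⟨isState_mixture hs1 hm1 hi1, isState_mixture hs2 hm2 hi2, isState_mixture hs3 hm3 hi3,
    isState_mixture hs4 hm4 hi4, fun ξ => norm_charFn_mixture_le hs4 hm4 hi4 fun γ => le_of_eq ?_⟩
  -- The displacement and the coherent amplitudes enter only as phases, which leaves the modulus for
  -- a vacuum ancilla.
  rw [(hg3 γ).charFn_displacement, norm_mul, norm_exp_I_mul, one_mul, (hg2 γ).charFn_partialTrace,
    (hg1 γ).charFn_passive hu, hρ.isGeo.charFn_tensor (isGeo_coherent γ), norm_mul, norm_charFn_coherent,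
    hρ.charFn_eq', norm_exp_gaussian, ← Real.exp_add]
  have h1 := (pullback_invariant hu (joinPhase ξ 0) (joinPhase ξ (0 : Fin m × Fin 2 → ℝ))).1
  rw [fstPhase_dotProduct (n := n) (m := m) (pullback u _), joinPhase_dotProduct, dotProduct_zero, add_zero] at h1
  rw [outForm, ← h1]
  congr 1
  ring

theorem le_outForm {n m : ℕ} {V : Matrix (Fin n × Fin 2) (Fin n × Fin 2) ℝ} {v κ : ℝ}
    (hV : IsBounded (covForm V) v κ) (hv : v ≤ 1 / 2) {u : Matrix (Fin (n + m)) (Fin (n + m)) ℂ}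
    (hu : u ∈ Matrix.unitaryGroup (Fin (n + m)) ℂ) (ξ : Fin n × Fin 2 → ℝ) :
    v * (ξ ⬝ᵥ ξ) ≤ outForm V u ξ ∧
      fstPhase (pullback u (joinPhase ξ 0)) ⬝ᵥ fstPhase (pullback u (joinPhase ξ 0)) ≤ ξ ⬝ᵥ ξ := by
  have h1 := (pullback_invariant hu (joinPhase ξ 0) (joinPhase ξ (0 : Fin m × Fin 2 → ℝ))).1
  rw [fstPhase_dotProduct (n := n) (m := m) (pullback u _), joinPhase_dotProduct, dotProduct_zero, add_zero] at h1
  have h2 := dotProduct_self_nonneg' (sndPhase (pullback u (joinPhase ξ (0 : Fin m × Fin 2 → ℝ))))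
  have h3 := hV.le (fstPhase (pullback u (joinPhase ξ (0 : Fin m × Fin 2 → ℝ))))
  refine ⟨?_, by linarith⟩
  rw [outForm]
  nlinarith

/-- On the single system mode the compressed unitary is multiplication by a complex number.
Consequently the output depends on one entry of `u` and commutes with quarter turns. -/
theorem fstPhase_pullback_eq {m : ℕ} (u : Matrix (Fin (1 + m)) (Fin (1 + m)) ℂ) (ξ : Fin 1 × Fin 2 → ℝ) :
    fstPhase (pullback u (joinPhase ξ (0 : Fin m × Fin 2 → ℝ))) =
      ofComplex fun _ => star (u (Fin.castAdd m 0) (Fin.castAdd m 0)) * (ξ (0, 0) + Complex.I * ξ (0, 1)) := by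
  have h := congrFun (toComplex_pullback u (joinPhase ξ (0 : Fin m × Fin 2 → ℝ))) (Fin.castAdd m 0)
  have h2 : toComplex (fstPhase (pullback u (joinPhase ξ (0 : Fin m × Fin 2 → ℝ)))) =
      fun _ => star (u (Fin.castAdd m 0) (Fin.castAdd m 0)) * (ξ (0, 0) + Complex.I * ξ (0, 1)) := by
    funext i
    rw [Subsingleton.elim i 0]
    refine h.trans ?_
    rw [Matrix.mulVec, dotProduct, Fin.sum_univ_add]
    simp [toComplex, joinPhase]
  rw [← h2, ofComplex_toComplex]

theorem outForm_smul {n m : ℕ} (V : Matrix (Fin n × Fin 2) (Fin n × Fin 2) ℝ)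
    (u : Matrix (Fin (n + m)) (Fin (n + m)) ℂ) (t : ℝ) (ξ : Fin n × Fin 2 → ℝ) :
    outForm V u (t • ξ) = t ^ 2 * outForm V u ξ := by
  have h : fstPhase (pullback u (joinPhase (t • ξ) (0 : Fin m × Fin 2 → ℝ))) = t • fstPhase (pullback u (joinPhase ξ 0)) :=
    (fstPhaseL n m ∘ₗ pullback u ∘ₗ joinPhaseL n m ∘ₗ LinearMap.inl ℝ _ _).map_smul t ξ
  rw [outForm, outForm, h]
  simp only [map_smul, LinearMap.smul_apply, smul_eq_mul, smul_dotProduct, dotProduct_smul]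
  ring

/-- The values of `outForm` along two orthogonal axes. -/
theorem HasAxes.outForm_axes {V c s p v} (hV : HasAxes V c s p v) {m : ℕ} (u : Matrix (Fin (1 + m)) (Fin (1 + m)) ℂ)
    {c' s' : ℝ} (h' : c' ^ 2 + s' ^ 2 = 1) : ∃ x y : ℝ,
      outForm V u (axisVec c' s' 1 0) = p * x ^ 2 + v * y ^ 2 + (1 - (x ^ 2 + y ^ 2)) / 2 ∧
      outForm V u (axisVec c' s' 0 1) = p * y ^ 2 + v * x ^ 2 + (1 - (x ^ 2 + y ^ 2)) / 2 := by
  set z := u (Fin.castAdd m 0) (Fin.castAdd m 0) with hz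
  refine ⟨majorCoord c s (fstPhase (pullback u (joinPhase (axisVec c' s' 1 0) 0))),
    minorCoord c s (fstPhase (pullback u (joinPhase (axisVec c' s' 1 0) 0))), ?_, ?_⟩
  · rw [outForm, hV.covForm_eq, dotProduct_eq_coord hV.unit (fstPhase _), dotProduct_eq_coord h',
      majorCoord_axisVec h', minorCoord_axisVec h']
    ring
  -- The minor axis is the quarter turn of the major one, so its image is the quarter turn of the
  -- image: the coordinates are exchanged up to sign.
  · have e1 : majorCoord c s (fstPhase (pullback u (joinPhase (axisVec c' s' 0 1) 0))) =
        -minorCoord c s (fstPhase (pullback u (joinPhase (axisVec c' s' 1 0) 0))) := by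
      rw [fstPhase_pullback_eq, fstPhase_pullback_eq]
      simp [majorCoord, minorCoord, ofComplex, axisVec]
      ring
    have e2 : minorCoord c s (fstPhase (pullback u (joinPhase (axisVec c' s' 0 1) 0))) =
        majorCoord c s (fstPhase (pullback u (joinPhase (axisVec c' s' 1 0) 0))) := by
      rw [fstPhase_pullback_eq, fstPhase_pullback_eq]
      simp [majorCoord, minorCoord, ofComplex, axisVec]
      ring
    rw [outForm, hV.covForm_eq, dotProduct_eq_coord hV.unit (fstPhase _), dotProduct_eq_coord h',
      majorCoord_axisVec h', minorCoord_axisVec h', e1, e2]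
    ring

theorem HasAxes.measurable_outForm {V c s p v} (hV : HasAxes V c s p v) {T : Type*} [MeasurableSpace T] {m : ℕ}
    {u : T → Matrix (Fin (1 + m)) (Fin (1 + m)) ℂ} (hu : ∀ i j, Measurable fun t => u t i j) (ξ : Fin 1 × Fin 2 → ℝ) :
    Measurable fun t => outForm V (u t) ξ := by
  have h : Continuous fun z : ℂ => p * majorCoord c s (ofComplex fun _ => star z * (ξ (0, 0) + Complex.I * ξ (0, 1))) ^ 2 +
      v * minorCoord c s (ofComplex fun _ => star z * (ξ (0, 0) + Complex.I * ξ (0, 1))) ^ 2 +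
      (ξ ⬝ᵥ ξ - (majorCoord c s (ofComplex fun _ => star z * (ξ (0, 0) + Complex.I * ξ (0, 1))) ^ 2 +
        minorCoord c s (ofComplex fun _ => star z * (ξ (0, 0) + Complex.I * ξ (0, 1))) ^ 2)) / 2 := by
    simp only [majorCoord, minorCoord, ofComplex, one_ne_zero, if_true, if_false]
    fun_prop
  refine (congrArg Measurable (funext fun t => ?_)).mp (h.measurable.comp (hu (Fin.castAdd m 0) (Fin.castAdd m 0)))
  simp only [Function.comp_apply]
  rw [outForm, hV.covForm_eq, dotProduct_eq_coord hV.unit (fstPhase _), fstPhase_pullback_eq]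

/-- Both sides equal one at `s = 0`; comparing the terms of order `s²` gives the claim. Boundedness
of `f` controls the remainder uniformly. -/
theorem integral_le_of_exp_le {T : Type*} [MeasurableSpace T] {μ : Measure T} [IsProbabilityMeasure μ] {f : T → ℝ}
    (hf : Measurable f) (h0 : ∀ t, 0 ≤ f t) {C w : ℝ} (hC : ∀ t, f t ≤ C)
    (h : ∀ s : ℝ, Real.exp (-(s ^ 2 * w) / 2) ≤ ∫ t, Real.exp (-(s ^ 2 * f t) / 2) ∂μ) : ∫ t, f t ∂μ ≤ w := by
  have hfi : Integrable f μ := Integrable.of_bound hf.aestronglyMeasurable C (ae_of_all _ fun t => by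
    rw [Real.norm_of_nonneg (h0 t)]; exact hC t)
  have key : ∀ s : ℝ, 0 < s → ∫ t, f t ∂μ ≤ w + s * C ^ 2 := fun s hs => by
    have h1 := h (Real.sqrt s)
    rw [Real.sq_sqrt hs.le] at h1
    have h2 : ∫ t, Real.exp (-(s * f t) / 2) ∂μ ≤ ∫ t, (1 + s ^ 2 * C ^ 2 / 2 - s / 2 * f t) ∂μ := by
      refine integral_mono (Integrable.of_bound (by fun_prop) 1 (ae_of_all _ fun t => ?_))
        ((integrable_const _).sub (hfi.const_mul _)) fun t => ?_
      · rw [Real.norm_of_nonneg (Real.exp_nonneg _), Real.exp_le_one_iff]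
        nlinarith [h0 t]
      · have hx : 0 ≤ s * f t / 2 := by have := h0 t; positivity
        have h3 : Real.exp (-(s * f t / 2)) * (1 + s * f t / 2) ≤ 1 := by
          have := Real.add_one_le_exp (s * f t / 2)
          calc _ ≤ Real.exp (-(s * f t / 2)) * Real.exp (s * f t / 2) := by gcongr; linarith
            _ = 1 := by rw [← Real.exp_add]; simp
        -- With `x = s * f t / 2` the right side is `1 + x³`.
        have h4 : (1 : ℝ) ≤ (1 + (s * f t / 2) ^ 2 - s * f t / 2) * (1 + s * f t / 2) := by nlinarith [pow_nonneg hx 3]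
        have h5 : Real.exp (-(s * f t / 2)) ≤ 1 + (s * f t / 2) ^ 2 - s * f t / 2 :=
          le_of_mul_le_mul_right (h3.trans h4) (by linarith)
        have h6 : (f t) ^ 2 ≤ C ^ 2 := pow_le_pow_left₀ (h0 t) (hC t) 2
        have h7 := mul_le_mul_of_nonneg_left h6 (sq_nonneg s)
        rw [neg_div]
        nlinarith [mul_nonneg (sq_nonneg s) (sq_nonneg (f t))]
    rw [integral_sub (integrable_const _) (hfi.const_mul _), integral_const_mul, integral_const, probReal_univ,
      one_smul] at h2
    have h3 := Real.add_one_le_exp (-(s * w) / 2)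
    have h4 : s * ∫ t, f t ∂μ ≤ s * (w + s * C ^ 2) := by linarith
    exact le_of_mul_le_mul_left h4 hs
  refine le_of_forall_pos_le_add fun ε hε => ?_
  have h1 := key (ε / (C ^ 2 + 1)) (by positivity)
  have h2 : ε / (C ^ 2 + 1) * C ^ 2 ≤ ε := by
    rw [div_mul_eq_mul_div, div_le_iff₀ (by positivity)]
    nlinarith
  linarith

/-- The target's modulus is at most the average modulus for fixed random values, and contraction
towards the origin compares exponents. The unitaries remain in the conclusion because the inequality
between axes holds for each of them separately. -/
theorem TransformsP0.integral_outForm_le {ρ σ : FockMatrix 1} {d V e W} (h : TransformsP0 ρ σ)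
    (hρ : IsGaussian ρ d V) (hσ : IsGaussian σ e W) : ∃ (Ω : Type) (_ : MeasurableSpace Ω) (μ : Measure Ω) (m : ℕ)
      (u : Ω → Matrix (Fin (1 + m)) (Fin (1 + m)) ℂ), IsProbabilityMeasure μ ∧
      (∀ ω, u ω ∈ Matrix.unitaryGroup (Fin (1 + m)) ℂ) ∧ ∀ ξ, Integrable (fun ω => outForm V (u ω) ξ) μ ∧
        ∫ ω, outForm V (u ω) ξ ∂μ ≤ covForm W ξ ξ := by
  obtain ⟨Ω, mΩ, μ, m, τ, u, δ, hμ, hτm, hum, hδm, hτ, hu, hσe⟩ := h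
  obtain ⟨c, s, hV⟩ := hρ.exists_hasAxes
  refine ⟨Ω, mΩ, μ, m, u, hμ, hu, fun ξ => ?_⟩
  have hout := fun ω => classical_output hρ (hτ ω) (hu ω) (δ ω)
  have hm1 : ∀ k l, Measurable fun ω => tensor ρ (τ ω) k l := fun k l => (hτm _ _).const_mul _
  have hm2 := measurable_conjBy (fun ω => rowSummable_passive (hu ω)) (measurable_passive hum)
    (fun ω => (hout ω).1.norm_entry_le) hm1
  have hm3 := measurable_partialTrace (fun ω => (hout ω).2.1) hm2
  have hm4 := measurable_conjBy (fun ω => rowSummable_displacement (δ ω)) (measurable_displacement hδm)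
    (fun ω => (hout ω).2.2.1.norm_entry_le) hm3
  have hs4 := fun ω => (hout ω).2.2.2.1
  have hb := fun ω => le_outForm hV.isBounded (min_le_right _ _) (hu ω)
  have hv0 : 0 ≤ min (vMinus V) (1 / 2) := le_min hV.minor_pos.le (by norm_num)
  have h0 : ∀ ω, 0 ≤ outForm V (u ω) ξ := fun ω =>
    (mul_nonneg hv0 (dotProduct_self_nonneg' ξ)).trans (hb ω ξ).1
  have hC : ∀ ω, outForm V (u ω) ξ ≤ (vPlus V + 1 / 2) * (ξ ⬝ᵥ ξ) := fun ω => by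
    have h1 := (hb ω ξ).2
    have h2 := dotProduct_self_nonneg' (fstPhase (pullback (u ω) (joinPhase ξ 0)))
    rw [outForm, hV.covForm_eq]
    have h3 := dotProduct_eq_coord hV.unit (fstPhase (pullback (u ω) (joinPhase ξ 0)))
    have h4 := hV.minor_le
    have h5 := hV.half_le
    nlinarith [sq_nonneg (minorCoord c s (fstPhase (pullback (u ω) (joinPhase ξ 0))))]
  have hmeas := hV.measurable_outForm hum ξ
  refine ⟨Integrable.of_bound hmeas.aestronglyMeasurable _ (ae_of_all _ fun ω => by
    rw [Real.norm_of_nonneg (h0 ω)]; exact hC ω), integral_le_of_exp_le hmeas h0 hC fun t => ?_⟩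
  have hsm : covForm W (t • ξ) (t • ξ) = t ^ 2 * covForm W ξ ξ := by
    simp only [map_smul, LinearMap.smul_apply, smul_eq_mul]; ring
  have h1 : ‖charFn σ (t • ξ)‖ ≤ ∫ ω, Real.exp (-(t ^ 2 * outForm V (u ω) ξ) / 2) ∂μ := by
    rw [charFn_mixture hs4 hm4 hσe]
    refine (norm_integral_le_integral_norm _).trans (integral_mono ?_ ?_ fun ω => ?_)
    · exact (Integrable.of_bound (measurable_charFn_mixture hs4 hm4 _).aestronglyMeasurable 1
        (ae_of_all _ fun ω => (hs4 ω).norm_charFn_le _)).norm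
    · refine Integrable.of_bound (Real.measurable_exp.comp (((hmeas.const_mul _).neg).div_const _)).aestronglyMeasurable 1 (ae_of_all _ fun ω => ?_)
      rw [Real.norm_of_nonneg (Real.exp_nonneg _), Real.exp_le_one_iff]
      have := mul_nonneg (sq_nonneg t) (h0 ω)
      linarith
    · rw [← outForm_smul]
      exact (hout ω).2.2.2.2 _
  rwa [hσ.charFn_eq', norm_exp_gaussian, hsm] at h1

/-- Operations without measurements do not increase `𝒩₁` and `𝒩₂`. -/
theorem TransformsP0.N_le {ρ σ : FockMatrix 1} {d V e W} (h : TransformsP0 ρ σ) (hρ : IsGaussian ρ d V)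
    (hσ : IsGaussian σ e W) : N₁ W ≤ N₁ V ∧ N₂ W ≤ N₂ V := by
  obtain ⟨Ω, mΩ, μ, m, u, hμ, hu, hle⟩ := h.integral_outForm_le hρ hσ
  obtain ⟨c, s, hV⟩ := hρ.exists_hasAxes
  obtain ⟨c', s', hW⟩ := hσ.exists_hasAxes
  obtain ⟨hiM, hM⟩ := hle (axisVec c' s' 0 1)
  obtain ⟨hiP, hP⟩ := hle (axisVec c' s' 1 0)
  rw [hW.covForm_eq, majorCoord_axisVec hW.unit, minorCoord_axisVec hW.unit] at hM hP
  have hmin : min (vMinus V) (1 / 2) ≤ vMinus W := by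
    have h1 : ∫ ω, min (vMinus V) (1 / 2) ∂μ ≤ ∫ ω, outForm V (u ω) (axisVec c' s' 0 1) ∂μ := by
      refine integral_mono (integrable_const _) hiM fun ω => ?_
      have := (le_outForm hV.isBounded (min_le_right _ _) (hu ω) (axisVec c' s' 0 1)).1
      rw [dotProduct_eq_coord hW.unit, majorCoord_axisVec hW.unit, minorCoord_axisVec hW.unit] at this
      linarith
    rw [integral_const, probReal_univ, one_smul] at h1
    linarith
  refine ⟨?_, ?_⟩
  · rw [N₁_eq, N₁_eq]
    have := le_min hmin (min_le_right (vMinus V) (1 / 2))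
    linarith
  · rcases lt_or_ge (vMinus W) (1 / 2) with hw | hw
    · have hv : vMinus V < 1 / 2 := by
        by_contra! h
        rw [min_eq_right h] at hmin
        linarith
      have hp' := hV.half_lt hv
      have hw' := hW.half_lt hw
      rw [N₂, N₂, N₁_eq, N₁_eq, min_eq_left hw.le, min_eq_left hv.le, div_le_div_iff₀ (by linarith) (by linarith)]
      have hun := hV.uncertainty
      set p := vPlus V
      set v := vMinus V
      -- For each `ω` the right side exceeds the left by `(p - v)(p + v - 1) y²`. The inequality is
      -- linear in `outForm`, so it survives averaging.
      have h1 : ∫ ω, (p - 1 / 2) * (1 / 2 - outForm V (u ω) (axisVec c' s' 0 1)) ∂μ ≤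
          ∫ ω, (1 / 2 - v) * (outForm V (u ω) (axisVec c' s' 1 0) - 1 / 2) ∂μ := by
        refine integral_mono (((integrable_const _).sub hiM).const_mul _) ((hiP.sub (integrable_const _)).const_mul _)
          fun ω => ?_
        obtain ⟨x, y, e1, e2⟩ := hV.outForm_axes (u ω) hW.unit
        dsimp only
        rw [e1, e2]
        have h2 : 0 ≤ (p - v) * (p + v - 1) * y ^ 2 := by
          refine mul_nonneg (mul_nonneg (by linarith [hV.minor_le]) ?_) (sq_nonneg y)
          -- From `4 p v ≥ 1` follows `(p + v)² ≥ 1`.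
          nlinarith [sq_nonneg (p - v), hV.minor_pos]
        nlinarith
      rw [integral_const_mul, integral_const_mul, integral_sub (integrable_const _) hiM,
        integral_sub hiP (integrable_const _), integral_const, probReal_univ, one_smul] at h1
      have h2 := mul_le_mul_of_nonneg_left hM (by linarith : 0 ≤ p - 1 / 2)
      have h3 := mul_le_mul_of_nonneg_left hP (by linarith : 0 ≤ 1 / 2 - v)
      nlinarith
    · rw [N₂, N₁_eq, min_eq_right hw]
      norm_num
      exact hV.N₂_nonneg

end FockMatrix

end

/-! ### The two equivalences -/

theorem theorem5 (ρ σ : FockMatrix 1) (d e : Fin 1 × Fin 2 → ℝ)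
    (V W : Matrix (Fin 1 × Fin 2) (Fin 1 × Fin 2) ℝ)
    (hρ : FockMatrix.IsGaussian ρ d V) (hσ : FockMatrix.IsGaussian σ e W) :
    (FockMatrix.TransformsP0 ρ σ ↔
      FockMatrix.N₁ W ≤ FockMatrix.N₁ V ∧ FockMatrix.N₂ W ≤ FockMatrix.N₂ V) ∧
    (FockMatrix.TransformsGP ρ σ ↔
      FockMatrix.N₁ W ≤ FockMatrix.N₁ V ∧ FockMatrix.N₃ W ≤ FockMatrix.N₃ V) := by
  obtain ⟨c, s, hV⟩ := hρ.exists_hasAxes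
  obtain ⟨c', s', hW⟩ := hσ.exists_hasAxes
  refine ⟨⟨fun h => h.N_le hρ hσ, fun h => ?_⟩, ⟨fun h => h.N_le hρ hσ, fun h => ?_⟩⟩
  · obtain ⟨a, b, g, k, hab, hm, hp⟩ := hV.exists_noise hW h.1 h.2
    exact FockMatrix.transformsP0_of_split hρ hσ hV hW hab hm hp
  · obtain ⟨a, b, g, k, hab, hm, hp⟩ := hV.exists_feedforward hW h.1 h.2
    exact FockMatrix.transformsGP_of_split hρ hσ hV hW hab hm hp
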